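/- Let $G$ be a finite group and $\beta\colon G\times G\to U(1)$ a normalized 2-cocycle. For a compact manifold $X$ with smooth $G$-action, let $X^g\subset X$ be the submanifold of points fixed by $g\in G$, and let $\Omega^\bullet$ denote complex differential forms, i.e. functions on the supermanifold $\pi TX$. A $\beta$-twisted equivariant bundle is a vector bundle $V\to X$ with smoothly varying $\rho_x(g)\colon V_x\to V_{gx}$, $\rho(e)=\mathrm{id}$, $\rho(g)\rho(h)=\beta(g,h)\rho(gh)$. Let $\widehat{\mathrm K}{}^\beta_G(X)$ be the free abelian group on triples $(V,\nabla,\eta)$, where $V$ is a $\mathbb Z/2$-graded $\beta$-twisted equivariant bundle, $\nabla$ is an equivariant grading-preserving connection and $\eta\in\bigoplus_{[g]}\bigl(\Omega^{\mathrm{odd}}(X^g)\otimes\chi^\beta_g/d\,\Omega^{\mathrm{ev}}(X^g)\otimes\chi_g^\beta\bigr)^{C_G(g)}$ with $\chi^\beta_g(h)=\beta(h,g)\beta(g,h)^{-1}$ (and $h$ acting on forms by pullback), modulo the relations: (1) $(V,\nabla,\eta)\sim(V',\nabla',\eta+\mathrm{CS}(\nabla',\nabla))$ for every isomorphism $V'\cong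 V$ of graded twisted equivariant bundles, where $\mathrm{CS}(\nabla',\nabla)_g$ is the integral over $[0,1]$ of $\mathrm{sTr}(\exp(-\tilde\nabla^2)\rho(g))$ on $X^g\times[0,1]$ for the linear interpolation $\tilde\nabla$ from $\nabla'$ to $\nabla$; (2) $(V,\nabla,\eta)+(V',\nabla',\eta')\sim(V\oplus V',\nabla\oplus\nabla',\eta+\eta')$; (3) $(V,\nabla,\eta)+(\pi V,\nabla,-\eta)\sim0$. Its curvature map sends $(V,\nabla,\eta)$ to $\bigl(\mathrm{sTr}(\exp(-\nabla^2)\rho(g))+d\eta_g\bigr)_{[g]}$. Let $\mathsf P_0(X/\!\!/G)$ be the Lie category of energy zero gauged super paths: its objects form $\pi TX$, its morphisms form $\mathbb R^{1|1}_{\ge0}\times G\times\pi TX$, and it is the subcategory of the action groupoid of $\mathbb R^{1|1}\times G$ on $\pi TX$, where $(t,\theta)(s,\eta)=(t+s+\theta\eta,\theta+\eta)$, $t$ acts trivially, $\theta$ acts through the de Rham operator and $G$ through its action on $X$. A $\beta$-twisted representation $\mathsf E$ is a super vector bundle on $\pi TX$ with a smooth even bundle map from its source pullback to its target pullback over the morphisms,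 preserving identities and compatible with composition up to the factor $\beta(g,h)$. Its character $Z_g(\mathsf E)\in\Omega^{\mathrm{ev}}(X^g)$ is the supertrace of its value at $(t,\theta)=(1,0)$ and $g$, restricted to $X^g$. Let $\Gamma^{\mathrm{odd}}$, $\Gamma^{\mathrm{ev}}$ be the spaces of families $(\eta_g)_{g\in G}$ of odd, resp. even, forms on the $X^g$ with $h^*\eta_{hgh^{-1}}=\frac{\beta(hgh^{-1},h)}{\beta(h,g)}\eta_g$. A $\beta$-twisted gauged $1|1$-dimensional low-energy effective field theory over $X/\!\!/G$ is a pair $(\mathsf E,\eta)$ of a $\beta$-twisted representation and a class $\eta\in\Gamma^{\mathrm{odd}}/d\Gamma^{\mathrm{ev}}$; direct sum is $(\mathsf E_0\oplus\mathsf E_1,\eta_0+\eta_1)$ and the partition function is $Z(\mathsf E)+d\eta$. Theories $(\mathsf E_0,\eta_0)$, $(\mathsf E_1,\eta_1)$ are isomorphic if there is a $\beta$-twisted representation $\tilde{\mathsf E}$ of $\mathsf P_0((X\times\mathbb R)/\!\!/G)$ (with $G$ acting trivially on $\mathbb R$) whose restrictions to $X\times\{0\}$ and $X\times\{1\}$ are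 isomorphic to $\mathsf E_0$ and $\mathsf E_1$, and such that $\eta_0=\eta_1+\bigl[\int_{[0,1]}Z(\tilde{\mathsf E})\bigr]$. They are stably isomorphic if $\eta_0=\eta_1$ and $\mathsf E_0\cong\mathsf E_1\oplus\epsilon_V$, where $\epsilon_V$ is the representation determined by $V\oplus\pi V$ with the connection $\nabla\oplus\nabla$, for a purely even $\beta$-twisted equivariant bundle $V$ with equivariant connection $\nabla$. Let $\sim$ be the equivalence relation generated by isomorphism and stable isomorphism. Then there is an isomorphism, natural for smooth equivariant maps of compact $G$-manifolds, $$\widehat{\mathrm K}{}^\beta_G(X)\;\cong\;1|1\text{-}\mathsf{EFT}^\beta_{\mathrm{eff}}(X/\!\!/G)/{\sim},$$ that is, a bijection carrying addition to direct sum. It sends $(V,\nabla,\eta)$ to the class of the theory with representation $\exp(-t\nabla^2+\theta\nabla)\circ\rho(g)$ and with the section determined by $\eta$, and under it the curvature map corresponds to the partition function. -/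

import Mathlib

open scoped ContDiff Manifold NNReal

universe u v

noncomputable section

namespace TwistedK

/-! ### Complex exterior forms on a real vector space -/

section Exterior

variable {V W : Type*} [AddCommGroup V] [Module ℝ V] [AddCommGroup W] [Module ℝ W]

variable (V) in
/-- `Ext V = Λ (Hom_ℝ (V, ℂ))`: the complex-valued exterior forms on the real vector space `V`. -/
abbrev Ext : Type _ := ExteriorAlgebra ℂ (V →ₗ[ℝ] ℂ)

/-- Precomposition `Hom_ℝ (W, ℂ) → Hom_ℝ (V, ℂ)` with a real linear map `V → W`. -/
def dualMap (L : V →ₗ[ℝ] W) : (W →ₗ[ℝ] ℂ) →ₗ[ℂ] (V →ₗ[ℝ] ℂ) where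
  toFun φ := φ.comp L
  map_add' _ _ := rfl
  map_smul' _ _ := rfl

/-- Pullback of exterior forms along a linear map. -/
def Ext.map (L : V →ₗ[ℝ] W) : Ext W →ₐ[ℂ] Ext V := ExteriorAlgebra.map (dualMap L)

/-- Interior product of a vector with an exterior form: the antiderivation that sends a
`1`-form to its value on the vector. -/
def contract (w : V) : Ext V →ₗ[ℂ] Ext V :=
  CliffordAlgebra.contractLeft (LinearMap.applyₗ' ℂ w)

end Exterior

section Norm

variable (V : Type*) [AddCommGroup V] [Module ℝ V] [FiniteDimensional ℝ V]

/-- Linear coordinates on the finite-dimensional space `Ext V`. -/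
def Ext.coords : Ext V ≃ₗ[ℂ]
    (Finset (Fin (Module.finrank ℂ (V →ₗ[ℝ] ℂ))) → ℂ) :=
  (Module.finBasis ℂ (V →ₗ[ℝ] ℂ)).ExteriorAlgebra.equivFun

/-- A norm on the finite-dimensional space `Ext V`. It only serves to speak of smooth maps into
`Ext V`, their derivatives and their integrals, for which all norms are equivalent. -/
instance Ext.instNormedAddCommGroup : NormedAddCommGroup (Ext V) :=
  NormedAddCommGroup.induced (Ext V) (Finset (Fin (Module.finrank ℂ (V →ₗ[ℝ] ℂ))) → ℂ)
    (Ext.coords V) (Ext.coords V).injective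

instance Ext.instNormedSpace : NormedSpace ℂ (Ext V) :=
  NormedSpace.induced ℂ (Ext V) (Finset (Fin (Module.finrank ℂ (V →ₗ[ℝ] ℂ))) → ℂ)
    (Ext.coords V)

end Norm

/-! ### Superalgebras and adjoining an odd variable -/

/-- A ring with a grading involution: `+1` on even elements, `-1` on odd elements. -/
class SuperRing (A : Type*) [Ring A] where
  /-- The grading involution. -/
  inv : A →+* A
  inv_inv : ∀ a, inv (inv a) = a

/-- The grading involution of a super ring. -/
def sinv {A : Type*} [Ring A] [SuperRing A] : A →+* A := SuperRing.inv

@[simp] theorem sinv_sinv {A : Type*} [Ring A] [SuperRing A] (a : A) : sinv (sinv a) = a :=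
  SuperRing.inv_inv a

instance {V : Type*} [AddCommGroup V] [Module ℝ V] : SuperRing (Ext V) where
  inv := (CliffordAlgebra.involute : Ext V →ₐ[ℂ] Ext V).toRingHom
  inv_inv a := CliffordAlgebra.involute_involute a

instance {κ : Type*} {A : κ → Type*} [∀ k, Ring (A k)] [∀ k, SuperRing (A k)] :
    SuperRing (∀ k, A k) where
  inv := RingHom.pi fun k => sinv.comp (Pi.evalRingHom A k)
  inv_inv a := funext fun k => sinv_sinv (a k)

/-- `OddExt A = A[θ]`: the superalgebra obtained from the superalgebra `A` by adjoining one odd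
variable `θ`. The pair `⟨a, b⟩` stands for `a + θ b`. -/
@[ext]
structure OddExt (A : Type*) where
  /-- The coefficient of `1`. -/
  body : A
  /-- The coefficient of `θ`, written to the right of `θ`. -/
  soul : A

namespace OddExt

variable {A B : Type*}

/-- Apply a map to both coefficients. -/
def map (f : A → B) (r : OddExt A) : OddExt B := ⟨f r.body, f r.soul⟩

instance [SMul ℂ A] : SMul ℂ (OddExt A) := ⟨fun c r => ⟨c • r.body, c • r.soul⟩⟩

@[simp] theorem smul_body [SMul ℂ A] (c : ℂ) (r : OddExt A) : (c • r).body = c • r.body := rfl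
@[simp] theorem smul_soul [SMul ℂ A] (c : ℂ) (r : OddExt A) : (c • r).soul = c • r.soul := rfl

section

variable [Ring A]

instance : Zero (OddExt A) := ⟨⟨0, 0⟩⟩
instance : One (OddExt A) := ⟨⟨1, 0⟩⟩
instance : Add (OddExt A) := ⟨fun r s => ⟨r.body + s.body, r.soul + s.soul⟩⟩
instance : Neg (OddExt A) := ⟨fun r => ⟨-r.body, -r.soul⟩⟩

@[simp] theorem zero_body : (0 : OddExt A).body = 0 := rfl
@[simp] theorem zero_soul : (0 : OddExt A).soul = 0 := rfl
@[simp] theorem one_body : (1 : OddExt A).body = 1 := rfl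
@[simp] theorem one_soul : (1 : OddExt A).soul = 0 := rfl
@[simp] theorem add_body (r s : OddExt A) : (r + s).body = r.body + s.body := rfl
@[simp] theorem add_soul (r s : OddExt A) : (r + s).soul = r.soul + s.soul := rfl
@[simp] theorem neg_body (r : OddExt A) : (-r).body = -r.body := rfl
@[simp] theorem neg_soul (r : OddExt A) : (-r).soul = -r.soul := rfl

end

variable [Ring A] [SuperRing A]

/-- `(a + θ b) (a' + θ b') = a a' + θ (b a' + σ(a) b')`, where `a θ = θ σ(a)`. -/
instance : Mul (OddExt A) :=
  ⟨fun r s => ⟨r.body * s.body, r.soul * s.body + sinv r.body * s.soul⟩⟩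

@[simp] theorem mul_body (r s : OddExt A) : (r * s).body = r.body * s.body := rfl
@[simp] theorem mul_soul (r s : OddExt A) :
    (r * s).soul = r.soul * s.body + sinv r.body * s.soul := rfl
instance : Ring (OddExt A) where
  add_assoc r s t := by ext <;> simp [add_assoc]
  zero_add r := by ext <;> simp
  add_zero r := by ext <;> simp
  add_comm r s := by ext <;> simp [add_comm]
  neg_add_cancel r := by ext <;> simp
  mul_assoc r s t := by ext <;> simp [mul_assoc, add_mul, mul_add, add_assoc]
  one_mul r := by ext <;> simp
  mul_one r := by ext <;> simp
  left_distrib r s t := by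
    ext
    · simp [mul_add]
    · simp [mul_add]; abel
  right_distrib r s t := by
    ext
    · simp [add_mul]
    · simp [add_mul]; abel
  zero_mul r := by ext <;> simp
  mul_zero r := by ext <;> simp
  nsmul := nsmulRec
  zsmul := zsmulRec

/-- `σ(a + θ b) = σ(a) - θ σ(b)`. -/
instance : SuperRing (OddExt A) where
  inv :=
    { toFun := fun r => ⟨sinv r.body, -sinv r.soul⟩
      map_one' := by ext <;> simp
      map_mul' := fun r s => by ext <;> simp [add_comm]
      map_zero' := by ext <;> simp
      map_add' := fun r s => by ext <;> simp [add_comm] }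
  inv_inv r := by ext <;> simp

end OddExt

/-! ### Manifolds with an action of the group -/

/-- A smooth manifold (finite-dimensional, Hausdorff, without boundary) with a smooth action
of the discrete group `G`. Compactness is not included. -/
structure GMfd (G : Type v) [Group G] where
  /-- The underlying set. -/
  carrier : Type u
  /-- The vector space on which the manifold is modelled. -/
  E : Type
  /-- The model space of the charts. -/
  H : Type
  [normE : NormedAddCommGroup E]
  [spaceE : NormedSpace ℝ E]
  [finE : FiniteDimensional ℝ E]
  [topH : TopologicalSpace H]
  /-- The identification of `H` with `E`. -/
  I : ModelWithCorners ℝ E H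
  [noBoundary : I.Boundaryless]
  [top : TopologicalSpace carrier]
  [hausdorff : T2Space carrier]
  [charts : ChartedSpace H carrier]
  [smooth : IsManifold I ∞ carrier]
  /-- The action. -/
  act : G → carrier → carrier
  act_one : ∀ x, act 1 x = x
  act_mul : ∀ g h x, act (g * h) x = act g (act h x)
  smooth_act : ∀ g, ContMDiff I I ∞ (act g)

attribute [instance] GMfd.normE GMfd.spaceE GMfd.finE GMfd.topH GMfd.noBoundary GMfd.top
  GMfd.hausdorff GMfd.charts GMfd.smooth

section Manifolds

variable {G : Type v} [Group G]

/-- The product `X × ℝ`, with the action of `G` on the first factor. -/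
def GMfd.cyl (X : GMfd.{u} G) : GMfd.{u} G where
  carrier := X.carrier × ℝ
  E := X.E × ℝ
  H := ModelProd X.H ℝ
  I := X.I.prod 𝓘(ℝ, ℝ)
  noBoundary := inferInstance
  smooth := inferInstance
  act g p := (X.act g p.1, p.2)
  act_one p := by simp [X.act_one]
  act_mul g h p := by simp [X.act_mul]
  smooth_act g := ((X.smooth_act g).comp contMDiff_fst).prodMk contMDiff_snd

/-- The inclusion of `X` in `X × ℝ` at the parameter `l`. -/
def GMfd.incl (X : GMfd.{u} G) (l : ℝ) (x : X.carrier) : X.cyl.carrier := (x, l)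

/-- The projection of `X × ℝ` to `X`. -/
def GMfd.proj (X : GMfd.{u} G) (p : X.cyl.carrier) : X.carrier := Prod.fst p

/-- The projection of `X × ℝ` to `ℝ`. -/
def GMfd.height (X : GMfd.{u} G) (p : X.cyl.carrier) : ℝ := Prod.snd p

/-- Smooth equivariant maps. -/
structure IsEquivariantMap (X Y : GMfd.{u} G) (f : X.carrier → Y.carrier) : Prop where
  smooth : ContMDiff X.I Y.I ∞ f
  equivariant : ∀ g x, f (X.act g x) = Y.act g (f x)

/-! ### Differential forms -/

/-- The (not necessarily smooth) complex differential forms of mixed degree on `X`: to a point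
`x` is attached an exterior form on the tangent space at `x`. This is a superalgebra under
the pointwise operations. -/
abbrev Form (X : GMfd.{u} G) : Type u := X.carrier → Ext X.E

/-- The derivative of `f` at `x`, as a linear map of tangent spaces. -/
def tmap {X Y : GMfd.{u} G} (f : X.carrier → Y.carrier) (x : X.carrier) : X.E →L[ℝ] Y.E :=
  mfderiv X.I Y.I f x

/-- Pullback of differential forms. -/
def pull {X Y : GMfd.{u} G} (f : X.carrier → Y.carrier) : Form Y →+* Form X :=
  RingHom.pi fun x =>
    (Ext.map (tmap f x : X.E →ₗ[ℝ] Y.E)).toRingHom.comp (Pi.evalRingHom _ (f x))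

/-- The derivative of the chart at `x₀`, at the point `x`. -/
def chartDeriv {X : GMfd.{u} G} (x₀ x : X.carrier) : X.E →L[ℝ] X.E :=
  mfderiv X.I 𝓘(ℝ, X.E) (extChartAt X.I x₀) x

/-- The derivative of the inverse of the chart at `x₀`, at the point with coordinates `y`. -/
def chartInvDeriv {X : GMfd.{u} G} (x₀ : X.carrier) (y : X.E) : X.E →L[ℝ] X.E :=
  mfderiv 𝓘(ℝ, X.E) X.I (extChartAt X.I x₀).symm y

/-- The form `α` in the coordinates of the preferred chart at `x₀`. -/
def chartRep {X : GMfd.{u} G} (α : Form X) (x₀ : X.carrier) (y : X.E) : Ext X.E :=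
  Ext.map (chartInvDeriv x₀ y : X.E →ₗ[ℝ] X.E) (α ((extChartAt X.I x₀).symm y))

/-- Smoothness of a differential form. -/
def IsSmooth {X : GMfd.{u} G} (α : Form X) : Prop :=
  ∀ x₀ : X.carrier, ContDiffOn ℝ ∞ (chartRep α x₀) (extChartAt X.I x₀).target

/-- The exterior derivative `dτ = ∑ i, dxⁱ ∧ ∂ᵢ τ` of a form `τ` on a vector space. -/
def flatD {V : Type*} [NormedAddCommGroup V] [NormedSpace ℝ V] [FiniteDimensional ℝ V]
    (τ : V → Ext V) (y : V) : Ext V :=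
  ∑ i, ExteriorAlgebra.ι ℂ (Complex.ofRealCLM.toLinearMap.comp ((Module.finBasis ℝ V).coord i)) *
    fderiv ℝ τ y (Module.finBasis ℝ V i)

/-- The exterior derivative of a differential form, computed at `x` in the chart at `x`. -/
def extD {X : GMfd.{u} G} (α : Form X) : Form X := fun x =>
  Ext.map (chartDeriv x x : X.E →ₗ[ℝ] X.E) (flatD (chartRep α x) (extChartAt X.I x x))

/-- Forms of degree `k`. -/
def HasDegree {X : GMfd.{u} G} (k : ℕ) (α : Form X) : Prop :=
  ∀ x, α x ∈ ⋀[ℂ]^k (X.E →ₗ[ℝ] ℂ)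

/-- Even (`p = false`) and odd (`p = true`) forms. -/
def HasParity {X : GMfd.{u} G} (p : Bool) (α : Form X) : Prop :=
  sinv α = if p then -α else α

/-- Integration of forms along the fibres of `X × [0, 1] → X`, normalized so that
`dl ∧ γ` goes to the integral of `γ` over `l` in `[0, 1]`. -/
def fiberInt {X : GMfd.{u} G} (α : Form X.cyl) : Form X := fun x =>
  ∫ l in (0 : ℝ)..1, Ext.map (LinearMap.inl ℝ X.E ℝ)
    (contract ((0 : X.E), (1 : ℝ)) (show Ext (X.E × ℝ) from α (X.incl l x)))

/-! ### The function algebras of the category of energy zero gauged super paths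

The objects of the category form the supermanifold `πTX`, with functions `Form X`. Its morphisms
form `ℝ^{1|1}_{≥ 0} × G × πTX`; the functions on the component of `g : G` are
`OddExt (Fam X)`, where `Fam X` are the functions of `t ≥ 0` and of a point of `πTX`, and
`θ` is the odd coordinate. The pairs of composable morphisms form
`ℝ^{1|1}_{≥ 0} × ℝ^{1|1}_{≥ 0} × G × G × πTX`, with coordinates `(t, θ)` of the morphism that is
applied last and `(s, η)` of the one that is applied first; the functions on the component of
`(g, h)` are `OddExt (OddExt (Fam₂ X))`, the inner odd variable being `η`, the outer one `θ`. -/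

/-- Families of forms on `X` parametrized by `t ≥ 0`. -/
abbrev Fam (X : GMfd.{u} G) : Type u := ℝ≥0 → Form X

/-- Families of forms on `X` parametrized by `t ≥ 0` and `s ≥ 0`. -/
abbrev Fam₂ (X : GMfd.{u} G) : Type u := ℝ≥0 → ℝ≥0 → Form X

/-- Smoothness of a family of forms, as a function of `t ≥ 0` and of the point of `X`. -/
def IsSmoothFam {X : GMfd.{u} G} (P : Fam X) : Prop :=
  ∀ x₀ : X.carrier, ContDiffOn ℝ ∞
    (fun p : ℝ × X.E => chartRep (P p.1.toNNReal) x₀ p.2)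
    (Set.Ici 0 ×ˢ (extChartAt X.I x₀).target)

/-- The derivative `∂P/∂t`. -/
def tDeriv {X : GMfd.{u} G} (P : Fam X) : Fam X := fun t x =>
  derivWithin (fun s : ℝ => P s.toNNReal x) (Set.Ici 0) (t : ℝ)

/-- Pullback of functions along the source map `(t, θ, g, x) ↦ x`. -/
def src {X : GMfd.{u} G} (α : Form X) : OddExt (Fam X) := ⟨fun _ => α, 0⟩

/-- Pullback of functions along the target map `(t, θ, g, x) ↦ (t, θ, g) · x`: here `t` acts
trivially, `θ` through the de Rham operator and `g` through the action on `X`. -/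
def tgt {X : GMfd.{u} G} (g : G) (α : Form X) : OddExt (Fam X) :=
  ⟨fun _ => pull (X.act g) α, fun _ => extD (pull (X.act g) α)⟩

/-- Pullback of functions along `((t, θ, g), (s, η, h), x) ↦ (t, θ, g, (s, η, h) · x)`. -/
def pullLast {X : GMfd.{u} G} (h : G) (r : OddExt (Fam X)) : OddExt (OddExt (Fam₂ X)) :=
  ⟨⟨fun t _ => pull (X.act h) (r.body t), fun t _ => extD (pull (X.act h) (r.body t))⟩,
    ⟨fun t _ => pull (X.act h) (r.soul t), fun t _ => extD (pull (X.act h) (r.soul t))⟩⟩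

/-- Pullback of functions along `((t, θ, g), (s, η, h), x) ↦ (s, η, h, x)`. -/
def pullFirst {X : GMfd.{u} G} (r : OddExt (Fam X)) : OddExt (OddExt (Fam₂ X)) :=
  ⟨⟨fun _ s => r.body s, fun _ s => r.soul s⟩, 0⟩

/-- Pullback of functions along the composition
`((t, θ, g), (s, η, h), x) ↦ (t + s + θ η, θ + η, g h, x)`: the function `a + θ b` goes to
`a(t + s) + θ η a'(t + s) + (θ + η) b(t + s)`. -/
def pullComp {X : GMfd.{u} G} (r : OddExt (Fam X)) : OddExt (OddExt (Fam₂ X)) :=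
  ⟨⟨fun t s => r.body (t + s), fun t s => r.soul (t + s)⟩,
    ⟨fun t s => r.soul (t + s), fun t s => tDeriv r.body (t + s)⟩⟩

/-! ### Matrices over superalgebras -/

/-- A matrix of a parity-preserving map between free supermodules. -/
def IsEvenMatrix {A m n : Type*} [Ring A] [SuperRing A] (p : m → Bool) (q : n → Bool)
    (M : Matrix m n A) : Prop :=
  ∀ i j, sinv (M i j) = if p i = q j then M i j else -M i j

/-- The supertrace. -/
def strace {A m : Type*} [Ring A] [Fintype m] (p : m → Bool) (M : Matrix m m A) : A :=
  ∑ i, if p i then -M i i else M i i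

/-! ### Twisted representations of the category of super paths -/

/-- Normalized `U(1)`-valued 2-cocycles. -/
structure IsNormalizedCocycle (β : G → G → Circle) : Prop where
  one_left : ∀ g, β 1 g = 1
  one_right : ∀ g, β g 1 = 1
  cocycle : ∀ g h k, β g h * β (g * h) k = β h k * β g (h * k)

/-- The data of a representation. A super vector bundle on `πTX`, that is a finitely generated
projective supermodule over the forms, is given as the image of an even idempotent matrix `e` in a
free supermodule with a homogeneous basis `ι` of parities `par`. A bundle map from the pullback
of the bundle by the source map to its pullback by the target map is then a matrix `R g` of
functions on morphisms, for each `g`. -/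
structure PreRep (X : GMfd.{u} G) where
  /-- The basis of the free supermodule. -/
  ι : Type
  [fin : Fintype ι]
  [dec : DecidableEq ι]
  /-- The parities of the basis elements. -/
  par : ι → Bool
  /-- The idempotent matrix. -/
  e : Matrix ι ι (Form X)
  /-- The value of the representation on morphisms. -/
  R : G → Matrix ι ι (OddExt (Fam X))

attribute [instance] PreRep.fin PreRep.dec

/-- The conditions for data to be a `β`-twisted representation: smoothness, `e` an even
idempotent, `R` an even bundle map from `s^* e` to `t^* e` (`R_hom`), equal to the identity on
identity morphisms, and compatible with composition up to `β`. -/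
structure IsRep (β : G → G → Circle) {X : GMfd.{u} G} (D : PreRep X) : Prop where
  e_smooth : ∀ i j, IsSmooth (D.e i j)
  e_even : IsEvenMatrix D.par D.par D.e
  e_idem : D.e * D.e = D.e
  R_smooth : ∀ g i j, IsSmoothFam (D.R g i j).body ∧ IsSmoothFam (D.R g i j).soul
  R_even : ∀ g, IsEvenMatrix D.par D.par (D.R g)
  R_hom : ∀ g, D.R g = D.e.map (tgt g) * D.R g * D.e.map src
  R_one : (D.R 1).map (fun r => r.body 0) = D.e
  R_comp : ∀ g h, (D.R g).map (pullLast h) * (D.R h).map pullFirst =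
    (β g h : ℂ) • (D.R (g * h)).map pullComp

/-- `β`-twisted representations of the category of energy zero gauged super paths in `X`. -/
structure Rep (β : G → G → Circle) (X : GMfd.{u} G) extends PreRep X where
  isRep : IsRep β toPreRep

/-- Isomorphism of representations: mutually inverse smooth even bundle maps over `πTX`,
compatible with the action of all morphisms. -/
def PreRep.Iso {X : GMfd.{u} G} (D D' : PreRep X) : Prop :=
  ∃ (a : Matrix D'.ι D.ι (Form X)) (b : Matrix D.ι D'.ι (Form X)),
    (∀ i j, IsSmooth (a i j)) ∧ (∀ i j, IsSmooth (b i j)) ∧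
    IsEvenMatrix D'.par D.par a ∧ IsEvenMatrix D.par D'.par b ∧
    a = D'.e * a * D.e ∧ b = D.e * b * D'.e ∧ a * b = D'.e ∧ b * a = D.e ∧
    ∀ g, D'.R g * a.map src = a.map (tgt g) * D.R g

/-- Pullback of the data of a representation along an equivariant map. -/
def PreRep.pull {X Y : GMfd.{u} G} (f : X.carrier → Y.carrier) (D : PreRep Y) : PreRep X where
  ι := D.ι
  par := D.par
  e := D.e.map (TwistedK.pull f)
  R g := (D.R g).map (OddExt.map fun P t => TwistedK.pull f (P t))

/-- Direct sum of data. -/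
def PreRep.sum {X : GMfd.{u} G} (D D' : PreRep X) : PreRep X where
  ι := D.ι ⊕ D'.ι
  par := Sum.elim D.par D'.par
  e := Matrix.fromBlocks D.e 0 0 D'.e
  R g := Matrix.fromBlocks (D.R g) 0 0 (D'.R g)

section Zero

variable {X : GMfd.{u} G}

theorem chartRep_zero (x₀ : X.carrier) : chartRep (0 : Form X) x₀ = 0 := by
  funext y; simp [chartRep]

theorem chartRep_add (α α' : Form X) (x₀ : X.carrier) :
    chartRep (α + α') x₀ = chartRep α x₀ + chartRep α' x₀ := by
  funext y; simp [chartRep]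

theorem chartRep_neg (α : Form X) (x₀ : X.carrier) :
    chartRep (-α) x₀ = -chartRep α x₀ := by
  funext y; simp [chartRep]

theorem IsSmooth.zero : IsSmooth (0 : Form X) := fun x₀ => by
  rw [chartRep_zero]; exact contDiffOn_const

theorem IsSmooth.add {α α' : Form X} (h : IsSmooth α) (h' : IsSmooth α') :
    IsSmooth (α + α') := fun x₀ => by
  rw [chartRep_add]; exact (h x₀).add (h' x₀)

theorem IsSmooth.neg {α : Form X} (h : IsSmooth α) : IsSmooth (-α) := fun x₀ => by
  rw [chartRep_neg]; exact (h x₀).neg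

theorem IsSmoothFam.zero : IsSmoothFam (0 : Fam X) := fun x₀ => by
  have : (fun p : ℝ × X.E => chartRep ((0 : Fam X) p.1.toNNReal) x₀ p.2) = 0 := by
    funext p; simp [chartRep_zero]
  rw [this]; exact contDiffOn_const

theorem IsSmooth.differentiableAt {α : Form X} (h : IsSmooth α) (x : X.carrier) :
    DifferentiableAt ℝ (chartRep α x) (extChartAt X.I x x) :=
  ((h x).differentiableOn (by simp)).differentiableAt
    ((isOpen_extChartAt_target x).mem_nhds (mem_extChartAt_target x))

theorem extD_zero : extD (0 : Form X) = 0 := by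
  funext x; simp [extD, chartRep_zero, flatD]

theorem extD_add {α α' : Form X} (h : IsSmooth α) (h' : IsSmooth α') :
    extD (α + α') = extD α + extD α' := by
  funext x
  simp only [extD, chartRep_add, flatD, Pi.add_apply]
  rw [← map_add, ← Finset.sum_add_distrib]
  congr 1
  refine Finset.sum_congr rfl fun i _ => ?_
  rw [fderiv_add (h.differentiableAt x) (h'.differentiableAt x)]
  simp [mul_add]

theorem extD_neg (α : Form X) : extD (-α) = -extD α := by
  funext x
  simp only [extD, chartRep_neg, flatD, Pi.neg_apply]
  rw [← map_neg, ← Finset.sum_neg_distrib]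
  congr 1
  refine Finset.sum_congr rfl fun i _ => ?_
  rw [fderiv_neg]
  simp

theorem src_zero : src (0 : Form X) = 0 := rfl

theorem tgt_zero (g : G) : tgt g (0 : Form X) = 0 := by
  ext <;> simp [tgt, extD_zero]

theorem pullLast_zero (h : G) : pullLast h (0 : OddExt (Fam X)) = 0 := by
  ext <;> simp [pullLast, extD_zero]

theorem pullFirst_zero : pullFirst (0 : OddExt (Fam X)) = 0 := rfl

theorem pullComp_zero : pullComp (0 : OddExt (Fam X)) = 0 := by
  ext <;> simp [pullComp, tDeriv]

theorem IsEvenMatrix.fromBlocks {A m n : Type*} [Ring A] [SuperRing A] {p : m → Bool}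
    {q : n → Bool} {M : Matrix m m A} {N : Matrix n n A} (hM : IsEvenMatrix p p M)
    (hN : IsEvenMatrix q q N) :
    IsEvenMatrix (Sum.elim p q) (Sum.elim p q) (Matrix.fromBlocks M 0 0 N) := by
  rintro (i | i) (j | j)
  · exact hM i j
  · simp
  · simp
  · exact hN i j

theorem IsRep.sum {β : G → G → Circle} {D D' : PreRep X} (h : IsRep β D) (h' : IsRep β D') :
    IsRep β (D.sum D') where
  e_smooth := by
    rintro (i | i) (j | j)
    · exact h.e_smooth i j
    · exact IsSmooth.zero
    · exact IsSmooth.zero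
    · exact h'.e_smooth i j
  e_even := h.e_even.fromBlocks h'.e_even
  e_idem := by
    show Matrix.fromBlocks D.e 0 0 D'.e * Matrix.fromBlocks D.e 0 0 D'.e =
      Matrix.fromBlocks D.e 0 0 D'.e
    simp [Matrix.fromBlocks_multiply, h.e_idem, h'.e_idem]
  R_smooth := by
    rintro g (i | i) (j | j)
    · exact h.R_smooth g i j
    · exact ⟨IsSmoothFam.zero, IsSmoothFam.zero⟩
    · exact ⟨IsSmoothFam.zero, IsSmoothFam.zero⟩
    · exact h'.R_smooth g i j
  R_even g := (h.R_even g).fromBlocks (h'.R_even g)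
  R_hom g := by
    show Matrix.fromBlocks (D.R g) 0 0 (D'.R g) =
      (Matrix.fromBlocks D.e 0 0 D'.e).map (tgt g) * Matrix.fromBlocks (D.R g) 0 0 (D'.R g) *
        (Matrix.fromBlocks D.e 0 0 D'.e).map src
    simp only [Matrix.fromBlocks_map, Matrix.map_zero _ src_zero,
      Matrix.map_zero _ (tgt_zero g), Matrix.fromBlocks_multiply]
    simp [← h.R_hom, ← h'.R_hom]
  R_one := by
    have h0 := h.R_one
    have h0' := h'.R_one
    simp only [PreRep.sum, Matrix.fromBlocks_map]
    rw [h0, h0', Matrix.map_zero _ rfl, Matrix.map_zero _ rfl]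
  R_comp g k := by
    have hz : ∀ (m n : Type), (β g k : ℂ) • (0 : Matrix m n (OddExt (OddExt (Fam₂ X)))) = 0 := by
      intro m n
      refine Matrix.ext fun i j => ?_
      show (β g k : ℂ) • (0 : OddExt (OddExt (Fam₂ X))) = 0
      ext x y z <;> exact smul_zero (β g k : ℂ)
    show (Matrix.fromBlocks (D.R g) 0 0 (D'.R g)).map (pullLast k) *
      (Matrix.fromBlocks (D.R k) 0 0 (D'.R k)).map pullFirst =
      (β g k : ℂ) • (Matrix.fromBlocks (D.R (g * k)) 0 0 (D'.R (g * k))).map pullComp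
    simp only [Matrix.fromBlocks_map, Matrix.map_zero _ (pullLast_zero k),
      Matrix.map_zero _ pullFirst_zero, Matrix.map_zero _ pullComp_zero,
      Matrix.fromBlocks_multiply, Matrix.fromBlocks_smul]
    simp [h.R_comp, h'.R_comp, hz]

end Zero

/-- Direct sum of representations. -/
def Rep.sum {β : G → G → Circle} {X : GMfd.{u} G} (D D' : Rep β X) : Rep β X where
  toPreRep := D.toPreRep.sum D'.toPreRep
  isRep := D.isRep.sum D'.isRep

/-! ### Differential forms on fixed point sets -/

/-- The tangent space of the fixed point submanifold `X^g` at `x`: the vectors fixed by the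
derivative of `g`. -/
def fixTan (X : GMfd.{u} G) (g : G) (x : X.carrier) : Submodule ℝ X.E :=
  LinearMap.eqLocus (tmap (X.act g) x : X.E →ₗ[ℝ] X.E) LinearMap.id

/-- The (not necessarily smooth) differential forms on the fixed point submanifold `X^g`. -/
abbrev FixForm (X : GMfd.{u} G) (g : G) : Type u :=
  ∀ x : {x : X.carrier // X.act g x = x}, Ext (fixTan X g x)

/-- Restriction of differential forms from `X` to `X^g`. -/
def res {X : GMfd.{u} G} (g : G) : Form X →+* FixForm X g :=
  RingHom.pi fun x => (Ext.map (fixTan X g x).subtype).toRingHom.comp (Pi.evalRingHom _ x.1)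

theorem res_smul {X : GMfd.{u} G} (g : G) (c : ℂ) (α : Form X) : res g (c • α) = c • res g α :=
  funext fun x => map_smul (Ext.map (fixTan X g x).subtype) c (α x.1)

theorem pull_smul {X Y : GMfd.{u} G} (f : X.carrier → Y.carrier) (c : ℂ) (α : Form Y) :
    pull f (c • α) = c • pull f α :=
  funext fun x => map_smul (Ext.map (tmap f x : X.E →ₗ[ℝ] Y.E)) c (α (f x))

theorem HasParity.zero {X : GMfd.{u} G} (p : Bool) : HasParity p (0 : Form X) := by
  cases p <;> simp [HasParity]

theorem HasParity.add {X : GMfd.{u} G} {p : Bool} {α α' : Form X} (h : HasParity p α)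
    (h' : HasParity p α') : HasParity p (α + α') := by
  cases p <;> simp_all [HasParity, add_comm]

theorem HasParity.neg {X : GMfd.{u} G} {p : Bool} {α : Form X} (h : HasParity p α) :
    HasParity p (-α) := by
  cases p <;> simp_all [HasParity]

/-- The smooth forms of parity `p` on `X^g`. As `X^g` is a closed submanifold of `X`, these are the
restrictions of the smooth forms on `X`. -/
def fixOmega (X : GMfd.{u} G) (g : G) (p : Bool) : AddSubgroup (FixForm X g) where
  carrier := {z | ∃ α : Form X, IsSmooth α ∧ HasParity p α ∧ z = res g α}
  zero_mem' := ⟨0, IsSmooth.zero, HasParity.zero p, by simp⟩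
  add_mem' := by
    rintro _ _ ⟨α, h, hp, rfl⟩ ⟨α', h', hp', rfl⟩
    exact ⟨α + α', h.add h', hp.add hp', by simp⟩
  neg_mem' := by
    rintro _ ⟨α, h, hp, rfl⟩
    exact ⟨-α, h.neg, hp.neg, by simp⟩

/-- The subgroup `d Ω^ev(X^g)`. -/
def fixExact (X : GMfd.{u} G) (g : G) : AddSubgroup (FixForm X g) where
  carrier := {z | ∃ α : Form X, IsSmooth α ∧ HasParity false α ∧ z = res g (extD α)}
  zero_mem' := ⟨0, IsSmooth.zero, HasParity.zero _, by simp [extD_zero]⟩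
  add_mem' := by
    rintro _ _ ⟨α, h, hp, rfl⟩ ⟨α', h', hp', rfl⟩
    exact ⟨α + α', h.add h', hp.add hp', by simp [extD_add h h']⟩
  neg_mem' := by
    rintro _ ⟨α, h, hp, rfl⟩
    exact ⟨-α, h.neg, hp.neg, by simp [extD_neg]⟩

/-- The quotient `Ω^odd(X^g) / d Ω^ev(X^g)`. -/
abbrev OddFix (X : GMfd.{u} G) (g : G) : Type u :=
  fixOmega X g true ⧸ (fixExact X g).addSubgroupOf (fixOmega X g true)

/-- The class in `Ω^odd(X^g) / d Ω^ev(X^g)` of the restriction of a smooth odd form on `X`. -/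
def oddFixClass {X : GMfd.{u} G} (g : G) (α : Form X) (h : IsSmooth α) (hp : HasParity true α) :
    OddFix X g :=
  QuotientAddGroup.mk ⟨res g α, α, h, hp, rfl⟩

open Classical in
/-- The exterior derivative of a smooth form on `X^g`: extend the form smoothly to `X`,
differentiate, and restrict to `X^g`. The result does not depend on the extension. -/
def fixD {X : GMfd.{u} G} {g : G} (z : FixForm X g) : FixForm X g :=
  if h : ∃ α : Form X, IsSmooth α ∧ z = res g α then res g (extD h.choose) else 0

/-! ### Sections of the line bundle on the inertia groupoid -/

/-- The cocycle `β(h g h⁻¹, h) / β(h, g)` of the line bundle `L^β`. -/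
def inertiaCocycle (β : G → G → Circle) (h g : G) : ℂ :=
  (β (h * g * h⁻¹) h : ℂ) / (β h g : ℂ)

/-- The restrictions to `X^g` of the smooth forms `w g` on `X`, for `g : G`, are of parity `p` and
form a section of `L^β` on the groupoid `(∐ πTX^g) // G`: under the action of `h`, which maps
`X^g` to `X^{h g h⁻¹}`, they transform by the cocycle of `L^β`. -/
def IsSection (β : G → G → Circle) {X : GMfd.{u} G} (p : Bool) (w : G → Form X) : Prop :=
  (∀ g, IsSmooth (w g) ∧ HasParity p (w g)) ∧
  ∀ h g, res g (pull (X.act h) (w (h * g * h⁻¹))) = inertiaCocycle β h g • res g (w g)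

section Sections

variable {β : G → G → Circle} {X : GMfd.{u} G} {p : Bool} {w w' : G → Form X}

theorem IsSection.zero : IsSection β p (0 : G → Form X) :=
  ⟨fun _ => ⟨IsSmooth.zero, HasParity.zero p⟩, fun _ _ => by simp⟩

theorem IsSection.add (h : IsSection β p w) (h' : IsSection β p w') : IsSection β p (w + w') :=
  ⟨fun g => ⟨(h.1 g).1.add (h'.1 g).1, (h.1 g).2.add (h'.1 g).2⟩, fun k g => by
    simp [h.2 k g, h'.2 k g]⟩

theorem IsSection.neg (h : IsSection β p w) : IsSection β p (-w) :=
  ⟨fun g => ⟨(h.1 g).1.neg, (h.1 g).2.neg⟩, fun k g => by simp [h.2 k g]⟩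

end Sections

/-- The sections of parity `p` of `L^β` on the groupoid `(∐ πTX^g) // G`. -/
def sections (β : G → G → Circle) (X : GMfd.{u} G) (p : Bool) :
    AddSubgroup (∀ g, FixForm X g) where
  carrier := {z | ∃ w : G → Form X, IsSection β p w ∧ z = fun g => res g (w g)}
  zero_mem' := ⟨0, IsSection.zero, by funext; simp⟩
  add_mem' := by
    rintro _ _ ⟨w, h, rfl⟩ ⟨w', h', rfl⟩
    exact ⟨w + w', h.add h', by funext; simp⟩
  neg_mem' := by
    rintro _ ⟨w, h, rfl⟩
    exact ⟨-w, h.neg, by funext; simp⟩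

/-- The exterior derivatives of the even sections of `L^β`. -/
def exactSections (β : G → G → Circle) (X : GMfd.{u} G) :
    AddSubgroup (∀ g, FixForm X g) where
  carrier := {z | ∃ w : G → Form X, IsSection β false w ∧ z = fun g => res g (extD (w g))}
  zero_mem' := ⟨0, IsSection.zero, by funext; simp [extD_zero]⟩
  add_mem' := by
    rintro _ _ ⟨w, h, rfl⟩ ⟨w', h', rfl⟩
    exact ⟨w + w', h.add h', by funext g; simp [extD_add (h.1 g).1 (h'.1 g).1]⟩
  neg_mem' := by
    rintro _ ⟨w, h, rfl⟩
    exact ⟨-w, h.neg, by funext; simp [extD_neg]⟩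

/-- Odd sections of `L^β` modulo exterior derivatives of even ones. -/
abbrev OddClass (β : G → G → Circle) (X : GMfd.{u} G) : Type (max u v) :=
  sections β X true ⧸ (exactSections β X).addSubgroupOf (sections β X true)

/-- The class of the odd section given by the forms `w g`. -/
def oddClass {β : G → G → Circle} {X : GMfd.{u} G} (w : G → Form X)
    (h : IsSection β true w) : OddClass β X :=
  QuotientAddGroup.mk ⟨fun g => res g (w g), w, h, rfl⟩

/-! ### Twisted equivariant vector bundles with connection -/

/-- The data of a `ℤ/2`-graded twisted equivariant vector bundle with connection. The bundle,
that is its finitely generated projective module of sections, is the image of the idempotent matrix `e` of functions on `X` in a trivial graded bundle with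
homogeneous basis `ι`, the action of `g` has the matrix `ρ g`, and the connection is
`e ∘ d + A` for the matrix `A` of `1`-forms. -/
structure PreBundle (X : GMfd.{u} G) where
  /-- The basis of the trivial bundle. -/
  ι : Type
  [fin : Fintype ι]
  [dec : DecidableEq ι]
  /-- The parities of the basis elements. -/
  par : ι → Bool
  /-- The idempotent matrix. -/
  e : Matrix ι ι (Form X)
  /-- The action. -/
  ρ : G → Matrix ι ι (Form X)
  /-- The connection matrix. -/
  A : Matrix ι ι (Form X)

attribute [instance] PreBundle.fin PreBundle.dec

/-- Smooth matrices of forms of degree `k` whose entries preserve the gradings. -/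
def IsGradedMatrix {X : GMfd.{u} G} {m n : Type} (k : ℕ) (p : m → Bool) (q : n → Bool)
    (M : Matrix m n (Form X)) : Prop :=
  ∀ i j, IsSmooth (M i j) ∧ HasDegree k (M i j) ∧ (p i ≠ q j → M i j = 0)

/-- The conditions for data to be a `β`-twisted equivariant vector bundle with equivariant
grading-preserving connection: `e` is idempotent, `ρ g` maps the fibre at `x` to the fibre at
`g x`, `ρ 1 = id`, `ρ g ∘ ρ h = β(g, h) ρ (g h)`, and `ρ g ∘ ∇ = ∇ ∘ ρ g`. -/
structure IsBundle (β : G → G → Circle) {X : GMfd.{u} G} (V : PreBundle X) : Prop where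
  e_graded : IsGradedMatrix 0 V.par V.par V.e
  ρ_graded : ∀ g, IsGradedMatrix 0 V.par V.par (V.ρ g)
  A_graded : IsGradedMatrix 1 V.par V.par V.A
  e_idem : V.e * V.e = V.e
  ρ_hom : ∀ g, V.ρ g = V.e.map (pull (X.act g)) * V.ρ g * V.e
  A_hom : V.A = V.e * V.A * V.e
  ρ_one : V.ρ 1 = V.e
  ρ_mul : ∀ g h, (V.ρ g).map (pull (X.act h)) * V.ρ h = (β g h : ℂ) • V.ρ (g * h)
  A_equivariant : ∀ g, V.ρ g * V.A =
    V.e.map (pull (X.act g)) * (V.ρ g).map extD * V.e + V.A.map (pull (X.act g)) * V.ρ g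

/-- `ℤ/2`-graded `β`-twisted equivariant vector bundles on `X` with equivariant
grading-preserving connection. -/
structure Bundle (β : G → G → Circle) (X : GMfd.{u} G) extends PreBundle X where
  isBundle : IsBundle β toPreBundle

namespace PreBundle

variable {X Y : GMfd.{u} G}

/-- Isomorphism of graded equivariant bundles with connection: mutually inverse smooth
grading-preserving bundle maps `a`, `b` such that `a` commutes with the actions and
the connections. -/
def Iso (V V' : PreBundle X) : Prop :=
  ∃ (a : Matrix V'.ι V.ι (Form X)) (b : Matrix V.ι V'.ι (Form X)),
    IsGradedMatrix 0 V'.par V.par a ∧ IsGradedMatrix 0 V.par V'.par b ∧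
    a = V'.e * a * V.e ∧ b = V.e * b * V'.e ∧ a * b = V'.e ∧ b * a = V.e ∧
    (∀ g, V'.ρ g * a = a.map (TwistedK.pull (X.act g)) * V.ρ g) ∧
    a * V.A = V'.e * a.map extD * V.e + V'.A * a

/-- Pullback along an equivariant map. -/
def pull (f : X.carrier → Y.carrier) (V : PreBundle Y) : PreBundle X where
  ι := V.ι
  par := V.par
  e := V.e.map (TwistedK.pull f)
  ρ g := (V.ρ g).map (TwistedK.pull f)
  A := V.A.map (TwistedK.pull f)

/-- Direct sum. -/
def sum (V V' : PreBundle X) : PreBundle X where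
  ι := V.ι ⊕ V'.ι
  par := Sum.elim V.par V'.par
  e := Matrix.fromBlocks V.e 0 0 V'.e
  ρ g := Matrix.fromBlocks (V.ρ g) 0 0 (V'.ρ g)
  A := Matrix.fromBlocks V.A 0 0 V'.A

/-- Reversal of the grading. -/
def flip (V : PreBundle X) : PreBundle X where
  ι := V.ι
  par i := !V.par i
  e := V.e
  ρ := V.ρ
  A := V.A

/-- The same bundle with another connection. -/
def withConnection (V : PreBundle X) (A : Matrix V.ι V.ι (Form X)) : PreBundle X where
  ι := V.ι
  par := V.par
  e := V.e
  ρ := V.ρ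
  A := A

/-- The pullback of the bundle to `X × ℝ` with the connection that interpolates linearly between
the connection of the bundle at `0` and the connection `e ∘ d + A` at `1`. -/
def interpolate (V : PreBundle X) (A : Matrix V.ι V.ι (Form X)) : PreBundle X.cyl where
  ι := V.ι
  par := V.par
  e := V.e.map (TwistedK.pull X.proj)
  ρ g := (V.ρ g).map (TwistedK.pull X.proj)
  A := Matrix.of fun i j p =>
    (1 - (X.height p : ℂ)) • TwistedK.pull X.proj (V.A i j) p +
      (X.height p : ℂ) • TwistedK.pull X.proj (A i j) p

/-- The curvature `∇ ∘ ∇`, as a matrix of `2`-forms. -/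
def curvature (V : PreBundle X) : Matrix V.ι V.ι (Form X) :=
  V.e * V.e.map extD * V.e.map extD * V.e + V.e * V.A.map extD * V.e + V.A * V.A

/-- `exp (c ∇²)`; the terms left out are forms of degree above the dimension. -/
def expCurvature (V : PreBundle X) (c : ℂ) : Matrix V.ι V.ι (Form X) :=
  ∑ k ∈ Finset.range (Module.finrank ℝ X.E + 1), (c ^ k / (k.factorial : ℂ)) • V.curvature ^ k

/-- `sTr (exp (-∇²) ∘ ρ g)`, to be restricted to `X^g`. -/
def character (V : PreBundle X) (g : G) : Form X :=
  strace V.par (V.expCurvature (-1) * V.ρ g)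

/-- The representation `exp (-t ∇² + θ ∇) ∘ ρ g` determined by a bundle with connection. The
matrix of a bundle map from the source to the target bundle on the space of morphisms is
obtained by applying the operator to the basis of the trivial bundle, and `∇ = e ∘ d + A`
contributes the matrix `(de) e - A` for the coefficient of `θ`. -/
def toPreRep (V : PreBundle X) : PreRep X where
  ι := V.ι
  par := V.par
  e := V.e
  R g := Matrix.of fun i j =>
    ⟨fun t => (V.ρ g * V.expCurvature (-(t : ℝ) : ℂ)) i j,
     fun t => ((V.e.map extD * V.e - V.A).map (TwistedK.pull (X.act g)) *
        (V.ρ g * V.expCurvature (-(t : ℝ) : ℂ))) i j⟩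

end PreBundle

section BundleOps

variable {β : G → G → Circle} {X : GMfd.{u} G}

theorem pull_zero' {X Y : GMfd.{u} G} (f : X.carrier → Y.carrier) : pull f (0 : Form Y) = 0 :=
  map_zero _

theorem HasDegree.zero (k : ℕ) : HasDegree k (0 : Form X) := fun _ => Submodule.zero_mem _

theorem IsGradedMatrix.fromBlocks {m n : Type} {k : ℕ} {p : m → Bool} {q : n → Bool}
    {M : Matrix m m (Form X)} {N : Matrix n n (Form X)} (hM : IsGradedMatrix k p p M)
    (hN : IsGradedMatrix k q q N) :
    IsGradedMatrix k (Sum.elim p q) (Sum.elim p q) (Matrix.fromBlocks M 0 0 N) := by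
  rintro (i | i) (j | j)
  · exact hM i j
  · exact ⟨IsSmooth.zero, HasDegree.zero k, fun _ => rfl⟩
  · exact ⟨IsSmooth.zero, HasDegree.zero k, fun _ => rfl⟩
  · exact hN i j

theorem IsGradedMatrix.flip {m : Type} {k : ℕ} {p : m → Bool} {M : Matrix m m (Form X)}
    (hM : IsGradedMatrix k p p M) :
    IsGradedMatrix k (fun i => !p i) (fun i => !p i) M := fun i j =>
  ⟨(hM i j).1, (hM i j).2.1, fun h => (hM i j).2.2 fun h' => h (by show (!p i) = (!p j); rw [h'])⟩

theorem IsBundle.sum {V V' : PreBundle X} (h : IsBundle β V) (h' : IsBundle β V') :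
    IsBundle β (V.sum V') where
  e_graded := h.e_graded.fromBlocks h'.e_graded
  ρ_graded g := (h.ρ_graded g).fromBlocks (h'.ρ_graded g)
  A_graded := h.A_graded.fromBlocks h'.A_graded
  e_idem := by
    show Matrix.fromBlocks V.e 0 0 V'.e * Matrix.fromBlocks V.e 0 0 V'.e =
      Matrix.fromBlocks V.e 0 0 V'.e
    simp [Matrix.fromBlocks_multiply, h.e_idem, h'.e_idem]
  ρ_hom g := by
    show Matrix.fromBlocks (V.ρ g) 0 0 (V'.ρ g) =
      (Matrix.fromBlocks V.e 0 0 V'.e).map (pull (X.act g)) *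
        Matrix.fromBlocks (V.ρ g) 0 0 (V'.ρ g) * Matrix.fromBlocks V.e 0 0 V'.e
    simp only [Matrix.fromBlocks_map, Matrix.map_zero _ (pull_zero' _),
      Matrix.fromBlocks_multiply]
    simp [← h.ρ_hom, ← h'.ρ_hom]
  A_hom := by
    show Matrix.fromBlocks V.A 0 0 V'.A =
      Matrix.fromBlocks V.e 0 0 V'.e * Matrix.fromBlocks V.A 0 0 V'.A *
        Matrix.fromBlocks V.e 0 0 V'.e
    simp [Matrix.fromBlocks_multiply, ← h.A_hom, ← h'.A_hom]
  ρ_one := by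
    show Matrix.fromBlocks (V.ρ 1) 0 0 (V'.ρ 1) = Matrix.fromBlocks V.e 0 0 V'.e
    rw [h.ρ_one, h'.ρ_one]
  ρ_mul g k := by
    show (Matrix.fromBlocks (V.ρ g) 0 0 (V'.ρ g)).map (pull (X.act k)) *
      Matrix.fromBlocks (V.ρ k) 0 0 (V'.ρ k) =
      (β g k : ℂ) • Matrix.fromBlocks (V.ρ (g * k)) 0 0 (V'.ρ (g * k))
    simp only [Matrix.fromBlocks_map, Matrix.map_zero _ (pull_zero' _),
      Matrix.fromBlocks_multiply, Matrix.fromBlocks_smul]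
    simp [h.ρ_mul, h'.ρ_mul]
  A_equivariant g := by
    show Matrix.fromBlocks (V.ρ g) 0 0 (V'.ρ g) * Matrix.fromBlocks V.A 0 0 V'.A =
      (Matrix.fromBlocks V.e 0 0 V'.e).map (pull (X.act g)) *
        (Matrix.fromBlocks (V.ρ g) 0 0 (V'.ρ g)).map extD * Matrix.fromBlocks V.e 0 0 V'.e +
      (Matrix.fromBlocks V.A 0 0 V'.A).map (pull (X.act g)) *
        Matrix.fromBlocks (V.ρ g) 0 0 (V'.ρ g)
    simp only [Matrix.fromBlocks_map, Matrix.map_zero _ (pull_zero' _),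
      Matrix.map_zero _ extD_zero, Matrix.fromBlocks_multiply, Matrix.fromBlocks_add]
    simp [h.A_equivariant, h'.A_equivariant]

theorem IsBundle.flip {V : PreBundle X} (h : IsBundle β V) : IsBundle β V.flip where
  e_graded := h.e_graded.flip
  ρ_graded g := (h.ρ_graded g).flip
  A_graded := h.A_graded.flip
  e_idem := h.e_idem
  ρ_hom := h.ρ_hom
  A_hom := h.A_hom
  ρ_one := h.ρ_one
  ρ_mul := h.ρ_mul
  A_equivariant := h.A_equivariant

end BundleOps

/-- Direct sum of bundles with connection. -/
def Bundle.sum {β : G → G → Circle} {X : GMfd.{u} G} (V V' : Bundle β X) : Bundle β X where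
  toPreBundle := V.toPreBundle.sum V'.toPreBundle
  isBundle := V.isBundle.sum V'.isBundle

/-- Reversal of the grading of a bundle with connection. -/
def Bundle.flip {β : G → G → Circle} {X : GMfd.{u} G} (V : Bundle β X) : Bundle β X where
  toPreBundle := V.toPreBundle.flip
  isBundle := V.isBundle.flip

/-! ### Twisted equivariant differential K-theory -/

/-- The chosen representative of a conjugacy class. -/
def conjRep (c : ConjClasses G) : G := Quotient.out c

/-- The group `⊕_{[g]} (Ω^odd(X^g) ⊗ χ_g / d Ω^ev(X^g) ⊗ χ_g)^{C_G(g)}`, with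
`χ_g(h) = β(h, g) β(g, h)⁻¹` and `h` acting on forms by pullback. -/
def invClasses (β : G → G → Circle) (X : GMfd.{u} G) :
    AddSubgroup (∀ c : ConjClasses G, OddFix X (conjRep c)) where
  carrier := {q | ∀ c, ∃ (α : Form X) (hs : IsSmooth α) (hp : HasParity true α),
    q c = oddFixClass (conjRep c) α hs hp ∧
    ∀ h, h * conjRep c = conjRep c * h →
      ((β h (conjRep c) : ℂ) * (β (conjRep c) h : ℂ)⁻¹) • res (conjRep c) (pull (X.act h) α) -
        res (conjRep c) α ∈ fixExact X (conjRep c)}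
  zero_mem' c := ⟨0, IsSmooth.zero, HasParity.zero _, by
    rw [oddFixClass]
    exact ((QuotientAddGroup.eq_zero_iff _).2 (by
      simp [AddSubgroup.mem_addSubgroupOf])).symm, fun h _ => by
    simp⟩
  add_mem' := by
    intro q q' hq hq' c
    obtain ⟨α, hs, hp, h1, h2⟩ := hq c
    obtain ⟨α', hs', hp', h1', h2'⟩ := hq' c
    refine ⟨α + α', hs.add hs', hp.add hp', ?_, fun h hh => ?_⟩
    · rw [Pi.add_apply, h1, h1', oddFixClass, oddFixClass, oddFixClass, ← QuotientAddGroup.mk_add]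
      congr 1
      ext1
      simp
    · have := add_mem (h2 h hh) (h2' h hh)
      rw [map_add, map_add, map_add, smul_add]
      rwa [sub_add_sub_comm] at this
  neg_mem' := by
    intro q hq c
    obtain ⟨α, hs, hp, h1, h2⟩ := hq c
    refine ⟨-α, hs.neg, hp.neg, ?_, fun h hh => ?_⟩
    · rw [Pi.neg_apply, h1, oddFixClass, oddFixClass, ← QuotientAddGroup.mk_neg]
      congr 1
      ext1
      simp
    · have := neg_mem (h2 h hh)
      rw [map_neg, map_neg, map_neg, smul_neg, sub_neg_eq_add]
      rwa [neg_sub, sub_eq_add_neg, add_comm] at this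

/-- The generators `(V, ∇, η)` of the differential K-group. -/
structure KGen (β : G → G → Circle) (X : GMfd.{u} G) where
  /-- The graded twisted equivariant bundle with connection. -/
  V : Bundle β X
  /-- The class of odd forms. -/
  η : invClasses β X

/-- The generators `x = (V, ∇, η)` and `y = (V', ∇', η')` are related by a change of connection: there
is an isomorphism of `V'` with `V` such that `η' = η + CS(∇', ∇)`. Here `∇` is transported to the
connection `e' ∘ d + A` on `V'`, and the Chern-Simons form is the fibre integral of the
character of the linear interpolation from `∇'` to `∇`. -/
def KGen.ChangeConnection {β : G → G → Circle} {X : GMfd.{u} G} (x y : KGen β X) : Prop :=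
  ∃ A : Matrix y.V.ι y.V.ι (Form X),
    IsBundle β (y.V.toPreBundle.withConnection A) ∧
    (y.V.toPreBundle.withConnection A).Iso x.V.toPreBundle ∧
    ∀ c, ∃ (hs : IsSmooth (fiberInt ((y.V.toPreBundle.interpolate A).character (conjRep c))))
      (hp : HasParity true (fiberInt ((y.V.toPreBundle.interpolate A).character (conjRep c)))),
      y.η.1 c = x.η.1 c + oddFixClass (conjRep c) _ hs hp

/-- Direct sum of generators. -/
def KGen.sum {β : G → G → Circle} {X : GMfd.{u} G} (x y : KGen β X) : KGen β X :=
  ⟨x.V.sum y.V, x.η + y.η⟩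

/-- The generator `(πV, ∇, -η)`. -/
def KGen.flip {β : G → G → Circle} {X : GMfd.{u} G} (x : KGen β X) : KGen β X :=
  ⟨x.V.flip, -x.η⟩

/-- The relations of the differential K-group. -/
def kRelations (β : G → G → Circle) (X : GMfd.{u} G) : AddSubgroup (FreeAbelianGroup (KGen β X)) :=
  AddSubgroup.closure
    ({r | ∃ x y : KGen β X, x.ChangeConnection y ∧
        r = FreeAbelianGroup.of x - FreeAbelianGroup.of y} ∪
      {r | ∃ x y : KGen β X,
        r = FreeAbelianGroup.of x + FreeAbelianGroup.of y - FreeAbelianGroup.of (x.sum y)} ∪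
      {r | ∃ x : KGen β X, r = FreeAbelianGroup.of x + FreeAbelianGroup.of x.flip})

/-- The `β`-twisted `G`-equivariant differential K-theory of `X`. -/
abbrev KHat (β : G → G → Circle) (X : GMfd.{u} G) : Type (max 1 u v) :=
  FreeAbelianGroup (KGen β X) ⧸ kRelations β X

/-- The class of a generator. -/
def KGen.cls {β : G → G → Circle} {X : GMfd.{u} G} (x : KGen β X) : KHat β X :=
  QuotientAddGroup.mk (FreeAbelianGroup.of x)

/-- The component at a conjugacy class of the curvature form `sTr (exp (-∇²) ∘ ρ g) + dη` of a
generator; it does not depend on the representative of the class `η` that is differentiated. -/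
def KGen.curvatureForm {β : G → G → Circle} {X : GMfd.{u} G} (x : KGen β X) (c : ConjClasses G) :
    FixForm X (conjRep c) :=
  res (conjRep c) (x.V.character (conjRep c)) + fixD (Quotient.out (x.η.1 c)).1

/-- `y` is the pullback of `x` along `f`. -/
def KGen.IsPullback {β : G → G → Circle} {X Y : GMfd.{u} G} (f : X.carrier → Y.carrier)
    (x : KGen β Y) (y : KGen β X) : Prop :=
  y.V.toPreBundle = x.V.toPreBundle.pull f ∧
  ∀ c, ∃ (α : Form Y) (hs : IsSmooth α) (hp : HasParity true α)
    (hs' : IsSmooth (pull f α)) (hp' : HasParity true (pull f α)),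
    x.η.1 c = oddFixClass (conjRep c) α hs hp ∧
    y.η.1 c = oddFixClass (conjRep c) (pull f α) hs' hp'

/-! ### Twisted gauged low-energy effective field theories -/

/-- The character of a representation: the supertrace of its value at the super loops of length
`1`. This form is to be restricted to `X^g`, where source and target of these loops agree. -/
def PreRep.character {X : GMfd.{u} G} (D : PreRep X) (g : G) : Form X :=
  strace D.par ((D.R g).map fun r => r.body 1)

/-- `β`-twisted gauged low-energy effective field theories of dimension `1|1` over `X`. -/
structure EFT (β : G → G → Circle) (X : GMfd.{u} G) where
  /-- The representation. -/
  rep : Rep β X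
  /-- The class of odd forms. -/
  η : OddClass β X

namespace EFT

variable {β : G → G → Circle} {X Y : GMfd.{u} G}

/-- Direct sum of field theories. -/
def sum (T T' : EFT β X) : EFT β X := ⟨T.rep.sum T'.rep, T.η + T'.η⟩

/-- Isomorphism of field theories: there is a concordance `C` of the representations, that is a
representation over `X × ℝ` with ends isomorphic to the given ones, and the forms differ by
its Chern-Simons form, the fibre integral over `[0, 1]` of its character. -/
def Iso (T T' : EFT β X) : Prop :=
  ∃ C : Rep β X.cyl,
    (C.toPreRep.pull (X.incl 0)).Iso T.rep.toPreRep ∧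
    (C.toPreRep.pull (X.incl 1)).Iso T'.rep.toPreRep ∧
    ∃ h : IsSection β true (fun g => fiberInt (C.character g)), T.η = T'.η + oddClass _ h

/-- Stable isomorphism of field theories: the forms agree, and the first representation is the sum
of the second one and of the trivial representation `ε_V` determined by
a purely even bundle `V` with connection, whose bundle is `V ⊕ πV` with the given
connection on both summands. -/
def StableIso (T T' : EFT β X) : Prop :=
  T.η = T'.η ∧
  ∃ (V : Bundle β X) (ε : Rep β X), (∀ i, V.par i = false) ∧
    ε.toPreRep = (V.sum V.flip).toPreRep ∧
    T.rep.toPreRep.Iso (T'.rep.sum ε).toPreRep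

/-- The partition function `Z(E) + dη`; it does not depend on the representative of the class
`η` that is differentiated. -/
def partitionFunction (T : EFT β X) (g : G) : FixForm X g :=
  res g (T.rep.character g) + fixD ((Quotient.out T.η).1 g)

/-- `T'` is the pullback of `T` along `f`. -/
def IsPullback (f : X.carrier → Y.carrier) (T : EFT β Y) (T' : EFT β X) : Prop :=
  T'.rep.toPreRep = T.rep.toPreRep.pull f ∧
  ∃ (w : G → Form Y) (h : IsSection β true w) (h' : IsSection β true fun g => pull f (w g)),
    T.η = oddClass w h ∧ T'.η = oddClass _ h'

/-- `T` is the field theory with the representation `exp (-t ∇² + θ ∇) ∘ ρ` determined by `(V, ∇)`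
and the section of `L^β` determined by its values `η` at the representatives of
the conjugacy classes. -/
def IsAssociated (x : KGen β X) (T : EFT β X) : Prop :=
  T.rep.toPreRep = x.V.toPreBundle.toPreRep ∧
  ∃ (w : G → Form X) (h : IsSection β true w), T.η = oddClass w h ∧
    ∀ c, x.η.1 c = oddFixClass (conjRep c) (w (conjRep c)) (h.1 _).1 (h.1 _).2

end EFT

/-- Stable isomorphism classes of field theories: the quotient by the equivalence relation
generated by isomorphism and stable isomorphism. -/
def EFTClasses (β : G → G → Circle) (X : GMfd.{u} G) : Type (max 1 u v) :=
  Quot fun T T' : EFT β X => T.Iso T' ∨ T.StableIso T'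

/-- The class of a field theory. -/
def EFT.cls {β : G → G → Circle} {X : GMfd.{u} G} (T : EFT β X) : EFTClasses β X :=
  Quot.mk _ T

end Manifolds
end TwistedK
end

noncomputable section

namespace TwistedK

open Matrix (fromBlocks)
open Matrix renaming mul_assoc → massoc, add_mul → madd_mul, neg_mul → mneg_mul, mul_add → mmul_add,
  mul_smul → mmul_smul, mul_sub → mmul_sub, smul_mul → msmul_mul, sub_mul → msub_mul,
  mul_zero → mmul_zero, mul_one → mmul_one, mul_neg → mmul_neg, map_mul → mmap_mul,
  map_apply → mmap_apply, map_add → mmap_add, map_zero → mmap_zero, map_one → mmap_one,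
  mul_apply → mmul_apply, sum_apply → msum_apply, one_apply → mone_apply, one_mul → mone_mul,
  zero_mul → mzero_mul, add_apply → madd_apply, mul_sum → mmul_sum, map_sub → mmap_sub,
  neg_apply → mneg_apply, sum_mul → msum_mul, submatrix_mul_equiv → msubmatrix_mul_equiv, of_apply → mof_apply
open TwistedK renaming pull → fpull
section

/-! ### The exterior algebra of complex-valued forms -/

section ExtAlgebra

variable {V W U : Type*} [AddCommGroup V] [Module ℝ V] [AddCommGroup W] [Module ℝ W]
  [AddCommGroup U] [Module ℝ U]

instance Ext.instRealSMul : SMul ℝ (Ext V) := Algebra.complexToReal.toSMul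

theorem Ext.map_ι (L : V →ₗ[ℝ] W) (φ : W →ₗ[ℝ] ℂ) :
    Ext.map L (ExteriorAlgebra.ι ℂ φ) = ExteriorAlgebra.ι ℂ (φ.comp L) := by
  simp [Ext.map, dualMap]

theorem Ext.map_id (x : Ext V) : Ext.map (LinearMap.id : V →ₗ[ℝ] V) x = x := by
  have : dualMap (LinearMap.id : V →ₗ[ℝ] V) = LinearMap.id := rfl
  rw [Ext.map, this, ExteriorAlgebra.map_id]; rfl

theorem Ext.map_map (L : V →ₗ[ℝ] W) (L' : W →ₗ[ℝ] U) (x : Ext U) :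
    Ext.map L (Ext.map L' x) = Ext.map (L'.comp L) x := by
  have : dualMap (L'.comp L) = dualMap L ∘ₗ dualMap L' := rfl
  rw [Ext.map, Ext.map, Ext.map, this, ← ExteriorAlgebra.map_comp_map]; rfl

theorem sinv_ι (φ : V →ₗ[ℝ] ℂ) :
    sinv (ExteriorAlgebra.ι ℂ φ : Ext V) = -ExteriorAlgebra.ι ℂ φ :=
  CliffordAlgebra.involute_ι φ

theorem sinv_algebraMap (c : ℂ) : sinv (algebraMap ℂ (Ext V) c) = algebraMap ℂ (Ext V) c :=
  AlgHom.commutes (CliffordAlgebra.involute : Ext V →ₐ[ℂ] Ext V) c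

theorem sinv_smul (c : ℂ) (x : Ext V) : sinv (c • x) = c • sinv x :=
  map_smul (CliffordAlgebra.involute : Ext V →ₐ[ℂ] Ext V) c x

theorem Ext.sinv_map (L : V →ₗ[ℝ] W) (x : Ext W) : sinv (Ext.map L x) = Ext.map L (sinv x) := by
  induction x using ExteriorAlgebra.induction with
  | algebraMap r => rw [sinv_algebraMap, AlgHom.commutes, sinv_algebraMap]
  | ι φ => rw [Ext.map_ι, sinv_ι, sinv_ι, map_neg, Ext.map_ι]
  | mul a b ha hb => simp [ha, hb]
  | add a b ha hb => simp [ha, hb]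

/-- The component of degree zero of an exterior form. -/
def Ext.aug : Ext V →ₐ[ℂ] ℂ := ExteriorAlgebra.algebraMapInv

theorem Ext.aug_algebraMap (c : ℂ) : Ext.aug (algebraMap ℂ (Ext V) c) = c :=
  AlgHom.commutes Ext.aug c

theorem Ext.aug_ι (φ : V →ₗ[ℝ] ℂ) : Ext.aug (ExteriorAlgebra.ι ℂ φ : Ext V) = 0 := by
  simp [Ext.aug, ExteriorAlgebra.algebraMapInv]

theorem Ext.aug_map (L : V →ₗ[ℝ] W) (x : Ext W) : Ext.aug (Ext.map L x) = Ext.aug x := by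
  induction x using ExteriorAlgebra.induction with
  | algebraMap r => simp
  | ι φ => rw [Ext.map_ι, Ext.aug_ι, Ext.aug_ι]
  | mul a b ha hb => simp [ha, hb]
  | add a b ha hb => simp [ha, hb]

theorem Ext.aug_sinv (x : Ext V) : Ext.aug (sinv x) = Ext.aug x := by
  induction x using ExteriorAlgebra.induction with
  | algebraMap r => rw [sinv_algebraMap]
  | ι φ => rw [sinv_ι, map_neg, Ext.aug_ι, neg_zero]
  | mul a b ha hb => simp [ha, hb]
  | add a b ha hb => simp [ha, hb]

theorem Ext.mem_degree_zero {x : Ext V} :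
    x ∈ ⋀[ℂ]^0 (V →ₗ[ℝ] ℂ) ↔ algebraMap ℂ (Ext V) (Ext.aug x) = x := by
  rw [ExteriorAlgebra.exteriorPower, pow_zero, Submodule.mem_one]
  constructor
  · rintro ⟨c, rfl⟩; rw [Ext.aug_algebraMap]
  · intro h; exact ⟨_, h⟩

theorem Ext.mul_mem_degree {k l : ℕ} {x y : Ext V} (hx : x ∈ ⋀[ℂ]^k (V →ₗ[ℝ] ℂ))
    (hy : y ∈ ⋀[ℂ]^l (V →ₗ[ℝ] ℂ)) : x * y ∈ ⋀[ℂ]^(k + l) (V →ₗ[ℝ] ℂ) := by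
  rw [ExteriorAlgebra.exteriorPower, pow_add]; exact Submodule.mul_mem_mul hx hy

theorem Ext.sinv_of_mem_degree {k : ℕ} {x : Ext V} (hx : x ∈ ⋀[ℂ]^k (V →ₗ[ℝ] ℂ)) :
    sinv x = (-1) ^ k * x := by
  refine Submodule.pow_induction_on_left' (C := fun k x _ => sinv x = (-1) ^ k * x) _
    (fun r => ?_) (fun x y i _ _ h h' => ?_) (fun m hm i x _ h => ?_) hx
  · rw [sinv_algebraMap, pow_zero, one_mul]
  · rw [map_add, h, h', mul_add]
  · obtain ⟨φ, rfl⟩ := hm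
    rw [map_mul, h, sinv_ι, pow_succ]
    rcases neg_one_pow_eq_or (Ext V) i with h | h <;> rw [h] <;> simp

theorem Ext.map_mem_degree (L : V →ₗ[ℝ] W) {k : ℕ} {x : Ext W} (hx : x ∈ ⋀[ℂ]^k (W →ₗ[ℝ] ℂ)) :
    Ext.map L x ∈ ⋀[ℂ]^k (V →ₗ[ℝ] ℂ) := by
  refine Submodule.pow_induction_on_left'
    (C := fun k x _ => Ext.map L x ∈ ⋀[ℂ]^k (V →ₗ[ℝ] ℂ)) _
    (fun r => ?_) (fun x y i _ _ h h' => ?_) (fun m hm i x _ h => ?_) hx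
  · rw [AlgHom.commutes, Ext.mem_degree_zero, Ext.aug_algebraMap]
  · rw [map_add]; exact add_mem h h'
  · obtain ⟨φ, rfl⟩ := hm
    rw [map_mul, Ext.map_ι, ExteriorAlgebra.exteriorPower, pow_succ']
    exact Submodule.mul_mem_mul ⟨_, rfl⟩ h

theorem Ext.ι_mem_degree (φ : V →ₗ[ℝ] ℂ) :
    (ExteriorAlgebra.ι ℂ φ : Ext V) ∈ ⋀[ℂ]^1 (V →ₗ[ℝ] ℂ) := by
  rw [ExteriorAlgebra.exteriorPower, pow_one]; exact ⟨φ, rfl⟩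

theorem Ext.algebraMap_mem_degree (c : ℂ) :
    (algebraMap ℂ (Ext V) c) ∈ ⋀[ℂ]^0 (V →ₗ[ℝ] ℂ) := by
  rw [Ext.mem_degree_zero, Ext.aug_algebraMap]

/-- The augmentation ideal is generated by forms of degree one. -/
theorem Ext.mem_of_aug_eq_zero {x : Ext V} (hx : Ext.aug x = 0) :
    x ∈ ⋀[ℂ]^1 (V →ₗ[ℝ] ℂ) * (⊤ : Submodule ℂ (Ext V)) := by
  have key : ∀ y : Ext V, y - algebraMap ℂ (Ext V) (Ext.aug y) ∈
      ⋀[ℂ]^1 (V →ₗ[ℝ] ℂ) * (⊤ : Submodule ℂ (Ext V)) := by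
    intro y
    induction y using ExteriorAlgebra.induction with
    | algebraMap r => rw [Ext.aug_algebraMap, sub_self]; exact zero_mem _
    | ι φ =>
      rw [Ext.aug_ι, map_zero, sub_zero, ← mul_one (ExteriorAlgebra.ι ℂ φ)]
      exact Submodule.mul_mem_mul (Ext.ι_mem_degree φ) Submodule.mem_top
    | mul a b ha hb =>
      have : a * b - algebraMap ℂ (Ext V) (Ext.aug (a * b)) =
          (a - algebraMap ℂ (Ext V) (Ext.aug a)) * b +
            Ext.aug a • (b - algebraMap ℂ (Ext V) (Ext.aug b)) := by
        rw [map_mul, map_mul, Algebra.smul_def]; noncomm_ring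
      rw [this]
      refine add_mem ?_ (Submodule.smul_mem _ _ hb)
      have h2 := Submodule.mul_mem_mul ha (Submodule.mem_top : b ∈ (⊤ : Submodule ℂ (Ext V)))
      rw [mul_assoc] at h2
      exact (mul_le_mul' le_rfl le_top : (_ : Submodule ℂ (Ext V)) ≤ _) h2
    | add a b ha hb =>
      have : a + b - algebraMap ℂ (Ext V) (Ext.aug (a + b)) =
          (a - algebraMap ℂ (Ext V) (Ext.aug a)) + (b - algebraMap ℂ (Ext V) (Ext.aug b)) := by
        rw [map_add, map_add]; abel
      rw [this]; exact add_mem ha hb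
  simpa [hx] using key x

theorem Ext.top_mul_degree_one_le :
    (⊤ : Submodule ℂ (Ext V)) * ⋀[ℂ]^1 (V →ₗ[ℝ] ℂ) ≤ ⋀[ℂ]^1 (V →ₗ[ℝ] ℂ) * ⊤ := by
  rw [Submodule.mul_le]
  intro x _ y hy
  rw [ExteriorAlgebra.exteriorPower, pow_one] at hy
  obtain ⟨φ, rfl⟩ := hy
  have := Ext.mem_of_aug_eq_zero (x := x * ExteriorAlgebra.ι ℂ φ)
    (by rw [map_mul, Ext.aug_ι, mul_zero])
  exact this

theorem Ext.pow_degree_one_mul_top_le (n : ℕ) :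
    (⋀[ℂ]^1 (V →ₗ[ℝ] ℂ) * (⊤ : Submodule ℂ (Ext V))) ^ n ≤ ⋀[ℂ]^n (V →ₗ[ℝ] ℂ) * ⊤ := by
  induction n with
  | zero => rw [pow_zero, ExteriorAlgebra.exteriorPower, pow_zero, one_mul]; exact le_top
  | succ n ih =>
    rw [pow_succ]
    have hs : ⋀[ℂ]^(n + 1) (V →ₗ[ℝ] ℂ) =
        (⋀[ℂ]^n (V →ₗ[ℝ] ℂ) * ⋀[ℂ]^1 (V →ₗ[ℝ] ℂ) : Submodule ℂ (Ext V)) := by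
      rw [ExteriorAlgebra.exteriorPower, ExteriorAlgebra.exteriorPower, ExteriorAlgebra.exteriorPower, pow_succ, pow_one]
    calc _ ≤ ⋀[ℂ]^n (V →ₗ[ℝ] ℂ) * (⊤ : Submodule ℂ (Ext V)) *
          (⋀[ℂ]^1 (V →ₗ[ℝ] ℂ) * (⊤ : Submodule ℂ (Ext V))) := mul_le_mul' ih le_rfl
      _ = ⋀[ℂ]^n (V →ₗ[ℝ] ℂ) * ((⊤ : Submodule ℂ (Ext V)) * ⋀[ℂ]^1 (V →ₗ[ℝ] ℂ)) * ⊤ := by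
        simp only [mul_assoc]
      _ ≤ ⋀[ℂ]^n (V →ₗ[ℝ] ℂ) * (⋀[ℂ]^1 (V →ₗ[ℝ] ℂ) * ⊤) * ⊤ :=
        mul_le_mul' (mul_le_mul' le_rfl Ext.top_mul_degree_one_le) le_rfl
      _ = ⋀[ℂ]^n (V →ₗ[ℝ] ℂ) * ⋀[ℂ]^1 (V →ₗ[ℝ] ℂ) * ((⊤ : Submodule ℂ (Ext V)) * ⊤) := by
        simp only [mul_assoc]
      _ ≤ _ := by rw [hs]; exact mul_le_mul' le_rfl le_top

theorem ext_degree_eq_bot [FiniteDimensional ℝ V] {n : ℕ}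
    (hn : Module.finrank ℝ V < n) : (⋀[ℂ]^n (V →ₗ[ℝ] ℂ) : Submodule ℂ (Ext V)) = ⊥ := by
  have hd : Module.finrank ℂ (V →ₗ[ℝ] ℂ) = Module.finrank ℝ V := by
    rw [Module.finrank_linearMap_self]
  have h := exteriorPower.finrank_eq ℂ (M := V →ₗ[ℝ] ℂ) n
  rw [hd, Nat.choose_eq_zero_of_lt hn] at h
  exact Submodule.finrank_eq_zero.1 h

theorem Ext.aug_pow_eq_bot [FiniteDimensional ℝ V] {n : ℕ}
    (hn : Module.finrank ℝ V < n) :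
    (LinearMap.ker (Ext.aug : Ext V →ₐ[ℂ] ℂ).toLinearMap) ^ n = ⊥ := by
  refine le_bot_iff.1 ?_
  calc _ ≤ (⋀[ℂ]^1 (V →ₗ[ℝ] ℂ) * (⊤ : Submodule ℂ (Ext V))) ^ n :=
        pow_le_pow_left' (fun x hx => Ext.mem_of_aug_eq_zero hx) n
    _ ≤ ⋀[ℂ]^n (V →ₗ[ℝ] ℂ) * ⊤ := Ext.pow_degree_one_mul_top_le n
    _ = ⊥ := by rw [ext_degree_eq_bot hn, Submodule.bot_mul]

/-- Square matrices over the augmentation ideal are nilpotent. -/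
theorem Ext.matrix_pow_eq_zero [FiniteDimensional ℝ V] {ι : Type*} [Fintype ι] [DecidableEq ι]
    (M : Matrix ι ι (Ext V)) (hM : ∀ i j, Ext.aug (M i j) = 0) {n : ℕ}
    (hn : Module.finrank ℝ V < n) : M ^ n = 0 := by
  have key : ∀ k i j, (M ^ k) i j ∈ (LinearMap.ker (Ext.aug : Ext V →ₐ[ℂ] ℂ).toLinearMap) ^ k := by
    intro k
    induction k with
    | zero =>
      intro i j
      rw [pow_zero, pow_zero, Submodule.mem_one, mone_apply]
      split_ifs
      · exact ⟨1, map_one _⟩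
      · exact ⟨0, map_zero _⟩
    | succ k ih =>
      intro i j
      rw [pow_succ, pow_succ, mmul_apply]
      exact sum_mem fun l _ => Submodule.mul_mem_mul (ih i l) (hM l j)
  ext1 i j
  have := key n i j
  rwa [Ext.aug_pow_eq_bot hn, Submodule.mem_bot] at this

theorem contract_algebraMap (w : V) (c : ℂ) : contract w (algebraMap ℂ (Ext V) c) = 0 :=
  CliffordAlgebra.contractLeft_algebraMap _ _ _

theorem contract_ι_mul (w : V) (φ : V →ₗ[ℝ] ℂ) (x : Ext V) :
    contract w (ExteriorAlgebra.ι ℂ φ * x) = φ w • x - ExteriorAlgebra.ι ℂ φ * contract w x :=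
  CliffordAlgebra.contractLeft_ι_mul _ _ _

theorem ext_left_induction {C : Ext V → Prop} (h0 : ∀ c, C (algebraMap ℂ (Ext V) c))
    (h1 : ∀ x y, C x → C y → C (x + y))
    (h2 : ∀ φ x, C x → C (ExteriorAlgebra.ι ℂ φ * x)) (x : Ext V) : C x :=
  CliffordAlgebra.left_induction (Q := (0 : QuadraticForm ℂ (V →ₗ[ℝ] ℂ))) h0 h1
    (fun x φ h => h2 φ x h) x

theorem contract_map (L : V →ₗ[ℝ] W) (w : V) (x : Ext W) :
    contract w (Ext.map L x) = Ext.map L (contract (L w) x) := by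
  induction x using ext_left_induction with
  | h0 c => rw [AlgHom.commutes, contract_algebraMap, contract_algebraMap, map_zero]
  | h1 x y hx hy => simp only [map_add, hx, hy]
  | h2 φ x hx =>
    rw [map_mul, Ext.map_ι, contract_ι_mul, contract_ι_mul, hx, map_sub, map_smul, map_mul,
      Ext.map_ι]; rfl

theorem contract_sinv (w : V) (x : Ext V) : contract w (sinv x) = -sinv (contract w x) := by
  induction x using ext_left_induction with
  | h0 c => rw [sinv_algebraMap, contract_algebraMap, map_zero, neg_zero]
  | h1 x y hx hy => simp only [map_add, hx, hy, neg_add]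
  | h2 φ x hx =>
    rw [map_mul, sinv_ι, neg_mul, map_neg, contract_ι_mul, contract_ι_mul, hx, map_sub, sinv_smul,
      map_mul, sinv_ι]
    simp

end ExtAlgebra

/-! ### Smooth functions with values in exterior forms -/

section ExtSmooth

variable {V W U : Type*} [NormedAddCommGroup V] [NormedSpace ℝ V] [FiniteDimensional ℝ V]
  [NormedAddCommGroup W] [NormedSpace ℝ W] [FiniteDimensional ℝ W]
  [NormedAddCommGroup U] [NormedSpace ℝ U] [FiniteDimensional ℝ U]

instance Ext.instFiniteDimensionalComplex {V : Type*} [AddCommGroup V] [Module ℝ V]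
    [FiniteDimensional ℝ V] : FiniteDimensional ℂ (Ext V) :=
  (Ext.coords V).symm.finiteDimensional

instance Ext.instFiniteDimensionalReal {V : Type*} [AddCommGroup V] [Module ℝ V]
    [FiniteDimensional ℝ V] : FiniteDimensional ℝ (Ext V) :=
  FiniteDimensional.complexToReal _

/-- A complex linear map between finite-dimensional spaces as a continuous real linear map. -/
def realCLM {A B : Type*} [NormedAddCommGroup A] [NormedSpace ℂ A] [FiniteDimensional ℂ A]
    [NormedAddCommGroup B] [NormedSpace ℂ B] (f : A →ₗ[ℂ] B) : A →L[ℝ] B :=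
  (LinearMap.toContinuousLinearMap f).restrictScalars ℝ

@[simp] theorem realCLM_apply {A B : Type*} [NormedAddCommGroup A] [NormedSpace ℂ A]
    [FiniteDimensional ℂ A] [NormedAddCommGroup B] [NormedSpace ℂ B] (f : A →ₗ[ℂ] B) (a : A) :
    realCLM f a = f a := rfl

/-- Pullback of exterior forms as a continuous linear map. -/
def Ext.mapL (L : V →L[ℝ] W) : Ext W →L[ℝ] Ext V := realCLM (Ext.map (L : V →ₗ[ℝ] W)).toLinearMap

@[simp] theorem Ext.mapL_apply (L : V →L[ℝ] W) (x : Ext W) :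
    Ext.mapL L x = Ext.map (L : V →ₗ[ℝ] W) x := rfl

/-- The grading involution as a continuous linear map. -/
def sinvL : Ext V →L[ℝ] Ext V := realCLM (CliffordAlgebra.involute : Ext V →ₐ[ℂ] Ext V).toLinearMap

@[simp] theorem sinvL_apply (x : Ext V) : sinvL x = sinv x := rfl

/-- Multiplication of exterior forms as a continuous bilinear map. -/
def Ext.mulL : Ext V →L[ℝ] Ext V →L[ℝ] Ext V :=
  LinearMap.toContinuousLinearMap
    { toFun := fun a => realCLM (LinearMap.mulLeft ℂ a)
      map_add' := fun a b => by ext x; simp [add_mul]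
      map_smul' := fun r a => by
        ext x
        simp only [realCLM_apply, LinearMap.mulLeft_apply, RingHom.id_apply,
          smul_apply]
        exact smul_mul_assoc (r : ℂ) a x }

@[simp] theorem Ext.mulL_apply (a b : Ext V) : Ext.mulL a b = a * b := rfl

/-- The inclusion of the `1`-forms as a continuous linear map. -/
def Ext.ιL : (V →L[ℝ] ℂ) →L[ℝ] Ext V :=
  LinearMap.toContinuousLinearMap
    { toFun := fun φ => ExteriorAlgebra.ι ℂ (φ : V →ₗ[ℝ] ℂ)
      map_add' := fun a b => by simp
      map_smul' := fun r a => by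
        have : ((r • a : V →L[ℝ] ℂ) : V →ₗ[ℝ] ℂ) = (r : ℂ) • (a : V →ₗ[ℝ] ℂ) := by
          ext x; simp
        rw [this, map_smul]; rfl }

@[simp] theorem Ext.ιL_apply (φ : V →L[ℝ] ℂ) : Ext.ιL φ = ExteriorAlgebra.ι ℂ (φ : V →ₗ[ℝ] ℂ) := rfl

section

variable {A : Type*} [NormedAddCommGroup A] [NormedSpace ℝ A] {n : ℕ∞ω} {s : Set A}

theorem contDiffOn_ext_mul {f g : A → Ext V} (hf : ContDiffOn ℝ n f s) (hg : ContDiffOn ℝ n g s) :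
    ContDiffOn ℝ n (fun a => f a * g a) s :=
  (Ext.mulL.contDiff.comp_contDiffOn hf).clm_apply hg

theorem contDiff_ext_mul {f g : A → Ext V} (hf : ContDiff ℝ n f) (hg : ContDiff ℝ n g) :
    ContDiff ℝ n (fun a => f a * g a) :=
  (Ext.mulL.contDiff.comp hf).clm_apply hg

theorem contDiff_ext_mapL : ContDiff ℝ n (Ext.mapL : (V →L[ℝ] W) → (Ext W →L[ℝ] Ext V)) := by
  rw [contDiff_clm_apply_iff]
  intro x
  simp only [Ext.mapL_apply]
  induction x using ExteriorAlgebra.induction with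
  | algebraMap r => simp only [AlgHom.commutes]; exact contDiff_const
  | ι φ =>
    simp only [Ext.map_ι]
    have : (fun L : V →L[ℝ] W => (ExteriorAlgebra.ι ℂ (φ.comp (L : V →ₗ[ℝ] W)) : Ext V)) =
        fun L => Ext.ιL ((LinearMap.toContinuousLinearMap φ).comp L) := rfl
    rw [this]
    exact Ext.ιL.contDiff.comp (contDiff_const.clm_comp contDiff_id)
  | mul a b ha hb => simp only [map_mul]; exact contDiff_ext_mul ha hb
  | add a b ha hb => simp only [map_add]; exact ha.add hb

end

end ExtSmooth

end

section

/-! ### Exterior derivative on a vector space -/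

section Wedge

variable {V W : Type*} [AddCommGroup V] [Module ℝ V] [FiniteDimensional ℝ V]
  [AddCommGroup W] [Module ℝ W] [FiniteDimensional ℝ W]

variable (V) in
/-- The coordinate `1`-forms. -/
def coordForm (i : Fin (Module.finrank ℝ V)) : V →ₗ[ℝ] ℂ :=
  Complex.ofRealCLM.toLinearMap.comp ((Module.finBasis ℝ V).coord i)

theorem coordForm_apply (i : Fin (Module.finrank ℝ V)) (v : V) :
    coordForm V i v = (((Module.finBasis ℝ V).repr v i : ℝ) : ℂ) := rfl

/-- The sum `∑ i, dxⁱ ∧ L(∂ᵢ)`. -/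
def wedge (L : V → Ext V) : Ext V :=
  ∑ i, ExteriorAlgebra.ι ℂ (coordForm V i) * L (Module.finBasis ℝ V i)

theorem linearForm_eq_sum (φ : V →ₗ[ℝ] ℂ) :
    φ = ∑ i, φ (Module.finBasis ℝ V i) • coordForm V i := by
  ext v
  conv_lhs => rw [← (Module.finBasis ℝ V).sum_repr v]
  rw [map_sum, LinearMap.sum_apply]
  refine Finset.sum_congr rfl fun i _ => ?_
  rw [map_smul, LinearMap.smul_apply, coordForm_apply, smul_eq_mul, mul_comm]; rfl

theorem ι_eq_sum (φ : V →ₗ[ℝ] ℂ) : (ExteriorAlgebra.ι ℂ φ : Ext V) =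
    ∑ i, φ (Module.finBasis ℝ V i) • ExteriorAlgebra.ι ℂ (coordForm V i) := by
  conv_lhs => rw [linearForm_eq_sum φ]
  rw [map_sum]
  simp only [map_smul]

theorem ι_mul_eq_sinv_mul {V : Type*} [AddCommGroup V] [Module ℝ V] (φ : V →ₗ[ℝ] ℂ) (x : Ext V) :
    ExteriorAlgebra.ι ℂ φ * x = sinv x * ExteriorAlgebra.ι ℂ φ := by
  induction x using ext_left_induction with
  | h0 c => rw [sinv_algebraMap]; exact (Algebra.commutes _ _).symm
  | h1 x y hx hy => rw [map_add, mul_add, add_mul, hx, hy]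
  | h2 ψ x hx =>
    have h : (ExteriorAlgebra.ι ℂ φ * ExteriorAlgebra.ι ℂ ψ : Ext V) =
        -(ExteriorAlgebra.ι ℂ ψ * ExteriorAlgebra.ι ℂ φ) :=
      eq_neg_of_add_eq_zero_left (ExteriorAlgebra.ι_add_mul_swap φ ψ)
    rw [← mul_assoc, h, map_mul, sinv_ι, neg_mul, mul_assoc, hx]
    noncomm_ring

theorem map_wedge (P : V →ₗ[ℝ] W) (L : W →ₗ[ℝ] Ext W) :
    Ext.map P (wedge L) = wedge fun v => Ext.map P (L (P v)) := by
  have h1 : ∀ j, P (Module.finBasis ℝ V j) = ∑ i, (Module.finBasis ℝ W).repr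
      (P (Module.finBasis ℝ V j)) i • Module.finBasis ℝ W i := fun j =>
    ((Module.finBasis ℝ W).sum_repr _).symm
  have h2 : ∀ j, L (P (Module.finBasis ℝ V j)) = ∑ i, (((Module.finBasis ℝ W).repr
      (P (Module.finBasis ℝ V j)) i : ℝ) : ℂ) • L (Module.finBasis ℝ W i) := fun j => by
    conv_lhs => rw [h1 j, map_sum]
    refine Finset.sum_congr rfl fun i _ => ?_
    rw [map_smul]; rfl
  simp only [wedge, map_sum, map_mul, Ext.map_ι]
  have h3 : ∀ i, (ExteriorAlgebra.ι ℂ ((coordForm W i).comp P) : Ext V) =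
      ∑ j, (((Module.finBasis ℝ W).repr (P (Module.finBasis ℝ V j)) i : ℝ) : ℂ) •
        ExteriorAlgebra.ι ℂ (coordForm V j) := fun i => by
    rw [ι_eq_sum]; rfl
  simp only [h3, h2, Finset.sum_mul, map_sum, map_smul, Finset.mul_sum]
  rw [Finset.sum_comm]
  refine Finset.sum_congr rfl fun j _ => Finset.sum_congr rfl fun i _ => ?_
  rw [smul_mul_assoc, mul_smul_comm]

theorem contract_wedge (w : V) (L : V →ₗ[ℝ] Ext V) :
    contract w (wedge L) = L w - wedge fun v => contract w (L v) := by
  have h1 : L w = ∑ i, (coordForm V i w) • L (Module.finBasis ℝ V i) := by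
    conv_lhs => rw [← (Module.finBasis ℝ V).sum_repr w, map_sum]
    refine Finset.sum_congr rfl fun i _ => ?_
    rw [map_smul]; rfl
  rw [h1, wedge, wedge, map_sum, ← Finset.sum_sub_distrib]
  exact Finset.sum_congr rfl fun i _ => contract_ι_mul _ _ _

theorem wedge_add (L L' : V → Ext V) : (wedge fun v => L v + L' v) = wedge L + wedge L' := by
  simp only [wedge, mul_add, Finset.sum_add_distrib]

theorem wedge_smul (c : ℂ) (L : V → Ext V) : (wedge fun v => c • L v) = c • wedge L := by
  simp only [wedge, mul_smul_comm, Finset.smul_sum]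

theorem wedge_mul_right (L : V → Ext V) (y : Ext V) : (wedge fun v => L v * y) = wedge L * y := by
  simp only [wedge, Finset.sum_mul, mul_assoc]

theorem wedge_mul_left (x : Ext V) (L : V → Ext V) :
    (wedge fun v => x * L v) = sinv x * wedge L := by
  simp only [wedge, Finset.mul_sum, ← mul_assoc, ι_mul_eq_sinv_mul _ x]

theorem wedge_sinv (L : V → Ext V) : (wedge fun v => sinv (L v)) = -sinv (wedge L) := by
  simp only [wedge, map_sum, map_mul, sinv_ι, ← Finset.sum_neg_distrib, neg_mul, neg_neg]

theorem wedge_zero : wedge (fun _ : V => (0 : Ext V)) = 0 := by simp [wedge]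

theorem wedge_wedge_symm
    (c : Fin (Module.finrank ℝ V) → Fin (Module.finrank ℝ V) → Ext V) (hc : ∀ i j, c i j = c j i) :
    ∑ i, ∑ j, ExteriorAlgebra.ι ℂ (coordForm V i) *
      (ExteriorAlgebra.ι ℂ (coordForm V j) * c i j) = 0 := by
  set S := ∑ i, ∑ j, ExteriorAlgebra.ι ℂ (coordForm V i) *
      (ExteriorAlgebra.ι ℂ (coordForm V j) * c i j) with hS
  have : S = -S := by
    conv_lhs => rw [hS, Finset.sum_comm]
    rw [hS, ← Finset.sum_neg_distrib]
    refine Finset.sum_congr rfl fun i _ => ?_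
    rw [← Finset.sum_neg_distrib]
    refine Finset.sum_congr rfl fun j _ => ?_
    rw [← mul_assoc, ← mul_assoc, ← neg_mul, hc]
    congr 1
    exact eq_neg_of_add_eq_zero_left (ExteriorAlgebra.ι_add_mul_swap _ _)
  have h2 : (2 : ℂ) • S = 0 := by
    rw [two_smul]
    nth_rewrite 1 [this]
    exact neg_add_cancel S
  exact (smul_eq_zero.1 h2).resolve_left two_ne_zero

end Wedge

section Flat

variable {V W : Type*} [NormedAddCommGroup V] [NormedSpace ℝ V] [FiniteDimensional ℝ V]
  [NormedAddCommGroup W] [NormedSpace ℝ W] [FiniteDimensional ℝ W]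

theorem flatD_eq_wedge (τ : V → Ext V) (y : V) : flatD τ y = wedge (fderiv ℝ τ y) := rfl

theorem flatD_congr {τ τ' : V → Ext V} {y : V} (h : τ =ᶠ[nhds y] τ') : flatD τ y = flatD τ' y := by
  rw [flatD_eq_wedge, flatD_eq_wedge, h.fderiv_eq]

theorem flatD_const (x : Ext V) (y : V) : flatD (fun _ => x) y = 0 := by
  rw [flatD_eq_wedge, fderiv_fun_const]; exact wedge_zero

theorem flatD_add {τ τ' : V → Ext V} {y : V} (h : DifferentiableAt ℝ τ y)
    (h' : DifferentiableAt ℝ τ' y) :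
    flatD (fun z => τ z + τ' z) y = flatD τ y + flatD τ' y := by
  simp only [flatD_eq_wedge]
  rw [fderiv_fun_add h h', ← wedge_add]; rfl

theorem flatD_smul (c : ℂ) {τ : V → Ext V} {y : V} (h : DifferentiableAt ℝ τ y) :
    flatD (fun z => c • τ z) y = c • flatD τ y := by
  simp only [flatD_eq_wedge]
  rw [fderiv_fun_const_smul h, ← wedge_smul]; rfl

theorem flatD_mul {τ τ' : V → Ext V} {y : V} (h : DifferentiableAt ℝ τ y)
    (h' : DifferentiableAt ℝ τ' y) :
    flatD (fun z => τ z * τ' z) y = flatD τ y * τ' y + sinv (τ y) * flatD τ' y := by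
  have h1 : HasFDerivAt (fun z => τ z * τ' z) _ y :=
    Ext.mulL.hasFDerivAt_of_bilinear h.hasFDerivAt h'.hasFDerivAt
  simp only [flatD_eq_wedge]
  rw [h1.fderiv, ← wedge_mul_right, ← wedge_mul_left, ← wedge_add]
  congr 1
  funext v
  simp [add_comm]

theorem flatD_sinv {τ : V → Ext V} {y : V} (h : DifferentiableAt ℝ τ y) :
    flatD (fun z => sinv (τ z)) y = -sinv (flatD τ y) := by
  have h1 : HasFDerivAt (fun z => sinv (τ z)) _ y :=
    (sinvL (V := V)).hasFDerivAt.comp y h.hasFDerivAt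
  simp only [flatD_eq_wedge]
  rw [h1.fderiv, ← wedge_sinv]; rfl

theorem contDiffOn_flatD {τ : V → Ext V} {s : Set V} (hs : IsOpen s) (h : ContDiffOn ℝ ∞ τ s) :
    ContDiffOn ℝ ∞ (flatD τ) s := by
  have h1 : ContDiffOn ℝ ∞ (fderiv ℝ τ) s := h.fderiv_of_isOpen hs (by simp)
  have : flatD τ = fun y => ∑ i, ExteriorAlgebra.ι ℂ (coordForm V i) *
      fderiv ℝ τ y (Module.finBasis ℝ V i) := rfl
  rw [this]
  exact ContDiffOn.sum fun i _ => contDiffOn_ext_mul contDiffOn_const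
    (h1.clm_apply contDiffOn_const)

theorem fderiv_fderiv_comm {V A : Type*} [NormedAddCommGroup V]
    [NormedSpace ℝ V] [NormedAddCommGroup A] [NormedSpace ℝ A] {τ : V → A} {y : V}
    (h : ContDiffAt ℝ 2 τ y) (v w : V) :
    fderiv ℝ (fderiv ℝ τ) y v w = fderiv ℝ (fderiv ℝ τ) y w v :=
  h.isSymmSndFDerivAt (by simp) v w

theorem flatD_flatD {τ : V → Ext V} {y : V} (h : ContDiffAt ℝ 2 τ y) :
    flatD (flatD τ) y = 0 := by
  have h1 : DifferentiableAt ℝ (fderiv ℝ τ) y :=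
    (h.fderiv_right (m := 1) (by norm_num)).differentiableAt (by simp)
  have h2 : HasFDerivAt (flatD τ) (∑ i, (Ext.mulL (ExteriorAlgebra.ι ℂ (coordForm V i))).comp
      ((fderiv ℝ (fderiv ℝ τ) y).flip (Module.finBasis ℝ V i))) y := by
    refine HasFDerivAt.fun_sum fun i _ => ?_
    refine (Ext.mulL (ExteriorAlgebra.ι ℂ (coordForm V i))).hasFDerivAt.comp y ?_
    have := h1.hasFDerivAt.clm_apply (hasFDerivAt_const (Module.finBasis ℝ V i) y)
    simpa using this
  rw [flatD_eq_wedge, h2.fderiv, wedge]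
  simp only [sum_apply, ContinuousLinearMap.comp_apply, Ext.mulL_apply,
    ContinuousLinearMap.flip_apply, Finset.mul_sum]
  exact wedge_wedge_symm
    (fun i j => fderiv ℝ (fderiv ℝ τ) y (Module.finBasis ℝ V i) (Module.finBasis ℝ V j))
    fun i j => fderiv_fderiv_comm h _ _

/-- The pullback of a constant form by a smooth map is closed. -/
theorem flatD_map_fderiv {φ : V → W} {y : V} (hφ : ContDiffAt ℝ 2 φ y) (x : Ext W) :
    DifferentiableAt ℝ (fun z => Ext.map (fderiv ℝ φ z : V →ₗ[ℝ] W) x) y ∧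
    flatD (fun z => Ext.map (fderiv ℝ φ z : V →ₗ[ℝ] W) x) y = 0 := by
  have h1 : DifferentiableAt ℝ (fderiv ℝ φ) y :=
    (hφ.fderiv_right (m := 1) (by norm_num)).differentiableAt (by simp)
  induction x using ExteriorAlgebra.induction with
  | algebraMap r =>
    simp only [AlgHom.commutes]
    exact ⟨differentiableAt_const _, flatD_const _ _⟩
  | ι ψ =>
    have hd : HasFDerivAt (fun z => Ext.map (fderiv ℝ φ z : V →ₗ[ℝ] W) (ExteriorAlgebra.ι ℂ ψ))
        (Ext.ιL.comp ((ContinuousLinearMap.compL ℝ V W ℂ (LinearMap.toContinuousLinearMap ψ)).comp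
          (fderiv ℝ (fderiv ℝ φ) y))) y := by
      simp only [Ext.map_ι]
      exact Ext.ιL.hasFDerivAt.comp y
        ((ContinuousLinearMap.compL ℝ V W ℂ (LinearMap.toContinuousLinearMap ψ)).hasFDerivAt.comp y
          h1.hasFDerivAt)
    refine ⟨hd.differentiableAt, ?_⟩
    rw [flatD_eq_wedge, hd.fderiv, wedge]
    have hb : ∀ i, Ext.ιL.comp ((ContinuousLinearMap.compL ℝ V W ℂ
        (LinearMap.toContinuousLinearMap ψ)).comp (fderiv ℝ (fderiv ℝ φ) y))
          (Module.finBasis ℝ V i) = ∑ j, ExteriorAlgebra.ι ℂ (coordForm V j) *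
            algebraMap ℂ (Ext V) (ψ (fderiv ℝ (fderiv ℝ φ) y (Module.finBasis ℝ V i)
              (Module.finBasis ℝ V j))) := fun i => by
      simp only [ContinuousLinearMap.comp_apply, Ext.ιL_apply]
      rw [ι_eq_sum]
      refine Finset.sum_congr rfl fun j _ => ?_
      rw [← Algebra.commutes, ← Algebra.smul_def]; rfl
    simp only [hb, Finset.mul_sum]
    exact wedge_wedge_symm
      (fun i j => algebraMap ℂ (Ext V) (ψ (fderiv ℝ (fderiv ℝ φ) y (Module.finBasis ℝ V i)
        (Module.finBasis ℝ V j)))) fun i j => by rw [fderiv_fderiv_comm hφ]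
  | mul a b ha hb =>
    simp only [map_mul]
    refine ⟨?_, ?_⟩
    · exact (Ext.mulL.hasFDerivAt_of_bilinear ha.1.hasFDerivAt hb.1.hasFDerivAt).differentiableAt
    · rw [flatD_mul ha.1 hb.1, ha.2, hb.2, zero_mul, mul_zero, add_zero]
  | add a b ha hb =>
    simp only [map_add]
    exact ⟨ha.1.add hb.1, by rw [flatD_add ha.1 hb.1, ha.2, hb.2, add_zero]⟩

theorem flatD_pullback {φ : V → W} {y : V} {τ : W → Ext W} (hφ : ContDiffAt ℝ 2 φ y)
    (hτ : DifferentiableAt ℝ τ (φ y)) :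
    flatD (fun z => Ext.map (fderiv ℝ φ z : V →ₗ[ℝ] W) (τ (φ z))) y =
      Ext.map (fderiv ℝ φ y : V →ₗ[ℝ] W) (flatD τ (φ y)) := by
  have h1 : DifferentiableAt ℝ (fderiv ℝ φ) y :=
    (hφ.fderiv_right (m := 1) (by norm_num)).differentiableAt (by simp)
  have h2 : DifferentiableAt ℝ (fun z => Ext.mapL (fderiv ℝ φ z)) y :=
    ((contDiff_ext_mapL (n := 1)).differentiable (by simp)).differentiableAt.comp y h1
  have h3 : HasFDerivAt (fun z => τ (φ z)) ((fderiv ℝ τ (φ y)).comp (fderiv ℝ φ y)) y :=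
    hτ.hasFDerivAt.comp y (hφ.differentiableAt (by simp)).hasFDerivAt
  have h4 : HasFDerivAt (fun z => Ext.mapL (fderiv ℝ φ z) (τ (φ z))) _ y :=
    h2.hasFDerivAt.clm_apply h3
  have h5 : HasFDerivAt (fun z => Ext.mapL (fderiv ℝ φ z) (τ (φ y))) _ y :=
    h2.hasFDerivAt.clm_apply (hasFDerivAt_const (τ (φ y)) y)
  have h6 := (flatD_map_fderiv hφ (τ (φ y))).2
  rw [flatD_eq_wedge] at h6 ⊢
  erw [h5.fderiv] at h6
  erw [h4.fderiv, flatD_eq_wedge, map_wedge (fderiv ℝ φ y : V →ₗ[ℝ] W)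
    (fderiv ℝ τ (φ y) : W →ₗ[ℝ] Ext W)]
  refine Eq.trans ?_ (add_zero _)
  rw [← h6, ← wedge_add]
  congr 1
  funext v
  simp

end Flat

end

section

/-! ### Differential forms in charts -/

section Charts

variable {G : Type v} [Group G] {X Y Z : GMfd.{u} G}

/-- Smooth maps of manifolds, as a class. -/
class SmoothMap (X Y : GMfd.{u} G) (f : X.carrier → Y.carrier) : Prop where
  smooth : ContMDiff X.I Y.I ∞ f

instance SmoothMap.act (g : G) : SmoothMap X X (X.act g) := ⟨X.smooth_act g⟩

instance SmoothMap.ident : SmoothMap X X id := ⟨contMDiff_id⟩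

theorem SmoothMap.mdifferentiableAt (f : X.carrier → Y.carrier) [hf : SmoothMap X Y f]
    (x : X.carrier) : MDifferentiableAt X.I Y.I f x :=
  hf.smooth.contMDiffAt.mdifferentiableAt (by simp)

theorem tmap_id (x : X.carrier) : tmap (X := X) (Y := X) id x = ContinuousLinearMap.id ℝ X.E :=
  mfderiv_id

theorem tmap_comp (f : X.carrier → Y.carrier) (g : Y.carrier → Z.carrier)
    [SmoothMap X Y f] [SmoothMap Y Z g] (x : X.carrier) :
    tmap (X := X) (Y := Z) (g ∘ f) x =
      (tmap (X := Y) (Y := Z) g (f x)).comp (tmap (X := X) (Y := Y) f x) :=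
  mfderiv_comp x (SmoothMap.mdifferentiableAt g (f x)) (SmoothMap.mdifferentiableAt f x)

theorem pull_apply (f : X.carrier → Y.carrier) (α : Form Y) (x : X.carrier) :
    pull f α x = Ext.map (tmap f x : X.E →ₗ[ℝ] Y.E) (α (f x)) := rfl

theorem pull_id (α : Form X) : pull (X := X) (Y := X) id α = α := by
  funext x
  rw [pull_apply, tmap_id]
  exact Ext.map_id _

theorem pull_comp (f : X.carrier → Y.carrier) (g : Y.carrier → Z.carrier)
    [SmoothMap X Y f] [SmoothMap Y Z g] (α : Form Z) :
    pull (X := X) (Y := Z) (g ∘ f) α = pull (X := X) (Y := Y) f (pull (X := Y) (Y := Z) g α) := by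
  funext x
  rw [pull_apply, pull_apply, pull_apply, Ext.map_map, tmap_comp f g]; rfl

theorem pull_sinv (f : X.carrier → Y.carrier) (α : Form Y) : pull f (sinv α) = sinv (pull f α) :=
  funext fun _ => (Ext.sinv_map _ _).symm

theorem mdifferentiableAt_chart {x₀ x : X.carrier} (hx : x ∈ (extChartAt X.I x₀).source) :
    MDifferentiableAt X.I 𝓘(ℝ, X.E) (extChartAt X.I x₀) x :=
  mdifferentiableAt_extChartAt (by rwa [extChartAt_source] at hx)

theorem mdifferentiableAt_chart_symm {x₀ : X.carrier} {y : X.E}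
    (hy : y ∈ (extChartAt X.I x₀).target) :
    MDifferentiableAt 𝓘(ℝ, X.E) X.I (extChartAt X.I x₀).symm y := by
  have := mdifferentiableWithinAt_extChartAt_symm (I := X.I) hy
  rwa [X.I.range_eq_univ, mdifferentiableWithinAt_univ] at this

theorem chartDeriv_comp_chartInvDeriv {x₀ : X.carrier} {y : X.E}
    (hy : y ∈ (extChartAt X.I x₀).target) :
    (chartDeriv x₀ ((extChartAt X.I x₀).symm y)).comp (chartInvDeriv x₀ y) =
      ContinuousLinearMap.id ℝ X.E := by
  have := mfderiv_extChartAt_comp_mfderivWithin_extChartAt_symm (I := X.I) hy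
  rwa [X.I.range_eq_univ, mfderivWithin_univ] at this

theorem chartInvDeriv_comp_chartDeriv {x₀ x : X.carrier} (hx : x ∈ (extChartAt X.I x₀).source) :
    (chartInvDeriv x₀ (extChartAt X.I x₀ x)).comp (chartDeriv x₀ x) =
      ContinuousLinearMap.id ℝ X.E := by
  have := mfderivWithin_extChartAt_symm_comp_mfderiv_extChartAt' (I := X.I) hx
  rwa [X.I.range_eq_univ, mfderivWithin_univ] at this

theorem form_eq_chartRep (α : Form X) {x₀ x : X.carrier} (hx : x ∈ (extChartAt X.I x₀).source) :
    α x = Ext.map (chartDeriv x₀ x : X.E →ₗ[ℝ] X.E) (chartRep α x₀ (extChartAt X.I x₀ x)) := by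
  have h : (chartInvDeriv x₀ (extChartAt X.I x₀ x) : X.E →ₗ[ℝ] X.E).comp
      (chartDeriv x₀ x : X.E →ₗ[ℝ] X.E) = LinearMap.id :=
    congrArg (fun L : X.E →L[ℝ] X.E => (L : X.E →ₗ[ℝ] X.E)) (chartInvDeriv_comp_chartDeriv hx)
  rw [chartRep, Ext.map_map, (extChartAt X.I x₀).left_inv hx, h]
  exact (Ext.map_id _).symm

theorem map_chartInvDeriv_map_chartDeriv {x₀ : X.carrier} {y : X.E}
    (hy : y ∈ (extChartAt X.I x₀).target) (z : Ext X.E) :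
    Ext.map (chartInvDeriv x₀ y : X.E →ₗ[ℝ] X.E)
      (Ext.map (chartDeriv x₀ ((extChartAt X.I x₀).symm y) : X.E →ₗ[ℝ] X.E) z) = z := by
  have h : (chartDeriv x₀ ((extChartAt X.I x₀).symm y) : X.E →ₗ[ℝ] X.E).comp
      (chartInvDeriv x₀ y : X.E →ₗ[ℝ] X.E) = LinearMap.id :=
    congrArg (fun L : X.E →L[ℝ] X.E => (L : X.E →ₗ[ℝ] X.E)) (chartDeriv_comp_chartInvDeriv hy)
  rw [Ext.map_map, h]
  exact Ext.map_id _

/-- A map of manifolds in charts. -/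
def chartMap (f : X.carrier → Y.carrier) (x₀ : X.carrier) (y₀ : Y.carrier) : X.E → Y.E :=
  fun y => extChartAt Y.I y₀ (f ((extChartAt X.I x₀).symm y))

variable (f : X.carrier → Y.carrier) [hf : SmoothMap X Y f] {x₀ : X.carrier} {y₀ : Y.carrier}

theorem fderiv_chartMap {y : X.E} (hy : y ∈ (extChartAt X.I x₀).target)
    (hy' : f ((extChartAt X.I x₀).symm y) ∈ (extChartAt Y.I y₀).source) :
    fderiv ℝ (chartMap f x₀ y₀) y =
      (chartDeriv y₀ (f ((extChartAt X.I x₀).symm y))).comp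
        ((tmap f ((extChartAt X.I x₀).symm y)).comp (chartInvDeriv x₀ y)) := by
  have h1 := mdifferentiableAt_chart_symm hy
  have h2 := SmoothMap.mdifferentiableAt f ((extChartAt X.I x₀).symm y)
  have h3 := mdifferentiableAt_chart hy'
  rw [← mfderiv_eq_fderiv]
  have h4 := mfderiv_comp y (h2 : MDifferentiableAt X.I Y.I f ((extChartAt X.I x₀).symm y)) h1
  have h5 := mfderiv_comp (I := 𝓘(ℝ, X.E)) (I'' := 𝓘(ℝ, Y.E)) y (g := extChartAt Y.I y₀)
    (f := f ∘ (extChartAt X.I x₀).symm) h3 (h2.comp y h1)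
  rw [h4] at h5
  exact h5

theorem contDiffAt_chartMap {y : X.E} (hy : y ∈ (extChartAt X.I x₀).target)
    (hy' : f ((extChartAt X.I x₀).symm y) ∈ (extChartAt Y.I y₀).source) :
    ContDiffAt ℝ ∞ (chartMap f x₀ y₀) y := by
  have h1 : ContMDiffAt 𝓘(ℝ, X.E) X.I ∞ (extChartAt X.I x₀).symm y :=
    (contMDiffOn_extChartAt_symm x₀).contMDiffAt ((isOpen_extChartAt_target x₀).mem_nhds hy)
  have h3 : ContMDiffAt Y.I 𝓘(ℝ, Y.E) ∞ (extChartAt Y.I y₀) (f ((extChartAt X.I x₀).symm y)) :=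
    contMDiffAt_extChartAt' (by rwa [extChartAt_source] at hy')
  exact (h3.comp y (hf.smooth.contMDiffAt.comp y h1)).contDiffAt

theorem eventually_chart_mem {y : X.E} (hy : y ∈ (extChartAt X.I x₀).target)
    (hy' : f ((extChartAt X.I x₀).symm y) ∈ (extChartAt Y.I y₀).source) :
    ∀ᶠ z in nhds y, z ∈ (extChartAt X.I x₀).target ∧
      f ((extChartAt X.I x₀).symm z) ∈ (extChartAt Y.I y₀).source := by
  have h1 : ContinuousAt (fun z => f ((extChartAt X.I x₀).symm z)) y :=
    hf.smooth.continuous.continuousAt.comp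
      ((continuousOn_extChartAt_symm x₀).continuousAt ((isOpen_extChartAt_target x₀).mem_nhds hy))
  exact Filter.Eventually.and ((isOpen_extChartAt_target x₀).mem_nhds hy)
    (h1.eventually ((isOpen_extChartAt_source y₀).mem_nhds hy'))

theorem chartRep_pull (α : Form Y) {y : X.E} (hy : y ∈ (extChartAt X.I x₀).target)
    (hy' : f ((extChartAt X.I x₀).symm y) ∈ (extChartAt Y.I y₀).source) :
    chartRep (pull f α) x₀ y = Ext.map (fderiv ℝ (chartMap f x₀ y₀) y : X.E →ₗ[ℝ] Y.E)
      (chartRep α y₀ (chartMap f x₀ y₀ y)) := by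
  rw [chartRep, pull_apply, form_eq_chartRep α hy', Ext.map_map, Ext.map_map,
    fderiv_chartMap f hy hy']; rfl

theorem chartRep_pull_eventuallyEq (α : Form Y) {y : X.E} (hy : y ∈ (extChartAt X.I x₀).target)
    (hy' : f ((extChartAt X.I x₀).symm y) ∈ (extChartAt Y.I y₀).source) :
    chartRep (pull f α) x₀ =ᶠ[nhds y] fun z =>
      Ext.map (fderiv ℝ (chartMap f x₀ y₀) z : X.E →ₗ[ℝ] Y.E)
        (chartRep α y₀ (chartMap f x₀ y₀ z)) := by
  filter_upwards [eventually_chart_mem f hy hy'] with z hz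
  exact chartRep_pull f α hz.1 hz.2

theorem IsSmooth.contDiffAt {α : Form X} (h : IsSmooth α) {y : X.E}
    (hy : y ∈ (extChartAt X.I x₀).target) : ContDiffAt ℝ ∞ (chartRep α x₀) y :=
  (h x₀).contDiffAt ((isOpen_extChartAt_target x₀).mem_nhds hy)

theorem IsSmooth.differentiableAt' {α : Form X} (h : IsSmooth α) {y : X.E}
    (hy : y ∈ (extChartAt X.I x₀).target) : DifferentiableAt ℝ (chartRep α x₀) y :=
  (h.contDiffAt hy).differentiableAt (by simp)

theorem IsSmooth.of_contDiffAt {α : Form X}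
    (h : ∀ x₀ : X.carrier, ∀ y ∈ (extChartAt X.I x₀).target, ContDiffAt ℝ ∞ (chartRep α x₀) y) :
    IsSmooth α := fun x₀ y hy => (h x₀ y hy).contDiffWithinAt

theorem chartMap_mem (f : X.carrier → Y.carrier) {x₀ : X.carrier} {y₀ : Y.carrier} {y : X.E}
    (hy' : f ((extChartAt X.I x₀).symm y) ∈ (extChartAt Y.I y₀).source) :
    chartMap f x₀ y₀ y ∈ (extChartAt Y.I y₀).target := (extChartAt Y.I y₀).map_source hy'

theorem contDiffAt_ext_map {V W A : Type*} [NormedAddCommGroup V] [NormedSpace ℝ V]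
    [FiniteDimensional ℝ V] [NormedAddCommGroup W] [NormedSpace ℝ W] [FiniteDimensional ℝ W]
    [NormedAddCommGroup A] [NormedSpace ℝ A] {n : ℕ∞ω} {L : A → V →L[ℝ] W} {f : A → Ext W} {a : A}
    (hL : ContDiffAt ℝ n L a) (hf : ContDiffAt ℝ n f a) :
    ContDiffAt ℝ n (fun a => Ext.map (L a : V →ₗ[ℝ] W) (f a)) a :=
  (contDiff_ext_mapL.contDiffAt.comp a hL).clm_apply hf

theorem IsSmooth.pull {α : Form Y} (h : IsSmooth α) : IsSmooth (pull f α) := by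
  refine IsSmooth.of_contDiffAt fun x₀ y hy => ?_
  have hy' := mem_extChartAt_source (I := Y.I) (f ((extChartAt X.I x₀).symm y))
  refine ContDiffAt.congr_of_eventuallyEq ?_ (chartRep_pull_eventuallyEq f α hy hy')
  have h1 := contDiffAt_chartMap f hy hy'
  exact contDiffAt_ext_map (h1.fderiv_right (m := ∞) (by simp))
    ((h.contDiffAt (chartMap_mem f hy')).comp y h1)

theorem flatD_chartRep_pull {α : Form Y} (h : IsSmooth α) {y : X.E}
    (hy : y ∈ (extChartAt X.I x₀).target)
    (hy' : f ((extChartAt X.I x₀).symm y) ∈ (extChartAt Y.I y₀).source) :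
    flatD (chartRep (fpull f α) x₀) y =
      Ext.map (fderiv ℝ (chartMap f x₀ y₀) y : X.E →ₗ[ℝ] Y.E)
        (flatD (chartRep α y₀) (chartMap f x₀ y₀ y)) := by
  rw [flatD_congr (chartRep_pull_eventuallyEq f α hy hy')]
  exact flatD_pullback ((contDiffAt_chartMap f hy hy').of_le (by norm_cast))
    (h.differentiableAt' (chartMap_mem f hy'))

/-- The exterior derivative may be computed in any chart. -/
theorem extD_eq {α : Form X} (h : IsSmooth α) {x : X.carrier}
    (hx : x ∈ (extChartAt X.I x₀).source) :
    extD α x = Ext.map (chartDeriv x₀ x : X.E →ₗ[ℝ] X.E)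
      (flatD (chartRep α x₀) (extChartAt X.I x₀ x)) := by
  have hy := mem_extChartAt_target (I := X.I) x
  have hx1 : (extChartAt X.I x).symm (extChartAt X.I x x) = x := extChartAt_to_inv x
  have hy' : id ((extChartAt X.I x).symm (extChartAt X.I x x)) ∈ (extChartAt X.I x₀).source := by
    rwa [id, hx1]
  have h1 := flatD_chartRep_pull (X := X) (Y := X) id h hy hy'
  rw [pull_id] at h1
  have h2 := fderiv_chartMap (X := X) (Y := X) id hy hy'
  have hm : chartMap (X := X) (Y := X) id x x₀ (extChartAt X.I x x) = extChartAt X.I x₀ x := by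
    rw [chartMap, id, hx1]
  rw [hm] at h1
  have h3 : (fderiv ℝ (chartMap (X := X) (Y := X) id x x₀) (extChartAt X.I x x)).comp
      (chartDeriv x x) = chartDeriv x₀ x := by
    rw [h2, tmap_id, ContinuousLinearMap.id_comp, ContinuousLinearMap.comp_assoc,
      chartInvDeriv_comp_chartDeriv (mem_extChartAt_source x), ContinuousLinearMap.comp_id, id, hx1]
  rw [extD, h1, Ext.map_map, ← h3]; rfl

theorem chartRep_extD {α : Form X} (h : IsSmooth α) {y : X.E}
    (hy : y ∈ (extChartAt X.I x₀).target) : chartRep (extD α) x₀ y = flatD (chartRep α x₀) y := by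
  rw [chartRep, extD_eq h ((extChartAt X.I x₀).map_target hy), map_chartInvDeriv_map_chartDeriv hy,
    (extChartAt X.I x₀).right_inv hy]

theorem chartRep_extD_eventuallyEq {α : Form X} (h : IsSmooth α) {y : X.E}
    (hy : y ∈ (extChartAt X.I x₀).target) :
    chartRep (extD α) x₀ =ᶠ[nhds y] flatD (chartRep α x₀) := by
  filter_upwards [(isOpen_extChartAt_target x₀).mem_nhds hy] with z hz
  exact chartRep_extD h hz

theorem IsSmooth.extD {α : Form X} (h : IsSmooth α) : IsSmooth (extD α) := fun x₀ =>
  (contDiffOn_flatD (isOpen_extChartAt_target x₀) (h x₀)).congr fun _ hy => chartRep_extD h hy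

theorem extD_extD {α : Form X} (h : IsSmooth α) : extD (extD α) = 0 := by
  funext x
  have hy := mem_extChartAt_target (I := X.I) x
  rw [TwistedK.extD, flatD_congr (chartRep_extD_eventuallyEq h hy),
    flatD_flatD ((h.contDiffAt hy).of_le (by norm_cast)), map_zero]; rfl

theorem extD_pull {α : Form Y} (h : IsSmooth α) :
    TwistedK.extD (fpull f α) = fpull f (TwistedK.extD α) := by
  funext x
  have hy := mem_extChartAt_target (I := X.I) x
  have hx1 : (extChartAt X.I x).symm (extChartAt X.I x x) = x := extChartAt_to_inv x
  have hs := mem_extChartAt_source (I := Y.I) (f x)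
  have hy' : f ((extChartAt X.I x).symm (extChartAt X.I x x)) ∈ (extChartAt Y.I (f x)).source := by
    rwa [hx1]
  have h2 := fderiv_chartMap f hy hy'
  have h3 : (fderiv ℝ (chartMap f x (f x)) (extChartAt X.I x x)).comp
      (chartDeriv x x) = (chartDeriv (f x) (f x)).comp (tmap f x) := by
    rw [h2, ContinuousLinearMap.comp_assoc, ContinuousLinearMap.comp_assoc,
      chartInvDeriv_comp_chartDeriv (mem_extChartAt_source x), ContinuousLinearMap.comp_id, hx1]
  rw [TwistedK.extD, flatD_chartRep_pull f h hy hy', Ext.map_map, pull_apply,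
    extD_eq h hs, Ext.map_map]
  have h4 : (fderiv ℝ (chartMap f x (f x)) (extChartAt X.I x x) : X.E →ₗ[ℝ] Y.E).comp
      (chartDeriv x x : X.E →ₗ[ℝ] X.E) = (chartDeriv (f x) (f x) : Y.E →ₗ[ℝ] Y.E).comp
        (tmap f x : X.E →ₗ[ℝ] Y.E) :=
    congrArg (fun L : X.E →L[ℝ] Y.E => (L : X.E →ₗ[ℝ] Y.E)) h3
  have h5 : chartMap f x (f x) (extChartAt X.I x x) = extChartAt Y.I (f x) (f x) := by
    rw [chartMap, hx1]
  rw [h5, h4]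

theorem chartRep_mul (α α' : Form X) (x₀ : X.carrier) :
    chartRep (α * α') x₀ = fun y => chartRep α x₀ y * chartRep α' x₀ y := by
  funext y; simp [chartRep]

theorem chartRep_sinv (α : Form X) (x₀ : X.carrier) :
    chartRep (sinv α) x₀ = fun y => sinv (chartRep α x₀ y) :=
  funext fun _ => (Ext.sinv_map _ _).symm

theorem chartRep_smul (c : ℂ) (α : Form X) (x₀ : X.carrier) :
    chartRep (c • α) x₀ = fun y => c • chartRep α x₀ y :=
  funext fun _ => map_smul (Ext.map _) c _

theorem chartRep_one (x₀ : X.carrier) : chartRep (1 : Form X) x₀ = fun _ => 1 :=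
  funext fun _ => map_one _

theorem IsSmooth.mul {α α' : Form X} (h : IsSmooth α) (h' : IsSmooth α') : IsSmooth (α * α') :=
  fun x₀ => by rw [chartRep_mul]; exact contDiffOn_ext_mul (h x₀) (h' x₀)

theorem IsSmooth.sinv {α : Form X} (h : IsSmooth α) : IsSmooth (sinv α) := fun x₀ => by
  rw [chartRep_sinv]; exact sinvL.contDiff.comp_contDiffOn (h x₀)

theorem IsSmooth.smul (c : ℂ) {α : Form X} (h : IsSmooth α) : IsSmooth (c • α) := fun x₀ => by
  rw [chartRep_smul]; exact (h x₀).const_smul c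

theorem IsSmooth.one : IsSmooth (1 : Form X) := fun x₀ => by
  rw [chartRep_one]; exact contDiffOn_const

theorem IsSmooth.sub {α α' : Form X} (h : IsSmooth α) (h' : IsSmooth α') : IsSmooth (α - α') := by
  rw [sub_eq_add_neg]; exact h.add h'.neg

theorem IsSmooth.sum {κ : Type*} {s : Finset κ} {α : κ → Form X} (h : ∀ k ∈ s, IsSmooth (α k)) :
    IsSmooth (∑ k ∈ s, α k) := Finset.sum_induction _ _ (fun _ _ => IsSmooth.add) IsSmooth.zero h

theorem extD_mul {α α' : Form X} (h : IsSmooth α) (h' : IsSmooth α') :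
    TwistedK.extD (α * α') = TwistedK.extD α * α' + TwistedK.sinv α * TwistedK.extD α' := by
  funext x
  have hx := mem_extChartAt_source (I := X.I) x
  have hl := fun β : Form X => form_eq_chartRep β hx
  simp only [Pi.add_apply, Pi.mul_apply]
  rw [hl α', hl (TwistedK.sinv α), TwistedK.extD, TwistedK.extD, TwistedK.extD, chartRep_mul,
    flatD_mul (h.differentiableAt x) (h'.differentiableAt x), chartRep_sinv]
  simp only [map_add, map_mul]

theorem extD_sinv {α : Form X} (h : IsSmooth α) :
    TwistedK.extD (TwistedK.sinv α) = -TwistedK.sinv (TwistedK.extD α) := by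
  funext x
  rw [TwistedK.extD, chartRep_sinv, flatD_sinv (h.differentiableAt x), map_neg, ← Ext.sinv_map]; rfl

theorem extD_smul (c : ℂ) {α : Form X} (h : IsSmooth α) :
    TwistedK.extD (c • α) = c • TwistedK.extD α := by
  funext x
  rw [TwistedK.extD, chartRep_smul, flatD_smul c (h.differentiableAt x), map_smul]; rfl

theorem extD_sub {α α' : Form X} (h : IsSmooth α) (h' : IsSmooth α') :
    TwistedK.extD (α - α') = TwistedK.extD α - TwistedK.extD α' := by
  rw [sub_eq_add_neg, extD_add h h'.neg, extD_neg, sub_eq_add_neg]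

theorem extD_sum {κ : Type*} {s : Finset κ} {α : κ → Form X} (h : ∀ k ∈ s, IsSmooth (α k)) :
    TwistedK.extD (∑ k ∈ s, α k) = ∑ k ∈ s, TwistedK.extD (α k) := by
  classical
  induction s using Finset.induction_on with
  | empty => simp [extD_zero]
  | insert a s ha ih =>
    rw [Finset.sum_insert ha, Finset.sum_insert ha, extD_add (h a (Finset.mem_insert_self a s))
      (IsSmooth.sum fun k hk => h k (Finset.mem_insert_of_mem hk)),
      ih fun k hk => h k (Finset.mem_insert_of_mem hk)]

end Charts

end

section

/-! ### Signs and graded commutativity -/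

/-- The sign of a parity. -/
def sg (b : Bool) : ℤ := if b then -1 else 1

@[simp] theorem sg_true : sg true = -1 := rfl
@[simp] theorem sg_false : sg false = 1 := rfl

theorem sg_xor (a b : Bool) : sg (a ^^ b) = sg a * sg b := by cases a <;> cases b <;> rfl

theorem sg_mul_self (a : Bool) : sg a * sg a = 1 := by cases a <;> rfl

section Commute

variable {V : Type*} [AddCommGroup V] [Module ℝ V]

theorem Ext.mul_comm_of_even {x : Ext V} (hx : sinv x = x) (y : Ext V) : x * y = y * x := by
  induction y using ext_left_induction with
  | h0 c => exact (Algebra.commutes _ _).symm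
  | h1 y z hy hz => rw [mul_add, add_mul, hy, hz]
  | h2 φ y hy => rw [← mul_assoc, mul_assoc _ y x, ← hy, ← mul_assoc, ι_mul_eq_sinv_mul φ x, hx]

theorem Ext.mul_comm_of_odd {x : Ext V} (hx : sinv x = -x) (y : Ext V) : x * y = sinv y * x := by
  induction y using ext_left_induction with
  | h0 c => rw [sinv_algebraMap]; exact (Algebra.commutes _ _).symm
  | h1 y z hy hz => rw [map_add, mul_add, add_mul, hy, hz]
  | h2 φ y hy =>
    rw [map_mul, mul_assoc _ (sinv y) x, ← hy, ← mul_assoc, ← mul_assoc, sinv_ι, neg_mul,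
      ι_mul_eq_sinv_mul φ x, hx]
    simp

end Commute

variable {G : Type v} [Group G] {X Y Z : GMfd.{u} G}

theorem form_mul_comm {a b : Bool} {α α' : Form X} (h : sinv α = sg a • α)
    (h' : sinv α' = sg b • α') : α * α' = sg (a && b) • (α' * α) := by
  funext x
  have hx : sinv (α x) = sg a • α x := congrFun h x
  have hx' : sinv (α' x) = sg b • α' x := congrFun h' x
  show α x * α' x = sg (a && b) • (α' x * α x)
  cases a
  · rw [Ext.mul_comm_of_even (by simpa using hx)]; simp
  · rw [Ext.mul_comm_of_odd (by simpa using hx), hx', Bool.true_and, smul_mul_assoc]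

theorem hasParity_iff {p : Bool} {α : Form X} : HasParity p α ↔ sinv α = sg p • α := by
  cases p <;> simp [HasParity]

/-! ### Matrices of differential forms -/

/-- The matrix of the exterior derivatives of the entries. -/
notation:max "𝐝" M:max => Matrix.map M extD
/-- The matrix of the images of the entries under the grading involution. -/
notation:max "𝐬" M:max => Matrix.map M (DFunLike.coe sinv)
/-- The pullback of a matrix of forms along the action of a group element. -/
notation:max M:max "⋆" g:max => Matrix.map M (DFunLike.coe (fpull (GMfd.act _ g)))

variable {m n o : Type}

/-- Matrices of smooth forms. -/
class MSmooth (M : Matrix m n (Form X)) : Prop where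
  smooth : ∀ i j, IsSmooth (M i j)

section MatrixCalculus

instance MSmooth.mul [Fintype n] (M : Matrix m n (Form X)) (N : Matrix n o (Form X))
    [hM : MSmooth M] [hN : MSmooth N] : MSmooth (M * N) :=
  ⟨fun i j => by
    rw [mmul_apply]; exact IsSmooth.sum fun k _ => (hM.smooth i k).mul (hN.smooth k j)⟩

instance MSmooth.add (M N : Matrix m n (Form X)) [hM : MSmooth M] [hN : MSmooth N] :
    MSmooth (M + N) := ⟨fun i j => (hM.smooth i j).add (hN.smooth i j)⟩

instance MSmooth.sub (M N : Matrix m n (Form X)) [hM : MSmooth M] [hN : MSmooth N] :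
    MSmooth (M - N) := ⟨fun i j => (hM.smooth i j).sub (hN.smooth i j)⟩

instance MSmooth.neg (M : Matrix m n (Form X)) [hM : MSmooth M] : MSmooth (-M) :=
  ⟨fun i j => (hM.smooth i j).neg⟩

instance MSmooth.smul (c : ℂ) (M : Matrix m n (Form X)) [hM : MSmooth M] : MSmooth (c • M) :=
  ⟨fun i j => (hM.smooth i j).smul c⟩

instance MSmooth.zero : MSmooth (0 : Matrix m n (Form X)) := ⟨fun _ _ => IsSmooth.zero⟩

instance MSmooth.one [DecidableEq m] : MSmooth (1 : Matrix m m (Form X)) :=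
  ⟨fun i j => by
    rw [mone_apply]; split_ifs
    · exact IsSmooth.one
    · exact IsSmooth.zero⟩

instance MSmooth.d (M : Matrix m n (Form X)) [hM : MSmooth M] : MSmooth 𝐝M :=
  ⟨fun i j => (hM.smooth i j).extD⟩

instance MSmooth.s (M : Matrix m n (Form X)) [hM : MSmooth M] : MSmooth 𝐬M :=
  ⟨fun i j => (hM.smooth i j).sinv⟩

instance MSmooth.pull (f : X.carrier → Y.carrier) [SmoothMap X Y f] (M : Matrix m n (Form Y))
    [hM : MSmooth M] : MSmooth (M.map (pull f)) :=
  ⟨fun i j => (hM.smooth i j).pull f⟩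

instance MSmooth.pow [Fintype m] [DecidableEq m] (M : Matrix m m (Form X)) [hM : MSmooth M]
    (k : ℕ) : MSmooth (M ^ k) := by
  induction k with
  | zero => rw [pow_zero]; infer_instance
  | succ k ih => rw [pow_succ]; infer_instance

theorem MSmooth.sum {κ : Type*} {s : Finset κ} {M : κ → Matrix m n (Form X)}
    (h : ∀ k ∈ s, MSmooth (M k)) : MSmooth (∑ k ∈ s, M k) :=
  Finset.sum_induction _ MSmooth (fun _ _ _ _ => inferInstance) inferInstance h

theorem d_mul [Fintype n] (M : Matrix m n (Form X)) (N : Matrix n o (Form X))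
    [hM : MSmooth M] [hN : MSmooth N] : 𝐝(M * N) = 𝐝M * N + 𝐬M * 𝐝N := by
  ext1 i j
  simp only [mmap_apply, mmul_apply, madd_apply, ← Finset.sum_add_distrib]
  rw [extD_sum fun k _ => (hM.smooth i k).mul (hN.smooth k j)]
  exact Finset.sum_congr rfl fun k _ => extD_mul (hM.smooth i k) (hN.smooth k j)

theorem d_add (M N : Matrix m n (Form X)) [hM : MSmooth M] [hN : MSmooth N] :
    𝐝(M + N) = 𝐝M + 𝐝N := by
  ext1 i j; exact extD_add (hM.smooth i j) (hN.smooth i j)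

theorem d_sub (M N : Matrix m n (Form X)) [hM : MSmooth M] [hN : MSmooth N] :
    𝐝(M - N) = 𝐝M - 𝐝N := by
  ext1 i j; exact extD_sub (hM.smooth i j) (hN.smooth i j)

theorem d_neg (M : Matrix m n (Form X)) : 𝐝(-M) = -𝐝M := by
  ext1 i j; exact extD_neg _

theorem d_smul (c : ℂ) (M : Matrix m n (Form X)) [hM : MSmooth M] : 𝐝(c • M) = c • 𝐝M := by
  ext1 i j; exact extD_smul c (hM.smooth i j)

theorem d_d (M : Matrix m n (Form X)) [hM : MSmooth M] : 𝐝(𝐝M) = 0 := by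
  ext1 i j; exact extD_extD (hM.smooth i j)

theorem d_s (M : Matrix m n (Form X)) [hM : MSmooth M] : 𝐝(𝐬M) = -𝐬(𝐝M) := by
  ext1 i j; exact extD_sinv (hM.smooth i j)

theorem d_pull (f : X.carrier → Y.carrier) [SmoothMap X Y f] (M : Matrix m n (Form Y))
    [hM : MSmooth M] : 𝐝(M.map (pull f)) = (𝐝M).map (pull f) := by
  ext1 i j; exact extD_pull f (hM.smooth i j)

theorem s_s (M : Matrix m n (Form X)) : 𝐬(𝐬M) = M := by
  ext1 i j; exact sinv_sinv _

theorem s_pull (f : X.carrier → Y.carrier) (M : Matrix m n (Form Y)) :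
    𝐬(M.map (pull f)) = (𝐬M).map (pull f) := by
  ext1 i j; exact (pull_sinv f _).symm

theorem s_mul [Fintype n] (M : Matrix m n (Form X)) (N : Matrix n o (Form X)) :
    𝐬(M * N) = 𝐬M * 𝐬N := mmap_mul

theorem s_add (M N : Matrix m n (Form X)) : 𝐬(M + N) = 𝐬M + 𝐬N := by
  ext1 i j; exact map_add sinv _ _

theorem s_sub (M N : Matrix m n (Form X)) : 𝐬(M - N) = 𝐬M - 𝐬N := by
  ext1 i j; exact map_sub sinv _ _

theorem s_neg (M : Matrix m n (Form X)) : 𝐬(-M) = -𝐬M := by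
  ext1 i j; exact map_neg sinv _

theorem form_sinv_smul (c : ℂ) (α : Form X) : sinv (c • α) = c • sinv α :=
  funext fun _ => sinv_smul _ _

theorem mpull_mul [Fintype n] (f : X.carrier → Y.carrier) (M : Matrix m n (Form Y))
    (N : Matrix n o (Form Y)) : (M * N).map (pull f) = M.map (pull f) * N.map (pull f) :=
  mmap_mul

theorem mpull_add (f : X.carrier → Y.carrier) (M N : Matrix m n (Form Y)) :
    (M + N).map (pull f) = M.map (pull f) + N.map (pull f) := by
  ext1 i j; exact map_add (pull f) _ _

theorem mpull_sub (f : X.carrier → Y.carrier) (M N : Matrix m n (Form Y)) :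
    (M - N).map (pull f) = M.map (pull f) - N.map (pull f) := by
  ext1 i j; exact map_sub (pull f) _ _

theorem mpull_neg (f : X.carrier → Y.carrier) (M : Matrix m n (Form Y)) :
    (-M).map (pull f) = -M.map (pull f) := by
  ext1 i j; exact map_neg (pull f) _

theorem mpull_smul (f : X.carrier → Y.carrier) (c : ℂ) (M : Matrix m n (Form Y)) :
    (c • M).map (pull f) = c • M.map (pull f) := by
  ext1 i j; exact pull_smul f c _

theorem mpull_comp (f : X.carrier → Y.carrier) (g : Y.carrier → Z.carrier)
    [SmoothMap X Y f] [SmoothMap Y Z g] (M : Matrix m n (Form Z)) :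
    M.map (pull (X := X) (Y := Z) (g ∘ f)) =
      (M.map (pull (X := Y) (Y := Z) g)).map (pull (X := X) (Y := Y) f) := by
  ext1 i j; exact pull_comp f g _

theorem act_comp_act (g h : G) : X.act g ∘ X.act h = X.act (g * h) :=
  funext fun x => (X.act_mul g h x).symm

theorem act_one_eq : X.act (1 : G) = id := funext X.act_one

theorem pull_act_act (g h : G) (α : Form X) :
    pull (X.act h) (pull (X.act g) α) = pull (X.act (g * h)) α := by
  rw [← act_comp_act, pull_comp (X := X) (Y := X) (Z := X)]

theorem pull_act_one (α : Form X) : pull (X.act (1 : G)) α = α := by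
  rw [act_one_eq, pull_id]

theorem mpull_act_act (g h : G) (M : Matrix m n (Form X)) :
    (M⋆g)⋆h = M⋆(g * h) := by
  ext1 i j; exact pull_act_act g h _

theorem mpull_act_one (M : Matrix m n (Form X)) : M⋆(1 : G) = M := by
  ext1 i j; exact pull_act_one _

end MatrixCalculus

/-! ### Homogeneous matrices -/

/-- Matrices of homogeneous maps of parity `b` between free supermodules. -/
def IsPar (b : Bool) (p : m → Bool) (q : n → Bool) (M : Matrix m n (Form X)) : Prop :=
  ∀ i j, sinv (M i j) = sg (b ^^ (p i ^^ q j)) • M i j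

section Par

variable {p : m → Bool} {q : n → Bool} {r : o → Bool} {a b : Bool}

theorem map_sg_smul {A B : Type*} [Ring A] [Ring B] (f : A →+* B) (k : Bool) (x : A) :
    f (sg k • x) = sg k • f x := by cases k <;> simp

theorem isEvenMatrix_iff {M : Matrix m n (Form X)} : IsEvenMatrix p q M ↔ IsPar false p q M := by
  refine forall_congr' fun i => forall_congr' fun j => ?_
  cases p i <;> cases q j <;> simp

theorem IsPar.mul [Fintype n] {M : Matrix m n (Form X)} {N : Matrix n o (Form X)}
    (hM : IsPar a p q M) (hN : IsPar b q r N) : IsPar (a ^^ b) p r (M * N) := fun i j => by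
  rw [mmul_apply, map_sum, Finset.smul_sum]
  refine Finset.sum_congr rfl fun k _ => ?_
  rw [map_mul, hM, hN, smul_mul_assoc, mul_smul_comm, smul_smul, ← sg_xor]
  congr 2
  cases a <;> cases b <;> cases p i <;> cases q k <;> cases r j <;> rfl

theorem IsPar.mul_ee [Fintype n] {M : Matrix m n (Form X)} {N : Matrix n o (Form X)}
    (hM : IsPar false p q M) (hN : IsPar false q r N) : IsPar false p r (M * N) := by
  have h := IsPar.mul hM hN
  rwa [Bool.xor_self] at h

theorem IsPar.mul_eo [Fintype n] {M : Matrix m n (Form X)} {N : Matrix n o (Form X)}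
    (hM : IsPar false p q M) (hN : IsPar true q r N) : IsPar true p r (M * N) := by
  have h := IsPar.mul hM hN
  rwa [Bool.false_xor] at h

theorem IsPar.mul_oe [Fintype n] {M : Matrix m n (Form X)} {N : Matrix n o (Form X)}
    (hM : IsPar true p q M) (hN : IsPar false q r N) : IsPar true p r (M * N) := by
  have h := IsPar.mul hM hN
  rwa [Bool.xor_false] at h

theorem IsPar.mul_oo [Fintype n] {M : Matrix m n (Form X)} {N : Matrix n o (Form X)}
    (hM : IsPar true p q M) (hN : IsPar true q r N) : IsPar false p r (M * N) := by
  have h := IsPar.mul hM hN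
  rwa [Bool.xor_self] at h

theorem IsPar.add {M N : Matrix m n (Form X)} (hM : IsPar a p q M) (hN : IsPar a p q N) :
    IsPar a p q (M + N) := fun i j => by
  rw [madd_apply, map_add, hM, hN, smul_add]

theorem IsPar.sub {M N : Matrix m n (Form X)} (hM : IsPar a p q M) (hN : IsPar a p q N) :
    IsPar a p q (M - N) := fun i j => by
  rw [Matrix.sub_apply, map_sub, hM, hN, smul_sub]

theorem IsPar.neg {M : Matrix m n (Form X)} (hM : IsPar a p q M) : IsPar a p q (-M) := fun i j => by
  rw [mneg_apply, map_neg, hM, smul_neg]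

theorem IsPar.smul (c : ℂ) {M : Matrix m n (Form X)} (hM : IsPar a p q M) :
    IsPar a p q (c • M) := fun i j => by
  rw [Matrix.smul_apply, form_sinv_smul, hM, smul_comm]

theorem IsPar.zero : IsPar a p q (0 : Matrix m n (Form X)) := fun i j => by simp

theorem IsPar.sum {κ : Type*} {s : Finset κ} {M : κ → Matrix m n (Form X)}
    (h : ∀ k ∈ s, IsPar a p q (M k)) : IsPar a p q (∑ k ∈ s, M k) :=
  Finset.sum_induction _ (IsPar a p q) (fun _ _ => IsPar.add) IsPar.zero h

theorem IsPar.one [DecidableEq m] : IsPar false p p (1 : Matrix m m (Form X)) := fun i j => by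
  rw [mone_apply]
  split_ifs with h
  · subst h; cases p i <;> simp
  · simp

theorem IsPar.pow [Fintype m] [DecidableEq m] {M : Matrix m m (Form X)} (hM : IsPar false p p M)
    (k : ℕ) : IsPar false p p (M ^ k) := by
  induction k with
  | zero => rw [pow_zero]; exact IsPar.one
  | succ k ih => rw [pow_succ]; exact ih.mul_ee hM

theorem IsPar.s {M : Matrix m n (Form X)} (hM : IsPar a p q M) : IsPar a p q 𝐬M := fun i j => by
  have h : sinv (sg (a ^^ (p i ^^ q j)) • M i j) = sg (a ^^ (p i ^^ q j)) • sinv (M i j) :=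
    map_sg_smul sinv _ _
  rw [mmap_apply, hM i j, h, hM i j]

theorem IsPar.pull (f : X.carrier → Y.carrier) {M : Matrix m n (Form Y)} (hM : IsPar a p q M) :
    IsPar a p q (M.map (pull f)) := fun i j => by
  rw [mmap_apply, ← pull_sinv, hM, map_sg_smul]

theorem extD_zsmul (k : Bool) (α : Form X) : extD (sg k • α) = sg k • extD α := by
  cases k
  · simp
  · simp [extD_neg]

theorem IsPar.d {M : Matrix m n (Form X)} [h : MSmooth M] (hM : IsPar a p q M) :
    IsPar (!a) p q 𝐝M := fun i j => by
  have := extD_sinv (h.smooth i j)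
  rw [hM, extD_zsmul] at this
  rw [mmap_apply, ← neg_neg (sinv _), ← this, ← neg_smul]
  congr 1
  cases a <;> cases p i <;> cases q j <;> rfl

theorem strace_eq_sum [Fintype m] (M : Matrix m m (Form X)) :
    strace p M = ∑ i, sg (p i) • M i i :=
  Finset.sum_congr rfl fun i _ => by cases p i <;> simp

theorem strace_mul_comm [Fintype m] [Fintype n] {M : Matrix m n (Form X)} {N : Matrix n m (Form X)}
    (hM : IsPar false p q M) (hN : IsPar false q p N) : strace p (M * N) = strace q (N * M) := by
  simp only [strace_eq_sum, mmul_apply, Finset.smul_sum]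
  rw [Finset.sum_comm]
  refine Finset.sum_congr rfl fun j _ => Finset.sum_congr rfl fun i _ => ?_
  rw [form_mul_comm (hM i j) (hN j i), smul_smul]
  congr 1
  cases p i <;> cases q j <;> rfl

theorem strace_s_mul_comm [Fintype m] [Fintype n] {M : Matrix m n (Form X)}
    {N : Matrix n m (Form X)} (hM : IsPar false p q M) (hN : IsPar true q p N) :
    strace p (𝐬M * N) = strace q (N * M) := by
  simp only [strace_eq_sum, mmul_apply, Finset.smul_sum]
  rw [Finset.sum_comm]
  refine Finset.sum_congr rfl fun j _ => Finset.sum_congr rfl fun i _ => ?_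
  rw [mmap_apply, hM, smul_mul_assoc, form_mul_comm (hM i j) (hN j i), smul_smul, smul_smul]
  congr 1
  cases p i <;> cases q j <;> rfl

theorem strace_add [Fintype m] (M N : Matrix m m (Form X)) :
    strace p (M + N) = strace p M + strace p N := by
  simp only [strace, ← Finset.sum_add_distrib]
  refine Finset.sum_congr rfl fun i _ => ?_
  split_ifs <;> simp [add_comm]

theorem strace_neg [Fintype m] (M : Matrix m m (Form X)) : strace p (-M) = -strace p M := by
  simp only [strace, ← Finset.sum_neg_distrib]
  refine Finset.sum_congr rfl fun i _ => ?_
  split_ifs <;> simp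

theorem strace_sub [Fintype m] (M N : Matrix m m (Form X)) :
    strace p (M - N) = strace p M - strace p N := by
  rw [sub_eq_add_neg, strace_add, strace_neg, sub_eq_add_neg]

theorem strace_smul [Fintype m] (c : ℂ) (M : Matrix m m (Form X)) :
    strace p (c • M) = c • strace p M := by
  simp only [strace, Finset.smul_sum]
  refine Finset.sum_congr rfl fun i _ => ?_
  split_ifs <;> simp

theorem strace_map {A B : Type*} [Ring A] [Ring B] [Fintype m] (f : A →+* B) (M : Matrix m m A) :
    strace p (M.map f) = f (strace p M) := by
  simp only [strace, map_sum]
  refine Finset.sum_congr rfl fun i _ => ?_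
  split_ifs <;> simp

theorem strace_d [Fintype m] (M : Matrix m m (Form X)) [hM : MSmooth M] :
    strace p 𝐝M = extD (strace p M) := by
  rw [strace, strace, extD_sum]
  · refine Finset.sum_congr rfl fun i _ => ?_
    split_ifs <;> simp [extD_neg]
  · intro i _
    split_ifs
    · exact (hM.smooth i i).neg
    · exact hM.smooth i i

theorem isSmooth_strace [Fintype m] (M : Matrix m m (Form X)) [hM : MSmooth M] :
    IsSmooth (strace p M) := IsSmooth.sum fun i _ => by
  split_ifs
  · exact (hM.smooth i i).neg
  · exact hM.smooth i i

theorem hasParity_strace [Fintype m] {M : Matrix m m (Form X)} (hM : IsPar a p p M) :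
    HasParity a (strace p M) := by
  rw [hasParity_iff, strace, map_sum, Finset.smul_sum]
  refine Finset.sum_congr rfl fun i _ => ?_
  have h := hM i i
  rw [Bool.xor_self, Bool.xor_false] at h
  split_ifs
  · rw [map_neg, h, smul_neg]
  · rw [h]

end Par

/-! ### Representations in components -/

section Components

variable {β : G → G → Circle}

/-- The coefficient of `1` in the value of a representation. -/
def PreRep.a (D : PreRep X) (g : G) (t : ℝ≥0) : Matrix D.ι D.ι (Form X) :=
  Matrix.of fun i j => (D.R g i j).body t

/-- The coefficient of `θ` in the value of a representation. -/
def PreRep.b (D : PreRep X) (g : G) (t : ℝ≥0) : Matrix D.ι D.ι (Form X) :=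
  Matrix.of fun i j => (D.R g i j).soul t

/-- The derivative of `PreRep.a` in the time parameter. -/
def PreRep.a' (D : PreRep X) (g : G) (t : ℝ≥0) : Matrix D.ι D.ι (Form X) :=
  Matrix.of fun i j => tDeriv (D.R g i j).body t

namespace OddExt

variable {A : Type*} [Ring A] [SuperRing A]

theorem body_sum {κ : Type*} (s : Finset κ) (r : κ → OddExt A) :
    (∑ k ∈ s, r k).body = ∑ k ∈ s, (r k).body :=
  map_sum (⟨⟨fun r => r.body, rfl⟩, fun _ _ => rfl⟩ : OddExt A →+ A) r s

theorem soul_sum {κ : Type*} (s : Finset κ) (r : κ → OddExt A) :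
    (∑ k ∈ s, r k).soul = ∑ k ∈ s, (r k).soul :=
  map_sum (⟨⟨fun r => r.soul, rfl⟩, fun _ _ => rfl⟩ : OddExt A →+ A) r s

theorem body_mul [Fintype n] (M : Matrix m n (OddExt A)) (N : Matrix n o (OddExt A)) :
    (M * N).map body = M.map body * N.map body := by
  ext1 i j
  rw [mmap_apply, mmul_apply, body_sum]; rfl

theorem soul_mul [Fintype n] (M : Matrix m n (OddExt A)) (N : Matrix n o (OddExt A)) :
    (M * N).map soul = M.map soul * N.map body + 𝐬(M.map body) * N.map soul := by
  ext1 i j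
  rw [mmap_apply, mmul_apply, soul_sum, madd_apply, mmul_apply,
    mmul_apply, ← Finset.sum_add_distrib]; rfl

@[simp] theorem sinv_body (r : OddExt A) : (sinv r).body = sinv r.body := rfl
@[simp] theorem sinv_soul (r : OddExt A) : (sinv r).soul = -sinv r.soul := rfl

end OddExt

/-- Evaluation of the entries of a matrix of families. -/
abbrev evalAt {T : Type*} {A : Type*} [Ring A] (t : T) : (T → A) →+* A :=
  Pi.evalRingHom (fun _ => A) t

variable (D : PreRep X)

theorem R_hom_iff (g : G) : D.R g = D.e.map (tgt g) * D.R g * D.e.map src ↔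
    ∀ t, D.a g t = D.e⋆g * D.a g t * D.e ∧
      D.b g t = 𝐝(D.e⋆g) * D.a g t * D.e +
        𝐬(D.e⋆g) * D.b g t * D.e := by
  have hb : ∀ t, ((D.e.map (tgt g) * D.R g * D.e.map src).map OddExt.body).map (evalAt t) =
      D.e⋆g * D.a g t * D.e := fun t => by
    rw [OddExt.body_mul, OddExt.body_mul, mmap_mul, mmap_mul]; rfl
  have hs : ∀ t, ((D.e.map (tgt g) * D.R g * D.e.map src).map OddExt.soul).map (evalAt t) =
      𝐝(D.e⋆g) * D.a g t * D.e +
        𝐬(D.e⋆g) * D.b g t * D.e := fun t => by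
    have h0 : (D.e.map src).map OddExt.soul = 0 := rfl
    rw [OddExt.soul_mul, h0, mul_zero, add_zero, OddExt.soul_mul, mmap_mul,
      mmap_add _ (map_add (evalAt t)), mmap_mul, mmap_mul, ← add_mul]; rfl
  constructor
  · intro h t
    constructor
    · rw [← hb, ← h]; rfl
    · rw [← hs, ← h]; rfl
  · intro h
    ext1 i j
    apply OddExt.ext
    · funext t; exact (congrFun (congrFun ((hb t).trans (h t).1.symm) i) j).symm
    · funext t; exact (congrFun (congrFun ((hs t).trans (h t).2.symm) i) j).symm

theorem R_comp_iff (c : ℂ) (g h : G) :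
    (D.R g).map (pullLast h) * (D.R h).map pullFirst = c • (D.R (g * h)).map pullComp ↔
    ∀ t s, (D.a g t)⋆h * D.a h s = c • D.a (g * h) (t + s) ∧
      𝐝((D.a g t)⋆h) * D.a h s +
        𝐬((D.a g t)⋆h) * D.b h s = c • D.b (g * h) (t + s) ∧
      (D.b g t)⋆h * D.a h s = c • D.b (g * h) (t + s) ∧
      𝐝((D.b g t)⋆h) * D.a h s +
        𝐬((D.b g t)⋆h) * D.b h s = c • D.a' (g * h) (t + s) := by
  set L := (D.R g).map (pullLast h) * (D.R h).map pullFirst with hL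
  have h0 : ((D.R h).map pullFirst).map OddExt.soul = 0 := rfl
  have h1 : ∀ t s, (((L.map OddExt.body).map OddExt.body).map (evalAt t)).map (evalAt s) =
      (D.a g t)⋆h * D.a h s := fun t s => by
    rw [hL, OddExt.body_mul, OddExt.body_mul, mmap_mul, mmap_mul]; rfl
  have h2 : ∀ t s, (((L.map OddExt.body).map OddExt.soul).map (evalAt t)).map (evalAt s) =
      𝐝((D.a g t)⋆h) * D.a h s +
        𝐬((D.a g t)⋆h) * D.b h s := fun t s => by
    rw [hL, OddExt.body_mul, OddExt.soul_mul, mmap_add _ (map_add (evalAt t)),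
      mmap_add _ (map_add (evalAt s)), mmap_mul, mmap_mul, mmap_mul,
      mmap_mul]; rfl
  have h3 : ∀ t s, (((L.map OddExt.soul).map OddExt.body).map (evalAt t)).map (evalAt s) =
      (D.b g t)⋆h * D.a h s := fun t s => by
    rw [hL, OddExt.soul_mul, h0, mul_zero, add_zero, OddExt.body_mul, mmap_mul,
      mmap_mul]; rfl
  have h4 : ∀ t s, (((L.map OddExt.soul).map OddExt.soul).map (evalAt t)).map (evalAt s) =
      𝐝((D.b g t)⋆h) * D.a h s +
        𝐬((D.b g t)⋆h) * D.b h s := fun t s => by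
    rw [hL, OddExt.soul_mul, h0, mul_zero, add_zero, OddExt.soul_mul,
      mmap_add _ (map_add (evalAt t)),
      mmap_add _ (map_add (evalAt s)), mmap_mul, mmap_mul, mmap_mul,
      mmap_mul]; rfl
  constructor
  · intro h t s
    refine ⟨?_, ?_, ?_, ?_⟩
    · rw [← h1, h]; rfl
    · rw [← h2, h]; rfl
    · rw [← h3, h]; rfl
    · rw [← h4, h]; rfl
  · intro h
    ext1 i j
    apply OddExt.ext <;> apply OddExt.ext <;> funext t s
    · exact congrFun (congrFun ((h1 t s).trans (h t s).1) i) j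
    · exact congrFun (congrFun ((h2 t s).trans (h t s).2.1) i) j
    · exact congrFun (congrFun ((h3 t s).trans (h t s).2.2.1) i) j
    · exact congrFun (congrFun ((h4 t s).trans (h t s).2.2.2) i) j

theorem R_even_iff (g : G) : IsEvenMatrix D.par D.par (D.R g) ↔
    ∀ t, IsPar false D.par D.par (D.a g t) ∧ IsPar true D.par D.par (D.b g t) := by
  have key : ∀ i j, (sinv (D.R g i j) = if D.par i = D.par j then D.R g i j else -D.R g i j) ↔
      ∀ t, sinv (D.a g t i j) = sg (D.par i ^^ D.par j) • D.a g t i j ∧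
        sinv (D.b g t i j) = sg (true ^^ (D.par i ^^ D.par j)) • D.b g t i j := by
    intro i j
    have hr : ∀ r : OddExt (Fam X), sinv (D.R g i j) = r ↔
        ∀ t, sinv (D.a g t i j) = r.body t ∧ -sinv (D.b g t i j) = r.soul t := by
      intro r
      rw [OddExt.ext_iff, funext_iff, funext_iff, forall_and]; rfl
    rw [hr]
    refine forall_congr' fun t => ?_
    have h1 : (D.R g i j).body t = D.a g t i j := rfl
    have h2 : (D.R g i j).soul t = D.b g t i j := rfl
    cases D.par i <;> cases D.par j <;> simp [h1, h2, neg_eq_iff_eq_neg]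
  constructor
  · intro h t
    exact ⟨fun i j => by rw [Bool.false_xor]; exact ((key i j).1 (h i j) t).1,
      fun i j => ((key i j).1 (h i j) t).2⟩
  · intro h i j
    refine (key i j).2 fun t => ⟨?_, (h t).2 i j⟩
    have := (h t).1 i j
    rwa [Bool.false_xor] at this

end Components

end

section

/-! ### Linear differential equations -/

theorem linear_ode_unique {W : Type*} [NormedAddCommGroup W] [NormedSpace ℝ W] (T : W →L[ℝ] W)
    {f g : ℝ → W} (hf : ∀ t ≥ 0, HasDerivWithinAt f (T (f t)) (Set.Ici 0) t)
    (hg : ∀ t ≥ 0, HasDerivWithinAt g (T (g t)) (Set.Ici 0) t) (h0 : f 0 = g 0) {t : ℝ}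
    (ht : 0 ≤ t) : f t = g t := by
  have hc : ∀ {k : ℝ → W}, (∀ t ≥ 0, HasDerivWithinAt k (T (k t)) (Set.Ici 0) t) →
      ContinuousOn k (Set.Icc 0 t) := fun h s hs =>
    ((h s hs.1).continuousWithinAt).mono Set.Icc_subset_Ici_self
  exact ODE_solution_unique_of_mem_Icc_right (v := fun _ => T) (s := fun _ => Set.univ)
    (K := ‖T‖₊) (fun _ _ => T.lipschitz.lipschitzOnWith) (hc hf)
    (fun s hs => (hf s hs.1).mono (Set.Ici_subset_Ici.2 hs.1)) (fun _ _ => trivial) (hc hg)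
    (fun s hs => (hg s hs.1).mono (Set.Ici_subset_Ici.2 hs.1)) (fun _ _ => trivial) h0
    ⟨ht, le_rfl⟩

/-- Derivatives in a parameter and in the space variable commute. -/
theorem hasDerivAt_fderiv_section {W A : Type*} [NormedAddCommGroup W] [NormedSpace ℝ W]
    [NormedAddCommGroup A] [NormedSpace ℝ A] {K : ℝ × W → A} {K' : W → A} {s : Set W}
    (hs : IsOpen s) (hK : ContDiffOn ℝ ∞ K (Set.univ ×ˢ s)) (t : ℝ)
    (hK' : ∀ y ∈ s, HasDerivAt (fun r => K (r, y)) (K' y) t) {y₀ : W} (hy : y₀ ∈ s) (v : W) :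
    HasDerivAt (fun r => fderiv ℝ (fun y => K (r, y)) y₀ v) (fderiv ℝ K' y₀ v) t := by
  have hKs : ∀ r, ∀ y ∈ s, ContDiffAt ℝ ∞ K (r, y) := fun r y hy =>
    hK.contDiffAt ((isOpen_univ.prod hs).mem_nhds ⟨trivial, hy⟩)
  have hKd : ∀ r, ∀ y ∈ s, HasFDerivAt K (fderiv ℝ K (r, y)) (r, y) :=
    fun r y hy => ((hKs r y hy).differentiableAt (by simp)).hasFDerivAt
  have htime : ∀ y ∈ s, fderiv ℝ K (t, y) (1, 0) = K' y := fun y hy => by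
    have h1 := HasFDerivAt.comp (f := fun r : ℝ => (r, y)) t (hKd t y hy)
      (hasFDerivAt_prodMk_left t y)
    exact h1.hasDerivAt.unique (hK' y hy)
  have hdd : DifferentiableAt ℝ (fderiv ℝ K) (t, y₀) :=
    ((hKs t y₀ hy).fderiv_right (m := 1) (by norm_cast)).differentiableAt (by simp)
  have h1 : ∀ r, fderiv ℝ (fun y => K (r, y)) y₀ v = fderiv ℝ K (r, y₀) (0, v) := fun r => by
    have := HasFDerivAt.comp (f := fun y : W => (r, y)) y₀ (hKd r y₀ hy)
      (hasFDerivAt_prodMk_right r y₀)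
    erw [this.fderiv]; rfl
  have h2 : HasDerivAt (fun r => fderiv ℝ K (r, y₀) (0, v))
      (fderiv ℝ (fderiv ℝ K) (t, y₀) (1, 0) (0, v)) t := by
    have h3 := HasFDerivAt.comp (f := fun r : ℝ => (r, y₀)) t hdd.hasFDerivAt
      (hasFDerivAt_prodMk_left t y₀)
    have h4 := h3.hasDerivAt.clm_apply (hasDerivAt_const t ((0 : ℝ), v))
    simpa using h4
  have h5 : fderiv ℝ K' y₀ v = fderiv ℝ (fderiv ℝ K) (t, y₀) (0, v) (1, 0) := by
    have h6 : K' =ᶠ[nhds y₀] fun y => fderiv ℝ K (t, y) (1, 0) := by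
      filter_upwards [hs.mem_nhds hy] with y hy'
      exact (htime y hy').symm
    have h3 := HasFDerivAt.comp (f := fun y : W => (t, y)) y₀ hdd.hasFDerivAt
      (hasFDerivAt_prodMk_right t y₀)
    have h4 := h3.clm_apply (hasFDerivAt_const ((1 : ℝ), (0 : W)) y₀)
    rw [h6.fderiv_eq]
    erw [h4.fderiv]
    simp
  simp only [h1]
  rw [h5, fderiv_fderiv_comm ((hKs t y₀ hy).of_le (by norm_cast))]
  exact h2

section MatrixExp

variable {V : Type*} [AddCommGroup V] [Module ℝ V] [FiniteDimensional ℝ V]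
  {ι : Type} [Fintype ι]

instance Ext.instCompleteSpace : CompleteSpace (Ext V) := FiniteDimensional.complete ℝ _

/-- Left multiplication by a matrix of exterior forms. -/
def leftMul {κ : Type} [Fintype κ] :
    (ι → ι → Ext V) →ₗ[ℝ] (ι → κ → Ext V) →L[ℝ] (ι → κ → Ext V) where
  toFun M := LinearMap.toContinuousLinearMap
    { toFun := fun y i k => ∑ j, M i j * y j k
      map_add' := fun y z => by
        funext i k; simp [mul_add, Finset.sum_add_distrib]
      map_smul' := fun r y => by
        funext i k
        simp only [Pi.smul_apply, RingHom.id_apply, Finset.smul_sum]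
        exact Finset.sum_congr rfl fun j _ => mul_smul_comm (r : ℂ) _ _ }
  map_add' M N := by
    ext y i k; simp [add_mul, Finset.sum_add_distrib]
  map_smul' r M := by
    ext y i k
    simp only [LinearMap.coe_toContinuousLinearMap', LinearMap.coe_mk, AddHom.coe_mk, smul_apply,
      RingHom.id_apply, Pi.smul_apply, Finset.smul_sum]
    exact Finset.sum_congr rfl fun j _ => smul_mul_assoc (r : ℂ) _ _

theorem leftMul_apply {κ : Type} [Fintype κ] (M : ι → ι → Ext V) (y : ι → κ → Ext V) (i : ι)
    (k : κ) : leftMul M y i k = ∑ j, M i j * y j k := rfl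

variable [DecidableEq ι]

/-- The exponential of a matrix of exterior forms. -/
def mexp (M : ι → ι → Ext V) : ι → ι → Ext V :=
  NormedSpace.exp (leftMul (κ := ι) M) (fun i j => if i = j then 1 else 0)

theorem mexp_zero : mexp (0 : ι → ι → Ext V) = fun i j => if i = j then 1 else 0 := by
  rw [mexp, map_zero, NormedSpace.exp_zero]; rfl

theorem hasDerivAt_mexp (M : ι → ι → Ext V) (t : ℝ) :
    HasDerivAt (fun s : ℝ => mexp (s • M)) (leftMul M (mexp (t • M))) t := by
  have h := (hasDerivAt_exp_smul_const' (leftMul (κ := ι) M) t).clm_apply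
    (hasDerivAt_const t (fun i j : ι => if i = j then (1 : Ext V) else 0))
  simp only [map_zero, add_zero] at h
  simp only [mexp, map_smul]
  exact h

theorem contDiff_mexp {n : ℕ∞ω} : ContDiff ℝ n (mexp : (ι → ι → Ext V) → _) := by
  have h1 : ContDiff ℝ n (NormedSpace.exp : ((ι → ι → Ext V) →L[ℝ] (ι → ι → Ext V)) → _) :=
    AnalyticOnNhd.contDiff fun x _ => NormedSpace.exp_analytic x
  have h2 : ContDiff ℝ n (leftMul (κ := ι) : (ι → ι → Ext V) → _) :=
    (LinearMap.toContinuousLinearMap (leftMul (V := V) (ι := ι) (κ := ι))).contDiff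
  exact (h1.comp h2).clm_apply contDiff_const

end MatrixExp

section Flow

variable {G : Type v} [Group G] {X Y : GMfd.{u} G} {m n o ι : Type}

/-- Entrywise derivative of a family of matrices of forms, in the half line `t ≥ 0`. -/
def MDeriv (f : ℝ → Matrix m n (Form X)) (f' : Matrix m n (Form X)) (t : ℝ) : Prop :=
  ∀ i j x, HasDerivWithinAt (fun s => f s i j x) (f' i j x) (Set.Ici 0) t

namespace MDeriv

variable {f g : ℝ → Matrix m n (Form X)} {f' g' : Matrix m n (Form X)} {t : ℝ}

theorem congr' (h : MDeriv f f' t) (hg : ∀ s ≥ 0, g s = f s) (h' : f' = g') (ht : 0 ≤ t) :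
    MDeriv g g' t := fun i j x => by
  rw [← h']
  exact (h i j x).congr (fun s hs => by rw [hg s hs]) (by rw [hg t ht])

theorem add (hf : MDeriv f f' t) (hg : MDeriv g g' t) :
    MDeriv (fun s => f s + g s) (f' + g') t := fun i j x => (hf i j x).add (hg i j x)

theorem sub (hf : MDeriv f f' t) (hg : MDeriv g g' t) :
    MDeriv (fun s => f s - g s) (f' - g') t := fun i j x => (hf i j x).sub (hg i j x)

theorem const (M : Matrix m n (Form X)) : MDeriv (fun _ => M) 0 t := fun _ _ _ =>
  hasDerivWithinAt_const _ _ _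

theorem mul_left [Fintype m] (M : Matrix o m (Form X)) (hf : MDeriv f f' t) :
    MDeriv (fun s => M * f s) (M * f') t := fun i j x => by
  simp only [mmul_apply, Finset.sum_apply, Pi.mul_apply]
  exact HasDerivWithinAt.fun_sum fun k _ =>
    (Ext.mulL (M i k x)).hasFDerivAt.comp_hasDerivWithinAt t (hf k j x)

theorem mul_right [Fintype n] (hf : MDeriv f f' t) (M : Matrix n o (Form X)) :
    MDeriv (fun s => f s * M) (f' * M) t := fun i j x => by
  simp only [mmul_apply, Finset.sum_apply, Pi.mul_apply]
  exact HasDerivWithinAt.fun_sum fun k _ =>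
    (Ext.mulL.flip (M k j x)).hasFDerivAt.comp_hasDerivWithinAt t (hf i k x)

theorem s (hf : MDeriv f f' t) : MDeriv (fun s => 𝐬(f s)) 𝐬f' t := fun i j x =>
  sinvL.hasFDerivAt.comp_hasDerivWithinAt t (hf i j x)

theorem pull {f : ℝ → Matrix m n (Form Y)} {f' : Matrix m n (Form Y)}
    (φ : X.carrier → Y.carrier) (hf : MDeriv f f' t) :
    MDeriv (fun s => (f s).map (pull φ)) (f'.map (pull φ)) t := fun i j x =>
  (Ext.mapL (tmap φ x)).hasFDerivAt.comp_hasDerivWithinAt t (hf i j (φ x))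

/-- Uniqueness for linear differential equations of matrices of forms. -/
theorem unique [Fintype m] {f g : ℝ → Matrix m n (Form X)} (F : Matrix m m (Form X))
    (hf : ∀ t ≥ 0, MDeriv f (-(F * f t)) t) (hg : ∀ t ≥ 0, MDeriv g (-(F * g t)) t)
    (h0 : f 0 = g 0) {t : ℝ} (ht : 0 ≤ t) : f t = g t := by
  ext1 i j
  funext x
  have key : ∀ {k : ℝ → Matrix m n (Form X)}, (∀ t ≥ 0, MDeriv k (-(F * k t)) t) → ∀ t ≥ 0,
      HasDerivWithinAt (fun s => fun i (_ : Unit) => k s i j x)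
        ((-leftMul (V := X.E) fun i l => F i l x) fun i (_ : Unit) => k t i j x)
        (Set.Ici 0) t := by
    intro k hk t ht
    refine hasDerivWithinAt_pi.2 fun i => hasDerivWithinAt_pi.2 fun _ => ?_
    have h := hk t ht i j x
    rw [neg_apply, Pi.neg_apply, Pi.neg_apply, leftMul_apply]
    rw [mneg_apply, mmul_apply, Pi.neg_apply, Finset.sum_apply] at h
    exact h
  have := linear_ode_unique _ (key hf) (key hg) (by rw [h0]) ht
  exact congrFun (congrFun this i) ()

end MDeriv

theorem hasDerivAt_extD {a : ℝ → Form X} {a' : Form X} {t : ℝ} (x : X.carrier)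
    (hs : ContDiffOn ℝ ∞ (fun p : ℝ × X.E => chartRep (a p.1) x p.2)
      (Set.univ ×ˢ (extChartAt X.I x).target))
    (h : ∀ y, HasDerivAt (fun s => a s y) (a' y) t) :
    HasDerivAt (fun s => extD (a s) x) (extD a' x) t := by
  have hc : ∀ y, HasDerivAt (fun s => chartRep (a s) x y) (chartRep a' x y) t := fun y =>
    (Ext.mapL (chartInvDeriv x y)).hasFDerivAt.comp_hasDerivAt t
      (h ((extChartAt X.I x).symm y))
  have hv : ∀ v, HasDerivAt (fun s => fderiv ℝ (chartRep (a s) x) (extChartAt X.I x x) v)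
      (fderiv ℝ (chartRep a' x) (extChartAt X.I x x) v) t := fun v =>
    hasDerivAt_fderiv_section (isOpen_extChartAt_target x) hs t
      (fun y _ => hc y) (mem_extChartAt_target x) v
  have hd : ∀ τ : X.E → Ext X.E, flatD τ (extChartAt X.I x x) =
      ∑ k, Ext.mulL (ExteriorAlgebra.ι ℂ (coordForm X.E k))
        (fderiv ℝ τ (extChartAt X.I x x) (Module.finBasis ℝ X.E k)) := fun _ => rfl
  have hfl : HasDerivAt (fun s => flatD (chartRep (a s) x) (extChartAt X.I x x))
      (flatD (chartRep a' x) (extChartAt X.I x x)) t := by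
    simp only [hd]
    exact HasDerivAt.fun_sum fun k _ =>
      (Ext.mulL (ExteriorAlgebra.ι ℂ (coordForm X.E k))).hasFDerivAt.comp_hasDerivAt t (hv _)
  exact (Ext.mapL (chartDeriv x x)).hasFDerivAt.comp_hasDerivAt t hfl

variable [Fintype ι] [DecidableEq ι]

/-- The solution `E` of `E' = -F E`, `E 0 = 1`. -/
structure IsFlow (F : Matrix ι ι (Form X)) (E : ℝ → Matrix ι ι (Form X)) : Prop where
  zero : E 0 = 1
  deriv : ∀ t i j x, HasDerivAt (fun s => E s i j x) ((-(F * E t)) i j x) t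
  smooth : ∀ i j (x₀ : X.carrier), ContDiffOn ℝ ∞
    (fun p : ℝ × X.E => chartRep (E p.1 i j) x₀ p.2) (Set.univ ×ˢ (extChartAt X.I x₀).target)

/-- The exponential of a matrix of forms. -/
def fexp (F : Matrix ι ι (Form X)) (t : ℝ) : Matrix ι ι (Form X) :=
  Matrix.of fun i j x => mexp ((-t) • fun i j => F i j x) i j

theorem linear_map_one_zero {V W : Type*} [AddCommGroup V] [Module ℝ V] [FiniteDimensional ℝ V]
    [AddCommGroup W] [Module ℝ W] [FiniteDimensional ℝ W]
    (L : V →ₗ[ℝ] W) (M : ι → ι → Ext W) (t : ℝ) (ht : 0 ≤ t) (i j : ι) :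
    Ext.map L (mexp (t • M) i j) = mexp (t • fun i j => Ext.map L (M i j)) i j := by
  let N : ι → ι → Ext V := fun i j => Ext.map L (M i j)
  have h1 : ∀ t ≥ 0, HasDerivWithinAt (fun s : ℝ => fun i j => Ext.map L (mexp (s • M) i j))
      (leftMul N fun i j => Ext.map L (mexp (t • M) i j)) (Set.Ici 0) t := by
    intro t _
    refine hasDerivWithinAt_pi.2 fun i => hasDerivWithinAt_pi.2 fun j => ?_
    have h := hasDerivAt_pi.1 (hasDerivAt_pi.1 (hasDerivAt_mexp M t) i) j
    have h' := (realCLM (Ext.map L).toLinearMap).hasFDerivAt.comp_hasDerivAt t h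
    have h3 : realCLM (Ext.map L).toLinearMap (leftMul M (mexp (t • M)) i j) =
        leftMul N (fun i j => Ext.map L (mexp (t • M) i j)) i j := by
      rw [leftMul_apply, leftMul_apply, map_sum]
      exact Finset.sum_congr rfl fun k _ => map_mul (Ext.map L) _ _
    rw [h3] at h'
    exact h'.hasDerivWithinAt
  have h2 : ∀ t ≥ 0, HasDerivWithinAt (fun s : ℝ => mexp (s • N))
      (leftMul N (mexp (t • N))) (Set.Ici 0) t := fun t _ =>
    (hasDerivAt_mexp N t).hasDerivWithinAt
  have h0 : (fun i j => Ext.map L (mexp ((0 : ℝ) • M) i j)) = mexp ((0 : ℝ) • N) := by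
    funext i j
    rw [zero_smul, zero_smul, mexp_zero, mexp_zero]
    show Ext.map L (if i = j then 1 else 0) = if i = j then 1 else 0
    split_ifs <;> simp
  exact congrFun (congrFun (linear_ode_unique _ h1 h2 h0 ht) i) j

theorem map_mexp {V W : Type*} [AddCommGroup V] [Module ℝ V] [FiniteDimensional ℝ V]
    [AddCommGroup W] [Module ℝ W] [FiniteDimensional ℝ W]
    (L : V →ₗ[ℝ] W) (M : ι → ι → Ext W) (i j : ι) :
    Ext.map L (mexp M i j) = mexp (fun i j => Ext.map L (M i j)) i j := by
  have := linear_map_one_zero L M 1 zero_le_one i j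
  rwa [one_smul, one_smul] at this

theorem isFlow_fexp (F : Matrix ι ι (Form X)) [hF : MSmooth F] : IsFlow F (fexp F) where
  zero := by
    ext1 i j
    funext x
    rw [fexp, mof_apply, neg_zero, zero_smul, mexp_zero, mone_apply]
    show (if i = j then 1 else 0) = _
    split_ifs <;> rfl
  deriv t i j x := by
    have h := (hasDerivAt_mexp (fun i j => F i j x) (-t)).scomp t (hasDerivAt_neg t)
    have h' := hasDerivAt_pi.1 (hasDerivAt_pi.1 h i) j
    rw [neg_smul, one_smul, Pi.neg_apply, Pi.neg_apply, leftMul_apply] at h'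
    rw [mneg_apply, mmul_apply, Pi.neg_apply, Finset.sum_apply]
    exact h'
  smooth i j x₀ := by
    have h1 : ∀ p : ℝ × X.E, chartRep (fexp F p.1 i j) x₀ p.2 =
        mexp ((-p.1) • fun i j => chartRep (F i j) x₀ p.2) i j := fun p => by
      rw [chartRep, fexp, mof_apply, map_mexp]
      congr 1
      funext i j
      simp only [Pi.smul_apply]
      exact map_smul (Ext.map _) ((-p.1 : ℝ) : ℂ) _
    simp only [h1]
    have h2 : ContDiffOn ℝ ∞ (fun p : ℝ × X.E => fun i j => chartRep (F i j) x₀ p.2)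
        (Set.univ ×ˢ (extChartAt X.I x₀).target) := by
      refine contDiffOn_pi.2 fun i => contDiffOn_pi.2 fun j => ?_
      exact (hF.smooth i j x₀).comp contDiffOn_snd fun p hp => hp.2
    have h3 := contDiff_mexp.comp_contDiffOn ((contDiffOn_fst (n := ∞)).neg.smul h2)
    exact contDiffOn_pi.1 (contDiffOn_pi.1 h3 i) j

namespace IsFlow

variable {F : Matrix ι ι (Form X)} {E : ℝ → Matrix ι ι (Form X)}

theorem mderiv (h : IsFlow F E) (t : ℝ) : MDeriv E (-(F * E t)) t := fun i j x =>
  (h.deriv t i j x).hasDerivWithinAt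

theorem msmooth (h : IsFlow F E) (t : ℝ) : MSmooth (E t) :=
  ⟨fun i j x₀ => by
    have h1 : ContDiffOn ℝ ∞ (fun y : X.E => (t, y)) (extChartAt X.I x₀).target :=
      contDiffOn_const.prodMk contDiffOn_id
    exact ContDiffOn.comp (g := fun p : ℝ × X.E => chartRep (E p.1 i j) x₀ p.2)
      (f := fun y : X.E => (t, y)) (h.smooth i j x₀) h1
      fun y hy => Set.mk_mem_prod (Set.mem_univ t) hy⟩

theorem mderiv_d (h : IsFlow F E) (t : ℝ) : MDeriv (fun s => 𝐝(E s)) 𝐝(-(F * E t)) t :=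
  fun i j x => (hasDerivAt_extD (a := fun s => E s i j) (a' := (-(F * E t)) i j) x
    (h.smooth i j x) (h.deriv t i j)).hasDerivWithinAt

/-- Intertwiners of generators intertwine the flows. -/
theorem intertwine {κ : Type} [Fintype κ] [DecidableEq κ] (h : IsFlow F E)
    {F' : Matrix κ κ (Form X)} {E' : ℝ → Matrix κ κ (Form X)} (h' : IsFlow F' E')
    {N : Matrix ι κ (Form X)} (hN : F * N = N * F') {t : ℝ} (ht : 0 ≤ t) :
    E t * N = N * E' t := by
  refine MDeriv.unique (f := fun t => E t * N) (g := fun t => N * E' t) F (fun t _ => ?_)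
    (fun t _ => ?_) ?_ ht
  · have := (h.mderiv t).mul_right N
    rwa [mneg_mul, massoc] at this
  · have := (h'.mderiv t).mul_left N
    rwa [mmul_neg, ← massoc, ← hN, massoc] at this
  · simp only [h.zero, h'.zero, mone_mul, mmul_one]

theorem add (h : IsFlow F E) {t : ℝ} (s : ℝ) (ht : 0 ≤ t) : E (t + s) = E t * E s := by
  refine MDeriv.unique (f := fun t => E (t + s)) (g := fun t => E t * E s) F (fun t _ => ?_)
    (fun t _ => ?_) ?_ ht
  · intro i j x
    exact ((h.deriv (t + s) i j x).comp_add_const t s).hasDerivWithinAt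
  · have := (h.mderiv t).mul_right (E s)
    rwa [neg_mul, massoc] at this
  · simp only [zero_add, h.zero, mone_mul]

theorem isPar (h : IsFlow F E) {p : ι → Bool} (hF : IsPar false p p F) {t : ℝ} (ht : 0 ≤ t) :
    IsPar false p p (E t) := by
  let P : Matrix ι ι (Form X) := Matrix.diagonal fun i => (sg (p i) : Form X)
  have hP : P * P = 1 := by
    rw [Matrix.diagonal_mul_diagonal, ← Matrix.diagonal_one]
    congr 1
    funext i
    rw [← Int.cast_mul, sg_mul_self, Int.cast_one]
  have key : ∀ M : Matrix ι ι (Form X), IsPar false p p M ↔ 𝐬M = P * M * P := by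
    intro M
    have h1 : ∀ i j, (P * M * P) i j = sg (false ^^ (p i ^^ p j)) • M i j := fun i j => by
      rw [Matrix.mul_diagonal, Matrix.diagonal_mul, ← zsmul_eq_mul, ← zsmul_eq_mul', smul_smul,
        Bool.false_xor, sg_xor, mul_comm]
    constructor
    · intro h; ext1 i j; rw [h1]; exact h i j
    · intro h i j; rw [← h1, ← h]; rfl
  rw [key]
  have hF' := (key F).1 hF
  refine MDeriv.unique (f := fun t => 𝐬(E t)) (g := fun t => P * E t * P) 𝐬F (fun t _ => ?_)
    (fun t _ => ?_) ?_ ht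
  · have := (h.mderiv t).s
    rwa [s_neg, s_mul] at this
  · have := ((h.mderiv t).mul_left P).mul_right P
    have h2 : 𝐬F * (P * E t * P) = P * (F * E t) * P := by
      rw [hF']
      calc P * F * P * (P * E t * P) = P * F * (P * P) * E t * P := by noncomm_ring
        _ = _ := by rw [hP]; noncomm_ring
    rw [h2]
    rwa [mmul_neg, mneg_mul] at this
  · simp only [h.zero, mmul_one, hP]
    exact mmap_one _ (map_zero sinv) (map_one sinv)

theorem unique {E' : ℝ → Matrix ι ι (Form X)} (h : IsFlow F E) (h' : IsFlow F E') {t : ℝ}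
    (ht : 0 ≤ t) : E t = E' t :=
  MDeriv.unique F (fun t _ => h.mderiv t) (fun t _ => h'.mderiv t) (h.zero.trans h'.zero.symm) ht

end IsFlow

end Flow

end

section

section SuperConnections

variable {G : Type v} [Group G] {X Y : GMfd.{u} G} {β : G → G → Circle} {m n : Type}

/-! ### Matrices of forms of pure degree -/

section Graded

variable {k : ℕ} {p : m → Bool} {q : n → Bool} {M : Matrix m n (Form X)}

theorem IsGradedMatrix.msmooth (h : IsGradedMatrix k p q M) : MSmooth M := ⟨fun i j => (h i j).1⟩

theorem HasDegree.sinv_eq {α : Form X} (h : HasDegree k α) : sinv α = (-1) ^ k * α :=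
  funext fun x => Ext.sinv_of_mem_degree (h x)

theorem IsGradedMatrix.isPar_even (h : IsGradedMatrix 0 p q M) : IsPar false p q M := fun i j => by
  by_cases hpq : p i = q j
  · rw [(h i j).2.1.sinv_eq, hpq, Bool.xor_self]; simp
  · rw [(h i j).2.2 hpq]; simp

theorem IsGradedMatrix.s_even (h : IsGradedMatrix 0 p q M) : 𝐬M = M := by
  ext1 i j
  rw [mmap_apply, (h i j).2.1.sinv_eq, pow_zero, one_mul]

theorem IsGradedMatrix.isPar_odd (h : IsGradedMatrix 1 p q M) : IsPar true p q M := fun i j => by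
  by_cases hpq : p i = q j
  · rw [(h i j).2.1.sinv_eq, hpq, Bool.xor_self]; simp
  · rw [(h i j).2.2 hpq]; simp

theorem IsGradedMatrix.s_odd (h : IsGradedMatrix 1 p q M) : 𝐬M = -M := by
  ext1 i j
  rw [mmap_apply, (h i j).2.1.sinv_eq, pow_one, neg_one_mul]; rfl

end Graded

/-! ### Superconnections -/

/-- The conditions for data to be a twisted equivariant bundle with equivariant superconnection
`e ∘ d + A`, where `A` is an odd matrix of forms. -/
structure IsSC (β : G → G → Circle) (V : PreBundle X) : Prop where
  e_graded : IsGradedMatrix 0 V.par V.par V.e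
  ρ_graded : ∀ g, IsGradedMatrix 0 V.par V.par (V.ρ g)
  A_smooth : MSmooth V.A
  A_odd : IsPar true V.par V.par V.A
  e_idem : V.e * V.e = V.e
  ρ_hom : ∀ g, V.ρ g = V.e⋆g * V.ρ g * V.e
  A_hom : V.A = V.e * V.A * V.e
  ρ_one : V.ρ 1 = V.e
  ρ_mul : ∀ g h, (V.ρ g)⋆h * V.ρ h = (β g h : ℂ) • V.ρ (g * h)
  A_equivariant : ∀ g, V.ρ g * V.A =
    V.e⋆g * 𝐝(V.ρ g) * V.e + V.A⋆g * V.ρ g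

theorem IsBundle.isSC {V : PreBundle X} (h : IsBundle β V) : IsSC β V where
  e_graded := h.e_graded
  ρ_graded := h.ρ_graded
  A_smooth := h.A_graded.msmooth
  A_odd := h.A_graded.isPar_odd
  e_idem := h.e_idem
  ρ_hom := h.ρ_hom
  A_hom := h.A_hom
  ρ_one := h.ρ_one
  ρ_mul := h.ρ_mul
  A_equivariant := h.A_equivariant

namespace PreBundle

/-- The matrix of the superconnection applied to the basis. -/
def B (V : PreBundle X) : Matrix V.ι V.ι (Form X) := 𝐝V.e * V.e - V.A

/-- The curvature of a superconnection. -/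
def scurv (V : PreBundle X) : Matrix V.ι V.ι (Form X) := -((𝐝V.B + 𝐬V.B * V.B) * V.e)

/-- The representation with action `ρ`, superconnection `B`, and time evolution `E`. -/
def repOf (V : PreBundle X) (E : ℝ → Matrix V.ι V.ι (Form X)) : PreRep X where
  ι := V.ι
  par := V.par
  e := V.e
  R g := Matrix.of fun i j =>
    ⟨fun t => (V.ρ g * E t) i j, fun t => (V.B⋆g * (V.ρ g * E t)) i j⟩

/-- The representation determined by a superconnection. -/
def toSRep (V : PreBundle X) : PreRep X := V.repOf (fexp V.scurv)

end PreBundle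

theorem PreRep.a'_eq {D : PreRep X} {g : G} {f : ℝ → Matrix D.ι D.ι (Form X)}
    (hf : ∀ s : ℝ≥0, D.a g s = f s) {t : ℝ≥0} {f' : Matrix D.ι D.ι (Form X)}
    (h : MDeriv f f' t) : D.a' g t = f' := by
  ext1 i j
  funext x
  have h1 : HasDerivWithinAt (fun s : ℝ => (D.R g i j).body s.toNNReal x) (f' i j x)
      (Set.Ici 0) t := by
    have hs : ∀ s ∈ Set.Ici (0 : ℝ), (D.R g i j).body s.toNNReal x = f s i j x := fun s hs => by
      have := congrFun (congrFun (congrFun (hf s.toNNReal) i) j) x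
      rwa [Real.coe_toNNReal s hs] at this
    exact (h i j x).congr hs (hs t t.2)
  exact h1.derivWithin (uniqueDiffOn_Ici 0 t t.2)

/-- Joint smoothness of a family of matrices of forms, for parameters `t ≥ 0`. -/
def MSmoothFam (f : ℝ → Matrix m n (Form X)) : Prop :=
  ∀ i j (x₀ : X.carrier), ContDiffOn ℝ ∞ (fun p : ℝ × X.E => chartRep (f p.1 i j) x₀ p.2)
    (Set.Ici 0 ×ˢ (extChartAt X.I x₀).target)

theorem chartRep_sum {κ : Type*} (s : Finset κ) (α : κ → Form X) (x₀ : X.carrier) (y : X.E) :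
    chartRep (∑ k ∈ s, α k) x₀ y = ∑ k ∈ s, chartRep (α k) x₀ y := by
  simp [chartRep, Finset.sum_apply]

theorem MSmoothFam.mul {o : Type} [Fintype n] {f : ℝ → Matrix m n (Form X)}
    {f' : ℝ → Matrix n o (Form X)} (hf : MSmoothFam f) (hf' : MSmoothFam f') :
    MSmoothFam fun t => f t * f' t := fun i j x₀ => by
  simp only [mmul_apply, chartRep_sum, chartRep_mul]
  exact ContDiffOn.sum fun k _ => contDiffOn_ext_mul (hf i k x₀) (hf' k j x₀)

theorem MSmoothFam.const (M : Matrix m n (Form X)) [hM : MSmooth M] :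
    MSmoothFam fun _ => M := fun i j x₀ =>
  (hM.smooth i j x₀).comp contDiffOn_snd fun _ hp => hp.2

theorem IsFlow.msmoothFam [Fintype m] [DecidableEq m] {F : Matrix m m (Form X)}
    {E : ℝ → Matrix m m (Form X)} (h : IsFlow F E) : MSmoothFam E := fun i j x₀ =>
  (h.smooth i j x₀).mono (Set.prod_mono_left (Set.subset_univ _))

theorem MSmoothFam.isSmoothFam {f : ℝ → Matrix m n (Form X)} (hf : MSmoothFam f) (i : m) (j : n) :
    IsSmoothFam fun t : ℝ≥0 => f t i j := fun x₀ =>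
  (hf i j x₀).congr fun p hp => by
    simp only
    rw [Real.coe_toNNReal p.1 hp.1]

namespace IsSC

variable {V : PreBundle X}

theorem e_smooth (h : IsSC β V) : MSmooth V.e := h.e_graded.msmooth

theorem ρ_smooth (h : IsSC β V) (g : G) : MSmooth (V.ρ g) := (h.ρ_graded g).msmooth

theorem B_smooth (h : IsSC β V) : MSmooth V.B := by
  have := h.e_smooth; have := h.A_smooth
  unfold PreBundle.B; infer_instance

theorem scurv_smooth (h : IsSC β V) : MSmooth V.scurv := by
  have := h.e_smooth; have := h.B_smooth
  unfold PreBundle.scurv; infer_instance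

theorem B_odd (h : IsSC β V) : IsPar true V.par V.par V.B := by
  have := h.e_smooth
  exact (h.e_graded.isPar_even.d.mul_oe h.e_graded.isPar_even).sub h.A_odd

theorem scurv_even (h : IsSC β V) : IsPar false V.par V.par V.scurv := by
  have := h.B_smooth
  exact ((h.B_odd.d.add (h.B_odd.s.mul_oo h.B_odd)).mul_ee h.e_graded.isPar_even).neg

theorem A_mul_e (h : IsSC β V) : V.A * V.e = V.A := by
  rw [h.A_hom, massoc _ V.e V.e, h.e_idem]

theorem e_mul_A (h : IsSC β V) : V.e * V.A = V.A := by
  rw [h.A_hom, ← massoc, ← massoc, h.e_idem]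

theorem ρ_mul_e (h : IsSC β V) (g : G) : V.ρ g * V.e = V.ρ g := by
  rw [h.ρ_hom, massoc _ V.e V.e, h.e_idem]

theorem e_pull_idem (h : IsSC β V) (g : G) :
    V.e⋆g * V.e⋆g = V.e⋆g := by
  rw [← mpull_mul, h.e_idem]

theorem e_mul_ρ (h : IsSC β V) (g : G) : V.e⋆g * V.ρ g = V.ρ g := by
  rw [h.ρ_hom, ← massoc, ← massoc, h.e_pull_idem]

theorem B_mul_e (h : IsSC β V) : V.B * V.e = V.B := by
  rw [PreBundle.B, msub_mul, massoc, h.e_idem, h.A_mul_e]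

theorem d_e (h : IsSC β V) : 𝐝V.e = 𝐝V.e * V.e + V.e * 𝐝V.e := by
  have := h.e_smooth
  conv_lhs => rw [← h.e_idem, d_mul, h.e_graded.s_even]

theorem e_d_e (h : IsSC β V) : V.e * (𝐝V.e * V.e) = 0 := by
  have h1 := congrArg (V.e * ·) h.d_e
  simp only [mmul_add, ← massoc, h.e_idem] at h1
  rw [← massoc]
  simpa using h1

theorem e_mul_B (h : IsSC β V) : V.e * V.B = -V.A := by
  rw [PreBundle.B, mmul_sub, h.e_d_e, h.e_mul_A, zero_sub]

theorem e_mul_B' (h : IsSC β V) : V.e * V.B = V.B - 𝐝V.e * V.e := by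
  rw [h.e_mul_B, PreBundle.B]; abel

theorem scurv_mul_e (h : IsSC β V) : V.scurv * V.e = V.scurv := by
  rw [PreBundle.scurv, mneg_mul, massoc, h.e_idem]

/-- The curvature as a sum of the curvature of the trivial connection on the image of `e` and of
terms in `A`. -/
theorem scurv_eq (h : IsSC β V) : V.scurv =
    V.e * 𝐝V.e * 𝐝V.e * V.e + V.e * 𝐝V.A * V.e - 𝐬V.A * V.A := by
  have := h.e_smooth; have := h.A_smooth
  have hB : 𝐝V.B = -(𝐝V.e * 𝐝V.e) - 𝐝V.A := by
    rw [PreBundle.B, d_sub, d_mul, d_d, mzero_mul, zero_add]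
    have h1 : 𝐬(𝐝V.e) = -𝐝V.e := by
      have := d_s V.e
      rw [h.e_graded.s_even] at this
      exact (neg_eq_iff_eq_neg.2 this).symm
    rw [h1, mneg_mul]
  have h1 : 𝐬(𝐝V.e) = -𝐝V.e := by
    have := d_s V.e
    rw [h.e_graded.s_even] at this
    exact (neg_eq_iff_eq_neg.2 this).symm
  have hs : 𝐬V.B = -(𝐝V.e * V.e) - 𝐬V.A := by
    rw [PreBundle.B, s_sub, s_mul, h.e_graded.s_even, h1, mneg_mul]
  have hsA : 𝐬V.A * V.e = 𝐬V.A := by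
    have := congrArg (fun M : Matrix V.ι V.ι (Form X) => 𝐬M) h.A_mul_e
    simp only [s_mul, h.e_graded.s_even] at this
    exact this
  have hdA : 𝐝V.A * V.e = 𝐝V.e * V.A + V.e * 𝐝V.A * V.e := by
    conv_lhs => rw [← h.e_mul_A, d_mul, h.e_graded.s_even, madd_mul, massoc,
      h.A_mul_e]
  have hdd : 𝐝V.e * 𝐝V.e * V.e = V.e * 𝐝V.e * 𝐝V.e * V.e := by
    have h2 : 𝐝V.e * V.e = 𝐝V.e - V.e * 𝐝V.e := eq_sub_of_add_eq h.d_e.symm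
    have h3 : V.e * 𝐝V.e = 𝐝V.e - 𝐝V.e * V.e := by rw [h2]; abel
    calc 𝐝V.e * 𝐝V.e * V.e = 𝐝V.e * (𝐝V.e * V.e) := massoc _ _ _
      _ = (𝐝V.e - 𝐝V.e * V.e) * (𝐝V.e * V.e) := by
        rw [msub_mul, massoc, h.e_d_e, mmul_zero, sub_zero]
      _ = V.e * 𝐝V.e * 𝐝V.e * V.e := by rw [← h3]; simp only [massoc]
  have hsB : 𝐬V.A * (𝐝V.e * V.e) = 0 := by
    rw [← hsA, massoc, h.e_d_e, mmul_zero]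
  have hde : 𝐝V.e * V.e * (𝐝V.e * V.e) = 0 := by
    rw [massoc, h.e_d_e, mmul_zero]
  have hdeA : 𝐝V.e * V.e * V.A = 𝐝V.e * V.A := by rw [massoc, h.e_mul_A]
  have hsBB : 𝐬V.B * V.B * V.e = 𝐝V.e * V.A + 𝐬V.A * V.A := by
    rw [massoc, h.B_mul_e, hs, PreBundle.B, mmul_sub, msub_mul,
      msub_mul, mneg_mul, mneg_mul, hde, hdeA, hsB]
    abel
  rw [PreBundle.scurv, madd_mul, hsBB, hB, msub_mul, mneg_mul, hdd, hdA]
  abel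

theorem e_mul_scurv (h : IsSC β V) : V.e * V.scurv = V.scurv := by
  have hsA : V.e * 𝐬V.A = 𝐬V.A := by
    have := congrArg (fun M : Matrix V.ι V.ι (Form X) => 𝐬M) h.e_mul_A
    simp only [s_mul, h.e_graded.s_even] at this
    exact this
  rw [h.scurv_eq, mmul_sub, mmul_add, ← massoc V.e (𝐬V.A), hsA]
  simp only [← massoc, h.e_idem]

/-- The Bianchi identity. -/
theorem bianchi (h : IsSC β V) : 𝐝V.scurv * V.e + 𝐬V.scurv * V.B = V.B * V.scurv := by
  have := h.e_smooth; have := h.A_smooth; have := h.B_smooth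
  set Q := 𝐝V.B + 𝐬V.B * V.B with hQ
  have hF : V.scurv = -(Q * V.e) := rfl
  have hdQ : 𝐝Q = -(𝐬(𝐝V.B)) * V.B + V.B * 𝐝V.B := by
    rw [hQ, d_add, d_d, d_mul, d_s, s_s, zero_add]
  have hsQ : 𝐬Q = 𝐬(𝐝V.B) + V.B * 𝐬V.B := by rw [hQ, s_add, s_mul, s_s]
  have h1 : 𝐝V.scurv * V.e = -(𝐝Q * V.e) - 𝐬Q * (𝐝V.e * V.e) := by
    rw [hF, d_neg, d_mul, mneg_mul, madd_mul, massoc, h.e_idem,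
      massoc]
    abel
  have h2 : 𝐬V.scurv * V.B = -(𝐬Q * V.B) + 𝐬Q * (𝐝V.e * V.e) := by
    rw [hF, s_neg, s_mul, h.e_graded.s_even, mneg_mul, massoc, h.e_mul_B',
      mmul_sub]
    abel
  have h3 : 𝐝Q * V.e = -(𝐬(𝐝V.B) * V.B) + V.B * (𝐝V.B * V.e) := by
    rw [hdQ, madd_mul, mneg_mul, mneg_mul, massoc, h.B_mul_e,
      massoc]
  have h4 : V.B * V.scurv = -(V.B * (𝐝V.B * V.e)) - V.B * (𝐬V.B * V.B) := by
    rw [hF, hQ, madd_mul, massoc (𝐬V.B), h.B_mul_e, mmul_neg,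
      mmul_add]
    abel
  have h5 : (𝐬(𝐝V.B) + V.B * 𝐬V.B) * V.B = 𝐬(𝐝V.B) * V.B + V.B * (𝐬V.B * V.B) := by
    rw [madd_mul, massoc V.B]
  rw [h1, h2, h3, h4, hsQ, h5]
  abel

theorem d_ρ (h : IsSC β V) (g : G) :
    𝐝(V.ρ g) * V.e + V.ρ g * V.B = V.B⋆g * V.ρ g := by
  have := h.e_smooth; have := h.A_smooth; have := h.ρ_smooth g
  have h1 : 𝐝(V.ρ g) = 𝐝(V.e⋆g) * V.ρ g +
      V.e⋆g * 𝐝(V.ρ g) := by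
    conv_lhs => rw [← h.e_mul_ρ g, d_mul, s_pull, h.e_graded.s_even]
  have h2 : V.ρ g * V.B = -(V.ρ g * V.A) := by
    rw [← h.ρ_mul_e g, massoc, h.e_mul_B, mmul_neg, h.ρ_mul_e]
  have h3 : V.B⋆g * V.ρ g =
      𝐝(V.e⋆g) * V.ρ g - V.A⋆g * V.ρ g := by
    rw [PreBundle.B, mpull_sub, msub_mul, mpull_mul, massoc, h.e_mul_ρ, d_pull]
  have h4 : 𝐝(V.ρ g) * V.e = 𝐝(V.e⋆g) * V.ρ g +
      V.e⋆g * 𝐝(V.ρ g) * V.e := by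
    conv_lhs => rw [h1, madd_mul, massoc, h.ρ_mul_e]
  rw [h2, h3, h.A_equivariant, h4]
  abel

theorem scurv_equivariant (h : IsSC β V) (g : G) :
    V.scurv⋆g * V.ρ g = V.ρ g * V.scurv := by
  have := h.e_smooth; have := h.A_smooth; have := h.ρ_smooth g; have := h.B_smooth
  set r := V.ρ g with hr
  set Bg := V.B⋆g with hBg
  have h0 := h.d_ρ g
  rw [← hr, ← hBg] at h0
  have hsr : 𝐬r = r := (h.ρ_graded g).s_even
  have hsdr : 𝐬(𝐝r) = -𝐝r := by
    have := d_s r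
    rw [hsr] at this
    exact (neg_eq_iff_eq_neg.2 this).symm
  have h1 : -(𝐝r * V.e) + r * 𝐬V.B = 𝐬Bg * r := by
    have := congrArg (fun M : Matrix V.ι V.ι (Form X) => 𝐬M) h0
    simp only [s_add, s_mul, hsr, hsdr, h.e_graded.s_even, mneg_mul] at this
    exact this
  have h2 : -(𝐝r * 𝐝V.e) + (𝐝r * V.B + r * 𝐝V.B) = 𝐝Bg * r + 𝐬Bg * 𝐝r := by
    have := congrArg (fun M : Matrix V.ι V.ι (Form X) => 𝐝M) h0
    simp only [d_add, d_mul, d_d, hsr, hsdr, mzero_mul, zero_add, mneg_mul] at this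
    exact this
  have h3 : 𝐝Bg * r = r * (𝐝V.B * V.e) - 𝐝r * (𝐝V.e * V.e) + 𝐝r * V.B - 𝐬Bg * (𝐝r * V.e) := by
    have h4 := congrArg (· * V.e) h2
    simp only [madd_mul, mneg_mul, massoc, h.B_mul_e] at h4
    rw [show r * V.e = r from h.ρ_mul_e g] at h4
    rw [eq_sub_iff_add_eq, ← h4]
    abel
  have h5 : 𝐬Bg * (𝐝r * V.e) = 𝐬Bg * Bg * r + 𝐝r * (V.B - 𝐝V.e * V.e) - r * (𝐬V.B * V.B) := by
    have h6 : 𝐝r * V.e = Bg * r - r * V.B := eq_sub_of_add_eq h0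
    rw [h6, mmul_sub, ← massoc, ← massoc, ← h1, madd_mul,
      mneg_mul, massoc (𝐝r), h.e_mul_B', massoc r]
    abel
  have h7 : (𝐝Bg + 𝐬Bg * Bg) * r = r * ((𝐝V.B + 𝐬V.B * V.B) * V.e) := by
    rw [madd_mul, h3, h5, madd_mul, massoc (𝐬V.B) V.B, h.B_mul_e,
      mmul_add, mmul_sub]
    abel
  have h8 : V.scurv⋆g = -((𝐝Bg + 𝐬Bg * Bg) * V.e⋆g) := by
    rw [PreBundle.scurv, mpull_neg, mpull_mul, mpull_add, mpull_mul, hBg, d_pull, s_pull]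
  rw [h8, mneg_mul, massoc, h.e_mul_ρ, h7, PreBundle.scurv, mmul_neg]

variable {E : ℝ → Matrix V.ι V.ι (Form X)}

theorem e_mul_flow (h : IsSC β V) (hE : IsFlow V.scurv E) {t : ℝ} (ht : 0 ≤ t) :
    V.e * E t = E t * V.e :=
  (hE.intertwine hE (by rw [h.e_mul_scurv, h.scurv_mul_e]) ht).symm

theorem flow_equivariant (h : IsSC β V) (hE : IsFlow V.scurv E) (g : G) {t : ℝ} (ht : 0 ≤ t) :
    (E t)⋆g * V.ρ g = V.ρ g * E t := by
  refine MDeriv.unique (f := fun t => (E t)⋆g * V.ρ g)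
    (g := fun t => V.ρ g * E t) (V.scurv⋆g) (fun t _ => ?_) (fun t _ => ?_) ?_ ht
  · have := ((hE.mderiv t).pull (X.act g)).mul_right (V.ρ g)
    rwa [mpull_neg, mpull_mul, mneg_mul, massoc] at this
  · have := (hE.mderiv t).mul_left (V.ρ g)
    rwa [mmul_neg, ← massoc, ← h.scurv_equivariant, massoc] at this
  · simp only [hE.zero, mmul_one]
    rw [mmap_one _ (map_zero _) (map_one _), mone_mul]

theorem d_flow (h : IsSC β V) (hE : IsFlow V.scurv E) {t : ℝ} (ht : 0 ≤ t) :
    𝐝(V.e * E t) * V.e + 𝐬(V.e * E t) * V.B = V.B * E t := by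
  have := h.e_smooth; have := h.scurv_smooth; have := h.B_smooth
  have hexp : ∀ s, 𝐝(V.e * E s) * V.e + 𝐬(V.e * E s) * V.B =
      𝐝V.e * (E s * V.e) + V.e * (𝐝(E s) * V.e) + V.e * (𝐬(E s) * V.B) := fun s => by
    have := hE.msmooth s
    rw [d_mul, s_mul, h.e_graded.s_even, madd_mul]
    simp only [massoc]
  have hd : ∀ s, MDeriv (fun s => 𝐝(V.e * E s) * V.e + 𝐬(V.e * E s) * V.B - V.B * E s)
      (𝐝V.e * (-(V.scurv * E s) * V.e) + V.e * (𝐝(-(V.scurv * E s)) * V.e) +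
        V.e * (𝐬(-(V.scurv * E s)) * V.B) - V.B * (-(V.scurv * E s))) s := fun s => by
    simp only [hexp]
    exact (((((hE.mderiv s).mul_right V.e).mul_left (𝐝V.e)).add
      (((hE.mderiv_d s).mul_right V.e).mul_left V.e)).add
      (((hE.mderiv s).s.mul_right V.B).mul_left V.e)).sub ((hE.mderiv s).mul_left V.B)
  have hsF : V.e * 𝐬V.scurv = 𝐬V.scurv := by
    have := congrArg (fun M : Matrix V.ι V.ι (Form X) => 𝐬M) h.e_mul_scurv
    simp only [s_mul, h.e_graded.s_even] at this
    exact this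
  have hsF' : 𝐬V.scurv * V.e = 𝐬V.scurv := by
    have := congrArg (fun M : Matrix V.ι V.ι (Form X) => 𝐬M) h.scurv_mul_e
    simp only [s_mul, h.e_graded.s_even] at this
    exact this
  have hdF : 𝐝V.scurv = 𝐝V.e * V.scurv + V.e * 𝐝V.scurv := by
    conv_lhs => rw [← h.e_mul_scurv, d_mul, h.e_graded.s_even]
  have key : ∀ t ≥ 0, 𝐝(V.e * E t) * V.e + 𝐬(V.e * E t) * V.B - V.B * E t = 0 := by
    intro t ht
    refine MDeriv.unique (f := fun s => 𝐝(V.e * E s) * V.e + 𝐬(V.e * E s) * V.B - V.B * E s)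
      (g := fun _ => (0 : Matrix V.ι V.ι (Form X))) 𝐬V.scurv (fun s hs => ?_) (fun s _ => ?_) ?_ ht
    · have := hE.msmooth s
      refine (hd s).congr' (fun _ _ => rfl) ?_ hs
      have hb : V.B * (V.scurv * E s) = 𝐝V.scurv * (E s * V.e) + 𝐬V.scurv * (V.B * E s) := by
        rw [← massoc, ← h.bianchi, madd_mul, massoc,
          h.e_mul_flow hE hs, massoc]
      have h1 : 𝐝V.scurv * (E s * V.e) =
          𝐝V.e * (V.scurv * E s * V.e) + V.e * (𝐝V.scurv * (E s * V.e)) := by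
        conv_lhs => rw [hdF, madd_mul]
        simp only [massoc]
      have h2 : 𝐬V.scurv * (𝐝(V.e * E s) * V.e + 𝐬(V.e * E s) * V.B) =
          𝐬V.scurv * (𝐝(E s) * V.e) + 𝐬V.scurv * (𝐬(E s) * V.B) := by
        rw [hexp, mmul_add, mmul_add, ← massoc _ V.e, hsF',
          ← massoc _ V.e, hsF', ← h.e_mul_flow hE hs]
        have : 𝐬V.scurv * (𝐝V.e * (V.e * E s)) = 0 := by
          rw [← hsF', massoc, ← massoc (𝐝V.e), ← massoc V.e,
            h.e_d_e, mzero_mul, mmul_zero]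
        rw [this, zero_add]
      rw [d_neg, d_mul, s_neg, s_mul]
      rw [mmul_sub, h2]
      simp only [mneg_mul, mmul_neg, madd_mul, mmul_add]
      rw [hb, h1]
      have h3 : V.e * (𝐬V.scurv * 𝐬(E s) * V.B) = 𝐬V.scurv * (𝐬(E s) * V.B) := by
        rw [massoc, ← massoc, hsF]
      have h4 : V.e * (𝐬V.scurv * 𝐝(E s) * V.e) = 𝐬V.scurv * (𝐝(E s) * V.e) := by
        rw [massoc, ← massoc, hsF]
      rw [h3, h4, massoc (𝐝V.scurv)]
      abel
    · rw [mmul_zero, neg_zero]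
      exact MDeriv.const _
    · simp only [hE.zero, mmul_one]
      rw [h.e_graded.s_even, h.e_mul_B']
      abel
  exact sub_eq_zero.1 (key t ht)

/-- A superconnection determines a representation. -/
theorem isRep_repOf (h : IsSC β V) (hE : IsFlow V.scurv E) : IsRep β (V.repOf E) := by
  have := h.e_smooth; have := h.scurv_smooth; have := h.B_smooth
  have := fun g => h.ρ_smooth g
  have := fun t => hE.msmooth t
  have ha : ∀ g (t : ℝ≥0), (V.repOf E).a g t = V.ρ g * E t := fun _ _ => rfl
  have hb : ∀ g (t : ℝ≥0), (V.repOf E).b g t = V.B⋆g * (V.ρ g * E t) :=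
    fun _ _ => rfl
  have hρE : ∀ g (t : ℝ≥0), V.ρ g * E t * V.e = V.ρ g * E t := fun g t => by
    rw [massoc, ← h.e_mul_flow hE t.coe_nonneg, ← massoc, h.ρ_mul_e]
  have heρE : ∀ g (t : ℝ), V.e⋆g * (V.ρ g * E t) = V.ρ g * E t := fun g t => by
    rw [← massoc, h.e_mul_ρ]
  have hmul : ∀ g k (t s : ℝ≥0), (V.ρ g * E t)⋆k * (V.ρ k * E s) =
      (β g k : ℂ) • (V.ρ (g * k) * E (t + s)) := fun g k t s => by
    rw [mpull_mul, massoc, ← massoc _ (V.ρ k), h.flow_equivariant hE k t.coe_nonneg,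
      massoc, ← hE.add (s : ℝ) t.coe_nonneg, ← massoc, h.ρ_mul, msmul_mul]
  have hd : ∀ g (t : ℝ≥0), 𝐝(V.ρ g * E t) * V.e + 𝐬(V.ρ g * E t) * V.B =
      V.B⋆g * (V.ρ g * E t) := fun g t => by
    have h1 : V.ρ g * E t = V.ρ g * (V.e * E t) := by rw [← massoc, h.ρ_mul_e]
    rw [h1, d_mul, s_mul, (h.ρ_graded g).s_even, madd_mul, massoc (V.ρ g),
      massoc (V.ρ g), add_assoc, ← mmul_add, h.d_flow hE t.coe_nonneg, ← h1,
      ← massoc (V.B.map _), ← h.d_ρ g, madd_mul, massoc (𝐝(V.ρ g)),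
      massoc (𝐝(V.ρ g)), h.e_mul_flow hE t.coe_nonneg, massoc (E _), h.e_idem,
      massoc (V.ρ g)]
  have hd' : ∀ g k (t s : ℝ≥0), 𝐝((V.ρ g * E t)⋆k) * (V.ρ k * E s) +
      𝐬((V.ρ g * E t)⋆k) * (V.B⋆k * (V.ρ k * E s)) =
      (β g k : ℂ) • (V.B⋆(g * k) * (V.ρ (g * k) * E (t + s))) :=
    fun g k t s => by
    have h1 := congrArg (fun M : Matrix V.ι V.ι (Form X) => M⋆k) (hd g t)
    simp only [mpull_add, mpull_mul (X.act k) _ V.e, mpull_mul (X.act k) _ V.B] at h1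
    rw [mpull_mul (X.act k) (V.B.map _), mpull_act_act] at h1
    have h2 := congrArg (· * (V.ρ k * E s)) h1
    simp only [madd_mul] at h2
    rw [massoc _ (V.e.map _), heρE, massoc, massoc (V.B.map _),
      hmul, mmul_smul] at h2
    rw [d_pull, s_pull, h2]
  have hhom1 : ∀ g (t : ℝ≥0), V.e⋆g * (V.ρ g * E t) * V.e = V.ρ g * E t :=
    fun g t => by rw [heρE, hρE]
  have hhom2 : ∀ g (t : ℝ≥0), 𝐝(V.e⋆g) * (V.ρ g * E t) * V.e +
      𝐬(V.e⋆g) * (V.B⋆g * (V.ρ g * E t)) * V.e =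
      V.B⋆g * (V.ρ g * E t) := fun g t => by
    have h1 : V.e⋆g * V.B⋆g =
        V.B⋆g - 𝐝(V.e⋆g) * V.e⋆g := by
      rw [← mpull_mul, h.e_mul_B', mpull_sub, mpull_mul, d_pull]
    rw [s_pull, h.e_graded.s_even, massoc (𝐝(V.e.map _)), hρE,
      massoc (V.e.map _), massoc (V.B.map _), hρE,
      ← massoc (V.e.map _), h1, msub_mul,
      massoc (𝐝(V.e.map _)) (V.e.map _), heρE]
    abel
  have hb1 : ∀ g k (t s : ℝ≥0), (V.B⋆g * (V.ρ g * E t))⋆k *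
      (V.ρ k * E s) = (β g k : ℂ) • (V.B⋆(g * k) * (V.ρ (g * k) * E (t + s))) :=
    fun g k t s => by
    rw [mpull_mul (X.act k) (V.B.map _), mpull_act_act, massoc, hmul, mmul_smul]
  have hb2 : ∀ g k (t s : ℝ≥0),
      𝐝((V.B⋆g * (V.ρ g * E t))⋆k) * (V.ρ k * E s) +
      𝐬((V.B⋆g * (V.ρ g * E t))⋆k) *
        (V.B⋆k * (V.ρ k * E s)) =
      (β g k : ℂ) • (V.ρ (g * k) * -(V.scurv * E (t + s))) := fun g k t s => by
    have h8 : V.scurv⋆(g * k) = -((𝐝(V.B⋆(g * k)) +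
        𝐬(V.B⋆(g * k)) * V.B⋆(g * k)) *
          V.e⋆(g * k)) := by
      rw [PreBundle.scurv, mpull_neg, mpull_mul, mpull_add, mpull_mul, d_pull, s_pull]
    have h9 : V.ρ (g * k) * -(V.scurv * E (t + s)) =
        𝐝(V.B⋆(g * k)) * (V.ρ (g * k) * E (t + s)) +
        𝐬(V.B⋆(g * k)) *
          (V.B⋆(g * k) * (V.ρ (g * k) * E (t + s))) := by
      rw [mmul_neg, ← massoc (V.ρ _), ← h.scurv_equivariant, h8, mneg_mul,
        mneg_mul, neg_neg, massoc, massoc, heρE, madd_mul,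
        massoc]
    rw [mpull_mul (X.act k) (V.B.map _), mpull_act_act, d_mul, s_mul, madd_mul, add_assoc,
      massoc, massoc, massoc, ← mmul_add, hd', hmul,
      mmul_smul, mmul_smul, ← smul_add, h9]
  refine ⟨h.e_smooth.smooth, isEvenMatrix_iff.2 h.e_graded.isPar_even, h.e_idem, ?_, ?_, ?_, ?_, ?_⟩
  · intro g i j
    have h1 : MSmoothFam fun t => V.ρ g * E t := (MSmoothFam.const _).mul hE.msmoothFam
    have h2 : MSmoothFam fun t => V.B⋆g * (V.ρ g * E t) :=
      (MSmoothFam.const _).mul h1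
    exact ⟨h1.isSmoothFam i j, h2.isSmoothFam i j⟩
  · intro g
    rw [R_even_iff]
    intro t
    have h1 := (h.ρ_graded g).isPar_even.mul_ee (hE.isPar h.scurv_even t.coe_nonneg)
    exact ⟨h1, (h.B_odd.pull _).mul_oe h1⟩
  · intro g
    rw [R_hom_iff]
    intro t
    exact ⟨(hhom1 g t).symm, (hhom2 g t).symm⟩
  · have h1 : (V.repOf E).a 1 0 = V.e := by
      rw [ha, NNReal.coe_zero, hE.zero, mmul_one, h.ρ_one]
    exact h1
  · intro g k
    rw [R_comp_iff]
    intro t s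
    have ha' : (V.repOf E).a' (g * k) (t + s) = V.ρ (g * k) * -(V.scurv * E (t + s)) := by
      have := (hE.mderiv (t + s)).mul_left (V.ρ (g * k))
      exact PreRep.a'_eq (ha (g * k)) (by rw [NNReal.coe_add]; exact this)
    rw [ha, ha, hb, hb, ha, hb, ha', NNReal.coe_add]
    exact ⟨hmul g k t s, hd' g k t s, hb1 g k t s, hb2 g k t s⟩

theorem isRep_toSRep (h : IsSC β V) : IsRep β V.toSRep := by
  have := h.scurv_smooth
  exact h.isRep_repOf (isFlow_fexp _)

theorem repOf_eq (h : IsSC β V) (hE : IsFlow V.scurv E) : V.repOf E = V.toSRep := by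
  have := h.scurv_smooth
  have h1 : ∀ t : ℝ≥0, E t = fexp V.scurv t := fun t => hE.unique (isFlow_fexp _) t.2
  unfold PreBundle.toSRep PreBundle.repOf
  simp only [h1]

end IsSC

end SuperConnections

end

section

section Conjugation

variable {G : Type v} [Group G] {X Y Z : GMfd.{u} G} {β : G → G → Circle} {m n o : Type}

/-! ### Matrices of functions on morphisms -/

/-- The coefficient of `1` of a matrix of functions on morphisms. -/
def mbody (M : Matrix m n (OddExt (Fam X))) (t : ℝ≥0) : Matrix m n (Form X) :=
  Matrix.of fun i j => (M i j).body t

/-- The coefficient of `θ` of a matrix of functions on morphisms. -/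
def msoul (M : Matrix m n (OddExt (Fam X))) (t : ℝ≥0) : Matrix m n (Form X) :=
  Matrix.of fun i j => (M i j).soul t

theorem oddMatrix_ext {M N : Matrix m n (OddExt (Fam X))} (h1 : ∀ t, mbody M t = mbody N t)
    (h2 : ∀ t, msoul M t = msoul N t) : M = N := by
  ext1 i j
  apply OddExt.ext
  · funext t; exact congrFun (congrFun (h1 t) i) j
  · funext t; exact congrFun (congrFun (h2 t) i) j

section

variable [Fintype n]

theorem mbody_mul (M : Matrix m n (OddExt (Fam X))) (N : Matrix n o (OddExt (Fam X))) (t : ℝ≥0) :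
    mbody (M * N) t = mbody M t * mbody N t := by
  have : ∀ {m n : Type} (M : Matrix m n (OddExt (Fam X))),
      mbody M t = (M.map OddExt.body).map (evalAt t) := fun _ => rfl
  rw [this, OddExt.body_mul, mmap_mul]; rfl

theorem msoul_mul (M : Matrix m n (OddExt (Fam X))) (N : Matrix n o (OddExt (Fam X))) (t : ℝ≥0) :
    msoul (M * N) t = msoul M t * mbody N t + 𝐬(mbody M t) * msoul N t := by
  have : ∀ {m n : Type} (M : Matrix m n (OddExt (Fam X))),
      msoul M t = (M.map OddExt.soul).map (evalAt t) := fun _ => rfl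
  rw [this, OddExt.soul_mul, mmap_add _ (map_add (evalAt t)), mmap_mul,
    mmap_mul]; rfl

end

theorem mbody_src (M : Matrix m n (Form X)) (t : ℝ≥0) : mbody (M.map src) t = M := rfl
theorem msoul_src (M : Matrix m n (Form X)) (t : ℝ≥0) : msoul (M.map src) t = 0 := rfl
theorem mbody_tgt (g : G) (M : Matrix m n (Form X)) (t : ℝ≥0) :
    mbody (M.map (tgt g)) t = M⋆g := rfl
theorem msoul_tgt (g : G) (M : Matrix m n (Form X)) (t : ℝ≥0) :
    msoul (M.map (tgt g)) t = 𝐝(M⋆g) := rfl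

theorem msoul_mul_src [Fintype n] (M : Matrix m n (OddExt (Fam X))) (N : Matrix n o (Form X))
    (t : ℝ≥0) : msoul (M * N.map src) t = msoul M t * N := by
  rw [msoul_mul, msoul_src, mbody_src, mmul_zero, add_zero]

theorem mbody_tgt_mul_src [Fintype m] [Fintype n] {o' : Type} (g : G) (b : Matrix o m (Form X))
    (R : Matrix m n (OddExt (Fam X))) (a : Matrix n o' (Form X)) (t : ℝ≥0) :
    mbody (b.map (tgt g) * R * a.map src) t = b⋆g * mbody R t * a := by
  rw [mbody_mul, mbody_mul, mbody_tgt, mbody_src]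

theorem msoul_tgt_mul_src [Fintype m] [Fintype n] {o' : Type} (g : G) (b : Matrix o m (Form X))
    (R : Matrix m n (OddExt (Fam X))) (a : Matrix n o' (Form X)) (t : ℝ≥0) :
    msoul (b.map (tgt g) * R * a.map src) t = 𝐝(b⋆g) * mbody R t * a +
      𝐬(b⋆g) * msoul R t * a := by
  rw [msoul_mul_src, msoul_mul, mbody_tgt, msoul_tgt, madd_mul]

theorem src_mul [Fintype n] (M : Matrix m n (Form X)) (N : Matrix n o (Form X)) :
    (M * N).map src = M.map src * N.map src :=
  oddMatrix_ext (fun t => by simp only [mbody_mul, mbody_src])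
    (fun t => by simp [msoul_mul, mbody_src, msoul_src])

theorem tgt_mul [Fintype n] (g : G) (M : Matrix m n (Form X)) (N : Matrix n o (Form X))
    [MSmooth M] [MSmooth N] : (M * N).map (tgt g) = M.map (tgt g) * N.map (tgt g) :=
  oddMatrix_ext (fun t => by simp only [mbody_mul, mbody_tgt, mpull_mul])
    (fun t => by simp only [msoul_mul, mbody_tgt, msoul_tgt, mpull_mul, d_mul])

/-! ### Components of a representation -/

theorem IsSmoothFam.isSmooth {P : Fam X} (h : IsSmoothFam P) (t : ℝ≥0) : IsSmooth (P t) :=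
  fun x₀ => by
    have h1 : ContDiffOn ℝ ∞ (fun y : X.E => ((t : ℝ), y)) (extChartAt X.I x₀).target :=
      contDiffOn_const.prodMk contDiffOn_id
    have := ContDiffOn.comp (g := fun p : ℝ × X.E => chartRep (P p.1.toNNReal) x₀ p.2)
      (f := fun y : X.E => ((t : ℝ), y)) (h x₀) h1 fun y hy => Set.mk_mem_prod t.2 hy
    simpa only [Function.comp_def, Real.toNNReal_coe] using this

theorem IsSmoothFam.hasDerivWithinAt {P : Fam X} (h : IsSmoothFam P) (t : ℝ≥0) (x : X.carrier) :
    HasDerivWithinAt (fun s : ℝ => P s.toNNReal x) (tDeriv P t x) (Set.Ici 0) t := by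
  have h1 : ContDiffOn ℝ ∞ (fun s : ℝ => (s, extChartAt X.I x x)) (Set.Ici 0) :=
    contDiffOn_id.prodMk contDiffOn_const
  have h2 := ContDiffOn.comp (g := fun p : ℝ × X.E => chartRep (P p.1.toNNReal) x p.2)
    (f := fun s : ℝ => (s, extChartAt X.I x x)) (h x) h1
    fun s hs => Set.mk_mem_prod hs (mem_extChartAt_target x)
  have h3 := (Ext.mapL (chartDeriv x x)).differentiableAt.comp_differentiableWithinAt (t : ℝ)
    (h2.differentiableOn (by simp) t t.2)
  refine (h3.congr (fun s _ => ?_) ?_).hasDerivWithinAt <;>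
  exact form_eq_chartRep _ (mem_extChartAt_source x)

namespace IsRep

variable {D : PreRep X}

theorem msmooth_e (h : IsRep β D) : MSmooth D.e := ⟨h.e_smooth⟩

theorem isPar_e (h : IsRep β D) : IsPar false D.par D.par D.e := isEvenMatrix_iff.1 h.e_even

theorem msmooth_a (h : IsRep β D) (g : G) (t : ℝ≥0) : MSmooth (D.a g t) :=
  ⟨fun i j => (h.R_smooth g i j).1.isSmooth t⟩

theorem msmooth_b (h : IsRep β D) (g : G) (t : ℝ≥0) : MSmooth (D.b g t) :=
  ⟨fun i j => (h.R_smooth g i j).2.isSmooth t⟩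

theorem hom (h : IsRep β D) (g : G) (t : ℝ≥0) :
    D.a g t = D.e⋆g * D.a g t * D.e ∧
    D.b g t = 𝐝(D.e⋆g) * D.a g t * D.e +
        𝐬(D.e⋆g) * D.b g t * D.e := (R_hom_iff D g).1 (h.R_hom g) t

theorem comp (h : IsRep β D) (g k : G) (t s : ℝ≥0) :
    (D.a g t)⋆k * D.a k s = (β g k : ℂ) • D.a (g * k) (t + s) ∧
      𝐝((D.a g t)⋆k) * D.a k s +
        𝐬((D.a g t)⋆k) * D.b k s = (β g k : ℂ) • D.b (g * k) (t + s) ∧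
      (D.b g t)⋆k * D.a k s = (β g k : ℂ) • D.b (g * k) (t + s) ∧
      𝐝((D.b g t)⋆k) * D.a k s +
        𝐬((D.b g t)⋆k) * D.b k s = (β g k : ℂ) • D.a' (g * k) (t + s) :=
  (R_comp_iff D _ g k).1 (h.R_comp g k) t s

theorem isPar_a (h : IsRep β D) (g : G) (t : ℝ≥0) : IsPar false D.par D.par (D.a g t) :=
  ((R_even_iff D g).1 (h.R_even g) t).1

theorem isPar_b (h : IsRep β D) (g : G) (t : ℝ≥0) : IsPar true D.par D.par (D.b g t) :=
  ((R_even_iff D g).1 (h.R_even g) t).2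

theorem a_one_zero (h : IsRep β D) : D.a 1 0 = D.e := h.R_one

theorem a_mul_e (h : IsRep β D) (g : G) (t : ℝ≥0) : D.a g t * D.e = D.a g t := by
  conv_lhs => rw [(h.hom g t).1, massoc, h.e_idem]
  exact (h.hom g t).1.symm

theorem e_mul_a (h : IsRep β D) (g : G) (t : ℝ≥0) :
    D.e⋆g * D.a g t = D.a g t := by
  conv_lhs => rw [(h.hom g t).1, ← massoc, ← massoc, ← mpull_mul, h.e_idem]
  exact (h.hom g t).1.symm

theorem b_mul_e (h : IsRep β D) (g : G) (t : ℝ≥0) : D.b g t * D.e = D.b g t := by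
  conv_lhs => rw [(h.hom g t).2, madd_mul, massoc _ D.e D.e,
    massoc _ D.e D.e, h.e_idem]
  exact (h.hom g t).2.symm

theorem b_eq (h : IsRep β D) (g : G) (t : ℝ≥0) :
    D.b g t = 𝐝(D.e⋆g) * D.a g t +
        𝐬(D.e⋆g) * D.b g t := by
  conv_lhs => rw [(h.hom g t).2, massoc, massoc, h.a_mul_e, h.b_mul_e]

theorem mderiv_a (h : IsRep β D) (g : G) (t : ℝ≥0) :
    MDeriv (fun s => D.a g s.toNNReal) (D.a' g t) t := fun i j x =>
  (h.R_smooth g i j).1.hasDerivWithinAt t x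

theorem msmoothFam_a (h : IsRep β D) (g : G) : MSmoothFam fun s => D.a g s.toNNReal :=
  fun i j => (h.R_smooth g i j).1

theorem msmoothFam_b (h : IsRep β D) (g : G) : MSmoothFam fun s => D.b g s.toNNReal :=
  fun i j => (h.R_smooth g i j).2

end IsRep

theorem MSmoothFam.add {f f' : ℝ → Matrix m n (Form X)} (hf : MSmoothFam f)
    (hf' : MSmoothFam f') : MSmoothFam fun t => f t + f' t := fun i j x₀ => by
  simp only [madd_apply, chartRep_add, Pi.add_apply]
  exact (hf i j x₀).add (hf' i j x₀)

/-! ### Isomorphisms of idempotent matrices -/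

/-- Mutually inverse smooth even maps between the images of idempotent matrices of forms. -/
structure MIso [Fintype m] [Fintype n] (p : m → Bool) (e : Matrix m m (Form X)) (q : n → Bool)
    (e' : Matrix n n (Form X)) (a : Matrix n m (Form X)) (b : Matrix m n (Form X)) : Prop where
  a_smooth : MSmooth a
  b_smooth : MSmooth b
  a_even : IsPar false q p a
  b_even : IsPar false p q b
  e_a : e' * a = a
  a_e : a * e = a
  e_b : e * b = b
  b_e : b * e' = b
  ab : a * b = e'
  ba : b * a = e

namespace MIso

variable [Fintype m] [Fintype n] [Fintype o] {p : m → Bool} {e : Matrix m m (Form X)}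
  {q : n → Bool} {e' : Matrix n n (Form X)} {a : Matrix n m (Form X)} {b : Matrix m n (Form X)}
  {r : o → Bool} {e'' : Matrix o o (Form X)} {a' : Matrix o n (Form X)} {b' : Matrix n o (Form X)}

theorem refl (he : MSmooth e) (hp : IsPar false p p e) (h : e * e = e) : MIso p e p e e e :=
  ⟨he, he, hp, hp, h, h, h, h, h, h⟩

theorem symm (h : MIso p e q e' a b) : MIso q e' p e b a :=
  ⟨h.b_smooth, h.a_smooth, h.b_even, h.a_even, h.e_b, h.b_e, h.e_a, h.a_e, h.ba, h.ab⟩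

theorem trans (h : MIso p e q e' a b) (h' : MIso q e' r e'' a' b') :
    MIso p e r e'' (a' * a) (b * b') where
  a_smooth := by have := h.a_smooth; have := h'.a_smooth; infer_instance
  b_smooth := by have := h.b_smooth; have := h'.b_smooth; infer_instance
  a_even := h'.a_even.mul_ee h.a_even
  b_even := h.b_even.mul_ee h'.b_even
  e_a := by rw [← massoc, h'.e_a]
  a_e := by rw [massoc, h.a_e]
  e_b := by rw [← massoc, h.e_b]
  b_e := by rw [massoc, h'.b_e]
  ab := by rw [massoc, ← massoc a, h.ab, h'.e_b, h'.ab]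
  ba := by rw [massoc, ← massoc b', h'.ba, h.e_a, h.ba]

theorem pull {p : m → Bool} {e : Matrix m m (Form Y)} {q : n → Bool} {e' : Matrix n n (Form Y)}
    {a : Matrix n m (Form Y)} {b : Matrix m n (Form Y)} (h : MIso p e q e' a b)
    (f : X.carrier → Y.carrier) [SmoothMap X Y f] :
    MIso p (e.map (pull f)) q (e'.map (fpull f)) (a.map (fpull f))
      (b.map (fpull f)) where
  a_smooth := by have := h.a_smooth; infer_instance
  b_smooth := by have := h.b_smooth; infer_instance
  a_even := h.a_even.pull f
  b_even := h.b_even.pull f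
  e_a := by rw [← mpull_mul, h.e_a]
  a_e := by rw [← mpull_mul, h.a_e]
  e_b := by rw [← mpull_mul, h.e_b]
  b_e := by rw [← mpull_mul, h.b_e]
  ab := by rw [← mpull_mul, h.ab]
  ba := by rw [← mpull_mul, h.ba]

theorem e_smooth (h : MIso p e q e' a b) : MSmooth e := by
  have := h.a_smooth; have := h.b_smooth
  rw [← h.ba]; infer_instance

theorem e_even (h : MIso p e q e' a b) : IsPar false p p e := by
  rw [← h.ba]; exact h.b_even.mul_ee h.a_even

theorem e_idem (h : MIso p e q e' a b) : e * e = e := by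
  conv_lhs => rw [← h.ba]
  rw [massoc, h.ba, h.a_e, h.ba]

end MIso

/-! ### Isomorphisms of representations -/

/-- The conditions on the data of a representation that make isomorphism an equivalence relation. -/
structure PreRep.Adm (D : PreRep X) : Prop where
  e_smooth : MSmooth D.e
  e_even : IsPar false D.par D.par D.e
  e_idem : D.e * D.e = D.e
  R_hom : ∀ g, D.R g = D.e.map (tgt g) * D.R g * D.e.map src

theorem IsRep.adm {D : PreRep X} (h : IsRep β D) : D.Adm :=
  ⟨h.msmooth_e, h.isPar_e, h.e_idem, h.R_hom⟩

theorem PreRep.iso_iff {D D' : PreRep X} (h : D.Adm) (h' : D'.Adm) : D.Iso D' ↔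
    ∃ a b, MIso D.par D.e D'.par D'.e a b ∧
      ∀ g, D'.R g * a.map src = a.map (tgt g) * D.R g := by
  constructor
  · rintro ⟨a, b, h1, h2, h3, h4, h5, h6, h7, h8, h9⟩
    refine ⟨a, b, ⟨⟨h1⟩, ⟨h2⟩, isEvenMatrix_iff.1 h3, isEvenMatrix_iff.1 h4, ?_, ?_, ?_, ?_, h7, h8⟩,
      h9⟩
    · conv_lhs => rw [h5, ← massoc, ← massoc, h'.e_idem]
      exact h5.symm
    · conv_lhs => rw [h5, massoc, h.e_idem]
      exact h5.symm
    · conv_lhs => rw [h6, ← massoc, ← massoc, h.e_idem]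
      exact h6.symm
    · conv_lhs => rw [h6, massoc, h'.e_idem]
      exact h6.symm
  · rintro ⟨a, b, hab, h9⟩
    exact ⟨a, b, hab.a_smooth.smooth, hab.b_smooth.smooth, isEvenMatrix_iff.2 hab.a_even,
      isEvenMatrix_iff.2 hab.b_even, by rw [hab.e_a, hab.a_e], by rw [hab.e_b, hab.b_e], hab.ab,
      hab.ba, h9⟩

namespace PreRep.Adm

variable {D D' : PreRep X}

theorem R_src (h : D.Adm) (g : G) : D.R g * D.e.map src = D.R g := by
  conv_lhs => rw [h.R_hom g, massoc, ← src_mul, h.e_idem]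
  exact (h.R_hom g).symm

theorem tgt_R (h : D.Adm) (g : G) : D.e.map (tgt g) * D.R g = D.R g := by
  have := h.e_smooth
  conv_lhs => rw [h.R_hom g, ← massoc, ← massoc, ← tgt_mul, h.e_idem]
  exact (h.R_hom g).symm

theorem pull {D : PreRep Y} (h : D.Adm) (f : X.carrier → Y.carrier) [hf : SmoothMap X Y f]
    (he : ∀ g x, f (X.act g x) = Y.act g (f x)) : (D.pull f).Adm := by
  have := h.e_smooth
  have h1 : MSmooth (D.e.map (fpull f)) := inferInstance
  refine ⟨h1, h.e_even.pull f, ?_, fun g => ?_⟩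
  · show D.e.map (fpull f) * D.e.map (fpull f) = D.e.map (fpull f)
    rw [← mpull_mul, h.e_idem]
  · rw [R_hom_iff]
    intro t
    have h2 := (R_hom_iff D g).1 (h.R_hom g) t
    have hfg : f ∘ X.act g = Y.act g ∘ f := funext fun x => he g x
    have h3 : (D.e.map (fpull f))⋆g =
        (D.e.map (fpull (Y.act g))).map (fpull f) := by
      rw [← mpull_comp, ← mpull_comp, hfg]
    constructor
    · have h4 := congrArg (fun M : Matrix _ _ (Form Y) => M.map (fpull f)) h2.1
      simp only [mpull_mul, ← h3] at h4
      exact h4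
    · have h4 := congrArg (fun M : Matrix _ _ (Form Y) => M.map (fpull f)) h2.2
      simp only [mpull_mul, mpull_add, ← d_pull, ← s_pull, ← h3] at h4
      exact h4

end PreRep.Adm

theorem mpull_equivariant {f : X.carrier → Y.carrier} [SmoothMap X Y f]
    (he : ∀ g x, f (X.act g x) = Y.act g (f x)) (g : G) (M : Matrix m n (Form Y)) :
    (M.map (pull f))⋆g = (M.map (pull (Y.act g))).map (pull f) := by
  have hfg : f ∘ X.act g = Y.act g ∘ f := funext fun x => he g x
  rw [← mpull_comp, ← mpull_comp, hfg]

namespace PreRep.Iso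

variable {D D' D'' : PreRep X}

theorem refl (h : D.Adm) : D.Iso D :=
  (PreRep.iso_iff h h).2 ⟨D.e, D.e, MIso.refl h.e_smooth h.e_even h.e_idem,
    fun g => by rw [h.R_src, h.tgt_R]⟩

theorem symm (hD : D.Adm) (hD' : D'.Adm) (h : D.Iso D') : D'.Iso D := by
  obtain ⟨a, b, hab, hR⟩ := (PreRep.iso_iff hD hD').1 h
  refine (PreRep.iso_iff hD' hD).2 ⟨b, a, hab.symm, fun g => ?_⟩
  have := hab.a_smooth; have := hab.b_smooth
  have h1 := congrArg (fun M => b.map (tgt g) * M * b.map src) (hR g)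
  simp only [massoc] at h1
  rw [← src_mul, hab.ab, hD'.R_src, ← massoc, ← tgt_mul, hab.ba, ← massoc,
    hD.tgt_R] at h1
  exact h1.symm

theorem trans (hD : D.Adm) (hD' : D'.Adm) (hD'' : D''.Adm) (h : D.Iso D') (h' : D'.Iso D'') :
    D.Iso D'' := by
  obtain ⟨a, b, hab, hR⟩ := (PreRep.iso_iff hD hD').1 h
  obtain ⟨a', b', hab', hR'⟩ := (PreRep.iso_iff hD' hD'').1 h'
  refine (PreRep.iso_iff hD hD'').2 ⟨_, _, hab.trans hab', fun g => ?_⟩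
  have := hab.a_smooth; have := hab'.a_smooth
  rw [src_mul, tgt_mul, ← massoc, hR', massoc, hR, massoc]

theorem pull {D D' : PreRep Y} (hD : D.Adm) (hD' : D'.Adm) (h : D.Iso D')
    (f : X.carrier → Y.carrier) [SmoothMap X Y f]
    (he : ∀ g x, f (X.act g x) = Y.act g (f x)) : (D.pull f).Iso (D'.pull f) := by
  obtain ⟨a, b, hab, hR⟩ := (PreRep.iso_iff hD hD').1 h
  have := hab.a_smooth
  refine (PreRep.iso_iff (hD.pull f he) (hD'.pull f he)).2
    ⟨a.map (fpull f), b.map (fpull f), hab.pull f, fun g => ?_⟩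
  refine oddMatrix_ext (fun t => ?_) (fun t => ?_)
  · have h1 := congrArg (fun M => (mbody M t).map (fpull f)) (hR g)
    simp only [mbody_mul, mbody_src, mbody_tgt, mpull_mul, ← mpull_equivariant he] at h1
    have e1 := mbody_mul ((D'.R g).map (OddExt.map fun P t => fpull f (P t)))
      ((a.map (fpull f)).map src) t
    have e2 := mbody_mul ((a.map (fpull f)).map (tgt g))
      ((D.R g).map (OddExt.map fun P t => fpull f (P t))) t
    rw [mbody_src] at e1
    rw [mbody_tgt] at e2
    exact e1.trans (h1.trans e2.symm)
  · have h1 := congrArg (fun M => (msoul M t).map (fpull f)) (hR g)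
    simp only [msoul_mul, mbody_src, mbody_tgt, msoul_src, msoul_tgt, mpull_mul, mpull_add,
      mmul_zero, add_zero, ← d_pull, ← s_pull, ← mpull_equivariant he] at h1
    have e1 := msoul_mul_src ((D'.R g).map (OddExt.map fun P t => fpull f (P t)))
      (a.map (fpull f)) t
    have e2 := msoul_mul ((a.map (fpull f)).map (tgt g))
      ((D.R g).map (OddExt.map fun P t => fpull f (P t))) t
    rw [mbody_tgt, msoul_tgt] at e2
    exact e1.trans (h1.trans e2.symm)

end PreRep.Iso

theorem PreRep.Iso.of_equiv {D D' : PreRep X} (h : D.Adm) (h' : D'.Adm) (σ : D.ι ≃ D'.ι)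
    (hp : ∀ i, D'.par (σ i) = D.par i) (he : ∀ i j, D'.e (σ i) (σ j) = D.e i j)
    (hR : ∀ g i j, D'.R g (σ i) (σ j) = D.R g i j) : D.Iso D' := by
  have he' : D.e = D'.e.submatrix σ σ := by ext1 i j; exact (he i j).symm
  have hR' : ∀ g, D.R g = (D'.R g).submatrix σ σ := fun g => by ext1 i j; exact (hR g i j).symm
  refine (PreRep.iso_iff h h').2 ⟨D'.e.submatrix id σ, D'.e.submatrix σ id,
    ⟨⟨fun i j => h'.e_smooth.smooth _ _⟩, ⟨fun i j => h'.e_smooth.smooth _ _⟩,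
      fun i j => by rw [← hp]; exact h'.e_even i (σ j), fun i j => by rw [← hp]; exact h'.e_even _ _,
      ?_, ?_, ?_, ?_, ?_, ?_⟩, fun g => ?_⟩
  · exact (msubmatrix_mul_equiv D'.e D'.e id (Equiv.refl _) σ).trans (by rw [h'.e_idem])
  · rw [he', msubmatrix_mul_equiv, h'.e_idem]
  · rw [he', msubmatrix_mul_equiv, h'.e_idem]
  · exact (msubmatrix_mul_equiv D'.e D'.e σ (Equiv.refl _) id).trans (by rw [h'.e_idem])
  · rw [msubmatrix_mul_equiv, h'.e_idem, Matrix.submatrix_id_id]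
  · rw [he']
    exact (msubmatrix_mul_equiv D'.e D'.e σ (Equiv.refl _) σ).trans (by rw [h'.e_idem])
  · have h1 : D'.R g * (D'.e.map src).submatrix id σ = (D'.R g).submatrix id σ :=
      (msubmatrix_mul_equiv (D'.R g) (D'.e.map src) id (Equiv.refl _) σ).trans
        (by rw [h'.R_src])
    have h2 : (D'.e.map (tgt g)).submatrix id σ * (D'.R g).submatrix σ σ =
        (D'.R g).submatrix id σ := by
      rw [msubmatrix_mul_equiv, h'.tgt_R]
    rw [hR']
    exact h1.trans h2.symm

/-! ### Transport of a representation along an isomorphism -/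

/-- Transport of a representation along an isomorphism `a` of idempotents with inverse `b`. -/
def PreRep.conj (D : PreRep X) [Fintype m] [DecidableEq m] (p : m → Bool) (e : Matrix m m (Form X))
    (a : Matrix D.ι m (Form X)) (b : Matrix m D.ι (Form X)) : PreRep X where
  ι := m
  par := p
  e := e
  R g := b.map (tgt g) * D.R g * a.map src

section Conj

variable {D : PreRep X} [Fintype m] [DecidableEq m] {p : m → Bool} {e : Matrix m m (Form X)}
  {a : Matrix D.ι m (Form X)} {b : Matrix m D.ι (Form X)}

theorem PreRep.conj_a (g : G) (t : ℝ≥0) :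
    (D.conj p e a b).a g t = b⋆g * D.a g t * a :=
  mbody_tgt_mul_src _ _ _ _ _

theorem PreRep.conj_b (g : G) (t : ℝ≥0) :
    (D.conj p e a b).b g t = 𝐝(b⋆g) * D.a g t * a +
      𝐬(b⋆g) * D.b g t * a :=
  msoul_tgt_mul_src _ _ _ _ _

theorem PreRep.conj_hom (h : MIso p e D.par D.e a b) (g : G) :
    (D.conj p e a b).R g =
      (D.conj p e a b).e.map (tgt g) * (D.conj p e a b).R g * (D.conj p e a b).e.map src := by
  have := h.b_smooth; have := h.e_smooth
  suffices b.map (tgt g) * D.R g * a.map src =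
    e.map (tgt g) * (b.map (tgt g) * D.R g * a.map src) * e.map src from this
  rw [massoc (e.map _), massoc (b.map (tgt g) * D.R g), ← src_mul, h.a_e,
    ← massoc (e.map _), ← massoc (e.map _), ← tgt_mul, h.e_b]

theorem PreRep.conj_iso (h : MIso p e D.par D.e a b) (hD : D.Adm) : (D.conj p e a b).Iso D := by
  refine (PreRep.iso_iff ⟨h.e_smooth, h.e_even, h.e_idem, PreRep.conj_hom h⟩ hD).2
    ⟨a, b, h, fun g => ?_⟩
  have := h.a_smooth; have := h.b_smooth
  show D.R g * a.map src = a.map (tgt g) * (b.map (tgt g) * D.R g * a.map src)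
  rw [← massoc, ← massoc, ← tgt_mul, h.ab, hD.tgt_R]

theorem IsRep.conj (h : MIso p e D.par D.e a b) (hD : IsRep β D) : IsRep β (D.conj p e a b) := by
  have := h.a_smooth; have := h.b_smooth; have := h.e_smooth; have := hD.msmooth_e
  have := hD.msmooth_a; have := hD.msmooth_b
  have hpar : ∀ g t, IsPar false p p (b⋆g * D.a g t * a) := fun g t =>
    ((h.b_even.pull _).mul_ee (hD.isPar_a g t)).mul_ee h.a_even
  have hpar' : ∀ g t, IsPar true p p (𝐝(b⋆g) * D.a g t * a +
      𝐬(b⋆g) * D.b g t * a) := fun g t =>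
    (((h.b_even.pull _).d.mul_oe (hD.isPar_a g t)).mul_oe h.a_even).add
      (((h.b_even.pull _).s.mul_eo (hD.isPar_b g t)).mul_oe h.a_even)
  refine ⟨h.e_smooth.smooth, isEvenMatrix_iff.2 h.e_even, h.e_idem, fun g i j => ?_, fun g => ?_,
    PreRep.conj_hom h, ?_, fun g k => ?_⟩
  · have h1 : MSmoothFam fun t => b⋆g * D.a g t.toNNReal * a :=
      ((MSmoothFam.const _).mul (hD.msmoothFam_a g)).mul (MSmoothFam.const a)
    have h2 : MSmoothFam fun t => 𝐝(b⋆g) * D.a g t.toNNReal * a +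
        𝐬(b⋆g) * D.b g t.toNNReal * a :=
      (((MSmoothFam.const _).mul (hD.msmoothFam_a g)).mul (MSmoothFam.const a)).add
        (((MSmoothFam.const _).mul (hD.msmoothFam_b g)).mul (MSmoothFam.const a))
    have h3 : ((D.conj p e a b).R g i j).body = fun t : ℝ≥0 =>
        (b⋆g * D.a g (t : ℝ).toNNReal * a) i j := by
      funext t
      rw [Real.toNNReal_coe, ← PreRep.conj_a]; rfl
    have h4 : ((D.conj p e a b).R g i j).soul = fun t : ℝ≥0 =>
        (𝐝(b⋆g) * D.a g (t : ℝ).toNNReal * a +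
        𝐬(b⋆g) * D.b g (t : ℝ).toNNReal * a) i j := by
      funext t
      rw [Real.toNNReal_coe, ← PreRep.conj_b]; rfl
    rw [h3, h4]
    exact ⟨h1.isSmoothFam i j, h2.isSmoothFam i j⟩
  · rw [R_even_iff]
    intro t
    rw [PreRep.conj_a, PreRep.conj_b]
    exact ⟨hpar g t, hpar' g t⟩
  · show (D.conj p e a b).a 1 0 = e
    rw [PreRep.conj_a, mpull_act_one, hD.a_one_zero, h.b_e, h.ba]
  · rw [R_comp_iff]
    intro t s
    have ha' : (D.conj p e a b).a' (g * k) (t + s) =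
        b⋆(g * k) * D.a' (g * k) (t + s) * a := by
      refine PreRep.a'_eq (f := fun t => b⋆(g * k) * D.a (g * k) t.toNNReal * a)
        (fun s => ?_) (((hD.mderiv_a (g * k) (t + s)).mul_left _).mul_right a)
      rw [Real.toNNReal_coe, PreRep.conj_a]
    set bg := b⋆(g * k) with hbg
    set α := (D.a g t)⋆k with hα
    set γ := (D.b g t)⋆k with hγ
    set ak := a⋆k with hak
    set bk := b⋆k with hbk
    set ek := D.e⋆k with hek
    have h1 : (b⋆g * D.a g t * a)⋆k = bg * α * ak := by
      rw [mpull_mul, mpull_mul, mpull_act_act]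
    have h2 : (𝐝(b⋆g) * D.a g t * a +
        𝐬(b⋆g) * D.b g t * a)⋆k =
        (𝐝bg * α + 𝐬bg * γ) * ak := by
      rw [mpull_add, mpull_mul, mpull_mul, mpull_mul, mpull_mul, ← d_pull, ← s_pull, mpull_act_act,
        madd_mul]
    have hab : ak * bk = ek := by rw [hak, hbk, ← mpull_mul, h.ab]
    have hdab : 𝐝ak * bk + 𝐬ak * 𝐝bk = 𝐝ek := by rw [← hab, d_mul]
    have hsab : 𝐬ak * 𝐬bk = 𝐬ek := by rw [← hab, s_mul]
    have hbe := hD.b_eq k s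
    have hae := hD.e_mul_a k s
    rw [← hek] at hbe hae
    obtain ⟨c1, c2, c3, c4⟩ := hD.comp g k t s
    rw [← hα] at c1 c2
    rw [← hγ] at c3 c4
    have key : ∀ (P : Matrix m D.ι (Form X)) [MSmooth P],
        𝐝(P * ak) * (bk * D.a k s * a) + 𝐬(P * ak) * (𝐝bk * D.a k s * a + 𝐬bk * D.b k s * a) =
        (𝐝P * D.a k s + 𝐬P * D.b k s) * a := fun P _ => by
      have e1 : 𝐝(P * ak) * (bk * D.a k s * a) +
          𝐬(P * ak) * (𝐝bk * D.a k s * a + 𝐬bk * D.b k s * a) =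
          (𝐝P * ((ak * bk) * D.a k s) + 𝐬P * ((𝐝ak * bk + 𝐬ak * 𝐝bk) * D.a k s +
            (𝐬ak * 𝐬bk) * D.b k s)) * a := by
        rw [d_mul, s_mul]
        simp only [madd_mul, mmul_add, massoc]
        abel
      rw [e1, hab, hdab, hsab, hae, ← hbe]
    have r1 : bg * α * ak * (bk * D.a k s * a) =
        (β g k : ℂ) • (bg * D.a (g * k) (t + s) * a) := by
      calc bg * α * ak * (bk * D.a k s * a) = bg * (α * ((ak * bk) * D.a k s)) * a := by
            simp only [massoc]
        _ = _ := by rw [hab, hae, c1, mmul_smul, msmul_mul]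
    have r2 : 𝐝(bg * α * ak) * (bk * D.a k s * a) +
        𝐬(bg * α * ak) * (𝐝bk * D.a k s * a + 𝐬bk * D.b k s * a) =
        (β g k : ℂ) • (𝐝bg * D.a (g * k) (t + s) * a + 𝐬bg * D.b (g * k) (t + s) * a) := by
      have e1 : 𝐝(bg * α) * D.a k s + 𝐬(bg * α) * D.b k s =
          𝐝bg * (α * D.a k s) + 𝐬bg * (𝐝α * D.a k s + 𝐬α * D.b k s) := by
        rw [d_mul, s_mul]
        simp only [madd_mul, mmul_add, massoc]
        abel
      rw [key, e1, c1, c2, mmul_smul, mmul_smul, ← smul_add, msmul_mul,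
        madd_mul]
    have r3 : (𝐝bg * α + 𝐬bg * γ) * ak * (bk * D.a k s * a) =
        (β g k : ℂ) • (𝐝bg * D.a (g * k) (t + s) * a + 𝐬bg * D.b (g * k) (t + s) * a) := by
      calc (𝐝bg * α + 𝐬bg * γ) * ak * (bk * D.a k s * a) =
          (𝐝bg * (α * ((ak * bk) * D.a k s)) + 𝐬bg * (γ * ((ak * bk) * D.a k s))) * a := by
            simp only [massoc, madd_mul]
        _ = _ := by
          rw [hab, hae, c1, c3, mmul_smul, mmul_smul, ← smul_add, msmul_mul,
            madd_mul]
    have r4 : 𝐝((𝐝bg * α + 𝐬bg * γ) * ak) * (bk * D.a k s * a) +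
        𝐬((𝐝bg * α + 𝐬bg * γ) * ak) * (𝐝bk * D.a k s * a + 𝐬bk * D.b k s * a) =
        (β g k : ℂ) • (bg * D.a' (g * k) (t + s) * a) := by
      rw [key]
      have e1 : 𝐝(𝐝bg * α + 𝐬bg * γ) * D.a k s + 𝐬(𝐝bg * α + 𝐬bg * γ) * D.b k s =
          𝐬(𝐝bg) * (𝐝α * D.a k s + 𝐬α * D.b k s) - 𝐬(𝐝bg) * (γ * D.a k s) +
            bg * (𝐝γ * D.a k s + 𝐬γ * D.b k s) := by
        rw [d_add, d_mul, d_mul, d_d, d_s, s_s, s_add, s_mul, s_mul, s_s]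
        simp only [madd_mul, mmul_add, massoc, mzero_mul,
          mneg_mul]
        abel
      rw [e1, c2, c3, c4, sub_self, zero_add, mmul_smul, msmul_mul]
    rw [← h1] at r1 r2
    rw [← h2] at r3 r4
    rw [PreRep.conj_a, PreRep.conj_a, PreRep.conj_a, PreRep.conj_b, PreRep.conj_b, PreRep.conj_b,
      ha']
    exact ⟨r1, r2, r3, r4⟩

end Conj

/-- Isomorphic representations are transports of each other. -/
theorem PreRep.eq_conj {D D' : PreRep X} {a : Matrix D'.ι D.ι (Form X)}
    {b : Matrix D.ι D'.ι (Form X)} (hD : D.Adm) (h : MIso D.par D.e D'.par D'.e a b)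
    (hR : ∀ g, D'.R g * a.map src = a.map (tgt g) * D.R g) : D = D'.conj D.par D.e a b := by
  have := h.a_smooth; have := h.b_smooth
  have h1 : ∀ g, b.map (tgt g) * D'.R g * a.map src = D.R g := fun g => by
    rw [massoc, hR, ← massoc, ← tgt_mul, h.ba, hD.tgt_R]
  unfold PreRep.conj
  simp only [h1]

theorem IsRep.of_iso {D D' : PreRep X} (hD : D.Adm) (hD' : IsRep β D') (h : D.Iso D') :
    IsRep β D := by
  obtain ⟨a, b, hab, hR⟩ := (PreRep.iso_iff hD hD'.adm).1 h
  rw [PreRep.eq_conj hD hab hR]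
  exact IsRep.conj hab hD'

end Conjugation

end

section

section Correspondence

variable {G : Type v} [Group G] {X Y Z : GMfd.{u} G} {β : G → G → Circle} {m n o : Type}

/-! ### The representation determined by a bundle with connection -/

theorem aug_extD (α : Form X) (x : X.carrier) : Ext.aug (extD α x) = 0 := by
  rw [extD, Ext.aug_map, flatD, map_sum]
  exact Finset.sum_eq_zero fun i _ => by rw [map_mul, Ext.aug_ι, zero_mul]

theorem Ext.aug_of_degree_one {V : Type*} [AddCommGroup V] [Module ℝ V] {x : Ext V}
    (hx : x ∈ ⋀[ℂ]^1 (V →ₗ[ℝ] ℂ)) : Ext.aug x = 0 := by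
  rw [ExteriorAlgebra.exteriorPower, pow_one] at hx
  obtain ⟨φ, rfl⟩ := hx
  exact Ext.aug_ι φ

/-- The entrywise value at `x` of a matrix of forms. -/
def evalMat (x : X.carrier) (M : Matrix m n (Form X)) : Matrix m n (Ext X.E) := M.map fun α => α x

theorem evalMat_pow [Fintype m] [DecidableEq m] (x : X.carrier) (M : Matrix m m (Form X)) (k : ℕ) :
    evalMat x (M ^ k) = evalMat x M ^ k :=
  map_pow (RingHom.mapMatrix (Pi.evalRingHom (fun _ : X.carrier => Ext X.E) x)) M k

theorem evalMat_ext {M N : Matrix m n (Form X)} (h : ∀ x, evalMat x M = evalMat x N) : M = N := by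
  ext1 i j; funext x; exact congrFun (congrFun (h x) i) j

theorem pow_eq_zero_of_aug [Fintype m] [DecidableEq m] {M : Matrix m m (Form X)}
    (hM : ∀ i j x, Ext.aug (M i j x) = 0) {k : ℕ} (hk : Module.finrank ℝ X.E < k) : M ^ k = 0 :=
  evalMat_ext fun x => by
    rw [evalMat_pow, Ext.matrix_pow_eq_zero (evalMat x M) (fun i j => hM i j x) hk]; rfl

theorem IsBundle.scurv_eq {V : PreBundle X} (h : IsBundle β V) : V.scurv = V.curvature := by
  rw [h.isSC.scurv_eq, h.A_graded.s_odd, mneg_mul, sub_neg_eq_add, PreBundle.curvature]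

theorem IsBundle.curvature_pow {V : PreBundle X} (h : IsBundle β V) :
    V.curvature ^ (Module.finrank ℝ X.E + 1) = 0 := by
  refine pow_eq_zero_of_aug (fun i j x => ?_) (Nat.lt_succ_self _)
  let φ : Form X →+* ℂ := (Ext.aug : Ext X.E →ₐ[ℂ] ℂ).toRingHom.comp (Pi.evalRingHom _ x)
  have hd : ∀ M : Matrix V.ι V.ι (Form X), (𝐝M).map φ = 0 := fun M => by
    ext i j; exact aug_extD _ x
  have hA : V.A.map φ = 0 := by
    ext i j; exact Ext.aug_of_degree_one ((h.A_graded i j).2.1 x)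
  have : V.curvature.map φ = 0 := by
    rw [PreBundle.curvature, mmap_add _ (map_add φ), mmap_add _ (map_add φ)]
    simp only [mmap_mul, hd, hA, mmul_zero, mzero_mul, add_zero]
  exact congrFun (congrFun this i) j

theorem hasDerivAt_neg_pow_div (k : ℕ) (t : ℝ) :
    HasDerivAt (fun s : ℝ => (-(s : ℂ)) ^ (k + 1) / ((k + 1).factorial : ℂ))
      (-((-(t : ℂ)) ^ k / (k.factorial : ℂ))) t := by
  have h1 : HasDerivAt (fun s : ℝ => -(s : ℂ)) (-1) t := (Complex.ofRealCLM.hasDerivAt (x := t)).neg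
  have h2 := (h1.pow (k + 1)).div_const ((k + 1).factorial : ℂ)
  refine h2.congr_deriv ?_
  have : (k.factorial : ℂ) ≠ 0 := by exact_mod_cast k.factorial_ne_zero
  have : ((k : ℂ) + 1) ≠ 0 := by exact_mod_cast k.succ_ne_zero
  rw [Nat.factorial_succ]
  push_cast
  field_simp

theorem IsBundle.isFlow {V : PreBundle X} (h : IsBundle β V) :
    IsFlow V.scurv fun t => V.expCurvature (-(t : ℂ)) where
  zero := by
    rw [Complex.ofReal_zero, neg_zero, PreBundle.expCurvature, Finset.sum_eq_single 0]
    · simp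
    · intro k _ hk; simp [hk]
    · simp
  deriv t i j x := by
    rw [h.scurv_eq]
    set N := Module.finrank ℝ X.E
    have h1 : ∀ s : ℝ, V.expCurvature (-(s : ℂ)) i j x = ∑ k ∈ Finset.range (N + 1),
        ((-(s : ℂ)) ^ k / (k.factorial : ℂ)) • (V.curvature ^ k) i j x := fun s => by
      rw [PreBundle.expCurvature, msum_apply, Finset.sum_apply]; rfl
    have h2 : (-(V.curvature * V.expCurvature (-(t : ℂ)))) i j x = ∑ k ∈ Finset.range N,
        (-((-(t : ℂ)) ^ k / (k.factorial : ℂ))) • (V.curvature ^ (k + 1)) i j x := by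
      rw [PreBundle.expCurvature, Finset.sum_range_succ, mmul_add, mmul_smul,
        ← pow_succ', h.curvature_pow, smul_zero, add_zero, mmul_sum, ← Finset.sum_neg_distrib,
        msum_apply, Finset.sum_apply]
      refine Finset.sum_congr rfl fun k _ => ?_
      rw [mmul_smul, ← pow_succ', neg_smul]; rfl
    simp only [h1]
    rw [h2]
    simp only [Finset.sum_range_succ' _ N]
    have h3 : HasDerivAt (fun s : ℝ => ∑ k ∈ Finset.range N,
        ((-(s : ℂ)) ^ (k + 1) / ((k + 1).factorial : ℂ)) • (V.curvature ^ (k + 1)) i j x)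
        (∑ k ∈ Finset.range N,
        (-((-(t : ℂ)) ^ k / (k.factorial : ℂ))) • (V.curvature ^ (k + 1)) i j x) t :=
      HasDerivAt.fun_sum fun k _ => (hasDerivAt_neg_pow_div k t).smul_const _
    simp only [pow_zero]
    exact h3.add_const _
  smooth i j x₀ := by
    have hF := h.isSC.scurv_smooth
    rw [h.scurv_eq] at hF
    have h1 : ∀ p : ℝ × X.E, chartRep (V.expCurvature (-(p.1 : ℂ)) i j) x₀ p.2 =
        ∑ k ∈ Finset.range (Module.finrank ℝ X.E + 1), ((-(p.1 : ℂ)) ^ k / (k.factorial : ℂ)) •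
          chartRep ((V.curvature ^ k) i j) x₀ p.2 := fun p => by
      rw [PreBundle.expCurvature, msum_apply, chartRep_sum]
      exact Finset.sum_congr rfl fun k _ => congrFun (chartRep_smul _ _ x₀) p.2
    simp only [h1]
    refine ContDiffOn.sum fun k _ => ContDiffOn.smul (𝕜' := ℂ) ?_ ?_
    · have : ContDiff ℝ ∞ fun p : ℝ × X.E => (p.1 : ℂ) := Complex.ofRealCLM.contDiff.comp contDiff_fst
      exact ((this.neg.pow k).div_const _).contDiffOn
    · have hk : MSmooth (V.curvature ^ k) := inferInstance
      exact (hk.smooth i j x₀).comp contDiffOn_snd fun p hp => hp.2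

theorem IsBundle.toPreRep_eq {V : PreBundle X} (h : IsBundle β V) : V.toPreRep = V.toSRep :=
  (show V.toPreRep = V.repOf fun t => V.expCurvature (-(t : ℂ)) by
    unfold PreBundle.toPreRep PreBundle.repOf PreBundle.B; rfl).trans (h.isSC.repOf_eq h.isFlow)

/-! ### The superconnection determined by a representation -/

/-- The data of a bundle with superconnection determined by a representation. -/
def PreRep.toPB (D : PreRep X) : PreBundle X where
  ι := D.ι
  par := D.par
  e := D.e
  ρ g := D.a g 0
  A := 𝐝D.e * D.e - D.b 1 0

theorem PreRep.toPB_B (D : PreRep X) : D.toPB.B = D.b 1 0 := sub_sub_cancel _ _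

section ToPB

variable {D : PreRep X}

theorem IsRep.a_eq (hβ : IsNormalizedCocycle β) (h : IsRep β D) (g : G) (t : ℝ≥0) : D.a g t = D.a g 0 * D.a 1 t := by
  have := (h.comp g 1 0 t).1
  rw [mpull_act_one, hβ.one_right, mul_one, zero_add] at this
  simpa using this.symm

theorem IsRep.b_eq_mul (hβ : IsNormalizedCocycle β) (h : IsRep β D) (g : G) (t : ℝ≥0) :
    D.b g t = (D.b 1 0)⋆g * D.a g t := by
  have := (h.comp 1 g 0 t).2.2.1
  rw [hβ.one_left, one_mul, zero_add] at this
  simpa using this.symm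

theorem IsRep.isSC_toPB (hβ : IsNormalizedCocycle β) (h : IsRep β D)
    (he : IsGradedMatrix 0 D.par D.par D.e)
    (hρ : ∀ g, IsGradedMatrix 0 D.par D.par (D.a g 0)) : IsSC β D.toPB := by
  have := h.msmooth_e; have := h.msmooth_b; have := h.msmooth_a
  have hB : D.b 1 0 = 𝐝D.e * D.e + D.e * D.b 1 0 := by
    have := h.b_eq 1 0
    rwa [mpull_act_one, h.a_one_zero, he.s_even] at this
  have hede : D.e * (𝐝D.e * D.e) = 0 := by
    have h1 : 𝐝D.e = 𝐝D.e * D.e + D.e * 𝐝D.e := by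
      conv_lhs => rw [← h.e_idem, d_mul, he.s_even]
    have h2 := congrArg (D.e * ·) h1
    simp only [mmul_add, ← massoc, h.e_idem] at h2
    rw [← massoc]
    simpa using h2
  obtain ⟨A, hA'⟩ : ∃ A : Matrix D.ι D.ι (Form X), A = 𝐝D.e * D.e - D.b 1 0 := ⟨_, rfl⟩
  have hA : A = -(D.e * D.b 1 0) := by
    rw [hA']
    conv_lhs => rw [hB]
    abel
  refine ⟨he, hρ, ?_, ?_, h.e_idem, fun g => (h.hom g 0).1, ?_, h.a_one_zero, fun g k => ?_,
    fun g => ?_⟩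
  · show MSmooth (𝐝D.e * D.e - D.b 1 0); infer_instance
  · exact (he.isPar_even.d.mul_oe he.isPar_even).sub (h.isPar_b 1 0)
  · suffices A = D.e * A * D.e by rw [hA'] at this; exact this
    rw [hA, mmul_neg, mneg_mul, ← massoc, h.e_idem, massoc,
      h.b_mul_e]
  · have := (h.comp g k 0 0).1
    rwa [add_zero] at this
  · have h1 := (h.comp g 1 0 0).2.1
    rw [mpull_act_one, hβ.one_right, mul_one, add_zero, h.a_one_zero, (hρ g).s_even,
      IsRep.b_eq_mul hβ h g 0] at h1
    have h1 : 𝐝(D.a g 0) * D.e + D.a g 0 * D.b 1 0 = (D.b 1 0)⋆g * D.a g 0 := by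
      simpa using h1
    suffices D.a g 0 * A = D.e⋆g * 𝐝(D.a g 0) * D.e +
      A⋆g * D.a g 0 by rw [hA'] at this; exact this
    have h2 := congrArg (D.e⋆g * ·) h1
    simp only [mmul_add, ← massoc, ← mpull_mul] at h2
    rw [h.e_mul_a] at h2
    rw [hA, mpull_neg, mmul_neg, mneg_mul, ← h2, ← massoc, h.a_mul_e]
    abel

theorem IsRep.toSRep_toPB (hβ : IsNormalizedCocycle β) (h : IsRep β D)
    (he : IsGradedMatrix 0 D.par D.par D.e)
    (hρ : ∀ g, IsGradedMatrix 0 D.par D.par (D.a g 0)) : D.toPB.toSRep = D := by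
  have hV := IsRep.isSC_toPB hβ h he hρ
  have hF := hV.scurv_smooth
  set B := D.b 1 0 with hB
  obtain ⟨F, hF'⟩ : ∃ F : Matrix D.ι D.ι (Form X), F = D.toPB.scurv := ⟨_, rfl⟩
  have hE : IsFlow F (fexp F) := by
    rw [hF']; exact isFlow_fexp D.toPB.scurv
  have hscurv : F = -((𝐝B + 𝐬B * B) * D.e) := by
    rw [hF', PreBundle.scurv, PreRep.toPB_B]; rfl
  have ha' : ∀ t : ℝ≥0, D.a' 1 t = -(F * D.a 1 t) := fun t => by
    have h1 := (h.comp 1 1 0 t).2.2.2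
    rw [mpull_act_one, hβ.one_right, mul_one, zero_add, IsRep.b_eq_mul hβ h 1 t, mpull_act_one] at h1
    have h2 : D.e * D.a 1 t = D.a 1 t := by
      have := h.e_mul_a 1 t
      rwa [mpull_act_one] at this
    rw [hscurv, mneg_mul, neg_neg, massoc, h2, madd_mul, massoc]
    simpa using h1.symm
  have ha1 : ∀ t : ℝ≥0, D.a 1 t = fexp F t * D.e := fun t => by
    have := MDeriv.unique (f := fun s => D.a 1 s.toNNReal)
      (g := fun s => fexp F s * D.e) F (fun s hs => ?_) (fun s _ => ?_) ?_ t.2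
    · simpa using this
    · have h1 := h.mderiv_a 1 s.toNNReal
      rwa [ha', Real.coe_toNNReal s hs] at h1
    · have h1 := (hE.mderiv s).mul_right D.e
      rwa [mneg_mul, massoc] at h1
    · rw [hE.zero, Real.toNNReal_zero, h.a_one_zero, mone_mul]
  have ha : ∀ g (t : ℝ≥0), D.a g t = D.a g 0 * fexp F t := fun g t => by
    rw [IsRep.a_eq hβ h, ha1]
    have h1 : D.e * fexp F t = fexp F t * D.e := by
      have h2 := hV.e_mul_flow (isFlow_fexp D.toPB.scurv) t.coe_nonneg
      rw [hF']
      exact h2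
    rw [← h1, ← massoc, h.a_mul_e]
  have hR : D.toPB.toSRep.R = D.R := by
    funext g
    rw [hF'] at ha
    refine oddMatrix_ext (fun t => (ha g t).symm) (fun t => ?_)
    refine Eq.trans ?_ (IsRep.b_eq_mul hβ h g t).symm
    rw [ha g t, ← D.toPB_B]
    rfl
  calc D.toPB.toSRep = { D with R := D.toPB.toSRep.R } := rfl
    _ = { D with R := D.R } := by rw [hR]
    _ = D := rfl

end ToPB

end Correspondence

end

section

section Twisted

variable {G : Type v} [Group G] {X Y Z : GMfd.{u} G} {β : G → G → Circle} {m n o : Type}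

/-! ### The part of degree zero -/

/-- The part of degree zero of a form. -/
def dz : Form X →+* Form X where
  toFun α x := algebraMap ℂ _ (Ext.aug (α x))
  map_one' := by funext x; simp
  map_mul' α α' := by funext x; simp
  map_zero' := by funext x; simp
  map_add' α α' := by funext x; simp

theorem dz_apply (α : Form X) (x : X.carrier) : dz α x = algebraMap ℂ _ (Ext.aug (α x)) := rfl

theorem hasDegree_dz (α : Form X) : HasDegree 0 (dz α) := fun _ => Ext.algebraMap_mem_degree _

theorem dz_of_hasDegree {α : Form X} (h : HasDegree 0 α) : dz α = α :=
  funext fun x => Ext.mem_degree_zero.1 (h x)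

theorem dz_pull (f : X.carrier → Y.carrier) (α : Form Y) : dz (pull f α) = pull f (dz α) := by
  funext x
  rw [dz_apply, pull_apply, pull_apply, dz_apply, Ext.aug_map, AlgHom.commutes]

theorem dz_smul (c : ℂ) (α : Form X) : dz (c • α) = c • dz α := by
  funext x
  rw [dz_apply, Pi.smul_apply, Pi.smul_apply, dz_apply, map_smul, Algebra.smul_def, map_mul]
  simp [Algebra.smul_def]

theorem dz_sinv (α : Form X) : dz (sinv α) = dz α := by
  funext x
  exact congrArg (algebraMap ℂ (Ext X.E)) (Ext.aug_sinv (α x))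

theorem IsSmooth.dz {α : Form X} (h : IsSmooth α) : IsSmooth (dz α) := fun x₀ => by
  have h1 : chartRep (TwistedK.dz α) x₀ = fun y => realCLM ((Algebra.linearMap ℂ (Ext X.E)).comp
      (Ext.aug : Ext X.E →ₐ[ℂ] ℂ).toLinearMap) (chartRep α x₀ y) := by
    funext y
    rw [chartRep, dz_apply, AlgHom.commutes, realCLM_apply]
    exact congrArg _ (Ext.aug_map _ _).symm
  rw [h1]
  exact (ContinuousLinearMap.contDiff _).comp_contDiffOn (h x₀)

instance MSmooth.dz (M : Matrix m n (Form X)) [hM : MSmooth M] : MSmooth (M.map dz) :=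
  ⟨fun i j => (hM.smooth i j).dz⟩

theorem mdz_mul [Fintype n] (M : Matrix m n (Form X)) (N : Matrix n o (Form X)) :
    (M * N).map dz = M.map dz * N.map dz := mmap_mul

theorem mdz_one [DecidableEq m] : (1 : Matrix m m (Form X)).map dz = 1 :=
  mmap_one _ (map_zero _) (map_one _)

theorem mdz_add (M N : Matrix m n (Form X)) : (M + N).map dz = M.map dz + N.map dz :=
  mmap_add _ (map_add dz) M N

theorem mdz_sub (M N : Matrix m n (Form X)) : (M - N).map dz = M.map dz - N.map dz :=
  mmap_sub _ (map_sub dz) M N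

theorem mdz_pull (f : X.carrier → Y.carrier) (M : Matrix m n (Form Y)) :
    (M.map (pull f)).map dz = (M.map dz).map (pull f) := by
  ext1 i j; exact dz_pull f _

theorem mdz_smul (c : ℂ) (M : Matrix m n (Form X)) : (c • M).map dz = c • M.map dz := by
  ext1 i j; exact dz_smul c _

theorem IsGradedMatrix.dz {p : m → Bool} {q : n → Bool} {M : Matrix m n (Form X)}
    (h : IsGradedMatrix 0 p q M) : M.map dz = M := by
  ext1 i j; exact dz_of_hasDegree (h i j).2.1

theorem isGradedMatrix_dz {p : m → Bool} {q : n → Bool} (M : Matrix m n (Form X)) [hM : MSmooth M]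
    (h : IsPar false p q M) : IsGradedMatrix 0 p q (M.map TwistedK.dz) := fun i j => by
  refine ⟨(hM.smooth i j).dz, hasDegree_dz _, fun hpq => ?_⟩
  have h1 := congrArg TwistedK.dz (h i j)
  have h2 : (p i ^^ q j) = true := by cases hi : p i <;> cases hj : q j <;> simp_all
  rw [h2, dz_sinv, Bool.false_xor, sg_true, neg_one_zsmul, map_neg] at h1
  have h3 : (2 : ℂ) • TwistedK.dz (M i j) = 0 := by
    rw [two_smul]; exact add_eq_zero_iff_eq_neg.2 h1
  exact (smul_eq_zero.1 h3).resolve_left two_ne_zero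

theorem exists_inverse_of_dz [Fintype m] [DecidableEq m] {p : m → Bool} {M : Matrix m m (Form X)}
    [MSmooth M] (hp : IsPar false p p M) (hM : M.map dz = 1) :
    ∃ N, MSmooth N ∧ IsPar false p p N ∧ M * N = 1 ∧ N * M = 1 := by
  set Q := 1 - M with hQ
  have hQ0 : Q ^ (Module.finrank ℝ X.E + 1) = 0 := by
    refine pow_eq_zero_of_aug (fun i j x => ?_) (Nat.lt_succ_self _)
    have h1 := congrFun (congrFun (congrFun hM i) j) x
    have h2 := congrArg Ext.aug h1
    rw [mmap_apply, dz_apply, Ext.aug_algebraMap] at h2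
    rw [hQ, Matrix.sub_apply, Pi.sub_apply, map_sub, h2, sub_self]
  have hMQ : M = 1 - Q := by rw [hQ]; abel
  refine ⟨∑ k ∈ Finset.range (Module.finrank ℝ X.E + 1), Q ^ k, MSmooth.sum fun k _ => inferInstance,
    IsPar.sum fun k _ => (IsPar.one.sub hp).pow k, ?_, ?_⟩
  · rw [hMQ, mul_neg_geom_sum, hQ0, sub_zero]
  · rw [hMQ, geom_sum_mul_neg, hQ0, sub_zero]

theorem MIso.of_unit [Fintype m] [DecidableEq m] {p : m → Bool} {e e' c ψ : Matrix m m (Form X)}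
    [MSmooth e] [MSmooth e'] [MSmooth c] [MSmooth ψ] (hc : IsPar false p p c)
    (hψ : IsPar false p p ψ) (hep : IsPar false p p e) (hep' : IsPar false p p e')
    (he : e * e = e) (he' : e' * e' = e') (hce : c * e = e' * c) (h1 : c * ψ = 1) (h2 : ψ * c = 1) :
    MIso p e p e' (c * e) (ψ * e') := by
  have hψe : ψ * e' = e * ψ := by
    calc ψ * e' = ψ * e' * (c * ψ) := by rw [h1, mul_one]
      _ = ψ * (c * e) * ψ := by rw [hce]; noncomm_ring
      _ = (ψ * c) * (e * ψ) := by noncomm_ring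
      _ = e * ψ := by rw [h2, one_mul]
  refine ⟨inferInstance, inferInstance, hc.mul_ee hep, hψ.mul_ee hep', ?_, ?_, ?_, ?_, ?_, ?_⟩
  · rw [hce, ← mul_assoc, he']
  · rw [mul_assoc, he]
  · rw [hψe, ← mul_assoc, he]
  · rw [mul_assoc, he']
  · calc c * e * (ψ * e') = e' * (c * ψ) * e' := by rw [hce]; noncomm_ring
      _ = e' := by rw [h1, mul_one, he']
  · calc ψ * e' * (c * e) = ψ * (e' * c) * e := by noncomm_ring
      _ = (ψ * c) * (e * e) := by rw [← hce]; noncomm_ring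
      _ = e := by rw [h2, he, one_mul]

/-! ### Twisted equivariant idempotents -/

/-- Even twisted equivariant idempotent matrices of forms. -/
structure IsTw (β : G → G → Circle) [Fintype m] (p : m → Bool) (e : Matrix m m (Form X))
    (ρ : G → Matrix m m (Form X)) : Prop where
  e_smooth : MSmooth e
  e_even : IsPar false p p e
  ρ_smooth : ∀ g, MSmooth (ρ g)
  ρ_even : ∀ g, IsPar false p p (ρ g)
  e_idem : e * e = e
  ρ_e : ∀ g, ρ g * e = ρ g
  e_ρ : ∀ g, e⋆g * ρ g = ρ g
  ρ_one : ρ 1 = e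
  ρ_mul : ∀ g h, (ρ g)⋆h * ρ h = (β g h : ℂ) • ρ (g * h)

theorem IsSC.isTw {V : PreBundle X} (h : IsSC β V) : IsTw β V.par V.e V.ρ :=
  ⟨h.e_smooth, h.e_graded.isPar_even, h.ρ_smooth, fun g => (h.ρ_graded g).isPar_even, h.e_idem,
    h.ρ_mul_e, h.e_mul_ρ, h.ρ_one, h.ρ_mul⟩

theorem IsRep.isTw {D : PreRep X} (h : IsRep β D) : IsTw β D.par D.e fun g => D.a g 0 :=
  ⟨h.msmooth_e, h.isPar_e, fun g => h.msmooth_a g 0, fun g => h.isPar_a g 0, h.e_idem,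
    fun g => h.a_mul_e g 0, fun g => h.e_mul_a g 0, h.a_one_zero, fun g k => by
      have := (h.comp g k 0 0).1
      rwa [add_zero] at this⟩

/-- The inverse of the action. -/
def twInv (β : G → G → Circle) (ρ : G → Matrix m m (Form X)) (g : G) : Matrix m m (Form X) :=
  (β g⁻¹ g : ℂ)⁻¹ • (ρ g⁻¹)⋆g

theorem IsNormalizedCocycle.inv_symm (hβ : IsNormalizedCocycle β) (g : G) :
    β g⁻¹ g = β g g⁻¹ := by
  have := hβ.cocycle g g⁻¹ g
  rw [mul_inv_cancel, inv_mul_cancel, hβ.one_left, hβ.one_right, mul_one, mul_one] at this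
  exact this.symm

theorem twInv_pull_dz (ρ : G → Matrix m m (Form X)) (g : G) :
    (twInv β ρ g).map dz = twInv β (fun g => (ρ g).map dz) g := by
  rw [twInv, mdz_smul, mdz_pull]; rfl

theorem card_smul_sum_const [Fintype G] (M : Matrix n m (Form X)) :
    (Fintype.card G : ℂ)⁻¹ • ∑ _g : G, M = M := by
  rw [Finset.sum_const, Finset.card_univ, ← Nat.cast_smul_eq_nsmul ℂ, smul_smul,
    inv_mul_cancel₀ (Nat.cast_ne_zero.2 Fintype.card_ne_zero), one_smul]

theorem mpull_sum (f : X.carrier → Y.carrier) {κ : Type*} (s : Finset κ)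
    (M : κ → Matrix m n (Form Y)) : (∑ k ∈ s, M k).map (pull f) = ∑ k ∈ s, (M k).map (pull f) := by
  ext1 i j
  rw [mmap_apply, msum_apply, msum_apply, map_sum]; rfl

namespace IsTw

variable [Fintype m] [Fintype n] {p : m → Bool} {e : Matrix m m (Form X)}
  {ρ : G → Matrix m m (Form X)} {q : n → Bool} {e' : Matrix n n (Form X)}
  {ρ' : G → Matrix n n (Form X)}

theorem dz (h : IsTw β p e ρ) : IsTw β p (e.map dz) fun g => (ρ g).map dz := by
  have := h.e_smooth; have := h.ρ_smooth
  exact ⟨inferInstance, (isGradedMatrix_dz e h.e_even).isPar_even, fun g => inferInstance,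
    fun g => (isGradedMatrix_dz (ρ g) (h.ρ_even g)).isPar_even, by rw [← mdz_mul, h.e_idem],
    fun g => by rw [← mdz_mul, h.ρ_e], fun g => by rw [← mdz_pull, ← mdz_mul, h.e_ρ],
    by rw [h.ρ_one], fun g k => by rw [← mdz_pull, ← mdz_mul, h.ρ_mul, mdz_smul]⟩

theorem twInv_smooth (h : IsTw β p e ρ) (g : G) : MSmooth (twInv β ρ g) := by
  have := h.ρ_smooth; unfold twInv; infer_instance

theorem twInv_even (h : IsTw β p e ρ) (g : G) : IsPar false p p (twInv β ρ g) :=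
  ((h.ρ_even _).pull _).smul _

theorem twInv_mul (h : IsTw β p e ρ) (g : G) : twInv β ρ g * ρ g = e := by
  rw [twInv, msmul_mul, h.ρ_mul, inv_mul_cancel, h.ρ_one, smul_smul,
    inv_mul_cancel₀ (Circle.coe_ne_zero _), one_smul]

theorem mul_twInv (h : IsTw β p e ρ) (hβ : IsNormalizedCocycle β) (g : G) :
    ρ g * twInv β ρ g = e⋆g := by
  have h1 := congrArg (fun M : Matrix m m (Form X) => M⋆g) (h.ρ_mul g g⁻¹)
  simp only [mpull_mul, mpull_act_act, mpull_smul, inv_mul_cancel, mul_inv_cancel, mpull_act_one,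
    h.ρ_one] at h1
  rw [twInv, mmul_smul, h1, hβ.inv_symm, smul_smul,
    inv_mul_cancel₀ (Circle.coe_ne_zero _), one_smul]

theorem twInv_e (h : IsTw β p e ρ) (g : G) :
    twInv β ρ g * e⋆g = twInv β ρ g := by
  rw [twInv, msmul_mul, ← mpull_mul, h.ρ_e]

theorem e_twInv (h : IsTw β p e ρ) (g : G) : e * twInv β ρ g = twInv β ρ g := by
  have h1 := congrArg (fun M : Matrix m m (Form X) => M⋆g) (h.e_ρ g⁻¹)
  simp only [mpull_mul, mpull_act_act, inv_mul_cancel, mpull_act_one] at h1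
  rw [twInv, mmul_smul, h1]

theorem ρ_twInv (h : IsTw β p e ρ) (hβ : IsNormalizedCocycle β) (g k : G) :
    ρ k * twInv β ρ (g * k) = (β g k : ℂ) • (twInv β ρ g)⋆k := by
  have h1 := congrArg (fun M => (twInv β ρ g)⋆k * M * twInv β ρ (g * k))
    (h.ρ_mul g k)
  simp only [mmul_smul, msmul_mul, ← massoc, ← mpull_mul] at h1
  rw [h.twInv_mul, h.e_ρ, massoc _ (ρ (g * k)), h.mul_twInv hβ, ← mpull_act_act,
    ← mpull_mul, h.twInv_e] at h1
  exact h1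

variable [Fintype G]

/-- The average of a matrix over the group. -/
def avg (β : G → G → Circle) (ρ : G → Matrix m m (Form X)) (ρ' : G → Matrix n n (Form X))
    (M : Matrix n m (Form X)) : Matrix n m (Form X) :=
  (Fintype.card G : ℂ)⁻¹ • ∑ g, twInv β ρ' g * M⋆g * ρ g

theorem avg_smooth (h : IsTw β p e ρ) (h' : IsTw β q e' ρ') (M : Matrix n m (Form X))
    [MSmooth M] : MSmooth (avg β ρ ρ' M) := by
  have := h.ρ_smooth; have := h'.twInv_smooth
  have : MSmooth (∑ g, twInv β ρ' g * M⋆g * ρ g) :=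
    MSmooth.sum fun g _ => inferInstance
  unfold avg; infer_instance

theorem avg_even (h : IsTw β p e ρ) (h' : IsTw β q e' ρ') {M : Matrix n m (Form X)}
    (hM : IsPar false q p M) : IsPar false q p (avg β ρ ρ' M) :=
  IsPar.smul _ (IsPar.sum fun g _ => ((h'.twInv_even g).mul_ee (hM.pull _)).mul_ee (h.ρ_even g))

theorem avg_e (h : IsTw β p e ρ) (M : Matrix n m (Form X)) :
    avg β ρ ρ' M * e = avg β ρ ρ' M := by
  rw [avg, msmul_mul, msum_mul]
  congr 1
  exact Finset.sum_congr rfl fun g _ => by rw [massoc, h.ρ_e]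

theorem e_avg (h' : IsTw β q e' ρ') (M : Matrix n m (Form X)) :
    e' * avg β ρ ρ' M = avg β ρ ρ' M := by
  rw [avg, mmul_smul, mmul_sum]
  congr 1
  exact Finset.sum_congr rfl fun g _ => by
    rw [← massoc, ← massoc, h'.e_twInv]

theorem avg_of_equivariant (h' : IsTw β q e' ρ') {M : Matrix n m (Form X)}
    (hM : ∀ g, ρ' g * M = M⋆g * ρ g) (he : e' * M = M) : avg β ρ ρ' M = M := by
  have : ∀ g, twInv β ρ' g * M⋆g * ρ g = M := fun g => by
    rw [massoc, ← hM, ← massoc, h'.twInv_mul, he]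
  rw [avg, Finset.sum_congr rfl fun g _ => this g, card_smul_sum_const]

theorem avg_equivariant (h : IsTw β p e ρ) (h' : IsTw β q e' ρ') (hβ : IsNormalizedCocycle β)
    (M : Matrix n m (Form X)) (k : G) :
    ρ' k * avg β ρ ρ' M = (avg β ρ ρ' M)⋆k * ρ k := by
  rw [avg, mmul_smul, mpull_smul, msmul_mul, mmul_sum, mpull_sum, msum_mul]
  congr 1
  refine (Fintype.sum_equiv (Equiv.mulRight k) _ _ fun g => ?_).symm
  rw [Equiv.coe_mulRight, mpull_mul, mpull_mul, mpull_act_act, massoc, h.ρ_mul,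
    ← massoc, ← massoc, h'.ρ_twInv hβ, mmul_smul, msmul_mul,
    msmul_mul]

theorem avg_dz (M : Matrix n m (Form X)) :
    (avg β ρ ρ' M).map TwistedK.dz =
      avg β (fun g => (ρ g).map TwistedK.dz) (fun g => (ρ' g).map TwistedK.dz)
        (M.map TwistedK.dz) := by
  have hs : ∀ N : G → Matrix n m (Form X), (∑ g, N g).map TwistedK.dz =
      ∑ g, (N g).map TwistedK.dz := fun N => by
    ext1 i j
    rw [mmap_apply, msum_apply, msum_apply, map_sum]; rfl
  rw [avg, mdz_smul, hs, avg]
  congr 1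
  exact Finset.sum_congr rfl fun g _ => by rw [mdz_mul, mdz_mul, twInv_pull_dz, mdz_pull]

end IsTw

/-! ### Reduction of representations to superconnections -/

theorem add_compl_mul_idem {R : Type*} [Ring R] {e e' w : R} (he : e * e = e) (he' : e' * e' = e')
    (h : w * e = w) (h' : e' * w = w) :
    (w + (1 - e') * (1 - e)) * e = w ∧ e' * (w + (1 - e') * (1 - e)) = w := by
  constructor
  · rw [add_mul, h, mul_assoc, sub_mul 1 e, he, one_mul, sub_self, mul_zero, add_zero]
  · rw [mul_add, h', ← mul_assoc, mul_sub e', he', mul_one, sub_self, zero_mul, add_zero]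

theorem IsRep.exists_isSC [Finite G] (hβ : IsNormalizedCocycle β) {D : PreRep X} (hD : IsRep β D) :
    ∃ V : PreBundle X, IsSC β V ∧ V.toSRep.Iso D := by
  cases nonempty_fintype G
  have h := hD.isTw
  have h0 := h.dz
  set e := D.e
  set e₀ := D.e.map dz with he₀
  have := h.e_smooth; have := h0.e_smooth
  have he₀g : IsGradedMatrix 0 D.par D.par e₀ := isGradedMatrix_dz D.e h.e_even
  have hρ₀g : ∀ g, IsGradedMatrix 0 D.par D.par ((D.a g 0).map dz) := fun g =>
    haveI := h.ρ_smooth g; isGradedMatrix_dz _ (h.ρ_even g)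
  set φ := IsTw.avg β (fun g => (D.a g 0).map dz) (fun g => D.a g 0) 1 with hφ
  have := IsTw.avg_smooth h0 h 1
  set c := φ + (1 - e) * (1 - e₀) with hc
  obtain ⟨hc1, hc2⟩ : c * e₀ = φ ∧ e * c = φ :=
    add_compl_mul_idem h0.e_idem h.e_idem (IsTw.avg_e h0 1) (IsTw.e_avg h 1)
  have hcp : IsPar false D.par D.par c :=
    (IsTw.avg_even h0 h IsPar.one).add
      ((IsPar.one.sub h.e_even).mul_ee (IsPar.one.sub h0.e_even))
  have hφ0 : φ.map dz = e₀ := by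
    rw [hφ, IsTw.avg_dz, mdz_one]
    simp only [(hρ₀g _).dz]
    refine Eq.trans ?_ (IsTw.avg_of_equivariant (ρ := fun g => (D.a g 0).map dz) h0 (M := e₀)
      (fun g => by rw [h0.ρ_e, h0.e_ρ]) h0.e_idem)
    unfold IsTw.avg
    congr 1
    refine Finset.sum_congr rfl fun g _ => ?_
    rw [h0.twInv_e, mmap_one _ (map_zero _) (map_one _), mul_one]
  have hcd : c.map dz = 1 := by
    rw [hc, mdz_add, hφ0, mdz_mul, mdz_sub, mdz_sub, mdz_one, ← he₀, he₀g.dz, sub_mul, one_mul,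
      mul_sub, h0.e_idem, mul_one, sub_self, sub_zero, add_sub_cancel]
  obtain ⟨ψ, hψs, hψp, hψ1, hψ2⟩ := exists_inverse_of_dz hcp hcd
  have hiso := MIso.of_unit hcp hψp h0.e_even h.e_even h0.e_idem h.e_idem (hc1.trans hc2.symm) hψ1 hψ2
  rw [hc1] at hiso
  have hE := IsRep.conj hiso hD
  have hEρ : ∀ g, (D.conj D.par e₀ φ (ψ * e)).a g 0 = (D.a g 0).map dz := fun g => by
    rw [PreRep.conj_a, massoc, IsTw.avg_equivariant h0 h hβ, ← massoc,
      ← mpull_mul, hiso.ba, h0.e_ρ]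
  have hEg : ∀ g, IsGradedMatrix 0 D.par D.par ((D.conj D.par e₀ φ (ψ * e)).a g 0) := fun g => by
    rw [hEρ]; exact hρ₀g g
  refine ⟨_, IsRep.isSC_toPB hβ hE he₀g hEg, ?_⟩
  rw [IsRep.toSRep_toPB hβ hE he₀g hEg]
  exact PreRep.conj_iso hiso hD.adm

end Twisted

end

section

section Operations

variable {G : Type v} [Group G] {X Y Z : GMfd.{u} G} {β : G → G → Circle} {m n o : Type}

/-! ### Matrices of pure degree -/

theorem hasDegree_one_extD {α : Form X} (h : HasDegree 0 α) (hs : IsSmooth α) :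
    HasDegree 1 (extD α) := fun x => by
  refine Ext.map_mem_degree _ (Submodule.sum_mem _ fun i _ => ?_)
  let P : Ext X.E →L[ℝ] Ext X.E := realCLM ((Algebra.linearMap ℂ (Ext X.E)).comp
      (Ext.aug : Ext X.E →ₐ[ℂ] ℂ).toLinearMap)
  have h1 : chartRep α x = fun y => P (chartRep α x y) := by
    funext y
    exact (Ext.mem_degree_zero.1 (Ext.map_mem_degree _ (h _))).symm
  have h2 := (P.hasFDerivAt.comp _ (hs.differentiableAt x).hasFDerivAt).fderiv
  have h3 : fderiv ℝ (chartRep α x) (extChartAt X.I x x) (Module.finBasis ℝ X.E i) =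
      P (fderiv ℝ (chartRep α x) (extChartAt X.I x x) (Module.finBasis ℝ X.E i)) := by
    conv_lhs => rw [h1]
    exact congrArg (fun L : X.E →L[ℝ] Ext X.E => L (Module.finBasis ℝ X.E i)) h2
  rw [h3]
  exact Ext.mul_mem_degree (l := 0) (Ext.ι_mem_degree _) (Ext.algebraMap_mem_degree _)

theorem HasDegree.add {k : ℕ} {α α' : Form X} (h : HasDegree k α) (h' : HasDegree k α') :
    HasDegree k (α + α') := fun x => Submodule.add_mem _ (h x) (h' x)

theorem HasDegree.neg {k : ℕ} {α : Form X} (h : HasDegree k α) : HasDegree k (-α) :=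
  fun x => Submodule.neg_mem _ (h x)

theorem HasDegree.smul {k : ℕ} (c : ℂ) {α : Form X} (h : HasDegree k α) : HasDegree k (c • α) :=
  fun x => Submodule.smul_mem _ _ (h x)

theorem HasDegree.mul {k l : ℕ} {α α' : Form X} (h : HasDegree k α) (h' : HasDegree l α') :
    HasDegree (k + l) (α * α') := fun x => Ext.mul_mem_degree (h x) (h' x)

theorem HasDegree.pull {k : ℕ} {α : Form Y} (h : HasDegree k α) (f : X.carrier → Y.carrier) :
    HasDegree k (pull f α) := fun x => Ext.map_mem_degree _ (h (f x))

theorem HasDegree.sum {k : ℕ} {κ : Type*} {s : Finset κ} {α : κ → Form X}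
    (h : ∀ i ∈ s, HasDegree k (α i)) : HasDegree k (∑ i ∈ s, α i) := fun x => by
  rw [Finset.sum_apply]
  exact Submodule.sum_mem _ fun i hi => h i hi x

namespace IsGradedMatrix

variable {k l : ℕ} {p : m → Bool} {q : n → Bool} {r : o → Bool}

theorem mul [Fintype n] {M : Matrix m n (Form X)} {N : Matrix n o (Form X)}
    (hM : IsGradedMatrix k p q M) (hN : IsGradedMatrix l q r N) :
    IsGradedMatrix (k + l) p r (M * N) := fun i j => by
  have := hM.msmooth; have := hN.msmooth
  refine ⟨(inferInstance : MSmooth (M * N)).smooth i j, ?_, fun hij => ?_⟩ <;> rw [mmul_apply]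
  · exact HasDegree.sum fun s _ => (hM i s).2.1.mul (hN s j).2.1
  · refine Finset.sum_eq_zero fun s _ => ?_
    by_cases h : p i = q s
    · rw [(hN s j).2.2 (h ▸ hij), mul_zero]
    · rw [(hM i s).2.2 h, zero_mul]

theorem add {M N : Matrix m n (Form X)} (hM : IsGradedMatrix k p q M)
    (hN : IsGradedMatrix k p q N) : IsGradedMatrix k p q (M + N) := fun i j =>
  ⟨(hM i j).1.add (hN i j).1, (hM i j).2.1.add (hN i j).2.1, fun h => by
    rw [madd_apply, (hM i j).2.2 h, (hN i j).2.2 h, add_zero]⟩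

theorem neg {M : Matrix m n (Form X)} (hM : IsGradedMatrix k p q M) :
    IsGradedMatrix k p q (-M) := fun i j =>
  ⟨(hM i j).1.neg, (hM i j).2.1.neg, fun h => by rw [mneg_apply, (hM i j).2.2 h, neg_zero]⟩

theorem sub {M N : Matrix m n (Form X)} (hM : IsGradedMatrix k p q M)
    (hN : IsGradedMatrix k p q N) : IsGradedMatrix k p q (M - N) := by
  rw [sub_eq_add_neg]; exact hM.add hN.neg

theorem smul (c : ℂ) {M : Matrix m n (Form X)} (hM : IsGradedMatrix k p q M) :
    IsGradedMatrix k p q (c • M) := fun i j =>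
  ⟨(hM i j).1.smul c, (hM i j).2.1.smul c, fun h => by
    rw [Matrix.smul_apply, (hM i j).2.2 h, smul_zero]⟩

theorem pull {M : Matrix m n (Form Y)} (hM : IsGradedMatrix k p q M) (f : X.carrier → Y.carrier)
    [SmoothMap X Y f] : IsGradedMatrix k p q (M.map (pull f)) := fun i j =>
  ⟨(hM i j).1.pull f, (hM i j).2.1.pull f, fun h => by
    rw [mmap_apply, (hM i j).2.2 h, map_zero]⟩

theorem d {M : Matrix m n (Form X)} (hM : IsGradedMatrix 0 p q M) :
    IsGradedMatrix 1 p q 𝐝M := fun i j =>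
  ⟨(hM i j).1.extD, hasDegree_one_extD (hM i j).2.1 (hM i j).1, fun h => by
    rw [mmap_apply, (hM i j).2.2 h, extD_zero]⟩

theorem sum {κ : Type*} {s : Finset κ} {M : κ → Matrix m n (Form X)}
    (h : ∀ i ∈ s, IsGradedMatrix k p q (M i)) : IsGradedMatrix k p q (∑ i ∈ s, M i) := fun i j => by
  rw [msum_apply]
  exact ⟨IsSmooth.sum fun a ha => (h a ha i j).1, HasDegree.sum fun a ha => (h a ha i j).2.1,
    fun hij => Finset.sum_eq_zero fun a ha => (h a ha i j).2.2 hij⟩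

end IsGradedMatrix

theorem IsSC.isBundle {V : PreBundle X} (h : IsSC β V) (hA : IsGradedMatrix 1 V.par V.par V.A) :
    IsBundle β V :=
  ⟨h.e_graded, h.ρ_graded, hA, h.e_idem, h.ρ_hom, h.A_hom, h.ρ_one, h.ρ_mul, h.A_equivariant⟩

/-! ### Existence of equivariant connections -/

theorem IsSC.exists_isBundle [Finite G] (hβ : IsNormalizedCocycle β) {V : PreBundle X}
    (h : IsSC β V) : ∃ A, IsBundle β (V.withConnection A) := by
  cases nonempty_fintype G
  have hT := h.isTw
  have := h.e_smooth; have := h.ρ_smooth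
  let τ := twInv β V.ρ
  have hτ : ∀ g, IsGradedMatrix 0 V.par V.par (τ g) := fun g => ((h.ρ_graded _).pull _).smul _
  let S := ∑ g, τ g * 𝐝(V.ρ g) * V.e
  let A := (Fintype.card G : ℂ)⁻¹ • S
  have hAg : IsGradedMatrix 1 V.par V.par A :=
    IsGradedMatrix.smul _ (IsGradedMatrix.sum fun g _ =>
      ((hτ g).mul (h.ρ_graded g).d).mul h.e_graded)
  have hSe : S * V.e = S := by
    rw [msum_mul]
    exact Finset.sum_congr rfl fun g _ => by rw [massoc, h.e_idem]
  have heS : V.e * S = S := by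
    rw [mmul_sum]
    exact Finset.sum_congr rfl fun g _ => by
      rw [← massoc, ← massoc, hT.e_twInv]
  have hSρ : ∀ k, V.ρ k * S = (Fintype.card G : ℂ) • (V.e⋆k * 𝐝(V.ρ k) * V.e) +
      S⋆k * V.ρ k := fun k => by
    have h1 : V.ρ k * S = ∑ g, (τ g)⋆k *
        ((β g k : ℂ) • 𝐝(V.ρ (g * k)) * V.e) := by
      rw [mmul_sum]
      refine (Fintype.sum_equiv (Equiv.mulRight k) _ _ fun g => ?_).symm
      show (twInv β V.ρ g)⋆k * ((β g k : ℂ) • 𝐝(V.ρ (g * k)) * V.e) =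
        V.ρ k * (twInv β V.ρ (g * k) * 𝐝(V.ρ (g * k)) * V.e)
      rw [massoc (twInv β V.ρ (g * k)), ← massoc (V.ρ k), hT.ρ_twInv hβ,
        msmul_mul, msmul_mul, mmul_smul]
    have h2 : ∀ g, (β g k : ℂ) • 𝐝(V.ρ (g * k)) * V.e =
        𝐝((V.ρ g)⋆k) * V.ρ k + (V.ρ g)⋆k * (𝐝(V.ρ k) * V.e) :=
      fun g => by
      rw [← d_smul, ← h.ρ_mul, d_mul, s_pull, (h.ρ_graded g).s_even, madd_mul,
        massoc, h.ρ_mul_e, massoc]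
    have h3 : ∀ g, (τ g)⋆k * (V.ρ g)⋆k =
        V.e⋆k := fun g => by rw [← mpull_mul, hT.twInv_mul]
    have h4 : S⋆k * V.ρ k =
        ∑ g, (τ g)⋆k * (𝐝((V.ρ g)⋆k) * V.ρ k) := by
      rw [mpull_sum, msum_mul]
      refine Finset.sum_congr rfl fun g _ => ?_
      rw [mpull_mul, mpull_mul, massoc, h.e_mul_ρ, massoc, d_pull]
    rw [h1, h4]
    simp only [h2, mmul_add, ← massoc _ _ (𝐝(V.ρ k) * V.e), h3]
    rw [Finset.sum_add_distrib, add_comm, Finset.sum_const, Finset.card_univ,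
      ← Nat.cast_smul_eq_nsmul ℂ, massoc]
  have hcard : (Fintype.card G : ℂ) ≠ 0 := Nat.cast_ne_zero.2 Fintype.card_ne_zero
  refine ⟨A, h.e_graded, h.ρ_graded, hAg, h.e_idem, h.ρ_hom, ?_, h.ρ_one, h.ρ_mul, fun g => ?_⟩
  · suffices A = V.e * A * V.e from this
    rw [mmul_smul, msmul_mul, heS, hSe]
  · suffices V.ρ g * A = V.e⋆g * 𝐝(V.ρ g) * V.e +
      A⋆g * V.ρ g from this
    rw [mmul_smul, hSρ, smul_add, smul_smul, inv_mul_cancel₀ hcard, one_smul, mpull_smul,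
      msmul_mul]

/-! ### Convex combinations of superconnections -/

/-- Multiplication of the entries of a matrix by a form. -/
def fs (χ : Form X) (M : Matrix m n (Form X)) : Matrix m n (Form X) := M.map (χ * ·)

section

variable {χ : Form X}

theorem fs_mul [Fintype n] (M : Matrix m n (Form X)) (N : Matrix n o (Form X)) :
    fs χ M * N = fs χ (M * N) := by
  ext1 i j
  simp only [fs, mmap_apply, mmul_apply, Finset.mul_sum, mul_assoc]

theorem mul_fs (hχ : HasDegree 0 χ) [Fintype n] (M : Matrix m n (Form X))
    (N : Matrix n o (Form X)) : M * fs χ N = fs χ (M * N) := by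
  have h1 : ∀ α : Form X, α * χ = χ * α := fun α => funext fun x =>
    (Ext.mul_comm_of_even (by rw [Ext.sinv_of_mem_degree (hχ x), pow_zero, one_mul]) _).symm
  ext1 i j
  simp only [fs, mmap_apply, mmul_apply, Finset.mul_sum, ← mul_assoc, h1]

theorem fs_pull (f : X.carrier → Y.carrier) (χ : Form Y) (M : Matrix m n (Form Y)) :
    (fs χ M).map (pull f) = fs (pull f χ) (M.map (pull f)) := by
  ext1 i j; exact map_mul (pull f) _ _

theorem fs_smooth (hs : IsSmooth χ) (M : Matrix m n (Form X)) [hM : MSmooth M] : MSmooth (fs χ M) :=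
  ⟨fun i j => hs.mul (hM.smooth i j)⟩

theorem fs_isPar (hχ : HasDegree 0 χ) {a : Bool} {p : m → Bool} {q : n → Bool}
    {M : Matrix m n (Form X)} (hM : IsPar a p q M) : IsPar a p q (fs χ M) := fun i j => by
  rw [fs, mmap_apply, map_mul, hM, hχ.sinv_eq, pow_zero, one_mul, mul_smul_comm]

theorem fs_graded (hχ : HasDegree 0 χ) (hs : IsSmooth χ) {k : ℕ} {p : m → Bool} {q : n → Bool}
    {M : Matrix m n (Form X)} (hM : IsGradedMatrix k p q M) : IsGradedMatrix k p q (fs χ M) :=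
  fun i j => ⟨hs.mul (hM i j).1, by
    have := hχ.mul (hM i j).2.1
    rwa [zero_add] at this, fun h => by rw [fs, mmap_apply, (hM i j).2.2 h, mul_zero]⟩

theorem fs_add (M N : Matrix m n (Form X)) : fs χ (M + N) = fs χ M + fs χ N := by
  ext1 i j; exact mul_add _ _ _

end

/-- The combination `(1 - χ) M + χ N`. -/
def comb (χ : Form X) (M N : Matrix m n (Form X)) : Matrix m n (Form X) := M - fs χ M + fs χ N

theorem IsSC.comb {V : PreBundle X} {A : Matrix V.ι V.ι (Form X)} {χ : Form X} (h : IsSC β V)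
    (h' : IsSC β (V.withConnection A)) (hχ : HasDegree 0 χ) (hs : IsSmooth χ)
    (hg : ∀ g, pull (X.act g) χ = χ) : IsSC β (V.withConnection (TwistedK.comb χ V.A A)) := by
  have := h.A_smooth
  have hA : MSmooth A := h'.A_smooth
  have := fs_smooth hs A; have := fs_smooth hs V.A
  have hAh : A = V.e * A * V.e := h'.A_hom
  refine ⟨h.e_graded, h.ρ_graded, ?_, ?_, h.e_idem, h.ρ_hom, ?_, h.ρ_one, h.ρ_mul, fun g => ?_⟩
  · suffices MSmooth (TwistedK.comb χ V.A A) from this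
    unfold TwistedK.comb; infer_instance
  · have h'o : IsPar true V.par V.par A := h'.A_odd
    exact (h.A_odd.sub (fs_isPar hχ h.A_odd)).add (fs_isPar hχ h'o)
  · suffices TwistedK.comb χ V.A A = V.e * TwistedK.comb χ V.A A * V.e from this
    rw [TwistedK.comb, mmul_add, mmul_sub, madd_mul, msub_mul, mul_fs hχ,
      mul_fs hχ, fs_mul, fs_mul, ← h.A_hom, ← hAh]
  · suffices V.ρ g * TwistedK.comb χ V.A A = V.e⋆g * 𝐝(V.ρ g) * V.e +
      (TwistedK.comb χ V.A A)⋆g * V.ρ g from this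
    have e1 : V.ρ g * A = V.e⋆g * 𝐝(V.ρ g) * V.e +
      A⋆g * V.ρ g := h'.A_equivariant g
    rw [TwistedK.comb, mmul_add, mmul_sub, mul_fs hχ, mul_fs hχ, h.A_equivariant, e1,
      mpull_add, mpull_sub, fs_pull, fs_pull, hg, madd_mul, msub_mul, fs_mul, fs_mul,
      fs_add, fs_add]
    abel

theorem comb_graded {χ : Form X} (hχ : HasDegree 0 χ) (hs : IsSmooth χ) {k : ℕ} {p : m → Bool}
    {q : n → Bool} {M N : Matrix m n (Form X)} (hM : IsGradedMatrix k p q M)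
    (hN : IsGradedMatrix k p q N) : IsGradedMatrix k p q (comb χ M N) :=
  (hM.sub (fs_graded hχ hs hM)).add (fs_graded hχ hs hN)

/-! ### Pullbacks -/

theorem IsSC.pull {V : PreBundle Y} (h : IsSC β V) (f : X.carrier → Y.carrier) [SmoothMap X Y f]
    (he : ∀ g x, f (X.act g x) = Y.act g (f x)) : IsSC β (V.pull f) := by
  have := h.e_smooth; have := h.A_smooth; have := h.ρ_smooth
  refine ⟨h.e_graded.pull f, fun g => (h.ρ_graded g).pull f, ?_, h.A_odd.pull f, ?_, fun g => ?_, ?_,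
    ?_, fun g k => ?_, fun g => ?_⟩
  · exact (inferInstance : MSmooth (V.A.map (fpull f)))
  · have := congrArg (fun M : Matrix _ _ (Form Y) => M.map (fpull f)) h.e_idem
    simp only [mpull_mul] at this
    exact this
  · have := congrArg (fun M : Matrix _ _ (Form Y) => M.map (fpull f)) (h.ρ_hom g)
    simp only [mpull_mul, ← mpull_equivariant he] at this
    exact this
  · have := congrArg (fun M : Matrix _ _ (Form Y) => M.map (fpull f)) h.A_hom
    simp only [mpull_mul] at this
    exact this
  · exact congrArg (fun M : Matrix _ _ (Form Y) => M.map (fpull f)) h.ρ_one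
  · have := congrArg (fun M : Matrix _ _ (Form Y) => M.map (fpull f)) (h.ρ_mul g k)
    simp only [mpull_mul, mpull_smul, ← mpull_equivariant he] at this
    exact this
  · have := congrArg (fun M : Matrix _ _ (Form Y) => M.map (fpull f)) (h.A_equivariant g)
    simp only [mpull_mul, mpull_add, ← mpull_equivariant he, ← d_pull] at this
    exact this

theorem fexp_pull [Fintype m] [DecidableEq m] (f : X.carrier → Y.carrier)
    (F : Matrix m m (Form Y)) (t : ℝ) : (fexp F t).map (pull f) = fexp (F.map (pull f)) t := by
  ext1 i j
  funext x
  rw [mmap_apply, pull_apply, fexp, mof_apply, map_mexp, fexp, mof_apply]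
  congr 1
  funext i j
  simp only [Pi.smul_apply]
  exact map_smul (Ext.map _) ((-t : ℝ) : ℂ) _

theorem PreBundle.pull_B (V : PreBundle Y) (hV : MSmooth V.e) (f : X.carrier → Y.carrier)
    [SmoothMap X Y f] : (V.pull f).B = V.B.map (fpull f) := by
  have : V.B.map (fpull f) =
      𝐝(V.e.map (fpull f)) * V.e.map (fpull f) - V.A.map (fpull f) := by
    rw [PreBundle.B, mpull_sub, mpull_mul, d_pull]
  exact this.symm

theorem IsSC.pull_scurv {V : PreBundle Y} (h : IsSC β V) (f : X.carrier → Y.carrier)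
    [SmoothMap X Y f] : (V.pull f).scurv = V.scurv.map (fpull f) := by
  have := h.B_smooth
  have h1 : V.scurv.map (fpull f) = -((𝐝(V.B.map (fpull f)) +
      𝐬(V.B.map (fpull f)) * V.B.map (fpull f)) * V.e.map (fpull f)) := by
    rw [PreBundle.scurv, mpull_neg, mpull_mul, mpull_add, mpull_mul, d_pull, s_pull]
  rw [h1, ← V.pull_B h.e_smooth]; rfl

theorem IsSC.pull_toSRep {V : PreBundle Y} (h : IsSC β V) (f : X.carrier → Y.carrier)
    [SmoothMap X Y f] (he : ∀ g x, f (X.act g x) = Y.act g (f x)) :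
    (V.pull f).toSRep = V.toSRep.pull f := by
  have hR : (V.pull f).toSRep.R = (V.toSRep.pull f).R := by
    funext g
    have h1 : ∀ t : ℝ, (V.ρ g).map (fpull f) * fexp (V.scurv.map (fpull f)) t =
        (V.ρ g * fexp V.scurv t).map (fpull f) := fun t => by rw [mpull_mul, fexp_pull]
    refine oddMatrix_ext (fun t => ?_) (fun t => ?_)
    · refine Eq.trans ?_ (h1 t)
      rw [← h.pull_scurv]; rfl
    · have h2 : (V.B.map (fpull f))⋆g *
          ((V.ρ g).map (fpull f) * fexp (V.scurv.map (fpull f)) t) =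
          (V.B.map (fpull (Y.act g)) * (V.ρ g * fexp V.scurv t)).map (fpull f) := by
        rw [h1, mpull_mul f (V.B.map _), mpull_equivariant he]
      refine Eq.trans ?_ h2
      rw [← h.pull_scurv, ← V.pull_B h.e_smooth]; rfl
  calc (V.pull f).toSRep = { V.toSRep.pull f with R := (V.pull f).toSRep.R } := rfl
    _ = { V.toSRep.pull f with R := (V.toSRep.pull f).R } := by rw [hR]
    _ = V.toSRep.pull f := rfl

end Operations

end

section

section Cylinder

variable {G : Type v} [Group G] {X Y Z : GMfd.{u} G} {β : G → G → Circle} {m n o : Type}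

/-! ### The cylinder -/

instance SmoothMap.incl (l : ℝ) : SmoothMap X X.cyl (X.incl l) :=
  ⟨contMDiff_id.prodMk contMDiff_const⟩

instance SmoothMap.proj : SmoothMap X.cyl X X.proj := ⟨contMDiff_fst⟩

/-- The product of a map with the identity of the line. -/
def cylMap (f : X.carrier → Y.carrier) (p : X.cyl.carrier) : Y.cyl.carrier :=
  (f (X.proj p), X.height p)

/-- The product of the identity with a map of the line. -/
def reparam (X : GMfd.{u} G) (χ : ℝ → ℝ) (p : X.cyl.carrier) : X.cyl.carrier :=
  (X.proj p, χ (X.height p))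

instance SmoothMap.cylMap (f : X.carrier → Y.carrier) [hf : SmoothMap X Y f] :
    SmoothMap X.cyl Y.cyl (cylMap f) :=
  ⟨(hf.smooth.comp contMDiff_fst).prodMk contMDiff_snd⟩

theorem SmoothMap.reparam {χ : ℝ → ℝ} (h : ContDiff ℝ ∞ χ) : SmoothMap X.cyl X.cyl (reparam X χ) :=
  ⟨contMDiff_fst.prodMk (h.contMDiff.comp contMDiff_snd)⟩

theorem incl_act (l : ℝ) (g : G) (x : X.carrier) :
    X.incl l (X.act g x) = X.cyl.act g (X.incl l x) := rfl

theorem proj_act (g : G) (p : X.cyl.carrier) : X.proj (X.cyl.act g p) = X.act g (X.proj p) := rfl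

theorem reparam_act (χ : ℝ → ℝ) (g : G) (p : X.cyl.carrier) :
    reparam X χ (X.cyl.act g p) = X.cyl.act g (reparam X χ p) := rfl

theorem cylMap_act {f : X.carrier → Y.carrier} (hf : ∀ g x, f (X.act g x) = Y.act g (f x)) (g : G)
    (p : X.cyl.carrier) : cylMap f (X.cyl.act g p) = Y.cyl.act g (cylMap f p) :=
  Prod.ext (hf g p.1) rfl

/-! ### Functions as forms -/

/-- A function as a differential form of degree zero. -/
def fnForm (f : X.carrier → ℂ) : Form X := fun x => algebraMap ℂ _ (f x)

theorem hasDegree_fnForm (f : X.carrier → ℂ) : HasDegree 0 (fnForm f) := fun _ =>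
  Ext.algebraMap_mem_degree _

theorem pull_fnForm (f : X.carrier → Y.carrier) (φ : Y.carrier → ℂ) :
    pull f (fnForm φ) = fnForm (φ ∘ f) := by
  funext x; exact AlgHom.commutes _ _

theorem isSmooth_fnForm_iff {f : X.carrier → ℂ} : IsSmooth (fnForm f) ↔
    ∀ x₀ : X.carrier, ContDiffOn ℝ ∞ (fun y => f ((extChartAt X.I x₀).symm y))
      (extChartAt X.I x₀).target := by
  have h1 : ∀ x₀ : X.carrier, chartRep (fnForm f) x₀ = fun y =>
      (algebraMap ℂ (Ext X.E) (f ((extChartAt X.I x₀).symm y))) := fun x₀ => by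
    funext y; exact AlgHom.commutes _ _
  let P : ℂ →L[ℝ] Ext X.E := realCLM (Algebra.linearMap ℂ (Ext X.E))
  let Q : Ext X.E →L[ℝ] ℂ := realCLM (Ext.aug : Ext X.E →ₐ[ℂ] ℂ).toLinearMap
  refine ⟨fun h x₀ => ?_, fun h x₀ => ?_⟩
  · refine (Q.contDiff.comp_contDiffOn (h x₀)).congr fun y _ => ?_
    rw [Function.comp, h1]
    exact (Ext.aug_algebraMap _).symm
  · rw [h1]
    exact P.contDiff.comp_contDiffOn (h x₀)

theorem isSmooth_fnForm {f : X.carrier → ℂ} (hf : ContMDiff X.I 𝓘(ℝ, ℂ) ∞ f) :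
    IsSmooth (fnForm f) := isSmooth_fnForm_iff.2 fun x₀ =>
  contMDiffOn_iff_contDiffOn.1 (hf.comp_contMDiffOn (contMDiffOn_extChartAt_symm x₀))

/-- The height function of the cylinder as a form. -/
def hgt (X : GMfd.{u} G) : Form X.cyl := fnForm fun p => (X.height p : ℂ)

theorem isSmooth_hgt : IsSmooth (hgt X) := isSmooth_fnForm <|
  (Complex.ofRealCLM.contDiff.contMDiff).comp (contMDiff_snd : ContMDiff X.cyl.I 𝓘(ℝ, ℝ) ∞ X.height)

theorem hasDegree_hgt : HasDegree 0 (hgt X) := hasDegree_fnForm _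

theorem pull_act_hgt (g : G) : pull (X.cyl.act g) (hgt X) = hgt X := pull_fnForm _ _

theorem pull_incl_hgt (l : ℝ) : pull (X.incl l) (hgt X) = fnForm fun _ => (l : ℂ) := pull_fnForm _ _

theorem pull_cylMap_hgt (f : X.carrier → Y.carrier) : pull (cylMap f) (hgt Y) = hgt X :=
  pull_fnForm _ _

theorem comb_zero (M N : Matrix m n (Form X)) : comb (fnForm fun _ => ((0 : ℝ) : ℂ)) M N = M := by
  ext1 i j
  have : (fnForm fun _ => ((0 : ℝ) : ℂ) : Form X) = 0 := by
    funext x; simp [fnForm]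
  rw [this]
  simp [comb, fs]

theorem comb_one (M N : Matrix m n (Form X)) : comb (fnForm fun _ => ((1 : ℝ) : ℂ)) M N = N := by
  ext1 i j
  have : (fnForm fun _ => ((1 : ℝ) : ℂ) : Form X) = 1 := by
    funext x; simp [fnForm]
  rw [this]
  simp [comb, fs]

theorem comb_pull (f : X.carrier → Y.carrier) (χ : Form Y) (M N : Matrix m n (Form Y)) :
    (comb χ M N).map (pull f) = comb (pull f χ) (M.map (pull f)) (N.map (pull f)) := by
  rw [comb, mpull_add, mpull_sub, fs_pull, fs_pull, comb]

/-! ### Equality of bundle data -/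

theorem PreBundle.mk_congr {ι : Type} [Fintype ι] [DecidableEq ι] {par : ι → Bool}
    {e e' : Matrix ι ι (Form X)} {ρ ρ' : G → Matrix ι ι (Form X)} {A A' : Matrix ι ι (Form X)}
    (he : e = e') (hρ : ∀ g, ρ g = ρ' g) (hA : A = A') :
    (PreBundle.mk ι par e ρ A : PreBundle X) = PreBundle.mk ι par e' ρ' A' := by
  subst he hA
  rw [funext hρ]

theorem mpull_id (M : Matrix m n (Form X)) : M.map (pull (X := X) (Y := X) id) = M := by
  ext1 i j; exact pull_id _

theorem PreBundle.pull_pull (V : PreBundle Z) (f : X.carrier → Y.carrier)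
    (g : Y.carrier → Z.carrier) [SmoothMap X Y f] [SmoothMap Y Z g] :
    (V.pull g).pull f = V.pull (g ∘ f) :=
  mk_congr (mpull_comp f g _).symm (fun _ => (mpull_comp f g _).symm) (mpull_comp f g _).symm

/-- The linear interpolation of matrices of forms. -/
def lerp (M N : Matrix m n (Form X)) : Matrix m n (Form X.cyl) :=
  comb (hgt X) (M.map (pull X.proj)) (N.map (pull X.proj))

theorem mpull_incl_proj (l : ℝ) (M : Matrix m n (Form X)) :
    (M.map (pull X.proj)).map (pull (X.incl l)) = M :=
  (mpull_comp (X.incl l) X.proj M).symm.trans (mpull_id M)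

theorem mpull_cylMap_proj (f : X.carrier → Y.carrier) [SmoothMap X Y f] (M : Matrix m n (Form Y)) :
    (M.map (pull Y.proj)).map (pull (cylMap f)) = (M.map (pull f)).map (pull X.proj) :=
  (mpull_comp (cylMap f) Y.proj M).symm.trans (mpull_comp X.proj f M)

theorem lerp_incl_zero (M N : Matrix m n (Form X)) : (lerp M N).map (pull (X.incl 0)) = M := by
  rw [lerp, comb_pull, mpull_incl_proj, mpull_incl_proj, pull_incl_hgt, comb_zero]

theorem lerp_incl_one (M N : Matrix m n (Form X)) : (lerp M N).map (pull (X.incl 1)) = N := by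
  rw [lerp, comb_pull, mpull_incl_proj, mpull_incl_proj, pull_incl_hgt, comb_one]

theorem lerp_cylMap (f : X.carrier → Y.carrier) [SmoothMap X Y f] (M N : Matrix m n (Form Y)) :
    (lerp M N).map (pull (cylMap f)) = lerp (M.map (pull f)) (N.map (pull f)) := by
  rw [lerp, comb_pull, mpull_cylMap_proj, mpull_cylMap_proj, pull_cylMap_hgt, lerp]

theorem lerp_apply (M N : Matrix m n (Form X)) (i : m) (j : n) (p : X.cyl.carrier) :
    lerp M N i j p = (1 - (X.height p : ℂ)) • pull X.proj (M i j) p +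
      (X.height p : ℂ) • pull X.proj (N i j) p := by
  show pull X.proj (M i j) p - algebraMap ℂ _ (X.height p : ℂ) * pull X.proj (M i j) p +
    algebraMap ℂ _ (X.height p : ℂ) * pull X.proj (N i j) p = _
  rw [← Algebra.smul_def, ← Algebra.smul_def, sub_smul, one_smul]

theorem PreBundle.interpolate_eq (V : PreBundle X) (A : Matrix V.ι V.ι (Form X)) :
    V.interpolate A = (V.pull X.proj).withConnection (lerp V.A A) := by
  refine PreBundle.mk_congr rfl (fun _ => rfl) ?_
  ext1 i j
  funext p
  exact (lerp_apply _ _ _ _ _).symm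

theorem PreBundle.interpolate_incl_zero (V : PreBundle X) (A : Matrix V.ι V.ι (Form X)) :
    (V.interpolate A).pull (X.incl 0) = V := by
  rw [interpolate_eq]
  exact PreBundle.mk_congr (mpull_incl_proj 0 _) (fun _ => mpull_incl_proj 0 _) (lerp_incl_zero _ _)

theorem PreBundle.interpolate_incl_one (V : PreBundle X) (A : Matrix V.ι V.ι (Form X)) :
    (V.interpolate A).pull (X.incl 1) = V.withConnection A := by
  rw [interpolate_eq]
  exact PreBundle.mk_congr (mpull_incl_proj 1 _) (fun _ => mpull_incl_proj 1 _) (lerp_incl_one _ _)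

theorem PreBundle.interpolate_cylMap (V : PreBundle Y) (A : Matrix V.ι V.ι (Form Y))
    (f : X.carrier → Y.carrier) [SmoothMap X Y f] :
    (V.interpolate A).pull (cylMap f) = (V.pull f).interpolate (A.map (fpull f)) := by
  refine Eq.trans ?_ ((V.pull f).interpolate_eq _).symm
  rw [interpolate_eq]
  exact PreBundle.mk_congr (mpull_cylMap_proj f _) (fun _ => mpull_cylMap_proj f _)
    (lerp_cylMap f _ _)

theorem IsSC.interpolate {V : PreBundle X} {A : Matrix V.ι V.ι (Form X)} (h : IsSC β V)
    (h' : IsSC β (V.withConnection A)) : IsSC β (V.interpolate A) := by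
  rw [V.interpolate_eq]
  exact (h.pull X.proj proj_act).comb (h'.pull X.proj proj_act) hasDegree_hgt isSmooth_hgt
    pull_act_hgt

theorem IsBundle.pull {V : PreBundle Y} (h : IsBundle β V) (f : X.carrier → Y.carrier)
    [SmoothMap X Y f] (he : ∀ g x, f (X.act g x) = Y.act g (f x)) : IsBundle β (V.pull f) :=
  (h.isSC.pull f he).isBundle (h.A_graded.pull f)

theorem IsBundle.interpolate {V : PreBundle X} {A : Matrix V.ι V.ι (Form X)} (h : IsBundle β V)
    (h' : IsBundle β (V.withConnection A)) : IsBundle β (V.interpolate A) := by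
  refine (h.isSC.interpolate h'.isSC).isBundle ?_
  rw [V.interpolate_eq]
  exact comb_graded hasDegree_hgt isSmooth_hgt (h.A_graded.pull X.proj) (h'.A_graded.pull X.proj)

/-! ### Superconnections as representations -/

theorem fexp_zero [Fintype m] [DecidableEq m] (F : Matrix m m (Form X)) : fexp F 0 = 1 := by
  ext1 i j
  funext x
  rw [fexp, mof_apply, neg_zero, zero_smul, mexp_zero, mone_apply]
  by_cases h : i = j
  · simp [h]
  · simp [h]

theorem PreBundle.toSRep_a_zero (V : PreBundle X) (g : G) : V.toSRep.a g 0 = V.ρ g := by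
  have : V.ρ g * fexp V.scurv 0 = V.ρ g := by rw [fexp_zero, mmul_one]
  exact this

theorem IsSC.toSRep_b_zero {V : PreBundle X} (h : IsSC β V) : V.toSRep.b 1 0 = V.B := by
  have : V.B⋆(1 : G) * (V.ρ 1 * fexp V.scurv 0) = V.B := by
    rw [fexp_zero, mmul_one, mpull_act_one, h.ρ_one, h.B_mul_e]
  exact this

theorem IsSC.toPB_toSRep {V : PreBundle X} (h : IsSC β V) : V.toSRep.toPB = V := by
  refine PreBundle.mk_congr rfl V.toSRep_a_zero ?_
  have : 𝐝V.e * V.e - V.B = V.A := by rw [PreBundle.B, sub_sub_cancel]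
  rw [← this, ← h.toSRep_b_zero]; rfl

/-- A representation whose idempotent and action are of degree zero comes from
a superconnection. -/
theorem IsRep.isSC_of_toPB_eq (hβ : IsNormalizedCocycle β) {D : PreRep X} (h : IsRep β D)
    (he : IsGradedMatrix 0 D.par D.par D.e)
    (hρ : ∀ g, IsGradedMatrix 0 D.par D.par (D.a g 0)) {V : PreBundle X} (hV : D.toPB = V) :
    IsSC β V ∧ V.toSRep = D := by
  rw [← hV]
  exact ⟨h.isSC_toPB hβ he hρ, h.toSRep_toPB hβ he hρ⟩

/-! ### Direct sums -/

theorem IsSC.sum (hβ : IsNormalizedCocycle β) {V V' : PreBundle X} (h : IsSC β V)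
    (h' : IsSC β V') : IsSC β (V.sum V') ∧ (V.sum V').toSRep = V.toSRep.sum V'.toSRep := by
  refine (h.isRep_toSRep.sum h'.isRep_toSRep).isSC_of_toPB_eq hβ (h.e_graded.fromBlocks h'.e_graded)
    (fun g => ?_) ?_
  · have h1 := (h.ρ_graded g).fromBlocks (h'.ρ_graded g)
    rw [← V.toSRep_a_zero, ← V'.toSRep_a_zero] at h1
    intro i j
    have := h1 i j
    rcases i with i | i <;> rcases j with j | j <;> exact this
  · refine PreBundle.mk_congr rfl (fun g => ?_) ?_
    · have : (V.toSRep.sum V'.toSRep).a g 0 =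
          fromBlocks (V.toSRep.a g 0) 0 0 (V'.toSRep.a g 0) := by
        ext1 i j; rcases i with i | i <;> rcases j with j | j <;> rfl
      rw [V.toSRep_a_zero, V'.toSRep_a_zero] at this
      exact this
    · have h1 : (V.toSRep.sum V'.toSRep).b 1 0 =
          fromBlocks (V.toSRep.b 1 0) 0 0 (V'.toSRep.b 1 0) := by
        ext1 i j; rcases i with i | i <;> rcases j with j | j <;> rfl
      rw [h.toSRep_b_zero, h'.toSRep_b_zero] at h1
      have h2 : 𝐝(fromBlocks V.e 0 0 V'.e) * fromBlocks V.e 0 0 V'.e -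
          fromBlocks V.B 0 0 V'.B = fromBlocks V.A 0 0 V'.A := by
        rw [Matrix.fromBlocks_map, mmap_zero _ extD_zero, mmap_zero _ extD_zero,
          Matrix.fromBlocks_multiply, sub_eq_add_neg, Matrix.fromBlocks_neg, Matrix.fromBlocks_add,
          PreBundle.B, PreBundle.B]
        simp
      exact (congrArg (𝐝(fromBlocks V.e 0 0 V'.e) * fromBlocks V.e 0 0 V'.e - ·)
        h1).trans h2

theorem PreBundle.interpolate_sum (V V' : PreBundle X) (A : Matrix V.ι V.ι (Form X))
    (A' : Matrix V'.ι V'.ι (Form X)) :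
    (V.sum V').interpolate (fromBlocks A 0 0 A') =
      (V.interpolate A).sum (V'.interpolate A') := by
  have hz : ∀ (m n : Type), (0 : Matrix m n (Form X)).map (fpull X.proj) = 0 := fun m n =>
    mmap_zero _ (map_zero _)
  refine PreBundle.mk_congr ?_ (fun g => ?_) ?_
  · show (fromBlocks V.e 0 0 V'.e).map (fpull X.proj) = fromBlocks _ 0 0 _
    rw [Matrix.fromBlocks_map, hz, hz]; rfl
  · show (fromBlocks (V.ρ g) 0 0 (V'.ρ g)).map (fpull X.proj) =
      fromBlocks _ 0 0 _
    rw [Matrix.fromBlocks_map, hz, hz]; rfl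
  · ext1 i j
    rcases i with i | i <;> rcases j with j | j
    · rfl
    · funext p
      show (1 - (X.height p : ℂ)) • fpull X.proj (0 : Form X) p +
        (X.height p : ℂ) • fpull X.proj (0 : Form X) p = 0
      simp
    · funext p
      show (1 - (X.height p : ℂ)) • fpull X.proj (0 : Form X) p +
        (X.height p : ℂ) • fpull X.proj (0 : Form X) p = 0
      simp
    · rfl

/-! ### Transport of a superconnection -/

/-- Transport of a bundle with superconnection along an isomorphism `a` with inverse `b`. -/
def PreBundle.conj (V : PreBundle X) [Fintype m] [DecidableEq m] (p : m → Bool)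
    (e : Matrix m m (Form X)) (ρ : G → Matrix m m (Form X)) (a : Matrix V.ι m (Form X))
    (b : Matrix m V.ι (Form X)) : PreBundle X where
  ι := m
  par := p
  e := e
  ρ := ρ
  A := 𝐝e * e - (𝐝b * V.e * a + 𝐬b * V.B * a)

section Conj

variable [Fintype m] [DecidableEq m] {V : PreBundle X} {p : m → Bool} {e : Matrix m m (Form X)}
  {ρ : G → Matrix m m (Form X)} {a : Matrix V.ι m (Form X)} {b : Matrix m V.ι (Form X)}

theorem IsSC.conj (hβ : IsNormalizedCocycle β) (h : IsSC β V) (hab : MIso p e V.par V.e a b)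
    (he : IsGradedMatrix 0 p p e) (hρ : ∀ g, IsGradedMatrix 0 p p (ρ g))
    (hρa : ∀ g, ρ g = b⋆g * V.ρ g * a) :
    IsSC β (V.conj p e ρ a b) ∧ (V.conj p e ρ a b).toSRep = V.toSRep.conj p e a b := by
  have h1 : ∀ g, (V.toSRep.conj p e a b).a g 0 = ρ g := fun g => by
    rw [hρa]
    exact (PreRep.conj_a g 0).trans (by rw [V.toSRep_a_zero]; rfl)
  refine (IsRep.conj hab h.isRep_toSRep).isSC_of_toPB_eq hβ he (fun g => ?_)
    (PreBundle.mk_congr rfl h1 ?_)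
  · rw [h1]; exact hρ g
  · have h3 : 𝐝(b⋆(1 : G)) * V.ρ 1 * a +
        𝐬(b⋆(1 : G)) * V.B * a = 𝐝b * V.e * a + 𝐬b * V.B * a := by
      rw [mpull_act_one, h.ρ_one]
    have h2 : (V.toSRep.conj p e a b).b 1 0 = 𝐝b * V.e * a + 𝐬b * V.B * a := by
      refine (PreRep.conj_b 1 0).trans (Eq.trans ?_ h3)
      rw [V.toSRep_a_zero, h.toSRep_b_zero]; rfl
    exact congrArg (𝐝e * e - ·) h2

theorem IsSC.conj_iso (h : IsSC β V) (hab : MIso p e V.par V.e a b) :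
    (V.toSRep.conj p e a b).Iso V.toSRep :=
  PreRep.conj_iso hab h.isRep_toSRep.adm

theorem IsBundle.conj_graded (h : IsBundle β V) (he : IsGradedMatrix 0 p p e)
    (ha : IsGradedMatrix 0 V.par p a) (hb : IsGradedMatrix 0 p V.par b) :
    IsGradedMatrix 1 p p (V.conj p e ρ a b).A := by
  suffices IsGradedMatrix 1 p p (𝐝e * e - (𝐝b * V.e * a + 𝐬b * V.B * a)) from this
  rw [hb.s_even]
  have hB : IsGradedMatrix 1 V.par V.par V.B := (h.e_graded.d.mul h.e_graded).sub h.A_graded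
  exact (he.d.mul he).sub (((hb.d.mul h.e_graded).mul ha).add ((hb.mul hB).mul ha))

/-- A transported bundle with connection is isomorphic to the original one. -/
theorem IsBundle.conj_bundleIso (h : IsBundle β V) (hab : MIso p e V.par V.e a b)
    (ha : IsGradedMatrix 0 V.par p a) (hb : IsGradedMatrix 0 p V.par b)
    (hρa : ∀ g, ρ g = b⋆g * V.ρ g * a) :
    (V.conj p e ρ a b).Iso V := by
  have := hab.a_smooth; have := hab.b_smooth; have := hab.e_smooth; have := h.isSC.e_smooth
  refine ⟨a, b, ha, hb, ?_, ?_, hab.ab, hab.ba, fun g => ?_, ?_⟩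
  · suffices a = V.e * a * e from this
    rw [hab.e_a, hab.a_e]
  · suffices b = e * b * V.e from this
    rw [hab.e_b, hab.b_e]
  · suffices V.ρ g * a = a⋆g * ρ g from this
    rw [hρa, ← massoc, ← massoc, ← mpull_mul, hab.ab, h.isSC.e_mul_ρ]
  · suffices a * (𝐝e * e - (𝐝b * V.e * a + 𝐬b * V.B * a)) = V.e * 𝐝a * e + V.A * a from this
    have e1 : a * (𝐝e * e) = 0 := by
      have h1 : 𝐝a = 𝐝a * e + a * 𝐝e := by
        conv_lhs => rw [← hab.a_e, d_mul, ha.s_even]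
      have h2 := congrArg (· * e) h1
      simp only [madd_mul] at h2
      rw [massoc, hab.e_idem, left_eq_add] at h2
      rw [← massoc, h2]
    have e2 : a * (𝐝b * V.e * a) = 𝐝V.e * a - 𝐝a * e := by
      have h1 : 𝐝V.e = 𝐝a * b + a * 𝐝b := by
        conv_lhs => rw [← hab.ab, d_mul, ha.s_even]
      have h2 := congrArg (· * a) h1
      simp only [madd_mul] at h2
      rw [massoc 𝐝a, hab.ba] at h2
      rw [h2, massoc 𝐝b, hab.e_a, ← massoc]; abel
    have e3 : a * (𝐬b * V.B * a) = -(V.A * a) := by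
      rw [hb.s_even, ← massoc, ← massoc, hab.ab, h.isSC.e_mul_B, mneg_mul]
    have e4 : V.e * 𝐝a * e = 𝐝a * e - 𝐝V.e * a := by
      have h1 : 𝐝a = 𝐝V.e * a + V.e * 𝐝a := by
        conv_lhs => rw [← hab.e_a, d_mul, h.e_graded.s_even]
      have h2 := congrArg (· * e) h1
      simp only [madd_mul] at h2
      rw [massoc 𝐝V.e, hab.a_e] at h2
      rw [h2]; abel
    rw [mmul_sub, mmul_add, e1, e2, e3, e4]; abel

/-- Transport along an isomorphism of degree zero is affine in the superconnection. -/
theorem PreBundle.conj_comb {χ : Form X} (hχ : HasDegree 0 χ) (hb : 𝐬b = b)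
    (A A' : Matrix V.ι V.ι (Form X)) :
    comb χ ((V.withConnection A).conj p e ρ a b).A ((V.withConnection A').conj p e ρ a b).A =
      ((V.withConnection (comb χ A A')).conj p e ρ a b).A := by
  have h1 : ∀ A : Matrix V.ι V.ι (Form X), ((V.withConnection A).conj p e ρ a b).A =
      𝐝e * e - (𝐝b * V.e * a + b * (𝐝V.e * V.e) * a) + b * A * a := fun A => by
    suffices 𝐝e * e - (𝐝b * V.e * a + 𝐬b * (𝐝V.e * V.e - A) * a) =
      𝐝e * e - (𝐝b * V.e * a + b * (𝐝V.e * V.e) * a) + b * A * a from this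
    rw [hb, mmul_sub, msub_mul]; abel
  obtain ⟨K, hK⟩ : ∃ K : Matrix m m (Form X),
    K = 𝐝e * e - (𝐝b * V.e * a + b * (𝐝V.e * V.e) * a) := ⟨_, rfl⟩
  rw [← hK] at h1
  obtain ⟨P, hP⟩ : ∃ P : Matrix m m (Form X),
    P = ((V.withConnection A).conj p e ρ a b).A := ⟨_, rfl⟩
  obtain ⟨P', hP'⟩ : ∃ P : Matrix m m (Form X),
    P = ((V.withConnection A').conj p e ρ a b).A := ⟨_, rfl⟩
  suffices comb χ P P' = K + b * comb χ A A' * a by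
    rw [hP, hP'] at this; exact this.trans (h1 _).symm
  rw [hP, hP']
  have h2 : comb χ (K + b * A * a) (K + b * A' * a) = K + b * comb χ A A' * a := by
    rw [comb, comb, mmul_add, mmul_sub, madd_mul, msub_mul, mul_fs hχ,
      mul_fs hχ, fs_mul, fs_mul, fs_add, fs_add]
    abel
  rw [← h2, ← h1 A, ← h1 A']

end Conj

theorem PreBundle.conj_pull (V : PreBundle Y) [Fintype m] [DecidableEq m] (p : m → Bool)
    {e : Matrix m m (Form Y)} (ρ : G → Matrix m m (Form Y)) {a : Matrix V.ι m (Form Y)}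
    {b : Matrix m V.ι (Form Y)} (f : X.carrier → Y.carrier) [SmoothMap X Y f]
    (he : MSmooth e) (hb : MSmooth b) (hV : MSmooth V.e) :
    (V.conj p e ρ a b).pull f = (V.pull f).conj p (e.map (fpull f))
      (fun g => (ρ g).map (fpull f)) (a.map (fpull f))
      (b.map (fpull f)) := by
  refine PreBundle.mk_congr rfl (fun _ => rfl) ?_
  have h1 : (𝐝e * e - (𝐝b * V.e * a + 𝐬b * V.B * a)).map (fpull f) =
      𝐝(e.map (fpull f)) * e.map (fpull f) -
        (𝐝(b.map (fpull f)) * V.e.map (fpull f) * a.map (fpull f) +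
        𝐬(b.map (fpull f)) * V.B.map (fpull f) * a.map (fpull f)) := by
    rw [mpull_sub, mpull_mul, mpull_add, mpull_mul, mpull_mul, mpull_mul, mpull_mul, d_pull, d_pull,
      s_pull]
  refine h1.trans ?_
  rw [← V.pull_B hV f]; rfl

end Cylinder

end

section

section ParametricIntegral

variable {E W : Type} [NormedAddCommGroup E] [NormedSpace ℝ E] [FiniteDimensional ℝ E]
  [NormedAddCommGroup W] [NormedSpace ℝ W]

theorem continuous_slice {E W : Type} [TopologicalSpace E] [TopologicalSpace W] {f : E × ℝ → W}
    {U : Set E} (hU : IsOpen U) (hf : ContinuousOn f (U ×ˢ Set.univ)) {y : E} (hy : y ∈ U) : Continuous fun l => f (y, l) :=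
  continuous_iff_continuousAt.2 fun l =>
    ((hf.continuousAt ((hU.prod isOpen_univ).mem_nhds ⟨hy, trivial⟩)).comp
      (f := fun l : ℝ => (y, l)) (by fun_prop))

theorem hasFDerivAt_integral_param {f : E × ℝ → W} {U : Set E} (hU : IsOpen U)
    (hf : ContDiffOn ℝ 1 f (U ×ˢ Set.univ)) {y : E} (hy : y ∈ U) :
    HasFDerivAt (fun y => ∫ l in (0 : ℝ)..1, f (y, l))
      (∫ l in (0 : ℝ)..1, (fderiv ℝ f (y, l)).comp (ContinuousLinearMap.inl ℝ E ℝ)) y := by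
  have hUo : IsOpen (U ×ˢ (Set.univ : Set ℝ)) := hU.prod isOpen_univ
  have hc : ContinuousOn (fun p => (fderiv ℝ f p).comp (ContinuousLinearMap.inl ℝ E ℝ))
      (U ×ˢ Set.univ) :=
    (((ContinuousLinearMap.compL ℝ E (E × ℝ) W).flip
      (ContinuousLinearMap.inl ℝ E ℝ)).continuous.comp_continuousOn
        (hf.continuousOn_fderiv_of_isOpen hUo le_rfl))
  obtain ⟨ε, hε, hεU⟩ := Metric.nhds_basis_closedBall.mem_iff.1 (hU.mem_nhds hy)
  obtain ⟨C, hC⟩ := ((isCompact_closedBall y ε).prod (isCompact_Icc (a := (0 : ℝ)) (b := 1))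
    ).exists_bound_of_continuousOn (hc.mono (Set.prod_mono hεU (Set.subset_univ _)))
  refine (intervalIntegral.hasFDerivAt_integral_of_dominated_of_fderiv_le
    (F := fun y l => f (y, l)) (bound := fun _ => C)
    (F' := fun y l => (fderiv ℝ f (y, l)).comp (ContinuousLinearMap.inl ℝ E ℝ))
    (Metric.ball_mem_nhds y hε) ?_ ?_ ?_ ?_ ?_ ?_)
  · filter_upwards [hU.mem_nhds hy] with z hz
    exact (continuous_slice hU hf.continuousOn hz).aestronglyMeasurable
  · exact (continuous_slice hU hf.continuousOn hy).intervalIntegrable _ _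
  · exact (continuous_slice hU hc hy).aestronglyMeasurable
  · refine Filter.Eventually.of_forall fun l hl z hz => hC (z, l) ⟨Metric.ball_subset_closedBall hz, ?_⟩
    rw [Set.uIoc_of_le zero_le_one] at hl
    exact Set.Ioc_subset_Icc_self hl
  · exact intervalIntegrable_const
  · refine Filter.Eventually.of_forall fun l _ z hz => ?_
    have h1 : DifferentiableAt ℝ f (z, l) := (hf.differentiableOn one_ne_zero).differentiableAt
      (hUo.mem_nhds ⟨hεU (Metric.ball_subset_closedBall hz), trivial⟩)
    exact h1.hasFDerivAt.comp z (hasFDerivAt_prodMk_left z l)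

variable [CompleteSpace W]

theorem contDiffOn_integral_param_nat (n : ℕ) : ∀ {W : Type} [NormedAddCommGroup W]
    [NormedSpace ℝ W] [CompleteSpace W] {f : E × ℝ → W} {U : Set E}, IsOpen U →
    ContDiffOn ℝ ∞ f (U ×ˢ Set.univ) →
    ContDiffOn ℝ n (fun y => ∫ l in (0 : ℝ)..1, f (y, l)) U := by
  induction n with
  | zero =>
    intro W _ _ _ f U hU hf
    refine contDiffOn_zero.2 fun y hy => ?_
    exact (hasFDerivAt_integral_param hU (hf.of_le (by norm_cast))
      hy).continuousAt.continuousWithinAt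
  | succ n ih =>
    intro W _ _ _ f U hU hf
    have h1 : ContDiffOn ℝ 1 f (U ×ˢ Set.univ) := hf.of_le (by norm_cast)
    push_cast
    rw [contDiffOn_succ_iff_fderiv_of_isOpen hU]
    refine ⟨fun y hy => (hasFDerivAt_integral_param hU h1 hy).differentiableAt.differentiableWithinAt,
      by simp, ?_⟩
    have h2 : ContDiffOn ℝ ∞ (fun p => (fderiv ℝ f p).comp (ContinuousLinearMap.inl ℝ E ℝ))
        (U ×ˢ Set.univ) :=
      ((ContinuousLinearMap.compL ℝ E (E × ℝ) W).flip
        (ContinuousLinearMap.inl ℝ E ℝ)).contDiff.comp_contDiffOn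
          (hf.fderiv_of_isOpen (hU.prod isOpen_univ) (by norm_cast))
    exact (ih hU h2).congr fun y hy => (hasFDerivAt_integral_param hU h1 hy).fderiv

theorem contDiffOn_integral_param {f : E × ℝ → W} {U : Set E} (hU : IsOpen U)
    (hf : ContDiffOn ℝ ∞ f (U ×ˢ Set.univ)) :
    ContDiffOn ℝ ∞ (fun y => ∫ l in (0 : ℝ)..1, f (y, l)) U :=
  contDiffOn_infty.2 fun n => contDiffOn_integral_param_nat n hU hf

end ParametricIntegral

section FlatFiber

variable {E : Type} [NormedAddCommGroup E] [NormedSpace ℝ E] [FiniteDimensional ℝ E]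

/-- Contraction with the unit vector of the second factor, followed by restriction to
the first factor. -/
def fiberL : Ext (E × ℝ) →L[ℝ] Ext E :=
  realCLM ((Ext.map (LinearMap.inl ℝ E ℝ)).toLinearMap ∘ₗ contract ((0 : E), (1 : ℝ)))

theorem fiberL_apply (z : Ext (E × ℝ)) : fiberL z =
    Ext.map (LinearMap.inl ℝ E ℝ) (contract ((0 : E), (1 : ℝ)) z) := rfl

theorem fiberL_map_prod {E' : Type} [NormedAddCommGroup E'] [NormedSpace ℝ E']
    [FiniteDimensional ℝ E'] (P : E →ₗ[ℝ] E') (c : ℝ) (z : Ext (E' × ℝ)) :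
    fiberL (Ext.map (P.prodMap (c • LinearMap.id)) z) = (c : ℂ) • Ext.map P (fiberL z) := by
  have h1 : (P.prodMap (c • LinearMap.id)) ((0 : E), (1 : ℝ)) = c • ((0 : E'), (1 : ℝ)) := by
    simp
  have h2 : ∀ (w : E' × ℝ) (z : Ext (E' × ℝ)), contract (c • w) z = (c : ℂ) • contract w z :=
    fun w z => by
      have : LinearMap.applyₗ' ℂ (c • w) = (c : ℂ) •
          (LinearMap.applyₗ' ℂ w : ((E' × ℝ) →ₗ[ℝ] ℂ) →ₗ[ℂ] ℂ) := by
        ext φ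
        exact (φ.map_smul c w).trans (by simp)
      rw [contract, this, map_smul]; rfl
  rw [fiberL_apply, contract_map, h1, h2, map_smul, map_smul, fiberL_apply, Ext.map_map,
    Ext.map_map]
  congr 2
  congr 1
  ext v <;> simp

theorem fiberL_map_fst (z : Ext E) : fiberL (Ext.map (LinearMap.fst ℝ E ℝ) z) = 0 := by
  have h0 : contract (0 : E) z = 0 := by rw [contract, map_zero, map_zero]; rfl
  rw [fiberL_apply, contract_map]
  exact (congrArg (fun z => Ext.map _ (Ext.map _ z)) h0).trans (by rw [map_zero, map_zero])

theorem contract_flatD (w : E) {τ : E → Ext E} {y : E} (h : DifferentiableAt ℝ τ y) :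
    contract w (flatD τ y) + flatD (fun z => contract w (τ z)) y = fderiv ℝ τ y w := by
  have h1 : fderiv ℝ (fun z => contract w (τ z)) y =
      (realCLM (contract w)).comp (fderiv ℝ τ y) :=
    ((realCLM (contract w)).hasFDerivAt.comp y h.hasFDerivAt).fderiv
  rw [flatD_eq_wedge, flatD_eq_wedge]
  have h2 := contract_wedge w (fderiv ℝ τ y : E →ₗ[ℝ] Ext E)
  have h3 : (fun v => contract w (fderiv ℝ τ y v)) =
      (fderiv ℝ (fun z => contract w (τ z)) y : E → Ext E) := by rw [h1]; rfl
  rw [← h3]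
  exact (congrArg (· + _) h2).trans (sub_add_cancel _ _)

theorem flatD_inl {τ : E × ℝ → Ext (E × ℝ)} {y : E} {l : ℝ} (h : DifferentiableAt ℝ τ (y, l)) :
    flatD (fun z => Ext.map (LinearMap.inl ℝ E ℝ) (τ (z, l))) y =
      Ext.map (LinearMap.inl ℝ E ℝ) (flatD (V := E × ℝ) τ (y, l)) := by
  have h0 : ∀ z, fderiv ℝ (fun z : E => (z, l)) z = ContinuousLinearMap.inl ℝ E ℝ := fun z =>
    (hasFDerivAt_prodMk_left z l).fderiv
  have h1 := flatD_pullback (φ := fun z : E => (z, l)) (y := y) (τ := τ)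
    (contDiff_id.prodMk contDiff_const).contDiffAt h
  simp only [h0] at h1
  exact h1

theorem flatD_integral_param {U : Set E} (hU : IsOpen U) {f : E × ℝ → Ext E}
    (hf : ContDiffOn ℝ ∞ f (U ×ˢ Set.univ)) {y : E} (hy : y ∈ U) :
    flatD (fun z => ∫ l in (0 : ℝ)..1, f (z, l)) y =
      ∫ l in (0 : ℝ)..1, flatD (fun z => f (z, l)) y := by
  have hUo : IsOpen (U ×ˢ (Set.univ : Set ℝ)) := hU.prod isOpen_univ
  have hint := hasFDerivAt_integral_param hU (hf.of_le (by norm_cast)) hy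
  have hc := continuous_slice hU ((hf.fderiv_of_isOpen hUo (m := 0) (by norm_cast)).continuousOn) hy
  have hc' : Continuous fun l => (fderiv ℝ f (y, l)).comp (ContinuousLinearMap.inl ℝ E ℝ) :=
    ((ContinuousLinearMap.compL ℝ E (E × ℝ) (Ext E)).flip
      (ContinuousLinearMap.inl ℝ E ℝ)).continuous.comp hc
  have h2 : ∀ l, fderiv ℝ (fun z => f (z, l)) y =
      (fderiv ℝ f (y, l)).comp (ContinuousLinearMap.inl ℝ E ℝ) := fun l => by
    have : DifferentiableAt ℝ f (y, l) :=
      (hf.differentiableOn (by simp)).differentiableAt (hUo.mem_nhds ⟨hy, trivial⟩)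
    exact (HasFDerivAt.comp (g := f) (f := fun z : E => (z, l)) y this.hasFDerivAt
      (hasFDerivAt_prodMk_left y l)).fderiv
  rw [flatD_eq_wedge, hint.fderiv]
  simp only [flatD_eq_wedge, h2, wedge]
  rw [intervalIntegral.integral_finsetSum]
  · refine Finset.sum_congr rfl fun i _ => ?_
    rw [ContinuousLinearMap.intervalIntegral_apply (hc'.intervalIntegrable _ _)]
    exact ((Ext.mulL (ExteriorAlgebra.ι ℂ (coordForm E i) : Ext E)).intervalIntegral_comp_comm
      ((hc'.clm_apply continuous_const).intervalIntegrable 0 1)).symm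
  · intro i _
    exact (((Ext.mulL (ExteriorAlgebra.ι ℂ (coordForm E i) : Ext E)).continuous.comp
      (hc'.clm_apply continuous_const))).intervalIntegrable _ _

/-- Cartan's formula, restricted to the first factor. -/
theorem fiberL_flatD {τ : E × ℝ → Ext (E × ℝ)} {y : E} {l : ℝ}
    (hd : DifferentiableAt ℝ τ (y, l)) :
    fiberL (flatD (V := E × ℝ) τ (y, l)) + flatD (fun z => fiberL (τ (z, l))) y =
      Ext.map (LinearMap.inl ℝ E ℝ) (fderiv ℝ τ (y, l) (0, 1)) := by
  have h3 : DifferentiableAt ℝ (fun p => contract ((0 : E), (1 : ℝ)) (τ p)) (y, l) :=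
    (realCLM (contract ((0 : E), (1 : ℝ)))).differentiableAt.comp _ hd
  have h4 : (fun z => fiberL (τ (z, l))) = fun z =>
      Ext.map (LinearMap.inl ℝ E ℝ) (contract ((0 : E), (1 : ℝ)) (τ (z, l))) :=
    funext fun z => fiberL_apply _
  rw [h4, flatD_inl h3, fiberL_apply, ← map_add, contract_flatD _ hd]

/-- Stokes' theorem for integration along the fibres of `U × [0, 1]`. -/
theorem flat_stokes {U : Set E} (hU : IsOpen U) {τ : E × ℝ → Ext (E × ℝ)}
    (hτ : ContDiffOn ℝ ∞ τ (U ×ˢ Set.univ)) {y : E} (hy : y ∈ U) :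
    (∫ l in (0 : ℝ)..1, fiberL (flatD (V := E × ℝ) τ (y, l))) +
        flatD (fun z => ∫ l in (0 : ℝ)..1, fiberL (τ (z, l))) y =
      Ext.map (LinearMap.inl ℝ E ℝ) (τ (y, 1)) - Ext.map (LinearMap.inl ℝ E ℝ) (τ (y, 0)) := by
  have hUo : IsOpen (U ×ˢ (Set.univ : Set ℝ)) := hU.prod isOpen_univ
  have hd : ∀ l, DifferentiableAt ℝ τ (y, l) := fun l =>
    (hτ.differentiableOn (by simp)).differentiableAt (hUo.mem_nhds ⟨hy, trivial⟩)
  have h1 := flatD_integral_param hU (fiberL.contDiff.comp_contDiffOn hτ) hy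
  have hI1 : IntervalIntegrable (fun l => fiberL (flatD (V := E × ℝ) τ (y, l)))
      MeasureTheory.volume 0 1 :=
    (continuous_slice hU (f := fun p => fiberL (flatD (V := E × ℝ) τ p))
      (fiberL.continuous.comp_continuousOn (contDiffOn_flatD hUo hτ).continuousOn) hy).intervalIntegrable _ _
  have hderiv : ∀ l, HasDerivAt (fun l => Ext.map (LinearMap.inl ℝ E ℝ) (τ (y, l)))
      (Ext.map (LinearMap.inl ℝ E ℝ) (fderiv ℝ τ (y, l) (0, 1))) l := fun l => by
    have h5 : HasDerivAt (fun l : ℝ => (y, l)) ((0 : E), (1 : ℝ)) l :=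
      (hasDerivAt_const l y).prodMk (hasDerivAt_id l)
    exact (realCLM (Ext.map (LinearMap.inl ℝ E ℝ)).toLinearMap).hasFDerivAt.comp_hasDerivAt l
      ((hd l).hasFDerivAt.comp_hasDerivAt l h5)
  have hcd : Continuous fun l => Ext.map (LinearMap.inl ℝ E ℝ) (fderiv ℝ τ (y, l) (0, 1)) :=
    (realCLM (Ext.map (LinearMap.inl ℝ E ℝ)).toLinearMap).continuous.comp
      ((continuous_slice hU ((hτ.fderiv_of_isOpen hUo (m := 0) (by norm_cast)).continuousOn)
        hy).clm_apply continuous_const)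
  have hI2 : IntervalIntegrable (fun l => flatD (fun z => fiberL (τ (z, l))) y)
      MeasureTheory.volume 0 1 := by
    have : (fun l => flatD (fun z => fiberL (τ (z, l))) y) = fun l =>
        Ext.map (LinearMap.inl ℝ E ℝ) (fderiv ℝ τ (y, l) (0, 1)) -
          fiberL (flatD (V := E × ℝ) τ (y, l)) := by
      funext l
      exact eq_sub_of_add_eq' (fiberL_flatD (hd l))
    rw [this]
    exact (hcd.intervalIntegrable _ _).sub hI1
  refine (congrArg (_ + ·) h1).trans ?_
  refine (intervalIntegral.integral_add hI1 hI2).symm.trans ?_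
  refine (intervalIntegral.integral_congr fun l _ => fiberL_flatD (hd l)).trans ?_
  exact intervalIntegral.integral_eq_sub_of_hasDerivAt (fun l _ => hderiv l)
    (hcd.intervalIntegrable _ _)

end FlatFiber

section FiberInt

variable {G : Type v} [Group G] {X Y Z : GMfd.{u} G}

/-! ### Derivatives of the maps of cylinders -/

theorem tmap_incl (l : ℝ) (x : X.carrier) : tmap (X.incl l) x = ContinuousLinearMap.inl ℝ X.E ℝ := by
  have h := mfderiv_prodMk (I := X.I) (I' := X.I) (I'' := 𝓘(ℝ, ℝ)) (x := x)
    (f := fun x : X.carrier => x) (g := fun _ : X.carrier => l) mdifferentiableAt_id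
    mdifferentiableAt_const
  have h1 : mfderiv X.I X.I (fun x : X.carrier => x) x = ContinuousLinearMap.id ℝ X.E := mfderiv_id
  have h2 : mfderiv X.I 𝓘(ℝ, ℝ) (fun _ : X.carrier => l) x = 0 := mfderiv_const
  rw [h1, h2] at h
  refine Eq.trans h ?_
  ext v <;> rfl

theorem tmap_proj (p : X.cyl.carrier) : tmap X.proj p = ContinuousLinearMap.fst ℝ X.E ℝ :=
  mfderiv_fst

theorem tmap_height (p : X.cyl.carrier) :
    mfderiv X.cyl.I 𝓘(ℝ, ℝ) X.height p = ContinuousLinearMap.snd ℝ X.E ℝ :=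
  mfderiv_snd

theorem tmap_cylMap (f : X.carrier → Y.carrier) [SmoothMap X Y f] (p : X.cyl.carrier) :
    tmap (cylMap f) p = (tmap f (X.proj p)).prodMap (ContinuousLinearMap.id ℝ ℝ) := by
  have hp : MDifferentiableAt X.cyl.I X.I X.proj p := SmoothMap.mdifferentiableAt X.proj p
  have hh : MDifferentiableAt X.cyl.I 𝓘(ℝ, ℝ) X.height p := mdifferentiableAt_snd
  have hf : MDifferentiableAt X.I Y.I f (X.proj p) := SmoothMap.mdifferentiableAt f _
  have h := mfderiv_prodMk (I := X.cyl.I) (I' := Y.I) (I'' := 𝓘(ℝ, ℝ)) (x := p)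
    (f := f ∘ X.proj) (g := X.height) (hf.comp p hp) hh
  have h1 : mfderiv X.cyl.I Y.I (f ∘ X.proj) p =
      (tmap f (X.proj p)).comp (ContinuousLinearMap.fst ℝ X.E ℝ) := by
    rw [← tmap_proj p]; exact mfderiv_comp p hf hp
  rw [h1, tmap_height] at h
  exact h.trans rfl

theorem tmap_reparam {χ : ℝ → ℝ} (hχ : Differentiable ℝ χ) (p : X.cyl.carrier) :
    tmap (reparam X χ) p = (ContinuousLinearMap.id ℝ X.E).prodMap
      (deriv χ (X.height p) • ContinuousLinearMap.id ℝ ℝ) := by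
  have hp : MDifferentiableAt X.cyl.I X.I X.proj p := SmoothMap.mdifferentiableAt X.proj p
  have hh : MDifferentiableAt X.cyl.I 𝓘(ℝ, ℝ) X.height p := mdifferentiableAt_snd
  have hf : MDifferentiableAt 𝓘(ℝ, ℝ) 𝓘(ℝ, ℝ) χ (X.height p) := (hχ _).mdifferentiableAt
  have h := mfderiv_prodMk (I := X.cyl.I) (I' := X.I) (I'' := 𝓘(ℝ, ℝ)) (x := p)
    (f := X.proj) (g := χ ∘ X.height) hp (hf.comp p hh)
  have h1 : mfderiv X.cyl.I 𝓘(ℝ, ℝ) (χ ∘ X.height) p =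
      (fderiv ℝ χ (X.height p)).comp (ContinuousLinearMap.snd ℝ X.E ℝ) := by
    rw [← tmap_height p, ← mfderiv_eq_fderiv]; exact mfderiv_comp p hf hh
  have h2 : fderiv ℝ χ (X.height p) = deriv χ (X.height p) • ContinuousLinearMap.id ℝ ℝ := by
    ext; simp
  rw [h1, h2, show mfderiv X.cyl.I X.I X.proj p = ContinuousLinearMap.fst ℝ X.E ℝ from tmap_proj p] at h
  exact h.trans rfl

theorem extChartAt_cyl (x₀ : X.carrier) (l₀ : ℝ) :
    extChartAt X.cyl.I (X.incl l₀ x₀) = (extChartAt X.I x₀).prod (PartialEquiv.refl ℝ) := by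
  have h := extChartAt_prod (I := X.I) (I' := 𝓘(ℝ, ℝ)) (x₀, l₀)
  rw [extChartAt_model_space_eq_id] at h
  exact h

theorem target_cyl (x₀ : X.carrier) (l₀ : ℝ) :
    (extChartAt X.cyl.I (X.incl l₀ x₀)).target = (extChartAt X.I x₀).target ×ˢ Set.univ := by
  rw [extChartAt_cyl]; rfl

theorem chartInvDeriv_cyl {x₀ : X.carrier} (l₀ : ℝ) {y : X.E} (hy : y ∈ (extChartAt X.I x₀).target)
    (l : ℝ) : chartInvDeriv (X := X.cyl) (X.incl l₀ x₀) (y, l) =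
      (chartInvDeriv x₀ y).prodMap (ContinuousLinearMap.id ℝ ℝ) := by
  have hs : ((extChartAt X.cyl.I (X.incl l₀ x₀)).symm : X.E × ℝ → X.carrier × ℝ) =
      fun q => ((extChartAt X.I x₀).symm q.1, q.2) := by rw [extChartAt_cyl]; rfl
  have hf : MDifferentiableAt 𝓘(ℝ, X.E) X.I (extChartAt X.I x₀).symm y :=
    mdifferentiableAt_chart_symm hy
  have hp : MDifferentiableAt 𝓘(ℝ, X.E × ℝ) 𝓘(ℝ, X.E) (Prod.fst : X.E × ℝ → X.E) (y, l) :=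
    differentiableAt_fst.mdifferentiableAt
  have hh : MDifferentiableAt 𝓘(ℝ, X.E × ℝ) 𝓘(ℝ, ℝ) (Prod.snd : X.E × ℝ → ℝ) (y, l) :=
    differentiableAt_snd.mdifferentiableAt
  have h := mfderiv_prodMk (I := 𝓘(ℝ, X.E × ℝ)) (I' := X.I) (I'' := 𝓘(ℝ, ℝ)) (x := (y, l))
    (f := (extChartAt X.I x₀).symm ∘ (Prod.fst : X.E × ℝ → X.E)) (g := Prod.snd)
    (MDifferentiableAt.comp (y, l) hf hp) hh
  have h1 : mfderiv 𝓘(ℝ, X.E × ℝ) X.I ((extChartAt X.I x₀).symm ∘ (Prod.fst : X.E × ℝ → X.E))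
      (y, l) = (chartInvDeriv x₀ y).comp (ContinuousLinearMap.fst ℝ X.E ℝ) := by
    have h3 : mfderiv 𝓘(ℝ, X.E × ℝ) 𝓘(ℝ, X.E) (Prod.fst : X.E × ℝ → X.E) (y, l) =
        ContinuousLinearMap.fst ℝ X.E ℝ := by rw [mfderiv_eq_fderiv, fderiv_fst]
    rw [← h3]; exact mfderiv_comp (y, l) hf hp
  have h2 : mfderiv 𝓘(ℝ, X.E × ℝ) 𝓘(ℝ, ℝ) (Prod.snd : X.E × ℝ → ℝ) (y, l) =
      ContinuousLinearMap.snd ℝ X.E ℝ := by rw [mfderiv_eq_fderiv, fderiv_snd]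
  rw [h1, h2] at h
  have h4 : chartInvDeriv (X := X.cyl) (X.incl l₀ x₀) (y, l) =
      mfderiv 𝓘(ℝ, X.E × ℝ) (X.I.prod 𝓘(ℝ, ℝ))
        (fun q : X.E × ℝ => ((extChartAt X.I x₀).symm q.1, q.2)) (y, l) := by
    have h5 : ∀ φ φ' : X.E × ℝ → X.carrier × ℝ, φ = φ' →
        mfderiv 𝓘(ℝ, X.E × ℝ) (X.I.prod 𝓘(ℝ, ℝ)) φ (y, l) =
          mfderiv 𝓘(ℝ, X.E × ℝ) (X.I.prod 𝓘(ℝ, ℝ)) φ' (y, l) := fun φ φ' h => by rw [h]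
    exact h5 _ _ hs
  exact h4.trans (h.trans rfl)

theorem chart_symm_cyl (x₀ : X.carrier) (l₀ : ℝ) (y : X.E) (l : ℝ) :
    (extChartAt X.cyl.I (X.incl l₀ x₀)).symm (y, l) = X.incl l ((extChartAt X.I x₀).symm y) := by
  rw [extChartAt_cyl]; rfl

/-- The form on a cylinder in a chart of the base. -/
def cylRep (α : Form X.cyl) (x₀ : X.carrier) : X.E × ℝ → Ext (X.E × ℝ) :=
  chartRep α (X.incl 0 x₀)

theorem cylRep_apply (α : Form X.cyl) {x₀ : X.carrier} {y : X.E}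
    (hy : y ∈ (extChartAt X.I x₀).target) (l : ℝ) : cylRep α x₀ (y, l) =
      Ext.map ((chartInvDeriv x₀ y : X.E →ₗ[ℝ] X.E).prodMap ((1 : ℝ) • LinearMap.id))
        (show Ext (X.E × ℝ) from α (X.incl l ((extChartAt X.I x₀).symm y))) := by
  have h : cylRep α x₀ (y, l) = Ext.map ((chartInvDeriv (X := X.cyl) (X.incl 0 x₀) (y, l) :
      X.cyl.E →L[ℝ] X.cyl.E) : X.cyl.E →ₗ[ℝ] X.cyl.E)
      (α ((extChartAt X.cyl.I (X.incl 0 x₀)).symm (y, l))) := rfl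
  rw [h, chartInvDeriv_cyl 0 hy l, chart_symm_cyl, one_smul]; rfl

theorem IsSmooth.cylRep {α : Form X.cyl} (h : IsSmooth α) (x₀ : X.carrier) :
    ContDiffOn ℝ ∞ (cylRep α x₀) ((extChartAt X.I x₀).target ×ˢ Set.univ) := by
  rw [← target_cyl x₀ 0]; exact h _

theorem cylRep_extD {α : Form X.cyl} (h : IsSmooth α) {x₀ : X.carrier} {y : X.E}
    (hy : y ∈ (extChartAt X.I x₀).target) (l : ℝ) :
    cylRep (extD α) x₀ (y, l) = flatD (cylRep α x₀) (y, l) :=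
  chartRep_extD h (by rw [target_cyl]; exact ⟨hy, trivial⟩)

/-! ### Integration along the fibres -/

/-- The integrand of the fibre integral. -/
def fiberAt (α : Form X.cyl) (x : X.carrier) (l : ℝ) : Ext X.E :=
  fiberL (show Ext (X.E × ℝ) from α (X.incl l x))

theorem fiberInt_apply (α : Form X.cyl) (x : X.carrier) :
    fiberInt α x = ∫ l in (0 : ℝ)..1, fiberAt α x l := rfl

theorem map_fiberAt (α : Form X.cyl) {x₀ : X.carrier} {y : X.E}
    (hy : y ∈ (extChartAt X.I x₀).target) (l : ℝ) :
    Ext.map (chartInvDeriv x₀ y : X.E →ₗ[ℝ] X.E) (fiberAt α ((extChartAt X.I x₀).symm y) l) =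
      fiberL (cylRep α x₀ (y, l)) := by
  rw [cylRep_apply α hy, fiberL_map_prod, Complex.ofReal_one, one_smul]; rfl

theorem continuous_fiberAt {α : Form X.cyl} (h : IsSmooth α) (x : X.carrier) :
    Continuous (fiberAt α x) := by
  have hy := mem_extChartAt_target (I := X.I) x
  have h1 : ∀ l, fiberAt α x l = Ext.mapL (chartDeriv x x)
      (fiberL (cylRep α x (extChartAt X.I x x, l))) := fun l => by
    rw [← map_fiberAt α hy, Ext.mapL_apply, Ext.map_map, extChartAt_to_inv x]
    have h3 : (chartInvDeriv x (extChartAt X.I x x) : X.E →ₗ[ℝ] X.E).comp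
        (chartDeriv x x : X.E →ₗ[ℝ] X.E) = LinearMap.id :=
      congrArg (fun L : X.E →L[ℝ] X.E => (L : X.E →ₗ[ℝ] X.E))
        (chartInvDeriv_comp_chartDeriv (mem_extChartAt_source x))
    rw [h3]; exact (Ext.map_id _).symm
  rw [funext h1]
  exact (Ext.mapL _).continuous.comp (fiberL.continuous.comp
    (continuous_slice (isOpen_extChartAt_target x) (h.cylRep x).continuousOn hy))

theorem chartRep_fiberInt {α : Form X.cyl} (h : IsSmooth α) {x₀ : X.carrier} {y : X.E}
    (hy : y ∈ (extChartAt X.I x₀).target) :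
    chartRep (fiberInt α) x₀ y = ∫ l in (0 : ℝ)..1, fiberL (cylRep α x₀ (y, l)) := by
  have h1 := (Ext.mapL (chartInvDeriv x₀ y)).intervalIntegral_comp_comm
    ((continuous_fiberAt h ((extChartAt X.I x₀).symm y)).intervalIntegrable
      (μ := MeasureTheory.volume) 0 1)
  refine h1.symm.trans ?_
  simp only [← map_fiberAt α hy]; rfl

theorem IsSmooth.fiberInt {α : Form X.cyl} (h : IsSmooth α) : IsSmooth (fiberInt α) := fun x₀ =>
  (contDiffOn_integral_param (isOpen_extChartAt_target x₀)
    (fiberL.contDiff.comp_contDiffOn (h.cylRep x₀))).congr fun _ hy => chartRep_fiberInt h hy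

theorem form_ext_chartRep {α α' : Form X} (h : ∀ x₀, ∀ y ∈ (extChartAt X.I x₀).target,
    chartRep α x₀ y = chartRep α' x₀ y) : α = α' := by
  funext x
  rw [form_eq_chartRep α (mem_extChartAt_source x), h x _ (mem_extChartAt_target x),
    ← form_eq_chartRep α' (mem_extChartAt_source x)]

theorem chartRep_pull_incl (α : Form X.cyl) (l : ℝ) {x₀ : X.carrier} {y : X.E}
    (hy : y ∈ (extChartAt X.I x₀).target) :
    chartRep (pull (X.incl l) α) x₀ y = Ext.map (LinearMap.inl ℝ X.E ℝ) (cylRep α x₀ (y, l)) := by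
  rw [cylRep_apply α hy, chartRep, pull_apply, tmap_incl]
  refine (Ext.map_map _ _ _).trans (Eq.trans ?_ (Ext.map_map _ _ _).symm)
  congr 1
  congr 1
  refine LinearMap.ext fun v => Prod.ext rfl ?_
  simp
  rfl

/-- Stokes' theorem for integration along the fibres of `X × [0, 1]`. -/
theorem fiberInt_stokes {α : Form X.cyl} (h : IsSmooth α) :
    fiberInt (extD α) + extD (fiberInt α) = pull (X.incl 1) α - pull (X.incl 0) α := by
  refine form_ext_chartRep fun x₀ y hy => ?_
  have hU := isOpen_extChartAt_target (I := X.I) x₀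
  have h2 := flat_stokes hU (h.cylRep x₀) hy
  have h3 : chartRep (extD (fiberInt α)) x₀ y =
      flatD (fun z => ∫ l in (0 : ℝ)..1, fiberL (cylRep α x₀ (z, l))) y := by
    rw [chartRep_extD h.fiberInt hy]
    refine flatD_congr ?_
    filter_upwards [hU.mem_nhds hy] with z hz
    exact chartRep_fiberInt h hz
  have h4 : chartRep (fiberInt (extD α)) x₀ y =
      ∫ l in (0 : ℝ)..1, fiberL (flatD (cylRep α x₀) (y, l)) := by
    rw [chartRep_fiberInt h.extD hy]
    simp only [cylRep_extD h hy]
  rw [chartRep_add, Pi.add_apply, h3, h4, h2, sub_eq_add_neg (pull _ _), chartRep_add, chartRep_neg,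
    Pi.add_apply, Pi.neg_apply, chartRep_pull_incl _ _ hy, chartRep_pull_incl _ _ hy,
    sub_eq_add_neg]

theorem fiberInt_add {α α' : Form X.cyl} (h : IsSmooth α) (h' : IsSmooth α') :
    fiberInt (α + α') = fiberInt α + fiberInt α' := by
  funext x
  have h1 : ∀ l, fiberAt (α + α') x l = fiberAt α x l + fiberAt α' x l := fun l =>
    map_add fiberL _ _
  rw [Pi.add_apply, fiberInt_apply, fiberInt_apply, fiberInt_apply, ← intervalIntegral.integral_add
    ((continuous_fiberAt h x).intervalIntegrable _ _)
    ((continuous_fiberAt h' x).intervalIntegrable _ _)]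
  simp only [h1]

theorem fiberInt_neg (α : Form X.cyl) : fiberInt (-α) = -fiberInt α := by
  funext x
  have h1 : ∀ l, fiberAt (-α) x l = -fiberAt α x l := fun l => map_neg fiberL _
  rw [Pi.neg_apply, fiberInt_apply, fiberInt_apply, ← intervalIntegral.integral_neg]
  simp only [h1]

theorem fiberInt_sub {α α' : Form X.cyl} (h : IsSmooth α) (h' : IsSmooth α') :
    fiberInt (α - α') = fiberInt α - fiberInt α' := by
  rw [sub_eq_add_neg, fiberInt_add h h'.neg, fiberInt_neg, sub_eq_add_neg]

theorem fiberInt_smul (c : ℂ) (α : Form X.cyl) : fiberInt (c • α) = c • fiberInt α := by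
  funext x
  have h1 : ∀ l, fiberAt (c • α) x l = c • fiberAt α x l := fun l =>
    ((Ext.map (LinearMap.inl ℝ X.E ℝ)).toLinearMap ∘ₗ
      contract ((0 : X.E), (1 : ℝ))).map_smul c (show Ext (X.E × ℝ) from α (X.incl l x))
  rw [Pi.smul_apply, fiberInt_apply, fiberInt_apply]
  simp only [h1]
  exact intervalIntegral.integral_smul c _

theorem fiberInt_hasParity {α : Form X.cyl} (hs : IsSmooth α) {p : Bool} (h : HasParity p α) :
    HasParity (!p) (fiberInt α) := by
  have h1 : ∀ x l, sinv (fiberAt α x l) = -fiberAt (sinv α) x l := fun x l => by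
    have := contract_sinv ((0 : X.E), (1 : ℝ)) (show Ext (X.E × ℝ) from α (X.incl l x))
    have h2 : fiberAt (sinv α) x l = Ext.map (LinearMap.inl ℝ X.E ℝ)
      (contract ((0 : X.E), (1 : ℝ)) (sinv (show Ext (X.E × ℝ) from α (X.incl l x)))) := rfl
    rw [h2, this, map_neg, neg_neg, ← Ext.sinv_map]; rfl
  have h3 : sinv (fiberInt α) = -fiberInt (sinv α) := by
    rw [← fiberInt_neg]
    funext x
    refine (sinvL.intervalIntegral_comp_comm
      ((continuous_fiberAt hs x).intervalIntegrable (μ := MeasureTheory.volume) 0 1)).symm.trans ?_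
    simp only [sinvL_apply, h1]
    rw [fiberInt_apply]
    refine intervalIntegral.integral_congr fun l _ => ?_
    exact (map_neg fiberL _).symm
  unfold HasParity at h ⊢
  rw [h3, h]
  cases p
  · rfl
  · simp [fiberInt_neg]

theorem fiberAt_cylMap (f : X.carrier → Y.carrier) [SmoothMap X Y f] (α : Form Y.cyl)
    (x : X.carrier) (l : ℝ) : fiberAt (pull (cylMap f) α) x l =
      Ext.map (tmap f x : X.E →ₗ[ℝ] Y.E) (fiberAt α (f x) l) := by
  have h := fiberL_map_prod (tmap f x : X.E →ₗ[ℝ] Y.E) 1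
    (show Ext (Y.E × ℝ) from α (Y.incl l (f x)))
  rw [Complex.ofReal_one, one_smul, one_smul] at h
  rw [fiberAt, pull_apply, tmap_cylMap]
  exact h

theorem fiberInt_cylMap (f : X.carrier → Y.carrier) [SmoothMap X Y f] {α : Form Y.cyl}
    (h : IsSmooth α) : fiberInt (pull (cylMap f) α) = pull f (fiberInt α) := by
  funext x
  rw [pull_apply, fiberInt_apply]
  simp only [fiberAt_cylMap]
  exact (Ext.mapL (tmap f x)).intervalIntegral_comp_comm
    ((continuous_fiberAt h (f x)).intervalIntegrable 0 1)

theorem act_cyl (g : G) : X.cyl.act g = cylMap (X.act g) := rfl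

theorem fiberInt_proj (α : Form X) : fiberInt (pull X.proj α) = 0 := by
  funext x
  have h1 : ∀ l, fiberAt (pull X.proj α) x l = 0 := fun l => by
    rw [fiberAt, pull_apply, tmap_proj]
    exact fiberL_map_fst (α x)
  rw [fiberInt_apply]
  simp only [h1]
  exact intervalIntegral.integral_zero

theorem fiberAt_reparam {χ : ℝ → ℝ} (hχ : Differentiable ℝ χ) (α : Form X.cyl) (x : X.carrier)
    (l : ℝ) : fiberAt (pull (reparam X χ) α) x l = ((deriv χ l : ℝ) : ℂ) • fiberAt α x (χ l) := by
  have h := fiberL_map_prod (LinearMap.id : X.E →ₗ[ℝ] X.E) (deriv χ l)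
    (show Ext (X.E × ℝ) from α (X.incl (χ l) x))
  rw [Ext.map_id] at h
  rw [fiberAt, pull_apply, tmap_reparam hχ]
  exact h

theorem fiberInt_reparam {χ : ℝ → ℝ} (hχ : ContDiff ℝ ∞ χ) {α : Form X.cyl} (h : IsSmooth α)
    (x : X.carrier) :
    fiberInt (pull (reparam X χ) α) x = ∫ l in (χ 0)..(χ 1), fiberAt α x l := by
  have hd : Differentiable ℝ χ := hχ.differentiable (by simp)
  rw [fiberInt_apply]
  simp only [fiberAt_reparam hd]
  have := intervalIntegral.integral_deriv_smul_comp (a := 0) (b := 1) (f := χ) (f' := deriv χ)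
    (g := fiberAt α x) (fun l _ => (hd l).hasDerivAt)
    ((hχ.continuous_deriv (by simp)).continuousOn) (continuous_fiberAt h x)
  exact this

end FiberInt

end

section

section Restriction

variable {G : Type v} [Group G] {X Y Z : GMfd.{u} G} {β : G → G → Circle}

/-! ### Restriction to fixed points -/

theorem res_apply (g : G) (α : Form X) (x : {x : X.carrier // X.act g x = x}) :
    res g α x = Ext.map (fixTan X g x).subtype (α x.1) := rfl

theorem mem_fixTan {g : G} {x : X.carrier} {w : X.E} : w ∈ fixTan X g x ↔ tmap (X.act g) x w = w :=
  Iff.rfl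

theorem res_pull_act (g : G) (α : Form X) : res g (pull (X.act g) α) = res g α := by
  funext x
  rw [res_apply, res_apply, pull_apply, Ext.map_map, x.2]
  congr 1
  congr 1
  exact LinearMap.ext fun v => v.2

/-- A linear map with values in the tangent space of the fixed points only sees the restriction
of a form. -/
theorem map_eq_of_res_eq {V : Type*} [AddCommGroup V] [Module ℝ V] {g : G} {α α' : Form X}
    (h : res g α = res g α') {x : X.carrier} (hx : X.act g x = x) (L : V →ₗ[ℝ] X.E)
    (hL : ∀ v, tmap (X.act g) x (L v) = L v) : Ext.map L (α x) = Ext.map L (α' x) := by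
  have h1 : ∀ α : Form X, Ext.map L (α x) =
      Ext.map (LinearMap.codRestrict (fixTan X g x) L hL) (res g α ⟨x, hx⟩) := fun α => by
    rw [res_apply, Ext.map_map]; rfl
  rw [h1, h1, h]

theorem res_pull_congr (f : X.carrier → Y.carrier) [SmoothMap X Y f] {g g' : G}
    (hf : ∀ x, f (X.act g x) = Y.act g' (f x)) {α α' : Form Y} (h : res g' α = res g' α') :
    res g (pull f α) = res g (pull f α') := by
  funext x
  rw [res_apply, res_apply, pull_apply, pull_apply, Ext.map_map, Ext.map_map]
  have hx : Y.act g' (f x) = f x := by rw [← hf, x.2]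
  refine map_eq_of_res_eq h hx _ fun v => ?_
  have h1 := tmap_comp f (Y.act g') x.1
  have h2 := tmap_comp (X.act g) f x.1
  have h3 : (Y.act g' ∘ f) = (f ∘ X.act g) := funext fun x => (hf x).symm
  rw [h3, h2, x.2] at h1
  have h4 := congrArg (fun L : X.E →L[ℝ] Y.E => L v) h1
  have h5 : tmap (X.act g) x.1 v = v := v.2
  refine h4.symm.trans ?_
  exact congrArg (tmap f x.1) h5

/-- Points near a fixed point of `g` that are fixed in the linearization: there is a local
parametrization of the fixed points by the fixed tangent vectors. -/
theorem exists_fixed_parametrization [Finite G] (g : G) {x : X.carrier} (hx : X.act g x = x) :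
    ∃ s : fixTan X g x → X.E, s 0 = extChartAt X.I x x ∧ ContDiffAt ℝ ∞ s 0 ∧
      fderiv ℝ s 0 = (chartDeriv x x).comp (fixTan X g x).subtypeL ∧
      ∀ᶠ w in nhds 0, s w ∈ (extChartAt X.I x).target ∧
        X.act g ((extChartAt X.I x).symm (s w)) = (extChartAt X.I x).symm (s w) := by
  classical
  have : Fintype (Subgroup.zpowers g) := Fintype.ofFinite _
  set y₀ := extChartAt X.I x x with hy₀
  have hy : y₀ ∈ (extChartAt X.I x).target := mem_extChartAt_target x
  have hsy : (extChartAt X.I x).symm y₀ = x := extChartAt_to_inv x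
  have hfix : ∀ h : Subgroup.zpowers g, X.act h x = x := by
    rintro ⟨_, k, rfl⟩
    have h1 : ∀ n : ℕ, X.act (g ^ n) x = x := fun n => by
      induction n with
      | zero => rw [pow_zero, X.act_one]
      | succ n ih => rw [pow_succ, X.act_mul, hx, ih]
    rcases Int.eq_nat_or_neg k with ⟨n, rfl | rfl⟩
    · simpa using h1 n
    · have := congrArg (X.act (g ^ n)⁻¹) (h1 n)
      rw [← X.act_mul, inv_mul_cancel, X.act_one] at this
      simpa using this.symm
  let f : Subgroup.zpowers g → X.E → X.E := fun h => chartMap (X.act h) x x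
  have hsrc : ∀ h : Subgroup.zpowers g,
      X.act h ((extChartAt X.I x).symm y₀) ∈ (extChartAt X.I x).source := fun h => by
    rw [hsy, hfix]; exact mem_extChartAt_source x
  have hf0 : ∀ h, f h y₀ = y₀ := fun h => by
    show extChartAt X.I x (X.act h ((extChartAt X.I x).symm y₀)) = y₀
    rw [hsy, hfix]
  have hfs : ∀ h, ContDiffAt ℝ ∞ (f h) y₀ := fun h => contDiffAt_chartMap _ hy (hsrc h)
  have hcomp : ∀ h k, f (h * k) =ᶠ[nhds y₀] f h ∘ f k := fun h k => by
    filter_upwards [eventually_chart_mem (X.act k) hy (hsrc k)] with z hz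
    show extChartAt X.I x (X.act (h * k : G) _) =
      extChartAt X.I x (X.act h ((extChartAt X.I x).symm (extChartAt X.I x (X.act k _))))
    rw [(extChartAt X.I x).left_inv hz.2, X.act_mul]
  let L : Subgroup.zpowers g → X.E →L[ℝ] X.E := fun h => fderiv ℝ (f h) y₀
  have hfd : ∀ h, HasFDerivAt (f h) (L h) y₀ := fun h =>
    ((hfs h).differentiableAt (by simp)).hasFDerivAt
  have hL : ∀ h k, L (h * k) = (L h).comp (L k) := fun h k => by
    have h1 : HasFDerivAt (f h) (L h) (f k y₀) := by rw [hf0]; exact hfd h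
    exact (hcomp h k).fderiv_eq.trans (h1.comp y₀ (hfd k)).fderiv
  have hL1 : L 1 = ContinuousLinearMap.id ℝ X.E := by
    have : f 1 =ᶠ[nhds y₀] id := by
      filter_upwards [(isOpen_extChartAt_target x).mem_nhds hy] with z hz
      show extChartAt X.I x (X.act (1 : G) _) = z
      rw [X.act_one, (extChartAt X.I x).right_inv hz]
    exact this.fderiv_eq.trans fderiv_id
  have hLC : ∀ w ∈ fixTan X g x, L ⟨g, Subgroup.mem_zpowers g⟩ (chartDeriv x x w) =
      chartDeriv x x w := fun w hw => by
    have h1 := fderiv_chartMap (X.act g) (x₀ := x) (y₀ := x) hy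
      (hsrc ⟨g, Subgroup.mem_zpowers g⟩)
    rw [hsy, hx] at h1
    have h2 : L ⟨g, Subgroup.mem_zpowers g⟩ (chartDeriv x x w) =
      chartDeriv x x (tmap (X.act g) x (chartInvDeriv x y₀ (chartDeriv x x w))) :=
      congrArg (fun A : X.E →L[ℝ] X.E => A (chartDeriv x x w)) h1
    have h3 : chartInvDeriv x y₀ (chartDeriv x x w) = w :=
      congrArg (fun A : X.E →L[ℝ] X.E => A w)
        (chartInvDeriv_comp_chartDeriv (mem_extChartAt_source (I := X.I) x))
    rw [h2, h3, mem_fixTan.1 hw]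
  let N : ℝ := Fintype.card (Subgroup.zpowers g)
  have hN : N ≠ 0 := Nat.cast_ne_zero.2 Fintype.card_ne_zero
  let ψ : X.E → X.E := fun z => N⁻¹ • ∑ h, L h⁻¹ (f h z - y₀)
  have hψ0 : ψ y₀ = 0 := by simp [ψ, hf0]
  have hψs : ContDiffAt ℝ ∞ ψ y₀ := by
    refine contDiffAt_const.smul (ContDiffAt.sum fun h _ => ?_)
    exact (L h⁻¹).contDiff.contDiffAt.comp y₀ ((hfs h).sub contDiffAt_const)
  have hψd : HasFDerivAt ψ (ContinuousLinearEquiv.refl ℝ X.E : X.E →L[ℝ] X.E) y₀ := by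
    have h1 : HasFDerivAt ψ (N⁻¹ • ∑ h, (L h⁻¹).comp (L h)) y₀ := by
      refine HasFDerivAt.const_smul (HasFDerivAt.fun_sum fun h _ => ?_) _
      exact (L h⁻¹).hasFDerivAt.comp y₀ ((hfd h).sub_const y₀)
    have h2 : N⁻¹ • ∑ h, (L h⁻¹).comp (L h) = ContinuousLinearMap.id ℝ X.E := by
      simp only [← hL, inv_mul_cancel, hL1]
      rw [Finset.sum_const, Finset.card_univ, ← Nat.cast_smul_eq_nsmul ℝ, smul_smul,
        inv_mul_cancel₀ hN, one_smul]
    rw [h2] at h1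
    exact h1
  let g' : Subgroup.zpowers g := ⟨g, Subgroup.mem_zpowers g⟩
  have hψF : ∀ᶠ z in nhds y₀, ψ (f g' z) = L g' (ψ z) := by
    have h1 : ∀ᶠ z in nhds y₀, ∀ h, f (h * g') z = f h (f g' z) :=
      Filter.eventually_all.2 fun h => hcomp h g'
    filter_upwards [h1] with z hz
    simp only [ψ, map_smul, map_sum]
    congr 1
    refine Fintype.sum_equiv (Equiv.mulRight g') _ _ fun h => ?_
    rw [Equiv.coe_mulRight, hz h]
    show _ = ((L g').comp (L (h * g')⁻¹)) _
    rw [← hL]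
    congr 2
    group
  let Ψ := hψs.toOpenPartialHomeomorph ψ hψd (by simp)
  have hΨ : (Ψ : X.E → X.E) = ψ := rfl
  have hyΨ : y₀ ∈ Ψ.source := hψs.mem_toOpenPartialHomeomorph_source hψd (by simp)
  let C : fixTan X g x →L[ℝ] X.E := (chartDeriv x x).comp (fixTan X g x).subtypeL
  have hΨ0 : Ψ.symm 0 = y₀ := by
    have := Ψ.left_inv hyΨ
    rwa [hΨ, hψ0] at this
  have h0t : (0 : X.E) ∈ Ψ.target := by
    have := Ψ.map_source hyΨ
    rwa [hΨ, hψ0] at this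
  have hinv : ContDiffAt ℝ ∞ Ψ.symm (C 0) := by
    have h := hψs.to_localInverse hψd (by simp)
    rw [hψ0] at h
    rw [map_zero]
    exact h
  have hinvd : HasFDerivAt Ψ.symm (ContinuousLinearMap.id ℝ X.E) (C 0) := by
    have h1 : HasFDerivAt Ψ (ContinuousLinearEquiv.refl ℝ X.E : X.E →L[ℝ] X.E) (Ψ.symm 0) := by
      rw [hΨ0]; exact hψd
    rw [map_zero]
    exact Ψ.hasFDerivAt_symm h0t h1
  have hcont : ContinuousAt (fun w => Ψ.symm (C w)) 0 :=
    hinv.continuousAt.comp C.continuous.continuousAt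
  have hs0 : Ψ.symm (C 0) = y₀ := by rw [map_zero, hΨ0]
  refine ⟨fun w => Ψ.symm (C w), hs0, hinv.comp 0 C.contDiff.contDiffAt, ?_, ?_⟩
  · exact (hinvd.comp (0 : fixTan X g x) C.hasFDerivAt).fderiv
  · have hcF : ContinuousAt (f g') y₀ := (hfs g').continuousAt
    have e1 : ∀ᶠ z in nhds y₀, f g' z ∈ Ψ.source :=
      hcF.eventually (by rw [hf0]; exact Ψ.open_source.mem_nhds hyΨ)
    have e3 : ∀ᶠ z in nhds y₀, z ∈ Ψ.source := Ψ.open_source.mem_nhds hyΨ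
    have e2 := hψF.and (e1.and (e3.and (eventually_chart_mem (X.act g) hy (hsrc g'))))
    have hcont' : Filter.Tendsto (fun w => Ψ.symm (C w)) (nhds 0) (nhds y₀) := by
      have := hcont.tendsto
      rwa [hs0] at this
    have e4 : ∀ᶠ w in nhds (0 : fixTan X g x), C w ∈ Ψ.target :=
      C.continuous.continuousAt.eventually (by
        rw [map_zero]; exact Ψ.open_target.mem_nhds h0t)
    filter_upwards [hcont'.eventually e2, e4] with w hw hwt
    obtain ⟨h1, h2, h3, h4, h5⟩ := hw
    refine ⟨h4, ?_⟩
    have h6 : f g' (Ψ.symm (C w)) = Ψ.symm (C w) := by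
      refine Ψ.injOn h2 h3 ?_
      have h7 : ψ (Ψ.symm (C w)) = C w := Ψ.right_inv hwt
      show ψ _ = ψ _
      rw [h1, h7]
      exact hLC w w.2
    have h8 := congrArg (extChartAt X.I x).symm h6
    rw [← (extChartAt X.I x).left_inv h5]
    exact h8

theorem res_extD_eq_zero [Finite G] {g : G} {α : Form X} (hs : IsSmooth α) (h : res g α = 0) :
    res g (extD α) = 0 := by
  funext ⟨x, hx⟩
  obtain ⟨s, hs0, hsd, hfd, hev⟩ := exists_fixed_parametrization g hx
  have h1 : Ext.map (fixTan X g x).subtype (extD α x) =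
      Ext.map (fderiv ℝ s 0 : fixTan X g x →ₗ[ℝ] X.E) (flatD (chartRep α x) (s 0)) := by
    rw [extD, Ext.map_map, hfd, hs0]; rfl
  have hd : DifferentiableAt ℝ (chartRep α x) (s 0) := by
    rw [hs0]; exact hs.differentiableAt x
  rw [res_apply, h1, ← flatD_pullback (hsd.of_le (by norm_cast)) hd]
  have hz : (fun z => Ext.map (fderiv ℝ s z : fixTan X g x →ₗ[ℝ] X.E) (chartRep α x (s z)))
      =ᶠ[nhds 0] fun _ => 0 := by
    have hdiff : ∀ᶠ w in nhds (0 : fixTan X g x), DifferentiableAt ℝ s w :=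
      ((hsd.of_le (m := 1) (by norm_cast)).eventually (by simp)).mono fun w hw =>
        hw.differentiableAt (by simp)
    filter_upwards [hev.eventually_nhds, hdiff] with w hw hdw
    obtain ⟨ht, hf⟩ := hw.self_of_nhds
    have hm1 := mdifferentiableAt_chart_symm ht
    have hm2 : MDifferentiableAt 𝓘(ℝ, fixTan X g x) X.I ((extChartAt X.I x).symm ∘ s) w :=
      MDifferentiableAt.comp w hm1 hdw.mdifferentiableAt
    have hD : mfderiv 𝓘(ℝ, fixTan X g x) X.I ((extChartAt X.I x).symm ∘ s) w =
        (chartInvDeriv x (s w)).comp (fderiv ℝ s w) := by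
      rw [← mfderiv_eq_fderiv]
      exact mfderiv_comp w hm1 hdw.mdifferentiableAt
    have hfix : X.act g ∘ ((extChartAt X.I x).symm ∘ s) =ᶠ[nhds w] (extChartAt X.I x).symm ∘ s :=
      hw.mono fun z hz => hz.2
    have hE := hfix.mfderiv_eq (I := 𝓘(ℝ, fixTan X g x)) (I' := X.I)
    have hm3 := SmoothMap.mdifferentiableAt (X.act g) (((extChartAt X.I x).symm ∘ s) w)
    have hC := mfderiv_comp w hm3 hm2
    rw [chartRep, Ext.map_map]
    have := map_eq_of_res_eq (α' := 0) (h.trans (map_zero _).symm) hf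
      ((chartInvDeriv x (s w) : X.E →ₗ[ℝ] X.E).comp (fderiv ℝ s w : fixTan X g x →ₗ[ℝ] X.E))
      (fun v => by
        have h9 : (tmap (X.act g) ((extChartAt X.I x).symm (s w))).comp
            ((chartInvDeriv x (s w)).comp (fderiv ℝ s w)) =
            (chartInvDeriv x (s w)).comp (fderiv ℝ s w) := by
          rw [← hD]; exact hC.symm.trans hE
        exact congrArg (fun A : fixTan X g x →L[ℝ] X.E => A v) h9)
    rw [this, Pi.zero_apply, map_zero]
  rw [flatD_congr hz, flatD_const]; rfl

theorem res_extD_congr [Finite G] {g : G} {α α' : Form X} (hs : IsSmooth α) (hs' : IsSmooth α')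
    (h : res g α = res g α') : res g (extD α) = res g (extD α') := by
  have := res_extD_eq_zero (hs.sub hs') (by rw [map_sub, h, sub_self])
  rwa [extD_sub hs hs', map_sub, sub_eq_zero] at this

theorem fixD_res [Finite G] {g : G} {α : Form X} (hs : IsSmooth α) :
    fixD (res g α) = res g (extD α) := by
  have h : ∃ α' : Form X, IsSmooth α' ∧ res g α = res g α' := ⟨α, hs, rfl⟩
  rw [fixD, dif_pos h]
  exact res_extD_congr h.choose_spec.1 hs h.choose_spec.2.symm

theorem res_fiberInt_eq_zero {g : G} {α : Form X.cyl} (hs : IsSmooth α) (h : res g α = 0) :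
    res g (fiberInt α) = 0 := by
  funext ⟨x, hx⟩
  have h1 : ∀ l, Ext.map (fixTan X g x).subtype (fiberAt α x l) = 0 := fun l => by
    let ι' : fixTan X g x × ℝ →ₗ[ℝ] X.E × ℝ := (fixTan X g x).subtype.prodMap ((1 : ℝ) • LinearMap.id)
    have h2 := fiberL_map_prod (fixTan X g x).subtype 1 (show Ext (X.E × ℝ) from α (X.incl l x))
    rw [Complex.ofReal_one] at h2
    refine ((one_smul ℂ _).symm.trans h2.symm).trans ?_
    have hx' : X.cyl.act g (X.incl l x) = X.incl l x := by rw [← incl_act, hx]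
    have h3 := map_eq_of_res_eq (X := X.cyl) (α' := 0) (h.trans (map_zero _).symm) hx' ι'
      fun v => by
        have h4 : tmap (X.cyl.act g) (X.incl l x) =
            (tmap (X.act g) x).prodMap (ContinuousLinearMap.id ℝ ℝ) := tmap_cylMap (X.act g) _
        have h5 : tmap (X.act g) x v.1 = v.1 := v.1.2
        rw [h4]
        refine Prod.ext h5 rfl
    rw [Pi.zero_apply, map_zero] at h3
    exact (congrArg fiberL h3).trans (map_zero _)
  rw [res_apply, fiberInt_apply]
  have h6 := (Ext.mapL (fixTan X g x).subtypeL).intervalIntegral_comp_comm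
    ((continuous_fiberAt hs x).intervalIntegrable (μ := MeasureTheory.volume) 0 1)
  refine h6.symm.trans ?_
  refine (intervalIntegral.integral_congr fun l _ => h1 l).trans ?_
  exact intervalIntegral.integral_zero

theorem res_fiberInt_congr {g : G} {α α' : Form X.cyl} (hs : IsSmooth α) (hs' : IsSmooth α')
    (h : res g α = res g α') : res g (fiberInt α) = res g (fiberInt α') := by
  have := res_fiberInt_eq_zero (hs.sub hs') (by rw [map_sub, h, sub_self])
  rwa [fiberInt_sub hs hs', map_sub, sub_eq_zero] at this

end Restriction

end

section

section Classes

variable {G : Type v} [Group G] {X Y Z : GMfd.{u} G} {β : G → G → Circle} {p : Bool}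
  {w w' : G → Form X}

/-! ### Classes of sections -/

theorem oddClass_eq_iff (h : IsSection β true w) (h' : IsSection β true w') :
    oddClass w h = oddClass w' h' ↔
      ∃ v, IsSection β false v ∧ ∀ g, res g (w g) = res g (w' g) + res g (extD (v g)) := by
  rw [oddClass, oddClass, eq_comm, QuotientAddGroup.eq, AddSubgroup.mem_addSubgroupOf]
  constructor
  · rintro ⟨v, hv, h1⟩
    refine ⟨v, hv, fun g => ?_⟩
    have h2 := congrFun h1 g
    have h3 : -res g (w' g) + res g (w g) = res g (extD (v g)) := h2
    rw [← h3]; abel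
  · rintro ⟨v, hv, h1⟩
    refine ⟨v, hv, funext fun g => ?_⟩
    show -res g (w' g) + res g (w g) = res g (extD (v g))
    rw [h1]; abel

theorem oddFixClass_eq_iff {g : G} {α α' : Form X} (hs : IsSmooth α) (hp : HasParity true α)
    (hs' : IsSmooth α') (hp' : HasParity true α') :
    oddFixClass g α hs hp = oddFixClass g α' hs' hp' ↔
      ∃ γ, IsSmooth γ ∧ HasParity false γ ∧ res g α = res g α' + res g (extD γ) := by
  rw [oddFixClass, oddFixClass, eq_comm, QuotientAddGroup.eq, AddSubgroup.mem_addSubgroupOf]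
  constructor
  · rintro ⟨γ, h1, h2, h3⟩
    refine ⟨γ, h1, h2, ?_⟩
    have h4 : -res g α' + res g α = res g (extD γ) := h3
    rw [← h4]; abel
  · rintro ⟨γ, h1, h2, h3⟩
    refine ⟨γ, h1, h2, ?_⟩
    show -res g α' + res g α = res g (extD γ)
    rw [h3]; abel

open Classical in
/-- The class of an odd section, and zero for other families of forms. -/
def oc (β : G → G → Circle) (w : G → Form X) : OddClass β X :=
  if h : IsSection β true w then oddClass w h else 0

theorem oc_eq (h : IsSection β true w) : oc β w = oddClass w h := dif_pos h

theorem oc_add (h : IsSection β true w) (h' : IsSection β true w') :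
    oc β (w + w') = oc β w + oc β w' := by
  rw [oc_eq h, oc_eq h', oc_eq (h.add h'), oddClass, oddClass, oddClass, ← QuotientAddGroup.mk_add]
  congr 1
  ext1
  funext g
  exact map_add (res g) _ _

theorem oc_eq_iff (h : IsSection β true w) (h' : IsSection β true w') : oc β w = oc β w' ↔
    ∃ v, IsSection β false v ∧ ∀ g, res g (w g) = res g (w' g) + res g (extD (v g)) := by
  rw [oc_eq h, oc_eq h', oddClass_eq_iff]

theorem oc_congr (h : IsSection β true w) (h' : IsSection β true w')
    (hr : ∀ g, res g (w g) = res g (w' g)) : oc β w = oc β w' :=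
  (oc_eq_iff h h').2 ⟨0, IsSection.zero, fun g => by
    rw [hr, Pi.zero_apply, extD_zero, map_zero, add_zero]⟩

theorem oc_zero : oc β (0 : G → Form X) = 0 := by
  have h := oc_add (IsSection.zero (β := β) (X := X) (p := true)) IsSection.zero
  rw [add_zero] at h
  exact left_eq_add.1 h

theorem exists_oc (q : OddClass β X) : ∃ w, IsSection β true w ∧ oc β w = q := by
  obtain ⟨⟨_, w, h, rfl⟩, rfl⟩ := QuotientAddGroup.mk_surjective q
  exact ⟨w, h, oc_eq h⟩

theorem IsSection.pull {w : G → Form Y} (h : IsSection β p w) (f : X.carrier → Y.carrier)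
    [SmoothMap X Y f] (he : ∀ g x, f (X.act g x) = Y.act g (f x)) :
    IsSection β p fun g => pull f (w g) := by
  refine ⟨fun g => ⟨(h.1 g).1.pull f, ?_⟩, fun k g => ?_⟩
  · have := (h.1 g).2
    unfold HasParity at this ⊢
    rw [← pull_sinv, this]
    split_ifs
    · exact map_neg _ _
    · rfl
  · have h1 := h.2 k g
    rw [← res_smul] at h1
    have h2 := res_pull_congr f (he g) h1
    rw [pull_smul, res_smul] at h2
    rw [← h2, ← pull_comp (X.act k) f, ← pull_comp f (Y.act k)]
    congr 2
    exact congrArg (fun φ : X.carrier → Y.carrier => fpull φ) (funext fun x => he k x)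

theorem IsSection.fiberInt [Finite G] {w : G → Form X.cyl} (h : IsSection β p w) :
    IsSection β (!p) fun g => fiberInt (w g) := by
  refine ⟨fun g => ⟨(h.1 g).1.fiberInt, fiberInt_hasParity (h.1 g).1 (h.1 g).2⟩, fun k g => ?_⟩
  rw [← fiberInt_cylMap (X.act k) (h.1 _).1, ← res_smul, ← fiberInt_smul]
  refine res_fiberInt_congr ((h.1 _).1.pull (X.cyl.act k)) ((h.1 g).1.smul _) ?_
  rw [res_smul]
  exact h.2 k g

/-- Pullback of classes of sections along an equivariant map. -/
def pullClass (f : X.carrier → Y.carrier) (q : OddClass β Y) : OddClass β X :=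
  oc β fun g => pull f ((exists_oc q).choose g)

section

variable (f : X.carrier → Y.carrier) [SmoothMap X Y f]
  (he : ∀ g x, f (X.act g x) = Y.act g (f x))

theorem pullClass_oc (he : ∀ g x, f (X.act g x) = Y.act g (f x)) {w : G → Form Y}
    (h : IsSection β true w) : pullClass f (oc β w) = oc β fun g => pull f (w g) := by
  have h1 := (exists_oc (oc β w)).choose_spec
  obtain ⟨v, hv, h2⟩ := (oc_eq_iff h1.1 h).1 h1.2
  refine (oc_eq_iff (h1.1.pull f he) (h.pull f he)).2 ⟨_, hv.pull f he, fun g => ?_⟩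
  rw [extD_pull f (hv.1 g).1, ← map_add, ← map_add]
  refine res_pull_congr f (he g) ?_
  rw [h2, map_add]

theorem pullClass_add (he : ∀ g x, f (X.act g x) = Y.act g (f x)) (q q' : OddClass β Y) :
    pullClass f (q + q') = pullClass f q + pullClass f q' := by
  obtain ⟨w, h, rfl⟩ := exists_oc q
  obtain ⟨w', h', rfl⟩ := exists_oc q'
  rw [← oc_add h h', pullClass_oc f he (h.add h'), pullClass_oc f he h, pullClass_oc f he h',
    ← oc_add (h.pull f he) (h'.pull f he)]
  congr 1
  funext g
  exact map_add (pull f) _ _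

end

/-! ### The cocycle of the inertia groupoid -/

theorem inertiaCocycle_ne_zero (h g : G) : inertiaCocycle β h g ≠ 0 :=
  div_ne_zero (Circle.coe_ne_zero _) (Circle.coe_ne_zero _)

theorem inertiaCocycle_mul (hβ : IsNormalizedCocycle β) (h k g : G) :
    inertiaCocycle β (h * k) g = inertiaCocycle β h (k * g * k⁻¹) * inertiaCocycle β k g := by
  have hc : ∀ a b c : G, (β a b : ℂ) * β (a * b) c = β b c * β a (b * c) := fun a b c => by
    rw [← Circle.coe_mul, hβ.cocycle, Circle.coe_mul]
  unfold inertiaCocycle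
  set a := k * g * k⁻¹ with ha
  have e1 : h * k * g * (h * k)⁻¹ = h * a * h⁻¹ := by rw [ha]; group
  rw [e1]
  set b := h * a * h⁻¹ with hb
  have e2 : b * h = h * a := by rw [hb]; group
  have e3 : a * k = k * g := by rw [ha]; group
  have h1 := hc b h k
  have h2 := hc h k g
  have h3 := hc h a k
  rw [e2] at h1
  rw [e3] at h3
  have n := fun a b : G => Circle.coe_ne_zero (β a b)
  rw [div_mul_div_comm, div_eq_div_iff (n _ _) (mul_ne_zero (n _ _) (n _ _))]
  have : ((β h k : ℂ) * β (h * a) k) * (β b (h * k) * ((β h a : ℂ) * β k g)) =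
      ((β h k : ℂ) * β (h * a) k) * ((β b h : ℂ) * β a k * β (h * k) g) := by
    linear_combination (-(β (h * a) k : ℂ) * β h a * β k g) * h1 -
      (β (h * a) k * β b h * β a k : ℂ) * h2 + (β (h * a) k * β b h * β k g : ℂ) * h3
  exact mul_left_cancel₀ (mul_ne_zero (n _ _) (n _ _)) this

theorem inertiaCocycle_of_commute {h g : G} (hg : h * g = g * h) :
    inertiaCocycle β h g = (β g h : ℂ) / β h g := by
  have : h * g * h⁻¹ = g := by rw [hg]; group
  rw [inertiaCocycle, this]

/-! ### Sections and their values at representatives of the conjugacy classes -/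

/-- The odd section with prescribed values at the representatives of the conjugacy classes gives
invariant classes. -/
def sectionToInv (β : G → G → Circle) (X : GMfd.{u} G) : sections β X true →+ invClasses β X where
  toFun z := ⟨fun c => QuotientAddGroup.mk ⟨z.1 (conjRep c), by
      obtain ⟨w, h, hz⟩ := z.2
      exact ⟨w (conjRep c), (h.1 _).1, (h.1 _).2, congrFun hz _⟩⟩, by
    obtain ⟨_, w, h, rfl⟩ := z
    refine fun c => ⟨w (conjRep c), (h.1 _).1, (h.1 _).2, rfl, fun k hk => ?_⟩
    have h1 := h.2 k (conjRep c)
    have h2 : k * conjRep c * k⁻¹ = conjRep c := by rw [hk]; group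
    rw [h2, inertiaCocycle_of_commute hk] at h1
    have n := fun a b : G => Circle.coe_ne_zero (β a b)
    rw [h1, smul_smul, mul_assoc, inv_mul_eq_div, div_div_cancel_left', mul_inv_cancel₀ (n _ _),
      one_smul, sub_self]
    · exact zero_mem _
    · exact n _ _⟩
  map_zero' := rfl
  map_add' _ _ := rfl

/-- The values of a class of sections at the representatives of the conjugacy classes. -/
def toInv (β : G → G → Circle) (X : GMfd.{u} G) : OddClass β X →+ invClasses β X :=
  QuotientAddGroup.lift _ (sectionToInv β X) fun z hz => by
    obtain ⟨v, hv, h⟩ := hz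
    refine Subtype.ext (funext fun c => (QuotientAddGroup.eq_zero_iff _).2 ?_)
    exact ⟨v (conjRep c), (hv.1 _).1, (hv.1 _).2, congrFun h _⟩

theorem toInv_oc (h : IsSection β true w) (c : ConjClasses G) : (toInv β X (oc β w)).1 c =
    oddFixClass (conjRep c) (w (conjRep c)) (h.1 _).1 (h.1 _).2 := by
  rw [oc_eq h]; rfl

theorem mk_conjRep (c : ConjClasses G) : ConjClasses.mk (conjRep c) = c := Quotient.out_eq c

theorem mk_conj (k g : G) : ConjClasses.mk (k * g * k⁻¹) = ConjClasses.mk g :=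
  ConjClasses.mk_eq_mk_iff_isConj.2 (isConj_iff.2 ⟨k, rfl⟩).symm

theorem hasParity_smul (c : ℂ) {γ : Form X} (h : HasParity p γ) : HasParity p (c • γ) := by
  unfold HasParity at h ⊢
  rw [form_sinv_smul, h]
  split_ifs
  · exact smul_neg _ _
  · rfl

theorem hasParity_sum {κ : Type*} {s : Finset κ} {γ : κ → Form X}
    (h : ∀ k ∈ s, HasParity p (γ k)) : HasParity p (∑ k ∈ s, γ k) := by
  classical
  induction s using Finset.induction_on with
  | empty => exact HasParity.zero p
  | insert a s ha ih =>
    rw [Finset.sum_insert ha]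
    exact (h a (Finset.mem_insert_self _ _)).add (ih fun k hk => h k (Finset.mem_insert_of_mem hk))

theorem hasParity_pull {γ : Form Y} (h : HasParity p γ) (f : X.carrier → Y.carrier) :
    HasParity p (pull f γ) := by
  unfold HasParity at h ⊢
  rw [← pull_sinv, h]
  split_ifs
  · exact map_neg _ _
  · rfl

theorem pull_sum {κ : Type*} (s : Finset κ) (γ : κ → Form Y) (f : X.carrier → Y.carrier) :
    pull f (∑ k ∈ s, γ k) = ∑ k ∈ s, pull f (γ k) := map_sum _ _ _

theorem res_sum {κ : Type*} (s : Finset κ) (γ : κ → Form X) (g : G) :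
    res g (∑ k ∈ s, γ k) = ∑ k ∈ s, res g (γ k) := map_sum _ _ _

section Average

variable [Fintype G]

open Classical in
/-- The elements that conjugate `g` to the representative of its conjugacy class. -/
def conjugators (g : G) : Finset G :=
  Finset.univ.filter fun h => h * g * h⁻¹ = conjRep (ConjClasses.mk g)

theorem mem_conjugators {g h : G} :
    h ∈ conjugators g ↔ h * g * h⁻¹ = conjRep (ConjClasses.mk g) := by simp [conjugators]

theorem card_conjugators_ne_zero (g : G) : ((conjugators g).card : ℂ) ≠ 0 := by
  have : IsConj g (conjRep (ConjClasses.mk g)) :=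
    (ConjClasses.mk_eq_mk_iff_isConj.1 (mk_conjRep (ConjClasses.mk g))).symm
  obtain ⟨c, hc⟩ := isConj_iff.1 this
  exact Nat.cast_ne_zero.2 (Finset.card_ne_zero_of_mem (mem_conjugators.2 hc))

theorem mul_mem_conjugators {k g h : G} :
    h * k ∈ conjugators g ↔ h ∈ conjugators (k * g * k⁻¹) := by
  rw [mem_conjugators, mem_conjugators, mk_conj]
  have : h * k * g * (h * k)⁻¹ = h * (k * g * k⁻¹) * h⁻¹ := by group
  rw [this]

/-- The section with given values at the representatives of the conjugacy classes. -/
def secAvg (β : G → G → Circle) (α : ConjClasses G → Form X) (g : G) : Form X :=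
  ((conjugators g).card : ℂ)⁻¹ • ∑ h ∈ conjugators g,
    (inertiaCocycle β h g)⁻¹ • pull (X.act h) (α (ConjClasses.mk g))

variable {α : ConjClasses G → Form X}

theorem secAvg_smooth (hα : ∀ c, IsSmooth (α c)) (g : G) : IsSmooth (secAvg β α g) :=
  (IsSmooth.sum fun h _ => ((hα _).pull (X.act h)).smul _).smul _

theorem pull_act_secAvg (hβ : IsNormalizedCocycle β) (k g : G) :
    pull (X.act k) (secAvg β α (k * g * k⁻¹)) = inertiaCocycle β k g • secAvg β α g := by
  have hcard : (conjugators (k * g * k⁻¹)).card = (conjugators g).card :=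
    Finset.card_nbij (· * k) (fun h hh => mul_mem_conjugators.2 hh)
      (fun a _ b _ h => mul_right_cancel h)
      (fun h hh => ⟨h * k⁻¹, mul_mem_conjugators.1 (by rwa [inv_mul_cancel_right]), by simp⟩)
  rw [secAvg, secAvg, pull_smul, pull_sum, hcard, smul_comm (inertiaCocycle β k g)]
  congr 1
  rw [Finset.smul_sum]
  refine Finset.sum_nbij (· * k) (fun h hh => mul_mem_conjugators.2 hh)
    (fun a _ b _ h => mul_right_cancel h)
    (fun h hh => ⟨h * k⁻¹, mul_mem_conjugators.1 (by rwa [inv_mul_cancel_right]), by simp⟩)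
    fun h _ => ?_
  rw [pull_smul, pull_act_act, inertiaCocycle_mul hβ, mk_conj, smul_smul, mul_inv, mul_left_comm,
    mul_inv_cancel₀ (inertiaCocycle_ne_zero k g), mul_one]

theorem isSection_secAvg (hβ : IsNormalizedCocycle β) (hα : ∀ c, IsSmooth (α c))
    (hp : ∀ c, HasParity p (α c)) : IsSection β p (secAvg β α) :=
  ⟨fun g => ⟨secAvg_smooth hα g,
    hasParity_smul _ (hasParity_sum fun h _ => hasParity_smul _ (hasParity_pull (hp _) _))⟩,
    fun k g => by rw [pull_act_secAvg hβ, res_smul]⟩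

theorem extD_secAvg (hα : ∀ c, IsSmooth (α c)) (g : G) :
    extD (secAvg β α g) = secAvg β (fun c => extD (α c)) g := by
  have h1 : ∀ h : G, IsSmooth ((inertiaCocycle β h g)⁻¹ •
      pull (X.act h) (α (ConjClasses.mk g))) := fun h => ((hα _).pull (X.act h)).smul _
  rw [secAvg, secAvg, extD_smul _ (IsSmooth.sum fun h _ => h1 h), extD_sum fun h _ => h1 h]
  congr 1
  refine Finset.sum_congr rfl fun h _ => ?_
  rw [extD_smul _ ((hα _).pull (X.act h)), extD_pull _ (hα _)]

theorem res_pull_conj {w : G → Form X} (hw : IsSection β p w) {g h : G} {γ : Form X}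
    (hh : h ∈ conjugators g) (hγ : res (conjRep (ConjClasses.mk g)) γ =
      res (conjRep (ConjClasses.mk g)) (w (conjRep (ConjClasses.mk g)))) :
    res g (pull (X.act h) γ) = inertiaCocycle β h g • res g (w g) := by
  rw [← hw.2 h g, mem_conjugators.1 hh]
  refine res_pull_congr (X.act h) (fun x => ?_) hγ
  rw [← X.act_mul, ← X.act_mul, ← mem_conjugators.1 hh]
  congr 1
  group

theorem res_secAvg {w : G → Form X} (hw : IsSection β p w)
    (h : ∀ c, res (conjRep c) (α c) = res (conjRep c) (w (conjRep c))) (g : G) :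
    res g (secAvg β α g) = res g (w g) := by
  have h1 : ∀ k ∈ conjugators g, res g ((inertiaCocycle β k g)⁻¹ •
      pull (X.act k) (α (ConjClasses.mk g))) = res g (w g) := fun k hk => by
    rw [res_smul, res_pull_conj hw hk (h _), smul_smul,
      inv_mul_cancel₀ (inertiaCocycle_ne_zero _ _), one_smul]
  rw [secAvg, res_smul, res_sum, Finset.sum_congr rfl h1, Finset.sum_const,
    ← Nat.cast_smul_eq_nsmul ℂ, smul_smul, inv_mul_cancel₀ (card_conjugators_ne_zero g), one_smul]

end Average

theorem toInv_injective [Finite G] (hβ : IsNormalizedCocycle β) :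
    Function.Injective (toInv β X) := by
  cases nonempty_fintype G
  rw [injective_iff_map_eq_zero]
  intro q hq
  obtain ⟨w, hw, rfl⟩ := exists_oc q
  have h1 : ∀ c, ∃ γ : Form X, IsSmooth γ ∧ HasParity false γ ∧
      res (conjRep c) (extD γ) = res (conjRep c) (w (conjRep c)) := fun c => by
    have h2 := congrFun (congrArg Subtype.val hq) c
    rw [toInv_oc hw, oddFixClass] at h2
    obtain ⟨γ, hs, hp, h3⟩ := (QuotientAddGroup.eq_zero_iff _).1 h2
    exact ⟨γ, hs, hp, h3.symm⟩
  choose γ hs hp h using h1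
  rw [← oc_zero, oc_eq_iff hw IsSection.zero]
  refine ⟨secAvg β γ, isSection_secAvg hβ hs hp, fun g => ?_⟩
  rw [extD_secAvg hs, res_secAvg hw h, Pi.zero_apply, map_zero, zero_add]

theorem toInv_surjective [Finite G] (hβ : IsNormalizedCocycle β) :
    Function.Surjective (toInv β X) := by
  cases nonempty_fintype G
  rintro ⟨q, hq⟩
  have hq' := hq
  choose α hs hp h1 h2 using hq'
  have hw : IsSection β true (secAvg β α) := isSection_secAvg hβ hs hp
  refine ⟨oc β (secAvg β α), Subtype.ext (funext fun c =>
    (toInv_oc hw c).trans (Eq.trans ?_ (h1 c).symm))⟩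
  refine (oddFixClass_eq_iff _ _ _ _).2 ?_
  have hterm : ∀ k ∈ conjugators (conjRep c), ∃ γ, IsSmooth γ ∧ HasParity false γ ∧
      res (conjRep c) ((inertiaCocycle β k (conjRep c))⁻¹ • pull (X.act k) (α c)) =
        res (conjRep c) (α c) + res (conjRep c) (extD γ) := fun k hk => by
    rw [mem_conjugators, mk_conjRep] at hk
    have hk' : k * conjRep c = conjRep c * k := by
      conv_rhs => rw [← hk]
      group
    obtain ⟨γ, a1, a2, a3⟩ := h2 c k hk'
    refine ⟨γ, a1, a2, ?_⟩
    rw [← a3, res_smul, inertiaCocycle_of_commute hk', inv_div, div_eq_mul_inv]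
    abel
  choose! γ g1 g2 g3 using hterm
  have hN0 := card_conjugators_ne_zero (conjRep c)
  refine ⟨((conjugators (conjRep c)).card : ℂ)⁻¹ • ∑ k ∈ conjugators (conjRep c), γ k, (IsSmooth.sum g1).smul _,
    hasParity_smul _ (hasParity_sum g2), ?_⟩
  rw [secAvg, mk_conjRep, res_smul, res_sum, Finset.sum_congr rfl g3, Finset.sum_add_distrib,
    Finset.sum_const, ← Nat.cast_smul_eq_nsmul ℂ, smul_add, smul_smul, inv_mul_cancel₀ hN0, one_smul,
    extD_smul _ (IsSmooth.sum g1), extD_sum g1, res_smul, res_sum]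

/-- Sections and invariant classes at the representatives of the conjugacy classes correspond. -/
def invEquiv [Finite G] (hβ : IsNormalizedCocycle β) (X : GMfd.{u} G) :
    OddClass β X ≃+ invClasses β X :=
  AddEquiv.ofBijective (toInv β X) ⟨toInv_injective hβ, toInv_surjective hβ⟩

end Classes

end

section

section ChernSimons

variable {G : Type v} [Group G] {X Y Z : GMfd.{u} G} {β : G → G → Circle} {m n : Type}

/-! ### Characters -/

theorem res_strace_pull_mul [Fintype m] [Fintype n] {p : m → Bool} (g : G)
    (M : Matrix m n (Form X)) (N : Matrix n m (Form X)) :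
    res g (strace p (M⋆g * N)) = res g (strace p (M * N)) := by
  rw [← strace_map, ← strace_map, mmap_mul, mmap_mul]
  congr 2
  exact Matrix.ext fun i j => res_pull_act g (M i j)

theorem PreRep.character_eq (D : PreRep X) (g : G) : D.character g = strace D.par (D.a g 1) := rfl

theorem PreRep.character_pull (D : PreRep Y) (f : X.carrier → Y.carrier) (g : G) :
    (D.pull f).character g = fpull f (D.character g) :=
  strace_map (fpull f) _

theorem PreRep.character_sum (D D' : PreRep X) (g : G) :
    (D.sum D').character g = D.character g + D'.character g :=
  Fintype.sum_sum_type _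

theorem PreRep.character_conj (D : PreRep X) [Fintype m] [DecidableEq m] {p : m → Bool}
    {e : Matrix m m (Form X)} {a : Matrix D.ι m (Form X)} {b : Matrix m D.ι (Form X)} (g : G) :
    (D.conj p e a b).character g =
      strace p (b⋆g * D.a g 1 * a) := by
  rw [← PreRep.conj_a (e := e) (p := p)]; rfl

theorem IsBundle.character_eq {V : PreBundle X} (h : IsBundle β V) (g : G) :
    V.toSRep.character g = V.character g := by
  rw [← h.toPreRep_eq]
  have hF := h.isSC.scurv_even
  have h1 := h.isFlow.isPar hF zero_le_one
  have h2 : V.toPreRep.character g =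
      strace V.par (V.ρ g * V.expCurvature (-((1 : ℝ) : ℂ))) := rfl
  rw [h2, strace_mul_comm (h.ρ_graded g).isPar_even h1, Complex.ofReal_one]
  rfl

section

variable {D D' : PreRep X}

theorem IsRep.character_smooth (h : IsRep β D) (g : G) : IsSmooth (D.character g) := by
  have := h.msmooth_a g 1
  exact isSmooth_strace (p := D.par) (D.a g 1)

theorem IsRep.character_even (h : IsRep β D) (g : G) : HasParity false (D.character g) :=
  hasParity_strace (h.isPar_a g 1)

theorem IsRep.res_character_iso (h : IsRep β D) (h' : IsRep β D') (hi : D.Iso D') (g : G) :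
    res g (D.character g) = res g (D'.character g) := by
  obtain ⟨a, b, hab, hR⟩ := (PreRep.iso_iff h'.adm h.adm).1 (PreRep.Iso.symm h.adm h'.adm hi)
  rw [PreRep.eq_conj h'.adm hab hR, PreRep.character_conj, massoc, res_strace_pull_mul]
  have hb := hab.b_even
  have ha := hab.a_even
  rw [strace_mul_comm hb ((h.isPar_a g 1).mul_ee ha), massoc, hab.ab, h.a_mul_e]
  rfl

/-- The character of a representation is a section of the line bundle on the inertia groupoid. -/
theorem IsRep.isSection_character (hβ : IsNormalizedCocycle β) (h : IsRep β D) :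
    IsSection β false D.character := by
  refine ⟨fun g => ⟨h.character_smooth g, h.character_even g⟩, fun k g => ?_⟩
  have ht := h.isTw
  have n := fun a b : G => Circle.coe_ne_zero (β a b)
  have e1 : k * g * k⁻¹ * k = k * g := by group
  have h1 := (h.comp (k * g * k⁻¹) k 1 0).1
  have h2 := (h.comp k g 0 1).1
  rw [e1, add_zero] at h1
  rw [zero_add] at h2
  obtain ⟨P, hP⟩ : ∃ P, P = (D.a (k * g * k⁻¹) 1)⋆k := ⟨_, rfl⟩
  obtain ⟨v, hv⟩ : ∃ v, v = twInv β (fun g => D.a g 0) k := ⟨_, rfl⟩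
  have hve : IsPar false D.par D.par v := hv ▸ ht.twInv_even k
  have h3 : P * D.a k 0 = inertiaCocycle β k g • ((D.a k 0)⋆g * D.a g 1) := by
    rw [hP, h1, h2, smul_smul, inertiaCocycle, div_mul_cancel₀ _ (n _ _)]
  have h4 : P = inertiaCocycle β k g • ((D.a k 0)⋆g * (D.a g 1 * v)) := by
    rw [← massoc, ← msmul_mul, ← h3, massoc, hv, ht.mul_twInv hβ k, hP,
      ← mpull_mul, h.a_mul_e]
  have h5 : pull (X.act k) (D.character (k * g * k⁻¹)) = strace D.par P := by
    rw [hP, strace_map]; rfl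
  rw [h5, h4, strace_smul, res_smul, res_strace_pull_mul,
    strace_mul_comm (h.isPar_a k 0) ((h.isPar_a g 1).mul_ee hve), massoc, hv,
    ht.twInv_mul k, h.a_mul_e]
  rfl

theorem IsRep.res_extD_character (hβ : IsNormalizedCocycle β) (h : IsRep β D) (g : G) :
    res g (extD (D.character g)) = 0 := by
  have i1 := h.msmooth_a g 1
  have i2 := h.msmooth_e
  have h1 := (h.comp g 1 1 0).2.1
  rw [h.a_one_zero, mpull_act_one, add_zero, mul_one, hβ.one_right, Circle.coe_one, one_smul] at h1
  have h2 := h.b_eq_mul hβ g 1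
  have h3 : 𝐝(D.a g 1) = 𝐝(D.a g 1) * D.e + 𝐬(D.a g 1) * 𝐝D.e := by
    conv_lhs => rw [← h.a_mul_e g 1, d_mul]
  have h4 : 𝐝(D.a g 1) = (D.b 1 0)⋆g * D.a g 1 - 𝐬(D.a g 1) * D.b 1 0 +
      𝐬(D.a g 1) * 𝐝D.e := by
    rw [h3, ← h2, ← h1]; abel
  have hd : IsPar true D.par D.par 𝐝D.e := h.isPar_e.d
  have h6 : 𝐝D.e * D.e * D.e = 𝐝D.e * D.e := by rw [massoc, h.e_idem]
  have h7 : 𝐬D.e * 𝐝D.e * D.e = 0 := by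
    have : 𝐝D.e = 𝐝D.e * D.e + 𝐬D.e * 𝐝D.e := by
      conv_lhs => rw [← h.e_idem, d_mul]
    have := congrArg (· * D.e) this
    simp only [madd_mul, h6] at this
    exact left_eq_add.1 this
  rw [PreRep.character_eq, ← strace_d, h4, strace_add, strace_sub, map_add, map_sub,
    res_strace_pull_mul, strace_s_mul_comm (h.isPar_a g 1) (h.isPar_b 1 0), sub_self, zero_add]
  have h8 : 𝐬(D.a g 1) * 𝐝D.e = (𝐬D.e)⋆g * (𝐬(D.a g 1) * 𝐝D.e) := by
    rw [← s_pull, ← massoc, ← s_mul, h.e_mul_a]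
  have h9 : 𝐬D.e * (𝐬(D.a g 1) * 𝐝D.e) = 𝐬(D.e * D.a g 1) * 𝐝D.e := by
    rw [← massoc, ← s_mul]
  have h10 : 𝐬(D.a g 1) = 𝐬(D.a g 1) * 𝐬D.e := by rw [← s_mul, h.a_mul_e]
  rw [h8, res_strace_pull_mul, h9, strace_s_mul_comm (h.isPar_e.mul_ee (h.isPar_a g 1)) hd,
    ← massoc, ← strace_s_mul_comm (h.isPar_a g 1) (hd.mul_oe h.isPar_e), h10,
    massoc, ← massoc (𝐬D.e), h7, mmul_zero]
  simp [strace]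

end

/-! ### Chern-Simons classes -/

/-- The Chern-Simons class of a representation over the cylinder. -/
def PreRep.cs (β : G → G → Circle) (D : PreRep X.cyl) : OddClass β X :=
  oc β fun g => fiberInt (D.character g)

theorem PreRep.cs_proj (D : PreRep X) : (D.pull X.proj).cs β = 0 := by
  rw [PreRep.cs, ← oc_zero]
  congr 1
  funext g
  rw [PreRep.character_pull, fiberInt_proj]
  rfl

variable [Finite G]

section

variable {D D' : PreRep X.cyl}

theorem IsRep.isSection_cs (hβ : IsNormalizedCocycle β) (h : IsRep β D) :
    IsSection β true fun g => fiberInt (D.character g) :=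
  (h.isSection_character hβ).fiberInt

theorem IsRep.cs_iso (hβ : IsNormalizedCocycle β) (h : IsRep β D) (h' : IsRep β D')
    (hi : D.Iso D') : D.cs β = D'.cs β :=
  oc_congr (h.isSection_cs hβ) (h'.isSection_cs hβ) fun g =>
    res_fiberInt_congr (h.character_smooth g) (h'.character_smooth g)
      (h.res_character_iso h' hi g)

theorem IsRep.cs_sum (hβ : IsNormalizedCocycle β) (h : IsRep β D) (h' : IsRep β D') :
    (D.sum D').cs β = D.cs β + D'.cs β := by
  rw [PreRep.cs, PreRep.cs, PreRep.cs, ← oc_add (h.isSection_cs hβ) (h'.isSection_cs hβ)]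
  congr 1
  funext g
  rw [PreRep.character_sum, fiberInt_add (h.character_smooth g) (h'.character_smooth g)]
  rfl

theorem IsRep.cs_cylMap {D : PreRep Y.cyl} (hβ : IsNormalizedCocycle β) (h : IsRep β D)
    (f : X.carrier → Y.carrier) [SmoothMap X Y f] (he : ∀ g x, f (X.act g x) = Y.act g (f x)) :
    (D.pull (cylMap f)).cs β = pullClass f (D.cs β) := by
  rw [PreRep.cs, PreRep.cs, pullClass_oc f he (h.isSection_cs hβ)]
  congr 1
  funext g
  rw [PreRep.character_pull, fiberInt_cylMap f (h.character_smooth g)]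

end

/-- Two applications of the theorem of Stokes compare the Chern-Simons classes of the four faces
of a representation over the product with a square. -/
theorem IsRep.cs_square (hβ : IsNormalizedCocycle β) {D : PreRep X.cyl.cyl} (h : IsRep β D)
    (h0 : IsRep β (D.pull (X.cyl.incl 0))) (h1 : IsRep β (D.pull (X.cyl.incl 1)))
    (k0 : IsRep β (D.pull (cylMap (X.incl 0)))) (k1 : IsRep β (D.pull (cylMap (X.incl 1)))) :
    (D.pull (X.cyl.incl 1)).cs β + (D.pull (cylMap (X.incl 0))).cs β =
      (D.pull (X.cyl.incl 0)).cs β + (D.pull (cylMap (X.incl 1))).cs β := by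
  have hI := h.isSection_cs hβ
  simp only [PreRep.cs]
  rw [← oc_add (h1.isSection_cs hβ) (k0.isSection_cs hβ),
    ← oc_add (h0.isSection_cs hβ) (k1.isSection_cs hβ),
    oc_eq_iff ((h1.isSection_cs hβ).add (k0.isSection_cs hβ))
      ((h0.isSection_cs hβ).add (k1.isSection_cs hβ))]
  refine ⟨-fun g => fiberInt (fiberInt (D.character g)), (hI.fiberInt).neg, fun g => ?_⟩
  have hs := h.character_smooth g
  have s1 := fiberInt_stokes hs
  have s2 := fiberInt_stokes hs.fiberInt
  rw [← fiberInt_cylMap (X.incl 1) hs, ← fiberInt_cylMap (X.incl 0) hs] at s2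
  have s3 := congrArg (fun α => res g (fiberInt α)) s1
  have s4 := congrArg (res g) s2
  beta_reduce at s3
  rw [fiberInt_add hs.extD.fiberInt hs.fiberInt.extD, fiberInt_sub (hs.pull _) (hs.pull _),
    map_add, map_sub,
    res_fiberInt_eq_zero hs.extD.fiberInt
      (res_fiberInt_eq_zero hs.extD (h.res_extD_character hβ g)), zero_add] at s3
  rw [map_add, map_sub, s3] at s4
  simp only [Pi.add_apply, Pi.neg_apply, PreRep.character_pull, extD_neg, map_add, map_neg]
  rw [← sub_eq_zero] at s4 ⊢
  rw [← s4]
  abel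

end ChernSimons

end

section

section KClasses

variable {G : Type v} [Group G] {X Y Z : GMfd.{u} G} {β : G → G → Circle} {m n : Type}

/-! ### Chern-Simons classes of superconnections -/

theorem sub_eq_of_eq_add {M : Type*} [AddCommGroup M] (a : M) {b c d : M} (h : d = b + c) :
    a - c = a + b - d := by
  rw [h]; abel

/-- The Chern-Simons class of a bundle with superconnection over the cylinder. -/
def PreBundle.cs (β : G → G → Circle) (V : PreBundle X.cyl) : OddClass β X := V.toSRep.cs β

theorem eq_of_add_eq_of_eq_zero {M : Type*} [AddCommGroup M] {a b c : M} (h : a = 0)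
    (h' : a + b = c) : b = c := by
  rwa [h, zero_add] at h'

theorem PreBundle.interpolate_congr {ι : Type} [Fintype ι] [DecidableEq ι] {par : ι → Bool}
    {e e' : Matrix ι ι (Form X)} {ρ ρ' : G → Matrix ι ι (Form X)} {B B' A A' : Matrix ι ι (Form X)}
    (he : e = e') (hρ : ∀ g, ρ g = ρ' g) (hB : B = B') (hA : A = A') :
    (PreBundle.mk ι par e ρ B : PreBundle X).interpolate A =
      (PreBundle.mk ι par e' ρ' B').interpolate A' := by
  obtain rfl : ρ = ρ' := funext hρ
  subst he hB hA
  rfl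

theorem PreBundle.withConnection_pull_incl (V : PreBundle X) (M : Matrix V.ι V.ι (Form X.cyl))
    (l : ℝ) : ((V.pull X.proj).withConnection M).pull (X.incl l) =
      V.withConnection (M.map (fpull (X.incl l))) :=
  PreBundle.mk_congr (mpull_incl_proj l _) (fun _ => mpull_incl_proj l _) rfl

theorem lerp_self (M : Matrix m n (Form X)) : lerp M M = M.map (pull X.proj) := by
  unfold lerp comb; abel

theorem PreBundle.interpolate_self (V : PreBundle X) : V.interpolate V.A = V.pull X.proj := by
  rw [PreBundle.interpolate_eq]
  exact PreBundle.mk_congr rfl (fun _ => rfl) (lerp_self V.A)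

theorem IsSC.cs_proj {V : PreBundle X} (h : IsSC β V) : (V.pull X.proj).cs β = 0 := by
  rw [PreBundle.cs, h.pull_toSRep X.proj proj_act, PreRep.cs_proj]

theorem IsSC.isRep_pull {V : PreBundle Y} (h : IsSC β V) (f : X.carrier → Y.carrier)
    [SmoothMap X Y f] (he : ∀ g x, f (X.act g x) = Y.act g (f x)) :
    IsRep β (V.toSRep.pull f) := by
  rw [← h.pull_toSRep f he]; exact (h.pull f he).isRep_toSRep

theorem IsSC.cs_iso [Finite G] (hβ : IsNormalizedCocycle β) {V V' : PreBundle X.cyl} (h : IsSC β V)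
    (h' : IsSC β V') (hi : V.toSRep.Iso V'.toSRep) : V.cs β = V'.cs β :=
  h.isRep_toSRep.cs_iso hβ h'.isRep_toSRep hi

theorem IsSC.cs_square [Finite G] (hβ : IsNormalizedCocycle β) {Q : PreBundle X.cyl.cyl}
    {F₀ F₁ E₀ E₁ : PreBundle X.cyl} (h : IsSC β Q) (f₀ : Q.pull (X.cyl.incl 0) = F₀)
    (f₁ : Q.pull (X.cyl.incl 1) = F₁) (e₀ : Q.pull (cylMap (X.incl 0)) = E₀)
    (e₁ : Q.pull (cylMap (X.incl 1)) = E₁) :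
    F₁.cs β + E₀.cs β = F₀.cs β + E₁.cs β := by
  have i0 : ∀ l g (x : X.cyl.carrier), X.cyl.incl l (X.cyl.act g x) =
    X.cyl.cyl.act g (X.cyl.incl l x) := incl_act (X := X.cyl)
  have i1 : ∀ l g (x : X.cyl.carrier), cylMap (X.incl l) (X.cyl.act g x) =
    X.cyl.cyl.act g (cylMap (X.incl l) x) := fun l => cylMap_act (incl_act l)
  have k := h.isRep_toSRep.cs_square hβ (h.isRep_pull (X.cyl.incl 0) (i0 0))
    (h.isRep_pull (X.cyl.incl 1) (i0 1)) (h.isRep_pull (cylMap (X.incl 0)) (i1 0))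
    (h.isRep_pull (cylMap (X.incl 1)) (i1 1))
  rw [← h.pull_toSRep (X.cyl.incl 0) (i0 0), ← h.pull_toSRep (X.cyl.incl 1) (i0 1),
    ← h.pull_toSRep (cylMap (X.incl 0)) (i1 0), ← h.pull_toSRep (cylMap (X.incl 1)) (i1 1),
    f₀, f₁, e₀, e₁] at k
  exact k

theorem PreBundle.interpolate_proj_cylMap_incl (V : PreBundle X) (M : Matrix V.ι V.ι (Form X.cyl))
    (A : Matrix V.ι V.ι (Form X)) (l : ℝ) :
    (((V.pull X.proj).withConnection M).interpolate (A.map (fpull X.proj))).pull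
      (cylMap (X.incl l)) =
      (V.withConnection (M.map (fpull (X.incl l)))).interpolate A :=
  (PreBundle.interpolate_cylMap _ _ (X.incl l)).trans (PreBundle.interpolate_congr
    (mpull_incl_proj l _) (fun _ => mpull_incl_proj l _) rfl (mpull_incl_proj l A))

theorem IsSC.cs_triangle [Finite G] (hβ : IsNormalizedCocycle β) {V : PreBundle X}
    {M : Matrix V.ι V.ι (Form X.cyl)} {A : Matrix V.ι V.ι (Form X)}
    (hU : IsSC β ((V.pull X.proj).withConnection M)) (hA : IsSC β (V.withConnection A)) :
    ((V.withConnection (M.map (fpull (X.incl 0)))).interpolate A).cs β =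
      ((V.pull X.proj).withConnection M).cs β +
        ((V.withConnection (M.map (fpull (X.incl 1)))).interpolate A).cs β := by
  have hp : IsSC β ((V.withConnection A).pull X.proj) := hA.pull X.proj proj_act
  have hQ : IsSC β (((V.pull X.proj).withConnection M).interpolate
    (A.map (fpull X.proj))) := hU.interpolate hp
  have f0 := PreBundle.interpolate_incl_zero ((V.pull X.proj).withConnection M)
    (A.map (fpull X.proj))
  have f1 := PreBundle.interpolate_incl_one ((V.pull X.proj).withConnection M)
    (A.map (fpull X.proj))
  have f2 : (V.withConnection A).pull X.proj =
    ((V.pull X.proj).withConnection M).withConnection (A.map (fpull X.proj)) := rfl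
  have h := hQ.cs_square hβ f0 f1 (V.interpolate_proj_cylMap_incl M A 0)
    (V.interpolate_proj_cylMap_incl M A 1)
  exact eq_of_add_eq_of_eq_zero ((congrArg (PreBundle.cs β) f2).symm.trans hA.cs_proj) h

theorem IsSC.cs_interpolate_sum [Finite G] (hβ : IsNormalizedCocycle β) {V V' : PreBundle X}
    {A : Matrix V.ι V.ι (Form X)} {A' : Matrix V'.ι V'.ι (Form X)} (h : IsSC β V)
    (h' : IsSC β V') (hA : IsSC β (V.withConnection A)) (hA' : IsSC β (V'.withConnection A')) :
    ((V.sum V').interpolate (fromBlocks A 0 0 A')).cs β =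
      (V.interpolate A).cs β + (V'.interpolate A').cs β := by
  have k := h.interpolate hA
  have k' := h'.interpolate hA'
  rw [PreBundle.interpolate_sum, PreBundle.cs, (IsSC.sum hβ k k').2,
    k.isRep_toSRep.cs_sum hβ k'.isRep_toSRep]
  rfl

/-! ### Classes in differential K-theory of bundles with superconnection -/

theorem PreBundle.Iso.refl {V : PreBundle X} (h : IsBundle β V) : V.Iso V := by
  refine ⟨V.e, V.e, h.e_graded, h.e_graded, ?_, ?_, h.e_idem, h.e_idem, fun g => ?_, ?_⟩
  · rw [h.e_idem, h.e_idem]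
  · rw [h.e_idem, h.e_idem]
  · rw [h.isSC.ρ_mul_e, h.isSC.e_mul_ρ]
  · have h1 : V.e * 𝐝V.e * V.e = 0 := by rw [massoc, h.isSC.e_d_e]
    have h2 : V.e * V.e.map extD * V.e = 0 := h1
    rw [h2, zero_add, h.isSC.e_mul_A, h.isSC.A_mul_e]

open Classical in
/-- The class of a bundle with connection and a class of odd sections, and zero for data
that are not a bundle with connection. -/
def kc (β : G → G → Circle) (W : PreBundle X) (η : OddClass β X) : KHat β X :=
  if h : IsBundle β W then KGen.cls ⟨⟨W, h⟩, toInv β X η⟩ else 0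

theorem kc_eq {W : PreBundle X} (h : IsBundle β W) (η : OddClass β X) :
    kc β W η = KGen.cls ⟨⟨W, h⟩, toInv β X η⟩ := dif_pos h

theorem kRelations_eq {r s : FreeAbelianGroup (KGen β X)} (h : r - s ∈ kRelations β X) :
    (QuotientAddGroup.mk r : KHat β X) = QuotientAddGroup.mk s := by
  rw [eq_comm, QuotientAddGroup.eq, neg_add_eq_sub]
  exact h

theorem KGen.ChangeConnection.cls_eq {x y : KGen β X} (h : x.ChangeConnection y) :
    x.cls = y.cls :=
  kRelations_eq (AddSubgroup.subset_closure (Or.inl (Or.inl ⟨x, y, h, rfl⟩)))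

theorem KGen.cls_sum (x y : KGen β X) : (x.sum y).cls = x.cls + y.cls :=
  (kRelations_eq (r := FreeAbelianGroup.of x + FreeAbelianGroup.of y)
    (AddSubgroup.subset_closure (Or.inl (Or.inr ⟨x, y, rfl⟩)))).symm

theorem KGen.cls_flip (x : KGen β X) : x.cls + x.flip.cls = 0 :=
  kRelations_eq (r := FreeAbelianGroup.of x + FreeAbelianGroup.of x.flip) (s := 0) (by
    rw [sub_zero]
    exact AddSubgroup.subset_closure (Or.inr ⟨x, rfl⟩))

theorem IsBundle.changeConnection [Finite G] (hβ : IsNormalizedCocycle β) {W W' : PreBundle X}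
    {A : Matrix W.ι W.ι (Form X)} (h : IsBundle β W) (h' : IsBundle β W')
    (hA : IsBundle β (W.withConnection A)) (hi : (W.withConnection A).Iso W')
    {q q' : invClasses β X} (hq : q' = q + toInv β X ((W.interpolate A).cs β)) :
    KGen.ChangeConnection ⟨⟨W', h'⟩, q⟩ ⟨⟨W, h⟩, q'⟩ := by
  have hI := h.interpolate hA
  have hs := hI.isSC.isRep_toSRep.isSection_cs hβ
  refine ⟨A, hA, hi, fun c => ?_⟩
  have hc := hI.character_eq (conjRep c)
  have k := toInv_oc hs c
  have k1 : q'.1 c = q.1 c + (toInv β X ((W.interpolate A).cs β)).1 c := by rw [hq]; rfl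
  have s1 := (hs.1 (conjRep c)).1
  have s2 := (hs.1 (conjRep c)).2
  refine ⟨hc ▸ s1, hc ▸ s2, k1.trans (congrArg (q.1 c + ·) (k.trans ?_))⟩
  rw [oddFixClass_eq_iff]
  exact ⟨0, IsSmooth.zero, HasParity.zero _, by rw [hc, extD_zero, map_zero, add_zero]⟩

theorem kc_change [Finite G] (hβ : IsNormalizedCocycle β) {W W' : PreBundle X}
    {A : Matrix W.ι W.ι (Form X)} (h : IsBundle β W) (h' : IsBundle β W')
    (hA : IsBundle β (W.withConnection A)) (hi : (W.withConnection A).Iso W') (η : OddClass β X) :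
    kc β W' η = kc β W (η + (W.interpolate A).cs β) := by
  rw [kc_eq h, kc_eq h']
  exact (h.changeConnection hβ h' hA hi (map_add _ _ _)).cls_eq

theorem kc_withConnection [Finite G] (hβ : IsNormalizedCocycle β) {W : PreBundle X}
    {A : Matrix W.ι W.ι (Form X)} (h : IsBundle β W) (hA : IsBundle β (W.withConnection A))
    (η : OddClass β X) :
    kc β (W.withConnection A) η = kc β W (η + (W.interpolate A).cs β) :=
  kc_change hβ h hA hA (PreBundle.Iso.refl hA) η

theorem kc_iso [Finite G] (hβ : IsNormalizedCocycle β) {W W' : PreBundle X} (h : IsBundle β W)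
    (h' : IsBundle β W') (hi : W.Iso W') (η : OddClass β X) : kc β W' η = kc β W η := by
  have hA : IsBundle β (W.withConnection W.A) := h
  rw [kc_change hβ h h' hA hi, PreBundle.interpolate_self, h.isSC.cs_proj, add_zero]

theorem kc_sum {W W' : PreBundle X} (h : IsBundle β W) (h' : IsBundle β W') (η η' : OddClass β X) :
    kc β (W.sum W') (η + η') = kc β W η + kc β W' η' := by
  rw [kc_eq h, kc_eq h', kc_eq (h.sum h'), ← KGen.cls_sum, map_add]
  rfl

theorem kc_flip {W : PreBundle X} (h : IsBundle β W) (η : OddClass β X) :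
    kc β W η + kc β W.flip (-η) = 0 := by
  rw [kc_eq h, kc_eq h.flip, map_neg]
  exact KGen.cls_flip ⟨⟨W, h⟩, toInv β X η⟩

open Classical in
/-- The class in differential K-theory of a bundle with superconnection and a class of odd
sections. -/
def sk (β : G → G → Circle) (V : PreBundle X) (η : OddClass β X) : KHat β X :=
  if h : ∃ A, IsBundle β (V.withConnection A) then
    kc β (V.withConnection h.choose) (η - (V.interpolate h.choose).cs β) else 0

section

variable {V V' : PreBundle X}

theorem sk_eq [Finite G] (hβ : IsNormalizedCocycle β) (h : IsSC β V) {A : Matrix V.ι V.ι (Form X)}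
    (hA : IsBundle β (V.withConnection A)) (η : OddClass β X) :
    sk β V η = kc β (V.withConnection A) (η - (V.interpolate A).cs β) := by
  have hex : ∃ A, IsBundle β (V.withConnection A) := ⟨A, hA⟩
  have hC := hex.choose_spec
  rw [sk, dif_pos hex]
  generalize hex.choose = C at hC ⊢
  have hU : IsSC β ((V.pull X.proj).withConnection (lerp V.A A)) := by
    rw [← PreBundle.interpolate_eq]; exact h.interpolate hA.isSC
  have k := hU.cs_triangle hβ hC.isSC
  have k' : (V.interpolate C).cs β = (V.interpolate A).cs β +
      ((V.withConnection A).interpolate C).cs β := by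
    have p0 := PreBundle.interpolate_congr (par := V.par) (e := V.e) (ρ := V.ρ) (A := C) rfl
      (fun _ => rfl) (lerp_incl_zero V.A A) rfl
    have p1 := PreBundle.interpolate_congr (par := V.par) (e := V.e) (ρ := V.ρ) (A := C) rfl
      (fun _ => rfl) (lerp_incl_one V.A A) rfl
    rw [PreBundle.interpolate_eq V A]
    exact (congrArg (PreBundle.cs β) p0).symm.trans (k.trans (congrArg _ (congrArg _ p1)))
  have := kc_withConnection hβ (W := V.withConnection A) (A := C) hA hC
    (η - (V.interpolate C).cs β)
  refine this.trans ?_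
  rw [k']
  congr 1
  abel

theorem IsSC.exists_isBundle' [Finite G] (hβ : IsNormalizedCocycle β) {B : Matrix V.ι V.ι (Form X)}
    (h : IsSC β (V.withConnection B)) : ∃ A, IsBundle β (V.withConnection A) :=
  h.exists_isBundle hβ

theorem sk_withConnection [Finite G] (hβ : IsNormalizedCocycle β) {A B : Matrix V.ι V.ι (Form X)}
    (h : IsSC β (V.withConnection B)) (hA : IsBundle β (V.withConnection A)) (η : OddClass β X) :
    sk β (V.withConnection B) η = kc β (V.withConnection A)
      (η - ((V.withConnection B).interpolate A).cs β) :=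
  sk_eq hβ h (A := A) hA η

theorem IsBundle.sk_eq [Finite G] (hβ : IsNormalizedCocycle β) (h : IsBundle β V) (η : OddClass β X) :
    sk β V η = kc β V η := by
  rw [TwistedK.sk_eq hβ h.isSC (A := V.A) h, PreBundle.interpolate_self, h.isSC.cs_proj, sub_zero]
  rfl

theorem sk_sum [Finite G] (hβ : IsNormalizedCocycle β) (h : IsSC β V) (h' : IsSC β V') (η η' : OddClass β X) :
    sk β (V.sum V') (η + η') = sk β V η + sk β V' η' := by
  obtain ⟨A, hA⟩ := h.exists_isBundle hβ
  obtain ⟨A', hA'⟩ := h'.exists_isBundle hβ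
  rw [sk_eq hβ h hA, sk_eq hβ h' hA', sk_eq hβ (IsSC.sum hβ h h').1
    (A := fromBlocks A 0 0 A') (hA.sum hA'), ← kc_sum hA hA',
    h.cs_interpolate_sum hβ h' hA.isSC hA'.isSC, add_sub_add_comm]
  rfl

/-- A superconnection over the cylinder on a bundle that does not depend on the parameter
compares the classes of its ends. -/
theorem sk_const [Finite G] (hβ : IsNormalizedCocycle β) {M : Matrix V.ι V.ι (Form X.cyl)}
    {B₀ B₁ : Matrix V.ι V.ι (Form X)} (h₀ : M.map (fpull (X.incl 0)) = B₀)
    (h₁ : M.map (fpull (X.incl 1)) = B₁)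
    (hU : IsSC β ((V.pull X.proj).withConnection M)) (η : OddClass β X) :
    sk β (V.withConnection B₁) η = sk β (V.withConnection B₀)
      (η + ((V.pull X.proj).withConnection M).cs β) := by
  have hl : ∀ l, IsSC β (V.withConnection (M.map (fpull (X.incl l)))) := fun l => by
    rw [← PreBundle.withConnection_pull_incl]; exact hU.pull (X.incl l) (incl_act l)
  subst h₀ h₁
  obtain ⟨A, hA'⟩ : ∃ A, IsBundle β (V.withConnection A) := (hl 0).exists_isBundle' hβ
  have k := hU.cs_triangle hβ hA'.isSC
  refine (sk_withConnection hβ (hl 1) hA' η).trans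
    (Eq.trans ?_ (sk_withConnection hβ (hl 0) hA' _).symm)
  exact congrArg (kc β (V.withConnection A)) (sub_eq_of_eq_add _ k)

end

end KClasses

end

section

section Invariance

variable {G : Type v} [Group G] {X Y Z : GMfd.{u} G} {β : G → G → Circle} {m n o : Type}

/-! ### Interpolation of matrices -/

theorem lerp_mul_proj [Fintype n] (M N : Matrix m n (Form X)) (P : Matrix n o (Form X)) :
    lerp M N * P.map (pull X.proj) = lerp (M * P) (N * P) := by
  unfold lerp comb
  rw [madd_mul, msub_mul, fs_mul, fs_mul, mpull_mul, mpull_mul]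

theorem proj_mul_lerp [Fintype n] (P : Matrix m n (Form X)) (M N : Matrix n o (Form X)) :
    P.map (pull X.proj) * lerp M N = lerp (P * M) (P * N) := by
  unfold lerp comb
  rw [mmul_add, mmul_sub, mul_fs hasDegree_hgt, mul_fs hasDegree_hgt, mpull_mul,
    mpull_mul]

theorem lerp_dz (M N : Matrix m n (Form X)) : (lerp M N).map dz = lerp (M.map dz) (N.map dz) := by
  refine Matrix.ext fun i j => ?_
  simp only [lerp, comb, fs, mmap_apply, madd_apply, Matrix.sub_apply, map_add, map_sub,
    map_mul, dz_pull, dz_of_hasDegree (hasDegree_hgt (X := X))]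

instance MSmooth.lerp (M N : Matrix m n (Form X)) [MSmooth M] [MSmooth N] : MSmooth (lerp M N) := by
  have h1 := fs_smooth (isSmooth_hgt (X := X)) (M.map (fpull X.proj))
  have h2 := fs_smooth (isSmooth_hgt (X := X)) (N.map (fpull X.proj))
  exact inferInstanceAs (MSmooth (M.map (fpull X.proj) - fs (hgt X) (M.map (fpull X.proj)) +
    fs (hgt X) (N.map (fpull X.proj))))

theorem lerp_isPar {a : Bool} {p : m → Bool} {q : n → Bool} {M N : Matrix m n (Form X)}
    (hM : IsPar a p q M) (hN : IsPar a p q N) : IsPar a p q (lerp M N) :=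
  ((hM.pull X.proj).sub (fs_isPar hasDegree_hgt (hM.pull X.proj))).add
    (fs_isPar hasDegree_hgt (hN.pull X.proj))

theorem MIso.dz [Fintype m] [Fintype n] {p : m → Bool} {e : Matrix m m (Form X)} {q : n → Bool}
    {e' : Matrix n n (Form X)} {a : Matrix n m (Form X)} {b : Matrix m n (Form X)}
    (h : MIso p e q e' a b) (he : IsGradedMatrix 0 p p e) (he' : IsGradedMatrix 0 q q e') :
    MIso p e q e' (a.map dz) (b.map dz) := by
  have := h.a_smooth; have := h.b_smooth
  refine ⟨inferInstance, inferInstance, (isGradedMatrix_dz a h.a_even).isPar_even,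
    (isGradedMatrix_dz b h.b_even).isPar_even, ?_, ?_, ?_, ?_, ?_, ?_⟩
  · conv_lhs => rw [← he'.dz, ← mdz_mul, h.e_a]
  · conv_lhs => rw [← he.dz, ← mdz_mul, h.a_e]
  · conv_lhs => rw [← he.dz, ← mdz_mul, h.e_b]
  · conv_lhs => rw [← he'.dz, ← mdz_mul, h.b_e]
  · rw [← mdz_mul, h.ab, he'.dz]
  · rw [← mdz_mul, h.ba, he.dz]

theorem MIso.right_unique [Fintype m] [Fintype n] {p : m → Bool} {e : Matrix m m (Form X)}
    {q : n → Bool} {e' : Matrix n n (Form X)} {a : Matrix n m (Form X)} {b b' : Matrix m n (Form X)}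
    (h : MIso p e q e' a b) (h' : MIso p e q e' a b') : b = b' := by
  rw [← h.b_e, ← h'.ab, ← massoc, h.ba, h'.e_b]

/-! ### Invariance of the classes in differential K-theory under isomorphism -/

theorem PreBundle.mk_A_eq {ι : Type} [Fintype ι] [DecidableEq ι] {par : ι → Bool}
    {e e' : Matrix ι ι (Form X)} {ρ ρ' : G → Matrix ι ι (Form X)} {A A' : Matrix ι ι (Form X)}
    (h : (PreBundle.mk ι par e ρ A : PreBundle X) = PreBundle.mk ι par e' ρ' A') : A = A' := by
  injection h

section

variable [Fintype m] [DecidableEq m] {V : PreBundle X} {p : m → Bool} {e : Matrix m m (Form X)}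
  {ρ : G → Matrix m m (Form X)} {a : Matrix V.ι m (Form X)} {b : Matrix m V.ι (Form X)}

theorem PreBundle.conj_A_congr {ι : Type} [Fintype ι] [DecidableEq ι] {par : ι → Bool}
    {e₀ : Matrix ι ι (Form X)} {ρ₀ : G → Matrix ι ι (Form X)} {A A' : Matrix ι ι (Form X)}
    {a : Matrix ι m (Form X)} {b : Matrix m ι (Form X)} (h : A = A') :
    ((PreBundle.mk ι par e₀ ρ₀ A : PreBundle X).conj p e ρ a b).A =
      ((PreBundle.mk ι par e₀ ρ₀ A' : PreBundle X).conj p e ρ a b).A := by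
  rw [h]

theorem PreBundle.conj_interpolate (A : Matrix V.ι V.ι (Form X)) (he : MSmooth e) (hb : MSmooth b)
    (hV : MSmooth V.e) (hbs : 𝐬b = b) :
    (V.conj p e ρ a b).interpolate ((V.withConnection A).conj p e ρ a b).A =
      (V.interpolate A).conj p (e.map (fpull X.proj))
        (fun g => (ρ g).map (fpull X.proj)) (a.map (fpull X.proj))
        (b.map (fpull X.proj)) := by
  have h1 : ∀ A', ((V.withConnection A').conj p e ρ a b).A.map (fpull X.proj) =
      (((V.pull X.proj).withConnection (A'.map (fpull X.proj))).conj p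
        (e.map (fpull X.proj)) (fun g => (ρ g).map (fpull X.proj))
        (a.map (fpull X.proj)) (b.map (fpull X.proj))).A := fun A' =>
    PreBundle.mk_A_eq (PreBundle.conj_pull (V.withConnection A') p ρ X.proj he hb hV)
  have h2 : 𝐬(b.map (fpull X.proj)) = b.map (fpull X.proj) := by
    rw [s_pull, hbs]
  have h3 := PreBundle.conj_comb (V := V.pull X.proj) (p := p) (e := e.map (fpull X.proj))
    (ρ := fun g => (ρ g).map (fpull X.proj)) (a := a.map (fpull X.proj))
    (hasDegree_hgt (X := X)) h2 (V.A.map (fpull X.proj)) (A.map (fpull X.proj))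
  rw [← h1, ← h1] at h3
  refine (PreBundle.interpolate_eq _ _).trans
    (PreBundle.mk_congr rfl (fun _ => rfl) (h3.trans (PreBundle.conj_A_congr ?_)))
  exact (PreBundle.mk_A_eq (V.interpolate_eq A)).symm

theorem sk_conj [Finite G] (hβ : IsNormalizedCocycle β) (h : IsSC β V)
    (hab : MIso p e V.par V.e a b) (he : IsGradedMatrix 0 p p e)
    (ha : IsGradedMatrix 0 V.par p a) (hb : IsGradedMatrix 0 p V.par b)
    (hρ : ∀ g, IsGradedMatrix 0 p p (ρ g))
    (hρa : ∀ g, ρ g = b⋆g * V.ρ g * a) (η : OddClass β X) :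
    sk β (V.conj p e ρ a b) η = sk β V η := by
  obtain ⟨A, hA⟩ := h.exists_isBundle hβ
  have hW := (h.conj hβ hab he hρ hρa).1
  have hWA : IsBundle β ((V.withConnection A).conj p e ρ a b) :=
    (hA.isSC.conj hβ hab he hρ hρa).1.isBundle (hA.conj_graded he ha hb)
  have hcs : ((V.conj p e ρ a b).interpolate ((V.withConnection A).conj p e ρ a b).A).cs β =
      (V.interpolate A).cs β := by
    have hI := h.interpolate hA.isSC
    have hab' := hab.pull X.proj
    have := hI.conj hβ hab' (he.pull X.proj) (fun g => (hρ g).pull X.proj)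
      (ρ := fun g => (ρ g).map (fpull X.proj)) fun g => by
        have h1 : (ρ g).map (fpull X.proj) =
            (b⋆g).map (fpull X.proj) *
              (V.ρ g).map (fpull X.proj) * a.map (fpull X.proj) := by
          rw [hρa g, mpull_mul, mpull_mul]
        rw [← mpull_equivariant proj_act] at h1
        exact h1
    rw [PreBundle.conj_interpolate A he.msmooth hb.msmooth h.e_smooth hb.s_even]
    exact this.1.cs_iso hβ hI (this.2 ▸ hI.conj_iso hab')
  rw [sk_eq hβ h hA, sk_eq hβ hW (A := ((V.withConnection A).conj p e ρ a b).A) hWA, hcs]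
  exact (kc_iso hβ hWA hA (hA.conj_bundleIso hab ha hb hρa) _).symm

end

section

variable {V V' : PreBundle X}

theorem IsSC.eq_of_toSRep (h : IsSC β V) (h' : IsSC β V') (he : V.toSRep = V'.toSRep) : V = V' := by
  rw [← h.toPB_toSRep, he, h'.toPB_toSRep]

theorem PreRep.intertwine_zero {D D' : PreRep X} {u : Matrix D'.ι D.ι (Form X)} {g : G}
    (h : D'.R g * u.map src = u.map (tgt g) * D.R g) :
    D'.a g 0 * u = u⋆g * D.a g 0 := by
  have h1 : mbody (D'.R g * u.map src) 0 = D'.a g 0 * u := by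
    rw [mbody_mul, mbody_src]; rfl
  have h2 : mbody (u.map (tgt g) * D.R g) 0 = u⋆g * D.a g 0 := by
    rw [mbody_mul, mbody_tgt]; rfl
  rw [← h1, ← h2, h]

theorem intertwine_ρ {u : Matrix V'.toSRep.ι V.toSRep.ι (Form X)} {g : G}
    (h : V'.toSRep.R g * u.map src = u.map (tgt g) * V.toSRep.R g) :
    V'.ρ g * (show Matrix V'.ι V.ι (Form X) from u) =
      (show Matrix V'.ι V.ι (Form X) from u)⋆g * V.ρ g := by
  have h1 := PreRep.intertwine_zero h
  rw [V.toSRep_a_zero, V'.toSRep_a_zero] at h1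
  exact h1

theorem eq_conj_of_intertwine [Fintype m] [Fintype n] {f : X.carrier → Y.carrier}
    {e : Matrix m m (Form Y)} {ρ : Matrix m m (Form X)} {ρ' : Matrix n n (Form X)}
    {a₀ : Matrix n m (Form X)} {a : Matrix n m (Form Y)} {b : Matrix m n (Form Y)}
    (h : ρ' * a₀ = a.map (pull f) * ρ) (hba : b * a = e) (he : e.map (pull f) * ρ = ρ) :
    ρ = b.map (pull f) * ρ' * a₀ := by
  rw [massoc, h, ← massoc, ← mpull_mul, hba, he]

theorem IsSC.conj_eq (hβ : IsNormalizedCocycle β) (h : IsSC β V) (h' : IsSC β V')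
    {a : Matrix V'.toSRep.ι V.toSRep.ι (Form X)} {b : Matrix V.ι V'.ι (Form X)}
    (hab : MIso V.par V.e V'.par V'.e a b)
    (hR : ∀ g, V'.toSRep.R g * a.map src = a.map (tgt g) * V.toSRep.R g) :
    V'.conj V.par V.e V.ρ a b = V := by
  have hc := h'.conj hβ hab h.e_graded h.ρ_graded fun g => eq_conj_of_intertwine (intertwine_ρ (hR g)) hab.ba (h.e_mul_ρ g)
  exact hc.1.eq_of_toSRep h (hc.2.trans (PreRep.eq_conj (D := V.toSRep) (D' := V'.toSRep)
    (a := a) (b := b) h.isRep_toSRep.adm hab hR).symm)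

end

end Invariance

end

section

section Invariance

variable {G : Type v} [Group G] {X Y Z : GMfd.{u} G} {β : G → G → Circle} {m n o : Type}

section

variable [Fintype m] [DecidableEq m] {p : m → Bool} {e u w : Matrix m m (Form X)}

/-- An automorphism of an idempotent that is the identity in degree zero is connected to
the identity. -/
theorem MIso.exists_lerp (hu : MIso p e p e u w) (he : IsGradedMatrix 0 p p e)
    (hd : u.map TwistedK.dz = e) :
    ∃ b, MIso p (e.map (fpull X.proj)) p (e.map (fpull X.proj)) (lerp e u) b := by
  have := hu.e_smooth; have := hu.a_smooth
  have hi := hu.e_idem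
  obtain ⟨E, hE⟩ : ∃ E, E = e.map (fpull X.proj) := ⟨_, rfl⟩
  have hEi : E * E = E := by rw [hE, ← mpull_mul, hi]
  have hEs : MSmooth E := hE ▸ inferInstance
  have hEp : IsPar false p p E := hE ▸ he.isPar_even.pull X.proj
  have hEd : E.map TwistedK.dz = E := by rw [hE, mdz_pull, he.dz]
  have h1 : lerp e u * E = lerp e u := by rw [hE, lerp_mul_proj, hi, hu.a_e]
  have h2 : E * lerp e u = lerp e u := by rw [hE, proj_mul_lerp, hi, hu.e_a]
  have c1 : (lerp e u + (1 - E)) * E = lerp e u := by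
    rw [madd_mul, h1, msub_mul, hEi, mone_mul, sub_self, add_zero]
  have c2 : E * (lerp e u + (1 - E)) = lerp e u := by
    rw [mmul_add, h2, mmul_sub, hEi, mmul_one, sub_self, add_zero]
  have cp : IsPar false p p (lerp e u + (1 - E)) :=
    (lerp_isPar he.isPar_even hu.a_even).add (IsPar.one.sub hEp)
  have cd : (lerp e u + (1 - E)).map TwistedK.dz = 1 := by
    rw [mdz_add, mdz_sub, mdz_one, lerp_dz, he.dz, hd, hEd, lerp_self, ← hE, add_sub_cancel]
  obtain ⟨ψ, hψs, hψp, hψ1, hψ2⟩ := exists_inverse_of_dz cp cd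
  have := MIso.of_unit cp hψp hEp hEp hEi hEi (c1.trans c2.symm) hψ1 hψ2
  rw [c1] at this
  exact ⟨ψ * E, hE ▸ this⟩

end

theorem PreBundle.conj_congr [Fintype m] [DecidableEq m] {p : m → Bool} {ι : Type} [Fintype ι]
    [DecidableEq ι] {par : ι → Bool} {e₀ e₀' : Matrix ι ι (Form X)}
    {ρ₀ ρ₀' : G → Matrix ι ι (Form X)} {A A' : Matrix ι ι (Form X)} {e e' : Matrix m m (Form X)}
    {ρ ρ' : G → Matrix m m (Form X)} {a : Matrix ι m (Form X)} {b : Matrix m ι (Form X)}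
    (h₀ : e₀ = e₀') (hρ₀ : ∀ g, ρ₀ g = ρ₀' g) (hA : A = A') (he : e = e') (hρ : ∀ g, ρ g = ρ' g) :
    (PreBundle.mk ι par e₀ ρ₀ A : PreBundle X).conj p e ρ a b =
      (PreBundle.mk ι par e₀' ρ₀' A' : PreBundle X).conj p e' ρ' a b := by
  obtain rfl : ρ₀ = ρ₀' := funext hρ₀
  obtain rfl : ρ = ρ' := funext hρ
  subst h₀ hA he
  rfl

theorem PreBundle.conj_congr' [Fintype m] [DecidableEq m] {V : PreBundle X} {p : m → Bool}
    {e : Matrix m m (Form X)} {ρ : G → Matrix m m (Form X)} {a a' : Matrix V.ι m (Form X)}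
    {b b' : Matrix m V.ι (Form X)} (ha : a = a') (hb : b = b') :
    V.conj p e ρ a b = V.conj p e ρ a' b' := by
  rw [ha, hb]

theorem PreBundle.conj_proj_incl [Fintype m] [DecidableEq m] (W : PreBundle X) (hW : MSmooth W.e)
    {p : m → Bool} {e : Matrix m m (Form X)} (he : MSmooth e) (ρ : G → Matrix m m (Form X))
    (a : Matrix W.ι m (Form X.cyl)) (b : Matrix m W.ι (Form X.cyl)) (hb : MSmooth b) (l : ℝ) :
    ((W.pull X.proj).conj p (e.map (fpull X.proj))
      (fun g => (ρ g).map (fpull X.proj)) a b).pull (X.incl l) =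
      W.conj p e ρ (a.map (fpull (X.incl l))) (b.map (fpull (X.incl l))) := by
  have h1 : MSmooth (W.pull X.proj).e :=
    inferInstanceAs (MSmooth (W.e.map (fpull X.proj)))
  have h2 : MSmooth (e.map (fpull X.proj)) := inferInstance
  exact (PreBundle.conj_pull (W.pull X.proj) p _ (X.incl l) h2 hb h1).trans
    (PreBundle.conj_congr (mpull_incl_proj l _) (fun _ => mpull_incl_proj l _)
      (mpull_incl_proj l _) (mpull_incl_proj l _) (fun _ => mpull_incl_proj l _))

theorem PreRep.Adm.intertwine {D : PreRep X} (h : D.Adm) (g : G) :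
    D.R g * D.e.map src = D.e.map (tgt g) * D.R g := (h.R_src g).trans (h.tgt_R g).symm

section

variable {V V' : PreBundle X}

theorem IsSC.conj_refl (hβ : IsNormalizedCocycle β) (h : IsSC β V) :
    V.conj V.par V.e V.ρ V.e V.e = V :=
  h.conj_eq hβ h (a := V.e) (b := V.e) (MIso.refl h.e_smooth h.e_graded.isPar_even h.e_idem)
    h.isRep_toSRep.adm.intertwine

theorem lerp_equivariant (h : IsSC β V) {u : Matrix V.ι V.ι (Form X)} (g : G)
    (hρ : V.ρ g * u = u⋆g * V.ρ g) :
    (V.ρ g).map (fpull X.proj) * lerp V.e u =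
      (lerp V.e u)⋆g * (V.ρ g).map (fpull X.proj) := by
  rw [act_cyl, lerp_cylMap, lerp_mul_proj, proj_mul_lerp, h.ρ_mul_e, h.e_mul_ρ, hρ]

theorem IsSC.conj_cs [Finite G] (hβ : IsNormalizedCocycle β) {V : PreBundle X.cyl} (h : IsSC β V)
    [Fintype m] [DecidableEq m] {p : m → Bool} {e : Matrix m m (Form X.cyl)}
    {ρ : G → Matrix m m (Form X.cyl)} {a : Matrix V.ι m (Form X.cyl)}
    {b : Matrix m V.ι (Form X.cyl)} (h' : IsSC β (V.conj p e ρ a b))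
    (he : (V.conj p e ρ a b).toSRep = V.toSRep.conj p e a b) (hab : MIso p e V.par V.e a b) :
    (V.conj p e ρ a b).cs β = V.cs β := by
  have hi := h.conj_iso hab
  rw [← he] at hi
  exact h'.cs_iso hβ h hi

theorem sk_const_of_eq [Finite G] (hβ : IsNormalizedCocycle β) {W₀ W₁ : PreBundle X}
    {M : Matrix V.ι V.ι (Form X.cyl)} (hU : IsSC β ((V.pull X.proj).withConnection M))
    (h₀ : ((V.pull X.proj).withConnection M).pull (X.incl 0) = W₀)
    (h₁ : ((V.pull X.proj).withConnection M).pull (X.incl 1) = W₁) (η : OddClass β X) :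
    sk β W₁ η = sk β W₀ (η + ((V.pull X.proj).withConnection M).cs β) := by
  subst h₀ h₁
  rw [PreBundle.withConnection_pull_incl, PreBundle.withConnection_pull_incl]
  exact sk_const hβ rfl rfl hU η

theorem sk_of_conj_proj [Finite G] (hβ : IsNormalizedCocycle β) {W₀ W₁ : PreBundle X}
    {P : PreBundle X.cyl} (hP : V.pull X.proj = P) {ξ : OddClass β X}
    {A : Matrix P.ι P.ι (Form X.cyl)}
    (hU : IsSC β (P.withConnection A))
    (h₀ : (P.withConnection A).pull (X.incl 0) = W₀)
    (h₁ : (P.withConnection A).pull (X.incl 1) = W₁)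
    (hcs : (P.withConnection A).cs β = ξ) (η : OddClass β X) :
    sk β W₁ η = sk β W₀ (η + ξ) := by
  subst hP hcs
  have := sk_const_of_eq (V := V) (M := A) hβ hU h₀ h₁ η
  exact this

/-- The class in differential K-theory does not change under an automorphism of the bundle that
is the identity in degree zero. -/
theorem sk_conj_of_dz_eq [Finite G] (hβ : IsNormalizedCocycle β) (h : IsSC β V)
    {u w : Matrix V.ι V.ι (Form X)} (hu : MIso V.par V.e V.par V.e u w) (hd : u.map dz = V.e)
    (hρ : ∀ g, V.ρ g * u = u⋆g * V.ρ g) (η : OddClass β X) :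
    sk β (V.conj V.par V.e V.ρ u w) η = sk β V η := by
  obtain ⟨b, hb⟩ := hu.exists_lerp h.e_graded hd
  have hP := h.pull X.proj proj_act
  have hρa : ∀ g, (V.ρ g).map (fpull X.proj) = b⋆g *
      (V.ρ g).map (fpull X.proj) * lerp V.e u := fun g =>
    eq_conj_of_intertwine (lerp_equivariant h g (hρ g)) hb.ba (hP.e_mul_ρ g)
  have hU := hP.conj hβ (p := V.par) (e := V.e.map (fpull X.proj))
    (ρ := fun g => (V.ρ g).map (fpull X.proj)) hb (h.e_graded.pull X.proj)
    (fun g => (h.ρ_graded g).pull X.proj) hρa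
  have hr := fun l => V.conj_proj_incl h.e_smooth h.e_smooth V.ρ (p := V.par) (lerp V.e u) b
    hb.b_smooth l
  have b0 := hb.pull (X.incl 0)
  have b1 := hb.pull (X.incl 1)
  rw [mpull_incl_proj, lerp_incl_zero] at b0
  rw [mpull_incl_proj, lerp_incl_one] at b1
  have hcs := (hP.conj_cs hβ hU.1 hU.2 hb).trans h.cs_proj
  have e0 := (hr 0).trans (PreBundle.conj_congr' (lerp_incl_zero V.e u)
    (b0.right_unique (MIso.refl h.e_smooth h.e_graded.isPar_even h.e_idem)))
  have e1 := (hr 1).trans (PreBundle.conj_congr' (lerp_incl_one V.e u) (b1.right_unique hu))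
  have k := sk_of_conj_proj (V := V) (P := V.pull X.proj) hβ rfl
    (A := ((V.pull X.proj).conj V.par (V.e.map (fpull X.proj))
      (fun g => (V.ρ g).map (fpull X.proj)) (lerp V.e u) b).A)
    hU.1 (e0.trans (h.conj_refl hβ)) e1 hcs η
  rwa [add_zero] at k

theorem PreBundle.conj_conj [Fintype m] [DecidableEq m] {o : Type} [Fintype o] [DecidableEq o]
    {p : m → Bool} {e : Matrix m m (Form X)} {ρ : G → Matrix m m (Form X)} {a : Matrix V.ι m (Form X)}
    {b : Matrix m V.ι (Form X)} (hab : MIso p e V.par V.e a b) {q : o → Bool}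
    {e' : Matrix o o (Form X)} {ρ' : G → Matrix o o (Form X)} {a' : Matrix m o (Form X)}
    {b' : Matrix o m (Form X)} (hab' : MIso q e' p e a' b') :
    (V.conj p e ρ a b).conj q e' ρ' a' b' = V.conj q e' ρ' (a * a') (b' * b) := by
  have := hab.b_smooth; have := hab'.b_smooth
  refine PreBundle.mk_congr rfl (fun _ => rfl) ?_
  suffices 𝐝e' * e' - (𝐝b' * e * a' + 𝐬b' * (𝐝e * e -
      (𝐝e * e - (𝐝b * V.e * a + 𝐬b * V.B * a))) * a') =
      𝐝e' * e' - (𝐝(b' * b) * V.e * (a * a') + 𝐬(b' * b) * V.B * (a * a')) from this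
  have h1 : 𝐝b' * b * V.e * (a * a') = 𝐝b' * e * a' := by
    rw [massoc (𝐝b'), hab.b_e, massoc, ← massoc b, hab.ba,
      ← massoc]
  rw [d_mul, s_mul, madd_mul, madd_mul, h1, sub_sub_cancel]
  simp only [mmul_add, madd_mul, massoc]
  abel

theorem sk_eq_of_conj_eq [Finite G] (hβ : IsNormalizedCocycle β) (h : IsSC β V) (h' : IsSC β V')
    {a : Matrix V'.ι V.ι (Form X)} {b : Matrix V.ι V'.ι (Form X)}
    (hab : MIso V.par V.e V'.par V'.e a b)
    (hρ : ∀ g, V'.ρ g * a = a⋆g * V.ρ g)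
    (hV : V'.conj V.par V.e V.ρ a b = V) (η : OddClass β X) : sk β V η = sk β V' η := by
  have h0 := hab.dz h.e_graded h'.e_graded
  have := hab.a_smooth; have := hab.b_smooth
  have g0 := isGradedMatrix_dz a hab.a_even
  have g1 := isGradedMatrix_dz b hab.b_even
  obtain ⟨a₀, ha₀⟩ : ∃ a₀, a₀ = a.map dz := ⟨_, rfl⟩
  obtain ⟨b₀, hb₀⟩ : ∃ b₀, b₀ = b.map dz := ⟨_, rfl⟩
  rw [← ha₀, ← hb₀] at h0
  rw [← ha₀] at g0
  rw [← hb₀] at g1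
  have hρ₀ : ∀ g, V'.ρ g * a₀ = a₀⋆g * V.ρ g := fun g => by
    have h1 := congrArg (Matrix.map · dz) (hρ g)
    simp only [mdz_mul, mdz_pull, (h.ρ_graded g).dz, (h'.ρ_graded g).dz] at h1
    rw [ha₀, h1]
  have hρa := fun g => eq_conj_of_intertwine (hρ₀ g) h0.ba (h.e_mul_ρ g)
  have hW := (h'.conj hβ h0 h.e_graded h.ρ_graded hρa).1
  have hu : MIso V.par V.e V.par V.e (b₀ * a) (b * a₀) := hab.trans h0.symm
  have hud : (b₀ * a).map dz = V.e := by rw [mdz_mul, g1.dz, ← ha₀, h0.ba]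
  have hρu : ∀ g, V.ρ g * (b₀ * a) = (b₀ * a)⋆g * V.ρ g := fun g => by
    rw [hρa g, massoc, ← massoc a₀, h0.ab, hab.e_a, massoc, hρ,
      ← massoc, ← mpull_mul, ← hρa]
  have k1 := sk_conj hβ h' h0 h.e_graded g0 g1 h.ρ_graded hρa η
  have k2 := sk_conj_of_dz_eq hβ (V := V'.conj V.par V.e V.ρ a₀ b₀) hW hu hud hρu η
  have k3 : (V'.conj V.par V.e V.ρ a₀ b₀).conj V.par V.e V.ρ (b₀ * a) (b * a₀) = V := by
    rw [PreBundle.conj_conj h0 hu, ← massoc, h0.ab, hab.e_a, massoc, h0.ab,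
      hab.b_e, hV]
  exact (congrArg (fun W => sk β W η) k3).symm.trans (k2.trans k1)

theorem sk_iso [Finite G] (hβ : IsNormalizedCocycle β) (h : IsSC β V) (h' : IsSC β V')
    (hi : V.toSRep.Iso V'.toSRep) (η : OddClass β X) : sk β V η = sk β V' η := by
  obtain ⟨a, b, hab, hR⟩ := (PreRep.iso_iff h.isRep_toSRep.adm h'.isRep_toSRep.adm).1 hi
  exact sk_eq_of_conj_eq (V := V) (V' := V') hβ h h' (a := a) (b := b) hab
    (fun g => intertwine_ρ (hR g)) (h.conj_eq hβ h' (a := a) (b := b) hab hR) η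

end

end Invariance

end

section

section Inverse

variable {G : Type v} [Group G] {X Y : GMfd.{u} G} {m : Type}

theorem fnForm_of_degree_zero {α : Form X} (h : HasDegree 0 α) :
    fnForm (fun x => Ext.aug (α x)) = α := dz_of_hasDegree h

/-- The ring of smooth complex functions. -/
def smoothFn (X : GMfd.{u} G) : Subring (X.carrier → ℂ) where
  carrier := {f | IsSmooth (fnForm f)}
  mul_mem' {f g} hf hg := by
    have : fnForm (f * g) = fnForm f * fnForm g := funext fun x => map_mul _ _ _
    show IsSmooth (fnForm (f * g)); rw [this]; exact hf.mul hg
  one_mem' := isSmooth_fnForm contMDiff_const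
  add_mem' {f g} hf hg := by
    have : fnForm (f + g) = fnForm f + fnForm g := funext fun x => map_add _ _ _
    show IsSmooth (fnForm (f + g)); rw [this]; exact hf.add hg
  zero_mem' := isSmooth_fnForm contMDiff_const
  neg_mem' {f} hf := by
    have : fnForm (-f) = -fnForm f := funext fun x => map_neg _ _
    show IsSmooth (fnForm (-f)); rw [this]; exact hf.neg

/-- Smooth functions as forms of degree zero. -/
def smoothFnHom (X : GMfd.{u} G) : smoothFn X →+* Form X where
  toFun f := fnForm f.1
  map_one' := funext fun _ => map_one _
  map_mul' _ _ := funext fun _ => map_mul _ _ _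
  map_zero' := funext fun _ => map_zero _
  map_add' _ _ := funext fun _ => map_add _ _ _

theorem continuous_smoothFn (f : smoothFn X) : Continuous f.1 :=
  continuous_iff_continuousAt.2 fun x => by
    have h := ((isSmooth_fnForm_iff.1 f.2 x).continuousOn.continuousAt
      ((isOpen_extChartAt_target x).mem_nhds (mem_extChartAt_target x))).comp
      (continuousAt_extChartAt (I := X.I) x)
    refine h.congr ?_
    filter_upwards [extChartAt_source_mem_nhds (I := X.I) x] with y hy
    exact congrArg f.1 ((extChartAt X.I x).left_inv hy)

/-- The matrix of functions underlying a matrix of forms of degree zero. -/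
def IsGradedMatrix.fn {p : m → Bool} {M : Matrix m m (Form X)} (h : IsGradedMatrix 0 p p M) :
    Matrix m m (smoothFn X) := Matrix.of fun i j =>
  ⟨fun x => Ext.aug (M i j x), by
    show IsSmooth _
    rw [fnForm_of_degree_zero (h i j).2.1]; exact (h i j).1⟩

theorem IsGradedMatrix.map_fn {p : m → Bool} {M : Matrix m m (Form X)}
    (h : IsGradedMatrix 0 p p M) : h.fn.map (smoothFnHom X) = M :=
  Matrix.ext fun i j => fnForm_of_degree_zero (h i j).2.1

variable [Fintype m] [DecidableEq m]

theorem IsGradedMatrix.det_fn {p : m → Bool} {M : Matrix m m (Form X)}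
    (h : IsGradedMatrix 0 p p M) (x : X.carrier) :
    h.fn.det.1 x = (Matrix.of fun i j => Ext.aug (M i j x)).det :=
  RingHom.map_det ((Pi.evalRingHom (fun _ => ℂ) x).comp (smoothFn X).subtype) h.fn

theorem exists_inverse_of_det {p : m → Bool} {M : Matrix m m (Form X)} (h : IsGradedMatrix 0 p p M)
    (hd : ∀ x, h.fn.det.1 x ≠ 0) :
    ∃ N, MSmooth N ∧ IsPar false p p N ∧ M * N = 1 ∧ N * M = 1 := by
  have hs : IsSmooth (fnForm fun x => (h.fn.det.1 x)⁻¹) := isSmooth_fnForm_iff.2 fun x₀ =>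
    (isSmooth_fnForm_iff.1 h.fn.det.2 x₀).inv fun y _ => hd _
  have hu : IsUnit h.fn.det := IsUnit.of_mul_eq_one (⟨_, hs⟩ : smoothFn X)
    (Subtype.ext (funext fun x => mul_inv_cancel₀ (hd x)))
  have h1 := congrArg (Matrix.map · (smoothFnHom X)) (Matrix.mul_nonsing_inv _ hu)
  have h2 := congrArg (Matrix.map · (smoothFnHom X)) (Matrix.nonsing_inv_mul _ hu)
  simp only [mmap_mul, h.map_fn, mmap_one _ (map_zero _) (map_one _)] at h1 h2
  obtain ⟨N, hN⟩ : ∃ N, N = h.fn⁻¹.map (smoothFnHom X) := ⟨_, rfl⟩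
  rw [← hN] at h1 h2
  have hN0 : ∀ i j, sinv (N i j) = N i j := fun i j => by
    rw [hN]
    exact ((hasDegree_fnForm _).sinv_eq).trans (by rw [pow_zero, one_mul]; rfl)
  refine ⟨N, ⟨fun i j => by rw [hN]; exact (h.fn⁻¹ i j).2⟩, fun i j => ?_, h1, h2⟩
  obtain ⟨D, hD⟩ : ∃ D : Matrix m m (Form X), D = Matrix.diagonal fun i => ((sg (p i) : ℤ) : Form X) :=
    ⟨_, rfl⟩
  have hDM : D * M = M * D := by
    refine Matrix.ext fun i j => ?_
    rw [hD, Matrix.diagonal_mul, Matrix.mul_diagonal]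
    by_cases hij : p i = p j
    · rw [hij, Int.cast_comm]
    · rw [(h i j).2.2 hij, mul_zero, zero_mul]
  have hDN : D * N = N * D := by
    have : N * (D * M) * N = N * (M * D) * N := by rw [hDM]
    rwa [← massoc N M, h2, mone_mul, massoc, massoc, h1,
      mmul_one, eq_comm] at this
  have hij := congrFun (congrFun hDN i) j
  rw [hD, Matrix.diagonal_mul, Matrix.mul_diagonal, ← Int.cast_comm, ← zsmul_eq_mul,
    ← zsmul_eq_mul] at hij
  rw [hN0, Bool.false_xor, sg_xor, mul_smul, ← hij, smul_smul, sg_mul_self, one_smul]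

end Inverse

section Homotopy

variable {G : Type v} [Group G] {X Y : GMfd.{u} G} {β : G → G → Circle} {m n : Type}

theorem avg_pull [Fintype G] [Fintype m] [Fintype n] (f : X.carrier → Y.carrier) [SmoothMap X Y f]
    (he : ∀ g x, f (X.act g x) = Y.act g (f x)) (ρ : G → Matrix m m (Form Y))
    (ρ' : G → Matrix n n (Form Y)) (M : Matrix n m (Form Y)) :
    (IsTw.avg β ρ ρ' M).map (pull f) =
      IsTw.avg β (fun g => (ρ g).map (pull f)) (fun g => (ρ' g).map (pull f)) (M.map (pull f)) := by
  simp only [IsTw.avg, twInv, mpull_smul, mpull_sum, mpull_mul, mpull_equivariant he]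

/-- Near a given parameter, a family of bundles is isomorphic to the constant family. -/
theorem exists_trivialization [Finite G] [CompactSpace X.carrier] [Fintype m] [DecidableEq m]
    (hβ : IsNormalizedCocycle β) {p : m → Bool} {e e' : Matrix m m (Form X.cyl)}
    {ρ ρ' : G → Matrix m m (Form X.cyl)} (h : IsTw β p e ρ) (h' : IsTw β p e' ρ')
    (he : IsGradedMatrix 0 p p e) (he' : IsGradedMatrix 0 p p e')
    (hρ : ∀ g, IsGradedMatrix 0 p p (ρ g)) (hρ' : ∀ g, IsGradedMatrix 0 p p (ρ' g)) (l₀ : ℝ)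
    (h0 : e.map (pull (X.incl l₀)) = e'.map (pull (X.incl l₀)))
    (hr0 : ∀ g, (ρ g).map (pull (X.incl l₀)) = (ρ' g).map (pull (X.incl l₀))) :
    ∃ (u : Matrix m m (Form X.cyl)) (hu : IsGradedMatrix 0 p p u), u * e = e' * u ∧
      (∀ g, ρ' g * (u * e) = (u * e)⋆g * ρ g) ∧
      ∀ᶠ l in nhds l₀, ∀ x, hu.fn.det.1 (X.incl l x) ≠ 0 := by
  have := Fintype.ofFinite G
  have := h.e_smooth; have := h'.e_smooth
  obtain ⟨w, hw⟩ : ∃ w, w = IsTw.avg β ρ ρ' (e' * e) := ⟨_, rfl⟩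
  have hws : MSmooth w := hw ▸ IsTw.avg_smooth h h' _
  have hwp : IsPar false p p w := hw ▸ IsTw.avg_even h h' (h'.e_even.mul_ee h.e_even)
  have hwe : w * e = w := hw ▸ IsTw.avg_e h _
  have hew : e' * w = w := hw ▸ IsTw.e_avg h' _
  have hwd : w.map dz = w := by
    rw [hw, IsTw.avg_dz, mdz_mul, he.dz, he'.dz]
    simp only [(hρ _).dz, (hρ' _).dz]
  have hu : IsGradedMatrix 0 p p (w + (1 - e') * (1 - e)) := by
    have h1 := isGradedMatrix_dz (w + (1 - e') * (1 - e))
      (hwp.add ((IsPar.one.sub h'.e_even).mul_ee (IsPar.one.sub h.e_even)))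
    rwa [mdz_add, mdz_mul, mdz_sub, mdz_sub, mdz_one, he.dz, he'.dz, hwd] at h1
  obtain ⟨c1, c2⟩ := add_compl_mul_idem h.e_idem h'.e_idem hwe hew
  have hi := mpull_mul (X.incl l₀) e e
  rw [h.e_idem] at hi
  have hw0 : w.map (pull (X.incl l₀)) = e.map (pull (X.incl l₀)) := by
    rw [hw, avg_pull (X.incl l₀) (fun _ _ => rfl), mpull_mul, ← h0, ← hi]
    simp only [← hr0]
    have hTw : IsTw β p (e.map (pull (X.incl l₀))) fun g => (ρ g).map (pull (X.incl l₀)) := by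
      have := h.ρ_smooth
      refine ⟨inferInstance, h.e_even.pull _, inferInstance, fun g => (h.ρ_even g).pull _,
        hi.symm, fun g => ?_, fun g => ?_, ?_, fun g k => ?_⟩
      · rw [← mpull_mul, h.ρ_e]
      · rw [mpull_equivariant (fun _ _ => rfl), ← mpull_mul, h.e_ρ]
      · rw [h.ρ_one]
      · rw [mpull_equivariant (fun _ _ => rfl), ← mpull_mul, h.ρ_mul, mpull_smul]
    exact IsTw.avg_of_equivariant hTw (fun g => (hTw.ρ_e g).trans (hTw.e_ρ g).symm) hTw.e_idem
  have hu0 : (w + (1 - e') * (1 - e)).map (pull (X.incl l₀)) = 1 := by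
    rw [mpull_add, mpull_mul, mpull_sub, mpull_sub,
      mmap_one _ (map_zero _) (map_one _), ← h0, hw0, msub_mul,
      mmul_sub, mmul_sub, ← hi]
    simp
  refine ⟨_, hu, c1.trans c2.symm, fun g => ?_, ?_⟩
  · rw [c1, hw]; exact IsTw.avg_equivariant h h' hβ _ g
  · have hc := continuous_smoothFn hu.fn.det
    have hdet : ∀ x, hu.fn.det.1 (X.incl l₀ x) = 1 := fun x => by
      rw [hu.det_fn, ← Matrix.det_one (n := m)]
      congr 1
      refine Matrix.ext fun i j => ?_
      have := congrArg Ext.aug (congrFun (congrFun (congrFun hu0 i) j) x)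
      rw [mmap_apply] at this
      refine (Ext.aug_map _ _).symm.trans (this.trans ?_)
      rw [mone_apply, mone_apply]
      split_ifs <;> simp
    have := isCompact_univ.eventually_forall_of_forall_eventually (x₀ := l₀)
      (K := (Set.univ : Set X.carrier)) (P := fun l x => hu.fn.det.1 (X.incl l x) ≠ 0)
      fun x _ => by
        have hc' : Continuous fun z : ℝ × X.carrier => hu.fn.det.1 (X.incl z.1 z.2) :=
          hc.comp (continuous_snd.prodMk continuous_fst)
        exact hc'.continuousAt.eventually_ne (by rw [hdet]; exact one_ne_zero)
    filter_upwards [this] with l hl x using hl x trivial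

/-- The integral of the character of a family of superconnections from one parameter to another. -/
def PreBundle.csOn (β : G → G → Circle) (V : PreBundle X.cyl) (a b : ℝ) : OddClass β X :=
  oc β fun g x => ∫ l in a..b, fiberAt (V.toSRep.character g) x l

theorem IsSC.pull_reparam {V : PreBundle X.cyl} (h : IsSC β V) {χ : ℝ → ℝ} (hχ : ContDiff ℝ ∞ χ) :
    IsSC β (V.pull (reparam X χ)) :=
  have := SmoothMap.reparam (X := X) hχ
  h.pull (reparam X χ) (reparam_act χ)

theorem mpull_reparam_proj {χ : ℝ → ℝ} (hχ : ContDiff ℝ ∞ χ) (M : Matrix m n (Form X)) :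
    (M.map (pull X.proj)).map (pull (reparam X χ)) = M.map (pull X.proj) := by
  have := SmoothMap.reparam (X := X) hχ
  exact (mpull_comp (reparam X χ) X.proj M).symm

section

variable [Finite G] {V : PreBundle X.cyl}

theorem IsSC.isSection_csOn (hβ : IsNormalizedCocycle β) (h : IsSC β V) {χ : ℝ → ℝ}
    (hχ : ContDiff ℝ ∞ χ) :
    IsSection β true (fun g x => ∫ l in (χ 0)..(χ 1), fiberAt (V.toSRep.character g) x l) ∧
      (V.pull (reparam X χ)).cs β = V.csOn β (χ 0) (χ 1) := by
  have := SmoothMap.reparam (X := X) hχ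
  have h1 := (h.pull_reparam hχ).isRep_toSRep.isSection_cs hβ
  have h2 : (fun g => fiberInt ((V.pull (reparam X χ)).toSRep.character g)) =
      fun g x => ∫ l in (χ 0)..(χ 1), fiberAt (V.toSRep.character g) x l := by
    funext g x
    rw [h.pull_toSRep (reparam X χ) (reparam_act χ), PreRep.character_pull]
    exact fiberInt_reparam hχ (h.isRep_toSRep.character_smooth g) x
  exact ⟨h2 ▸ h1, congrArg (oc β) h2⟩

theorem IsSC.csOn_add (hβ : IsNormalizedCocycle β) (h : IsSC β V) (a b c : ℝ) :
    V.csOn β a b + V.csOn β b c = V.csOn β a c := by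
  have hχ : ∀ a b : ℝ, IsSection β true
      (fun g x => ∫ l in a..b, fiberAt (V.toSRep.character g) x l) := fun a b => by
    have := (h.isSection_csOn hβ (χ := fun l => a + l * (b - a)) (by fun_prop)).1
    simpa using this
  rw [PreBundle.csOn, PreBundle.csOn, ← oc_add (hχ a b) (hχ b c)]
  refine congrArg (oc β) (funext fun g => funext fun x => ?_)
  have hc := continuous_fiberAt (h.isRep_toSRep.character_smooth g) x
  exact intervalIntegral.integral_add_adjacent_intervals (hc.intervalIntegrable _ _)
    (hc.intervalIntegrable _ _)

theorem sk_of_trivialization (hβ : IsNormalizedCocycle β) (h : IsSC β V) {W : PreBundle X}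
    {χ : ℝ → ℝ} (hχ : ContDiff ℝ ∞ χ) {P : PreBundle X.cyl} (hP : W.pull X.proj = P)
    (hPs : IsSC β P) {w : Matrix V.ι P.ι (Form X.cyl)} {b : Matrix P.ι V.ι (Form X.cyl)}
    (hb : MIso P.par P.e V.par (V.e.map (pull (reparam X χ))) w b)
    (hρ : ∀ g, (V.ρ g).map (pull (reparam X χ)) * w = w⋆g * P.ρ g)
    (η : OddClass β X) :
    sk β (V.pull (X.incl (χ 1))) η = sk β (V.pull (X.incl (χ 0))) (η + V.csOn β (χ 0) (χ 1)) := by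
  have := SmoothMap.reparam (X := X) hχ
  have h1 := h.pull_reparam hχ
  have hU := h1.conj hβ (p := P.par) (e := P.e) (ρ := P.ρ) hb hPs.e_graded hPs.ρ_graded
    fun g => eq_conj_of_intertwine (hρ g) hb.ba (hPs.e_mul_ρ g)
  have hi := h1.conj_iso hb
  rw [← hU.2] at hi
  have hcs := (h1.conj_cs hβ hU.1 hU.2 hb).trans (h.isSection_csOn hβ hχ).2
  have he : ∀ l ξ, sk β (((V.pull (reparam X χ)).conj P.par P.e P.ρ w b).pull (X.incl l)) ξ =
      sk β (V.pull (X.incl (χ l))) ξ := fun l ξ => by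
    refine sk_iso hβ (hU.1.pull (X.incl l) fun _ _ => rfl) (h.pull (X.incl (χ l)) fun _ _ => rfl)
      ?_ ξ
    have hi' := hi.pull hU.1.isRep_toSRep.adm h1.isRep_toSRep.adm (X.incl l) (incl_act l)
    rw [← hU.1.pull_toSRep _ (incl_act l), ← h1.pull_toSRep _ (incl_act l),
      PreBundle.pull_pull] at hi'
    exact hi'
  have k := sk_of_conj_proj (V := W) (P := P) hβ hP
    (A := ((V.pull (reparam X χ)).conj P.par P.e P.ρ w b).A) hU.1 rfl rfl hcs η
  exact (he 1 η).symm.trans (k.trans (he 0 _))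

theorem IsSC.eventually_sk_eq [CompactSpace X.carrier] (hβ : IsNormalizedCocycle β) (h : IsSC β V)
    (a : ℝ) : ∀ᶠ b in nhds a, ∀ η : OddClass β X,
      sk β (V.pull (X.incl b)) η = sk β (V.pull (X.incl a)) (η + V.csOn β a b) := by
  have hW := h.pull (X.incl a) (incl_act a)
  have hPs := hW.pull X.proj proj_act
  let E : Matrix V.ι V.ι (Form X.cyl) :=
    (V.e.map (fpull (X.incl a))).map (fpull X.proj)
  let ρ : G → Matrix V.ι V.ι (Form X.cyl) := fun g =>
    ((V.ρ g).map (fpull (X.incl a))).map (fpull X.proj)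
  obtain ⟨u, hu, hue, huρ, hdet⟩ := exists_trivialization (m := V.ι) (e := E) (ρ := ρ) hβ hPs.isTw h.isTw
    hPs.e_graded h.e_graded hPs.ρ_graded h.ρ_graded a (mpull_incl_proj a _)
    (fun g => mpull_incl_proj a _)
  have hue : u * E = V.e * u := hue
  have huρ : ∀ g, V.ρ g * (u * E) = (u * E)⋆g * ρ g := huρ
  obtain ⟨ε, hε, hε'⟩ := Metric.eventually_nhds_iff.1 hdet
  filter_upwards [Metric.ball_mem_nhds a hε] with b hb η
  obtain ⟨χ, hχe⟩ : ∃ χ : ℝ → ℝ, χ = fun l => a + (b - a) * Real.sin (Real.pi / 2 * l) ^ 2 :=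
    ⟨_, rfl⟩
  have hχ : ContDiff ℝ ∞ χ := by rw [hχe]; fun_prop
  have h0 : χ 0 = a := by simp [hχe]
  have h1 : χ 1 = b := by simp [hχe]
  have hχa : ∀ l, dist (χ l) a < ε := fun l => by
    refine lt_of_le_of_lt ?_ (Metric.mem_ball.1 hb)
    rw [hχe, Real.dist_eq, Real.dist_eq, add_sub_cancel_left, abs_mul,
      abs_of_nonneg (sq_nonneg (Real.sin _))]
    exact mul_le_of_le_one_right (abs_nonneg _) (Real.sin_sq_le_one _)
  have := SmoothMap.reparam (X := X) hχ
  have hu' := hu.pull (reparam X χ)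
  have hc : ∀ x, hu'.fn.det.1 x ≠ 0 := fun x => by
    have h2 := hε' (hχa x.2) x.1
    exact fun h3 => h2 ((hu.det_fn _).trans ((congrArg Matrix.det (Matrix.ext fun i j =>
      (Ext.aug_map _ _).symm)).trans ((hu'.det_fn x).symm.trans h3)))
  obtain ⟨ψ, hψs, hψp, hψ1, hψ2⟩ := exists_inverse_of_det hu' hc
  have he := hPs.e_graded.msmooth
  have he' := h.e_graded.msmooth
  have := hu'.msmooth
  have hwe : (u * E).map (fpull (reparam X χ)) =
      u.map (fpull (reparam X χ)) * E := by
    rw [mpull_mul]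
    exact congrArg _ (mpull_reparam_proj hχ _)
  have hiso := MIso.of_unit (p := V.par) (e := E)
    (e' := V.e.map (fpull (reparam X χ))) (c := u.map (fpull (reparam X χ))) hu'.isPar_even hψp
    hPs.e_graded.isPar_even (h.e_graded.isPar_even.pull _) hPs.e_idem
    (by rw [← mpull_mul, h.e_idem]) (hwe.symm.trans (by rw [hue, mpull_mul])) hψ1 hψ2
  rw [← hwe] at hiso
  have k := sk_of_trivialization hβ h hχ rfl hPs hiso (fun g => ?_) η
  · rwa [h0, h1] at k
  · have h3 := congrArg (Matrix.map · (fpull (reparam X χ))) (huρ g)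
    simp only [mpull_mul (reparam X χ) (V.ρ g), mpull_mul (reparam X χ) (Matrix.map _ _),
      ← mpull_equivariant (reparam_act χ)] at h3
    exact h3.trans (congrArg _ (mpull_reparam_proj hχ _))

theorem IsSC.sk_homotopy [CompactSpace X.carrier] (hβ : IsNormalizedCocycle β) (h : IsSC β V)
    (η : OddClass β X) :
    sk β (V.pull (X.incl 1)) η = sk β (V.pull (X.incl 0)) (η + V.cs β) := by
  have hs : V.cs β = V.csOn β 0 1 := rfl
  have hz : ∀ a, V.csOn β a a = 0 := fun a => by
    simpa using h.csOn_add hβ a a a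
  rw [hs]
  refine PreconnectedSpace.induction₂' (fun a b => ∀ η : OddClass β X,
    sk β (V.pull (X.incl b)) η = sk β (V.pull (X.incl a)) (η + V.csOn β a b)) (fun a => ?_)
    ⟨fun a b c hab hbc η => ?_⟩ 0 1 η
  · filter_upwards [h.eventually_sk_eq hβ a] with b hb
    refine ⟨hb, fun η => ?_⟩
    rw [hb, add_assoc, h.csOn_add hβ b a b, hz, add_zero]
  · rw [hbc, hab, add_assoc, add_comm (V.csOn β b c), h.csOn_add hβ]

end

end Homotopy

end

section

section Sums

variable {G : Type v} [Group G] {X Y Z : GMfd.{u} G} {β : G → G → Circle}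

theorem PreRep.mk_congr {ι : Type} [Fintype ι] [DecidableEq ι] {par : ι → Bool}
    {e e' : Matrix ι ι (Form X)} {R R' : G → Matrix ι ι (OddExt (Fam X))} (he : e = e')
    (hR : ∀ g, R g = R' g) : (PreRep.mk ι par e R : PreRep X) = PreRep.mk ι par e' R' := by
  obtain rfl : R = R' := funext hR
  subst he
  rfl

theorem PreRep.pull_pull (D : PreRep Z) (f : X.carrier → Y.carrier) (g : Y.carrier → Z.carrier)
    [SmoothMap X Y f] [SmoothMap Y Z g] : (D.pull g).pull f = D.pull (g ∘ f) :=
  PreRep.mk_congr (mpull_comp f g D.e).symm fun _ => Matrix.ext fun _ _ => OddExt.ext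
    (funext fun _ => (pull_comp f g _).symm) (funext fun _ => (pull_comp f g _).symm)

theorem PreRep.pull_proj_incl (D : PreRep X) (l : ℝ) : (D.pull X.proj).pull (X.incl l) = D :=
  (D.pull_pull (X.incl l) X.proj).trans <| PreRep.mk_congr (mpull_id D.e) fun _ =>
    Matrix.ext fun _ _ => OddExt.ext (funext fun _ => pull_id _) (funext fun _ => pull_id _)

theorem PreRep.pull_sum (D D' : PreRep Y) (f : X.carrier → Y.carrier) :
    (D.sum D').pull f = (D.pull f).sum (D'.pull f) := by
  have hz : OddExt.map (fun (P : Fam Y) t => fpull f (P t)) 0 = 0 :=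
    OddExt.ext (funext fun t => map_zero _) (funext fun t => map_zero _)
  refine PreRep.mk_congr (R := fun g => (fromBlocks (D.R g) 0 0 (D'.R g)).map _) ?_ fun g => ?_
  · exact (Matrix.fromBlocks_map _ _ _ _ _).trans
      (by rw [mmap_zero _ (map_zero _), mmap_zero _ (map_zero _)]; rfl)
  · rw [Matrix.fromBlocks_map, mmap_zero _ hz, mmap_zero _ hz]; rfl

theorem PreRep.Iso.sum {D D' E E' : PreRep X} (h : D.Iso D') (h' : E.Iso E') :
    (D.sum E).Iso (D'.sum E') := by
  obtain ⟨a, b, a1, b1, a2, b2, a3, b3, ab, ba, hR⟩ := h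
  obtain ⟨a', b', a1', b1', a2', b2', a3', b3', ab', ba', hR'⟩ := h'
  refine ⟨fromBlocks a 0 0 a', fromBlocks b 0 0 b', ?_, ?_, ?_, ?_, ?_, ?_, ?_, ?_,
    fun g => ?_⟩
  · rintro (i | i) (j | j)
    exacts [a1 i j, IsSmooth.zero, IsSmooth.zero, a1' i j]
  · rintro (i | i) (j | j)
    exacts [b1 i j, IsSmooth.zero, IsSmooth.zero, b1' i j]
  · rintro (i | i) (j | j)
    exacts [a2 i j, by simp, by simp, a2' i j]
  · rintro (i | i) (j | j)
    exacts [b2 i j, by simp, by simp, b2' i j]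
  · suffices fromBlocks a 0 0 a' = fromBlocks D'.e 0 0 E'.e *
      fromBlocks a 0 0 a' * fromBlocks D.e 0 0 E.e from this
    simp [Matrix.fromBlocks_multiply, ← a3, ← a3']
  · suffices fromBlocks b 0 0 b' = fromBlocks D.e 0 0 E.e *
      fromBlocks b 0 0 b' * fromBlocks D'.e 0 0 E'.e from this
    simp [Matrix.fromBlocks_multiply, ← b3, ← b3']
  · suffices fromBlocks a 0 0 a' * fromBlocks b 0 0 b' =
      fromBlocks D'.e 0 0 E'.e from this
    simp [Matrix.fromBlocks_multiply, ab, ab']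
  · suffices fromBlocks b 0 0 b' * fromBlocks a 0 0 a' =
      fromBlocks D.e 0 0 E.e from this
    simp [Matrix.fromBlocks_multiply, ba, ba']
  · show fromBlocks (D'.R g) 0 0 (E'.R g) * (fromBlocks a 0 0 a').map src =
      (fromBlocks a 0 0 a').map (tgt g) * fromBlocks (D.R g) 0 0 (E.R g)
    simp [Matrix.fromBlocks_map, mmap_zero _ src_zero, mmap_zero _ (tgt_zero g),
      Matrix.fromBlocks_multiply, hR, hR']

theorem IsRep.pull [Finite G] (hβ : IsNormalizedCocycle β) {D : PreRep Y} (h : IsRep β D)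
    (f : X.carrier → Y.carrier) [SmoothMap X Y f] (he : ∀ g x, f (X.act g x) = Y.act g (f x)) :
    IsRep β (D.pull f) := by
  obtain ⟨V, hV, hi⟩ := h.exists_isSC hβ
  have hi' := PreRep.Iso.symm hV.isRep_toSRep.adm h.adm hi
  exact IsRep.of_iso (h.adm.pull f he) (hV.isRep_pull f he)
    (hi'.pull h.adm hV.isRep_toSRep.adm f he)

section

variable {D D' D'' : PreRep X}

theorem IsRep.sum_comm (h : IsRep β D) (h' : IsRep β D') : (D.sum D').Iso (D'.sum D) :=
  PreRep.Iso.of_equiv (h.sum h').adm (h'.sum h).adm (Equiv.sumComm _ _)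
    (by rintro (i | i) <;> rfl) (by rintro (i | i) (j | j) <;> rfl)
    (by rintro g (i | i) (j | j) <;> rfl)

theorem IsRep.sum_assoc (h : IsRep β D) (h' : IsRep β D') (h'' : IsRep β D'') :
    ((D.sum D').sum D'').Iso (D.sum (D'.sum D'')) :=
  PreRep.Iso.of_equiv ((h.sum h').sum h'').adm (h.sum (h'.sum h'')).adm (Equiv.sumAssoc _ _ _)
    (by rintro ((i | i) | i) <;> rfl) (by rintro ((i | i) | i) ((j | j) | j) <;> rfl)
    (by rintro g ((i | i) | i) ((j | j) | j) <;> rfl)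

/-- The zero representation. -/
def PreRep.zero (X : GMfd.{u} G) : PreRep X where
  ι := Empty
  par := Empty.elim
  e := 0
  R _ := 0

theorem IsRep.zero : IsRep β (PreRep.zero X) :=
  ⟨fun i => i.elim, fun i => i.elim, Matrix.ext fun i => i.elim, fun _ i => i.elim,
    fun _ i => i.elim, fun _ => Matrix.ext fun i => i.elim, Matrix.ext fun i => i.elim,
    fun _ _ => Matrix.ext fun i => i.elim⟩

theorem IsRep.zero_sum (h : IsRep β D) : ((PreRep.zero X).sum D).Iso D :=
  PreRep.Iso.of_equiv (IsRep.zero.sum h).adm h.adm (Equiv.emptySum Empty D.ι)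
    (by rintro (i | i); exacts [i.elim, rfl]) (by rintro (i | i) (j | j); exacts [i.elim, i.elim, j.elim, rfl])
    (by rintro g (i | i) (j | j); exacts [i.elim, i.elim, j.elim, rfl])

end

end Sums

section Theories

variable {G : Type v} [Group G] [Finite G] {X Y : GMfd.{u} G} {β : G → G → Circle}

namespace EFT

variable {T T' T₁ T₂ : EFT β X}

theorem cls_eq_of_concordance (hβ : IsNormalizedCocycle β) {C : PreRep X.cyl} (hC : IsRep β C)
    (h₀ : (C.pull (X.incl 0)).Iso T.rep.toPreRep) (h₁ : (C.pull (X.incl 1)).Iso T'.rep.toPreRep)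
    (hη : T.η = T'.η + C.cs β) : T.cls = T'.cls :=
  Quot.sound (Or.inl ⟨⟨C, hC⟩, h₀, h₁, hC.isSection_cs hβ, by rw [hη, PreRep.cs, oc_eq]⟩)

theorem cls_eq_of_rep_iso (hβ : IsNormalizedCocycle β) (hi : T.rep.toPreRep.Iso T'.rep.toPreRep)
    (hη : T.η = T'.η) : T.cls = T'.cls := by
  have hC := T.rep.isRep.pull hβ X.proj proj_act
  refine cls_eq_of_concordance hβ hC ?_ ?_ (by rw [hη, PreRep.cs_proj, add_zero])
  · rw [PreRep.pull_proj_incl]; exact PreRep.Iso.refl T.rep.isRep.adm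
  · rw [PreRep.pull_proj_incl]; exact hi

theorem cls_sum_comm (hβ : IsNormalizedCocycle β) (T T' : EFT β X) :
    (T.sum T').cls = (T'.sum T).cls :=
  cls_eq_of_rep_iso hβ (T.rep.isRep.sum_comm T'.rep.isRep) (add_comm _ _)

theorem cls_sum_congr (hβ : IsNormalizedCocycle β) (T : EFT β X) (h : T₁.cls = T₂.cls) :
    (T.sum T₁).cls = (T.sum T₂).cls := by
  refine congrArg (Quot.lift (fun T₁ => (T.sum T₁).cls) ?_) h
  rintro T₁ T₂ (⟨C, h0, h1, hs, hη⟩ | ⟨hη, V, ε, hV, hε, hi⟩)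
  · have hP := T.rep.isRep.pull hβ X.proj proj_act
    refine cls_eq_of_concordance hβ (hP.sum C.isRep) ?_ ?_ ?_
    · rw [PreRep.pull_sum, PreRep.pull_proj_incl]
      exact (PreRep.Iso.refl T.rep.isRep.adm).sum h0
    · rw [PreRep.pull_sum, PreRep.pull_proj_incl]
      exact (PreRep.Iso.refl T.rep.isRep.adm).sum h1
    · rw [hP.cs_sum hβ C.isRep, PreRep.cs_proj, zero_add]
      exact (congrArg (T.η + ·) (hη.trans (by rw [← oc_eq]; rfl))).trans (add_assoc _ _ _).symm
  · refine Quot.sound (Or.inr ⟨congrArg (T.η + ·) hη, V, ε, hV, hε, ?_⟩)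
    have a1 := T.rep.isRep
    have a2 := T₂.rep.isRep
    exact PreRep.Iso.trans (a1.sum T₁.rep.isRep).adm (a1.sum (a2.sum ε.isRep)).adm
      ((a1.sum a2).sum ε.isRep).adm ((PreRep.Iso.refl a1.adm).sum hi)
      (PreRep.Iso.symm ((a1.sum a2).sum ε.isRep).adm (a1.sum (a2.sum ε.isRep)).adm
        (a1.sum_assoc a2 ε.isRep))

/-- The class in differential K-theory of a field theory. -/
def kcls (hβ : IsNormalizedCocycle β) (T : EFT β X) : KHat β X :=
  sk β (T.rep.isRep.exists_isSC hβ).choose T.η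

theorem kcls_eq (hβ : IsNormalizedCocycle β) {V : PreBundle X} (hV : IsSC β V)
    (hi : V.toSRep.Iso T.rep.toPreRep) : T.kcls hβ = sk β V T.η := by
  obtain ⟨hW, hj⟩ := (T.rep.isRep.exists_isSC hβ).choose_spec
  exact sk_iso hβ hW hV (PreRep.Iso.trans hW.isRep_toSRep.adm T.rep.isRep.adm hV.isRep_toSRep.adm hj
    (PreRep.Iso.symm hV.isRep_toSRep.adm T.rep.isRep.adm hi)) _

theorem kcls_sum (hβ : IsNormalizedCocycle β) (T T' : EFT β X) :
    (T.sum T').kcls hβ = T.kcls hβ + T'.kcls hβ := by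
  obtain ⟨V, hV, hi⟩ := T.rep.isRep.exists_isSC hβ
  obtain ⟨V', hV', hi'⟩ := T'.rep.isRep.exists_isSC hβ
  have hs := IsSC.sum hβ hV hV'
  rw [kcls_eq hβ hV hi, kcls_eq hβ hV' hi', ← sk_sum hβ hV hV']
  exact kcls_eq hβ hs.1 (hs.2.symm ▸ hi.sum hi')

theorem kcls_of_iso [CompactSpace X.carrier] (hβ : IsNormalizedCocycle β) (h : T.Iso T') :
    T.kcls hβ = T'.kcls hβ := by
  obtain ⟨C, h0, h1, hs, hη⟩ := h
  obtain ⟨W, hW, hi⟩ := C.isRep.exists_isSC hβ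
  have e : ∀ (l : ℝ) {T : EFT β X}, (C.pull (X.incl l)).Iso T.rep.toPreRep →
      T.kcls hβ = sk β (W.pull (X.incl l)) T.η := fun l T hl => by
    refine kcls_eq hβ (hW.pull (X.incl l) (incl_act l)) ?_
    rw [hW.pull_toSRep (X.incl l) (incl_act l)]
    exact PreRep.Iso.trans (hW.isRep_toSRep.adm.pull _ (incl_act l))
      (C.isRep.adm.pull _ (incl_act l)) T.rep.isRep.adm
      (hi.pull hW.isRep_toSRep.adm C.isRep.adm _ (incl_act l)) hl
  have hcs : W.cs β = oddClass _ hs :=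
    (hW.isRep_toSRep.cs_iso hβ C.isRep hi).trans (oc_eq hs)
  rw [e 0 h0, e 1 h1, hW.sk_homotopy hβ, hη, hcs]

theorem kcls_of_stableIso (hβ : IsNormalizedCocycle β) (h : T.StableIso T') :
    T.kcls hβ = T'.kcls hβ := by
  obtain ⟨hη, V, ε, -, hε, hi⟩ := h
  have hB := V.isBundle.sum V.isBundle.flip
  have hz : (EFT.mk ε 0).kcls hβ = 0 := by
    rw [kcls_eq hβ hB.isSC (by
      rw [← hB.toPreRep_eq]
      exact hε ▸ PreRep.Iso.refl ε.isRep.adm), hB.sk_eq hβ]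
    have := kc_flip V.isBundle (0 : OddClass β X)
    rwa [← kc_sum V.isBundle V.isBundle.flip, neg_zero, add_zero] at this
  have hs := kcls_sum hβ T' (EFT.mk ε 0)
  rw [hz, add_zero] at hs
  rw [← hs]
  obtain ⟨W, hW, hj⟩ := T.rep.isRep.exists_isSC hβ
  rw [kcls_eq hβ hW hj, kcls_eq (T := T'.sum ⟨ε, 0⟩) hβ hW (PreRep.Iso.trans hW.isRep_toSRep.adm
    T.rep.isRep.adm (T'.rep.isRep.sum ε.isRep).adm hj hi)]
  exact congrArg (sk β W) (hη.trans (add_zero _).symm)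

end EFT

end Theories

end

section

section Bundles

variable {G : Type v} [Group G] {X Y : GMfd.{u} G} {β : G → G → Circle} {V V' W : PreBundle X}

theorem PreBundle.Iso.toSRep (hβ : IsNormalizedCocycle β) (h : IsBundle β V) (h' : IsBundle β V')
    (hi : V.Iso V') : V.toSRep.Iso V'.toSRep := by
  obtain ⟨a, b, ha, hb, a3, b3, hab, hba, hρ, hA⟩ := hi
  have := ha.msmooth; have := hb.msmooth; have := h'.isSC.e_smooth
  have ea : V'.e * a = a := by
    rw [a3, ← massoc, ← massoc, h'.e_idem]
  have ae : a * V.e = a := by rw [a3, massoc, h.e_idem]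
  have eb : V.e * b = b := by rw [b3, ← massoc, ← massoc, h.e_idem]
  have be : b * V'.e = b := by rw [b3, massoc, h'.e_idem]
  have hm : MIso V.par V.e V'.par V'.e a b :=
    ⟨‹_›, ‹_›, ha.isPar_even, hb.isPar_even, ea, ae, eb, be, hab, hba⟩
  have hV : V = V'.conj V.par V.e V.ρ a b := by
    refine PreBundle.mk_congr rfl (fun _ => rfl) ?_
    suffices V.A = 𝐝V.e * V.e - (𝐝b * V'.e * a + 𝐬b * (𝐝V'.e * V'.e - V'.A) * a) from this
    have h1 : 𝐝V.e = 𝐝b * V'.e * a + b * 𝐝V'.e * a + b * 𝐝a := by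
      conv_lhs => rw [← hba, d_mul, hb.s_even, ← be, d_mul, hb.s_even, be, madd_mul]
    have h2 : V.A = b * (V'.e * 𝐝a * V.e + V'.A * a) := by
      rw [← hA, ← massoc, hba, h.isSC.e_mul_A]
    rw [h1, h2, hb.s_even]
    simp only [mmul_add, madd_mul, mmul_sub, msub_mul, massoc, ae,
      ea]
    rw [← massoc b V'.e, be]
    abel
  have hc := h'.isSC.conj hβ hm h.e_graded h.ρ_graded fun g =>
    eq_conj_of_intertwine (hρ g) hba (h.isSC.e_mul_ρ g)
  have k := h'.isSC.conj_iso hm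
  rwa [← hc.2, ← hV] at k

/-- The same bundle, regarded as purely even. -/
def PreBundle.even (W : PreBundle X) : PreBundle X := ⟨W.ι, fun _ => false, W.e, W.ρ, W.A⟩

theorem IsGradedMatrix.even {m : Type} {p : m → Bool} {k : ℕ} {M : Matrix m m (Form X)}
    (h : IsGradedMatrix k p p M) : IsGradedMatrix k (fun _ => false) (fun _ => false) M :=
  fun i j => ⟨(h i j).1, (h i j).2.1, fun h => absurd rfl h⟩

theorem IsBundle.even (h : IsBundle β W) : IsBundle β W.even :=
  ⟨h.e_graded.even, fun g => (h.ρ_graded g).even, h.A_graded.even, h.e_idem, h.ρ_hom, h.A_hom,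
    h.ρ_one, h.ρ_mul, h.A_equivariant⟩

theorem IsBundle.isRep (h : IsBundle β W) : IsRep β W.toPreRep :=
  h.toPreRep_eq ▸ h.isSC.isRep_toSRep

theorem IsBundle.R_eq_zero (h : IsBundle β W) (g : G) {i j : W.ι} (hij : W.par i ≠ W.par j) :
    W.toPreRep.R g i j = 0 := by
  have h1 := h.isRep.R_even g i j
  rw [if_neg (show ¬W.toPreRep.par i = W.toPreRep.par j from hij)] at h1
  have h2 := (h.even.isRep.R_even g i j).symm.trans h1
  have hz : ∀ v : Ext X.E, v = -v → v = 0 := fun v hv => by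
    have h3 : (2 : ℂ) • v = 0 := by rw [two_smul]; nth_rewrite 1 [hv]; exact neg_add_cancel v
    exact (smul_eq_zero.1 h3).resolve_left two_ne_zero
  exact OddExt.ext (funext fun t => funext fun x => hz _ (congrFun (congrFun (congrArg OddExt.body h2) t) x))
    (funext fun t => funext fun x => hz _ (congrFun (congrFun (congrArg OddExt.soul h2) t) x))

/-- Exchange of the summands for the odd basis elements. -/
def sumSwap {ι : Type} (p : ι → Bool) : ι ⊕ ι ≃ ι ⊕ ι :=
  Function.Involutive.toPerm (Sum.elim (fun i => if p i then Sum.inr i else Sum.inl i)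
    fun i => if p i then Sum.inl i else Sum.inr i) (by rintro (i | i) <;> cases h : p i <;> simp [h])

theorem sumSwap_inl {ι : Type} (p : ι → Bool) (i : ι) :
    sumSwap p (Sum.inl i) = if p i then Sum.inr i else Sum.inl i := rfl

theorem sumSwap_inr {ι : Type} (p : ι → Bool) (i : ι) :
    sumSwap p (Sum.inr i) = if p i then Sum.inl i else Sum.inr i := rfl

theorem par_sumSwap {ι : Type} (p : ι → Bool) (i : ι ⊕ ι) :
    Sum.elim (fun _ => false) (fun _ => true) (sumSwap p i) = Sum.elim p (fun i => !p i) i := by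
  rcases i with i | i <;> simp only [sumSwap_inl, sumSwap_inr] <;> cases h : p i <;> simp [h]

theorem fromBlocks_sumSwap {A : Type*} {ι : Type} [Zero A] {p : ι → Bool} {M : Matrix ι ι A}
    (hM : ∀ i j, p i ≠ p j → M i j = 0) (i j : ι ⊕ ι) :
    fromBlocks M 0 0 M (sumSwap p i) (sumSwap p j) = fromBlocks M 0 0 M i j := by
  rcases i with i | i <;> rcases j with j | j <;> simp only [sumSwap_inl, sumSwap_inr] <;>
    have h := hM i j <;> cases hi : p i <;> cases hj : p j <;> simp_all

theorem IsBundle.sum_flip_iso (h : IsBundle β W) :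
    (W.toPreRep.sum W.flip.toPreRep).Iso (W.even.toPreRep.sum W.even.flip.toPreRep) :=
  PreRep.Iso.of_equiv (h.isRep.sum h.flip.isRep).adm (h.even.isRep.sum h.even.flip.isRep).adm
    (sumSwap W.par)
    (par_sumSwap W.par)
    (fromBlocks_sumSwap fun i j hij => (h.e_graded i j).2.2 hij)
    fun g => fromBlocks_sumSwap fun i j hij => h.R_eq_zero g hij

theorem IsBundle.toPreRep_sum (hβ : IsNormalizedCocycle β) (h : IsBundle β V) (h' : IsBundle β W) :
    (V.sum W).toPreRep = V.toPreRep.sum W.toPreRep := by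
  rw [h.toPreRep_eq, h'.toPreRep_eq, (h.sum h').toPreRep_eq, (IsSC.sum hβ h.isSC h'.isSC).2]

/-- The field theory determined by a bundle with connection and a class of odd sections. -/
def IsBundle.theory (h : IsBundle β W) (η : OddClass β X) : EFT β X := ⟨⟨W.toPreRep, h.isRep⟩, η⟩

/-- The zero theory. -/
def EFT.zero (β : G → G → Circle) (X : GMfd.{u} G) : EFT β X := ⟨⟨PreRep.zero X, IsRep.zero⟩, 0⟩

theorem IsBundle.cls_theory_flip (hβ : IsNormalizedCocycle β) (h : IsBundle β W) (η : OddClass β X) :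
    ((h.theory η).sum (h.flip.theory (-η))).cls = (EFT.zero β X).cls := by
  have hs := h.even.isRep.sum h.even.flip.isRep
  have he := IsBundle.toPreRep_sum hβ h.even h.even.flip
  refine Quot.sound (Or.inr ⟨add_neg_cancel η, ⟨W.even, h.even⟩,
    ⟨W.even.toPreRep.sum W.even.flip.toPreRep, hs⟩, fun _ => rfl, he.symm, ?_⟩)
  exact PreRep.Iso.trans (h.isRep.sum h.flip.isRep).adm hs.adm (IsRep.zero.sum hs).adm h.sum_flip_iso
    (PreRep.Iso.symm (IsRep.zero.sum hs).adm hs.adm hs.zero_sum)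

section

variable [Finite G]

theorem IsBundle.cls_theory_sum (hβ : IsNormalizedCocycle β) (h : IsBundle β V) (h' : IsBundle β W)
    (η η' : OddClass β X) :
    ((h.sum h').theory (η + η')).cls = ((h.theory η).sum (h'.theory η')).cls :=
  EFT.cls_eq_of_rep_iso hβ (by
    show (V.sum W).toPreRep.Iso (V.toPreRep.sum W.toPreRep)
    rw [IsBundle.toPreRep_sum hβ h h']
    exact PreRep.Iso.refl (h.isRep.sum h'.isRep).adm) rfl

theorem IsSC.cls_eq_theory (hβ : IsNormalizedCocycle β) (h : IsSC β V) {A : Matrix V.ι V.ι (Form X)}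
    (hA : IsBundle β (V.withConnection A)) (h' : IsBundle β W) (hi : (V.withConnection A).Iso W)
    {T : EFT β X} (hT : V.toSRep.Iso T.rep.toPreRep) {η : OddClass β X}
    (hη : T.η = η + (V.interpolate A).cs β) : T.cls = (h'.theory η).cls := by
  have hI := h.interpolate hA.isSC
  refine EFT.cls_eq_of_concordance hβ hI.isRep_toSRep ?_ ?_ hη
  · rwa [← hI.pull_toSRep _ (incl_act 0), PreBundle.interpolate_incl_zero]
  · rw [← hI.pull_toSRep _ (incl_act 1), PreBundle.interpolate_incl_one]
    show PreRep.Iso _ W.toPreRep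
    rw [h'.toPreRep_eq]
    exact hi.toSRep hβ hA h'

/-- Every field theory is equivalent to one that is determined by a bundle with connection. -/
theorem EFT.exists_theory (hβ : IsNormalizedCocycle β) (T : EFT β X) :
    ∃ (W : PreBundle X) (h : IsBundle β W) (η : OddClass β X),
      T.cls = (h.theory η).cls ∧ T.kcls hβ = kc β W η := by
  obtain ⟨V, hV, hi⟩ := T.rep.isRep.exists_isSC hβ
  obtain ⟨A, hA⟩ := hV.exists_isBundle hβ
  refine ⟨V.withConnection A, hA, T.η - (V.interpolate A).cs β, ?_, ?_⟩
  · exact hV.cls_eq_theory hβ hA hA (PreBundle.Iso.refl hA) hi (sub_add_cancel _ _).symm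
  · rw [EFT.kcls_eq hβ hV hi, sk_eq hβ hV hA]

theorem IsBundle.kcls_theory (hβ : IsNormalizedCocycle β) (h : IsBundle β W) (η : OddClass β X) :
    (h.theory η).kcls hβ = kc β W η := by
  rw [← h.sk_eq hβ]
  exact EFT.kcls_eq hβ h.isSC (h.toPreRep_eq ▸ PreRep.Iso.refl h.isRep.adm)

end

end Bundles

end

section

section Group

variable {G : Type v} [Group G] {X Y : GMfd.{u} G} {β : G → G → Circle}

theorem EFTClasses.exists_cls (a : EFTClasses β X) : ∃ T : EFT β X, T.cls = a := Quot.exists_rep a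

theorem EFT.isAssociated_iff {x : KGen β X} {T : EFT β X} : EFT.IsAssociated x T ↔
    T.rep.toPreRep = x.V.toPreBundle.toPreRep ∧ toInv β X T.η = x.η := by
  refine and_congr_right fun _ => ⟨?_, fun h => ?_⟩
  · rintro ⟨w, hw, hη, hc⟩
    refine Subtype.ext (funext fun c => ?_)
    rw [hη, ← oc_eq hw, toInv_oc hw, hc]
  · obtain ⟨w, hw, hη⟩ := exists_oc T.η
    exact ⟨w, hw, by rw [← hη, oc_eq hw], fun c => by rw [← h, ← hη, toInv_oc hw]⟩

variable [Finite G]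

theorem toInv_symm (hβ : IsNormalizedCocycle β) (q : invClasses β X) :
    toInv β X ((invEquiv hβ X).symm q) = q := (invEquiv hβ X).apply_symm_apply q
theorem EFT.cls_sum_congr₂ (hβ : IsNormalizedCocycle β) {T₁ T₂ T₁' T₂' : EFT β X}
    (h : T₁.cls = T₂.cls) (h' : T₁'.cls = T₂'.cls) : (T₁.sum T₁').cls = (T₂.sum T₂').cls :=
  (cls_sum_congr hβ T₁ h').trans ((cls_sum_comm hβ _ _).trans
    ((cls_sum_congr hβ T₂' h).trans (cls_sum_comm hβ _ _)))

theorem EFT.exists_neg (hβ : IsNormalizedCocycle β) (T : EFT β X) :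
    ∃ T' : EFT β X, (T'.sum T).cls = (EFT.zero β X).cls := by
  obtain ⟨W, h, η, hT, -⟩ := T.exists_theory hβ
  exact ⟨h.flip.theory (-η), (cls_sum_congr hβ _ hT).trans
    ((cls_sum_comm hβ _ _).trans (h.cls_theory_flip hβ η))⟩

instance : Add (EFTClasses β X) := ⟨fun a b => (EFT.sum (Quot.out a) (Quot.out b)).cls⟩

variable [hβ : Fact (IsNormalizedCocycle β)]

theorem EFT.cls_add (T T' : EFT β X) : T.cls + T'.cls = (T.sum T').cls :=
  EFT.cls_sum_congr₂ hβ.out (Quot.out_eq _) (Quot.out_eq _)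

instance : Zero (EFTClasses β X) := ⟨(EFT.zero β X).cls⟩

theorem EFTClasses.exists_neg (a : EFTClasses β X) : ∃ b, b + a = 0 := by
  obtain ⟨T, rfl⟩ := a.exists_cls
  obtain ⟨T', h⟩ := T.exists_neg hβ.out
  exact ⟨T'.cls, (EFT.cls_add _ _).trans h⟩

instance : Neg (EFTClasses β X) := ⟨fun a => a.exists_neg.choose⟩

/-- Classes of field theories form a group under direct sum. -/
instance : AddCommGroup (EFTClasses β X) :=
  have comm : ∀ a b : EFTClasses β X, a + b = b + a := fun a b => by
    obtain ⟨T, rfl⟩ := a.exists_cls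
    obtain ⟨T', rfl⟩ := b.exists_cls
    rw [EFT.cls_add, EFT.cls_add, EFT.cls_sum_comm hβ.out]
  have zero : ∀ a : EFTClasses β X, 0 + a = a := fun a => by
    obtain ⟨T, rfl⟩ := a.exists_cls
    refine (EFT.cls_add _ _).trans ?_
    exact EFT.cls_eq_of_rep_iso hβ.out T.rep.isRep.zero_sum (zero_add _)
  { add_assoc := fun a b c => by
      obtain ⟨T, rfl⟩ := a.exists_cls
      obtain ⟨T', rfl⟩ := b.exists_cls
      obtain ⟨T'', rfl⟩ := c.exists_cls
      simp only [EFT.cls_add]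
      exact EFT.cls_eq_of_rep_iso hβ.out (T.rep.isRep.sum_assoc T'.rep.isRep T''.rep.isRep)
        (add_assoc _ _ _)
    zero_add := zero
    add_zero := fun a => (comm _ _).trans (zero a)
    nsmul := nsmulRec
    zsmul := zsmulRec
    neg_add_cancel := fun a => a.exists_neg.choose_spec
    add_comm := comm }

/-- The field theory determined by a generator. -/
def KGen.theory (hβ : IsNormalizedCocycle β) (x : KGen β X) : EFT β X :=
  x.V.isBundle.theory ((invEquiv hβ X).symm x.η)

theorem KGen.cls_theory_of_changeConnection {x y : KGen β X} (h : x.ChangeConnection y) :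
    (x.theory hβ.out).cls = (y.theory hβ.out).cls := by
  obtain ⟨A, hA, hi, hc⟩ := h
  have hy := y.V.isBundle
  have hs := (hy.interpolate hA).isSC.isRep_toSRep.isSection_cs hβ.out
  refine (hy.isSC.cls_eq_theory hβ.out hA x.V.isBundle hi (T := y.theory hβ.out) ?_ ?_).symm
  · exact hy.toPreRep_eq ▸ PreRep.Iso.refl hy.isRep.adm
  · refine toInv_injective hβ.out ((toInv_symm _ _).trans (Subtype.ext (funext fun c => ?_)))
    obtain ⟨hs', hp', h⟩ := hc c
    rw [map_add, toInv_symm, h]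
    refine congrArg (x.η.1 c + ·) (Eq.trans ?_ (toInv_oc hs c).symm)
    rw [oddFixClass_eq_iff]
    exact ⟨0, IsSmooth.zero, HasParity.zero _, by
      rw [(hy.interpolate hA).character_eq, extD_zero, map_zero, add_zero]⟩

/-- The homomorphism that sends `(V, ∇, η)` to the field theory determined by it. -/
def kToEFT (β : G → G → Circle) [hβ : Fact (IsNormalizedCocycle β)] (X : GMfd.{u} G) :
    KHat β X →+ EFTClasses β X :=
  QuotientAddGroup.lift _ (FreeAbelianGroup.lift fun x => (x.theory hβ.out).cls) <| by
    rw [kRelations, AddSubgroup.closure_le]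
    rintro _ ((⟨x, y, h, rfl⟩ | ⟨x, y, rfl⟩) | ⟨x, rfl⟩)
    · exact (map_sub _ _ _).trans (sub_eq_zero.2 (by
        simpa using KGen.cls_theory_of_changeConnection h))
    · refine (map_sub _ _ _).trans (sub_eq_zero.2 ?_)
      rw [map_add, FreeAbelianGroup.lift_apply_of, FreeAbelianGroup.lift_apply_of,
        FreeAbelianGroup.lift_apply_of, EFT.cls_add, KGen.theory, KGen.theory,
        ← IsBundle.cls_theory_sum hβ.out, ← (invEquiv hβ.out X).symm.map_add]
      rfl
    · refine (map_add _ _ _).trans ?_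
      rw [FreeAbelianGroup.lift_apply_of, FreeAbelianGroup.lift_apply_of, EFT.cls_add]
      refine Eq.trans ?_ (x.V.isBundle.cls_theory_flip hβ.out ((invEquiv hβ.out X).symm x.η))
      rw [← (invEquiv hβ.out X).symm.map_neg]
      rfl

theorem kToEFT_cls (x : KGen β X) : kToEFT β X x.cls = (x.theory hβ.out).cls :=
  FreeAbelianGroup.lift_apply_of _ _

theorem KGen.kcls_theory (x : KGen β X) : (x.theory hβ.out).kcls hβ.out = x.cls := by
  rw [KGen.theory, IsBundle.kcls_theory, kc_eq x.V.isBundle, toInv_symm]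

theorem kToEFT_kc {W : PreBundle X} (h : IsBundle β W) (η : OddClass β X) :
    kToEFT β X (kc β W η) = (h.theory η).cls := by
  rw [kc_eq h, kToEFT_cls, KGen.theory]
  exact congrArg (fun q => (h.theory q).cls) ((invEquiv hβ.out X).symm_apply_apply η)

/-- The isomorphism of differential K-theory and classes of field theories. -/
def kEquiv (β : G → G → Circle) [hβ : Fact (IsNormalizedCocycle β)] (X : GMfd.{u} G)
    [CompactSpace X.carrier] : KHat β X ≃+ EFTClasses β X :=
  let Ψ : EFTClasses β X →+ KHat β X := AddMonoidHom.mk'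
    (Quot.lift (EFT.kcls hβ.out) fun _ _ h =>
      h.elim (EFT.kcls_of_iso hβ.out) (EFT.kcls_of_stableIso hβ.out)) fun a b => by
      obtain ⟨T, rfl⟩ := a.exists_cls
      obtain ⟨T', rfl⟩ := b.exists_cls
      rw [EFT.cls_add]
      exact EFT.kcls_sum hβ.out T T'
  AddMonoidHom.toAddEquiv (kToEFT β X) Ψ
    (QuotientAddGroup.addMonoidHom_ext _ (FreeAbelianGroup.lift_ext _ _ fun x =>
      (congrArg Ψ (kToEFT_cls x)).trans x.kcls_theory))
    (AddMonoidHom.ext fun a => by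
      obtain ⟨T, rfl⟩ := a.exists_cls
      obtain ⟨W, h, η, hT, hk⟩ := T.exists_theory hβ.out
      show kToEFT β X (T.kcls hβ.out) = T.cls
      rw [hk, hT, kToEFT_kc])

theorem KGen.isAssociated_theory (x : KGen β X) : EFT.IsAssociated x (x.theory hβ.out) :=
  EFT.isAssociated_iff.2 ⟨rfl, toInv_symm _ _⟩

theorem EFT.IsAssociated.cls_eq {x : KGen β X} {T : EFT β X} (h : EFT.IsAssociated x T) :
    kToEFT β X x.cls = T.cls := by
  obtain ⟨h1, h2⟩ := EFT.isAssociated_iff.1 h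
  rw [kToEFT_cls]
  refine EFT.cls_eq_of_rep_iso hβ.out ?_ (toInv_injective hβ.out ((toInv_symm _ _).trans h2.symm))
  exact h1 ▸ PreRep.Iso.refl x.V.isBundle.isRep.adm

end Group

end

section

section Naturality

variable {G : Type v} [Group G] {X Y : GMfd.{u} G} {β : G → G → Circle}
  {f : X.carrier → Y.carrier} [SmoothMap X Y f]

theorem IsBundle.toPreRep_pull {V : PreBundle Y} (h : IsBundle β V)
    (he : ∀ g x, f (X.act g x) = Y.act g (f x)) : (V.pull f).toPreRep = V.toPreRep.pull f := by
  rw [h.toPreRep_eq, (h.pull f he).toPreRep_eq, h.isSC.pull_toSRep f he]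

theorem EFT.IsPullback.η_eq (he : ∀ g x, f (X.act g x) = Y.act g (f x)) {T : EFT β Y}
    {T' : EFT β X} (h : T.IsPullback f T') : pullClass f T.η = T'.η := by
  obtain ⟨-, w, h, h', hw, hw'⟩ := h
  rw [hw, hw', ← oc_eq, ← oc_eq, pullClass_oc f he h]

variable [Finite G]

/-- Pullback of field theories. -/
def EFT.pull (hβ : IsNormalizedCocycle β) (he : ∀ g x, f (X.act g x) = Y.act g (f x))
    (T : EFT β Y) : EFT β X :=
  ⟨⟨T.rep.toPreRep.pull f, T.rep.isRep.pull hβ f he⟩, pullClass f T.η⟩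

theorem EFT.isPullback_pull (hβ : IsNormalizedCocycle β)
    (he : ∀ g x, f (X.act g x) = Y.act g (f x)) (T : EFT β Y) : T.IsPullback f (T.pull hβ he) := by
  obtain ⟨w, hw, hη⟩ := exists_oc T.η
  refine ⟨rfl, w, hw, hw.pull f he, by rw [← hη, oc_eq], ?_⟩
  show pullClass f T.η = _
  rw [← hη, pullClass_oc f he hw, oc_eq]

theorem EFT.cls_pull (hβ : IsNormalizedCocycle β) (he : ∀ g x, f (X.act g x) = Y.act g (f x))
    {T T' : EFT β Y} (h : T.Iso T' ∨ T.StableIso T') :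
    (T.pull hβ he).cls = (T'.pull hβ he).cls := by
  rcases h with ⟨C, h0, h1, hs, hη⟩ | ⟨hη, V, ε, hV, hε, hi⟩
  · have e : ∀ l, (C.toPreRep.pull (cylMap f)).pull (X.incl l) = (C.toPreRep.pull (Y.incl l)).pull f :=
      fun l => (C.toPreRep.pull_pull (X.incl l) (cylMap f)).trans
        (C.toPreRep.pull_pull f (Y.incl l)).symm
    refine cls_eq_of_concordance hβ (C.isRep.pull hβ (cylMap f) (cylMap_act he)) ?_ ?_ ?_
    · rw [e]
      exact h0.pull (C.isRep.adm.pull _ (incl_act 0)) T.rep.isRep.adm f he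
    · rw [e]
      exact h1.pull (C.isRep.adm.pull _ (incl_act 1)) T'.rep.isRep.adm f he
    · rw [C.isRep.cs_cylMap hβ f he]
      show pullClass f T.η = pullClass f T'.η + _
      rw [hη, pullClass_add f he, PreRep.cs, oc_eq]
  · have hB := V.isBundle.pull f he
    refine Quot.sound (Or.inr ⟨congrArg (pullClass f) hη, ⟨V.pull f, hB⟩,
      ⟨ε.toPreRep.pull f, ε.isRep.pull hβ f he⟩, hV, ?_, ?_⟩)
    · show ε.toPreRep.pull f = ((V.pull f).sum (V.flip.pull f)).toPreRep
      rw [hε]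
      refine (congrArg (PreRep.pull f)
        (IsBundle.toPreRep_sum hβ V.isBundle V.isBundle.flip)).trans ?_
      rw [PreRep.pull_sum]
      refine Eq.trans ?_ (IsBundle.toPreRep_sum hβ hB (V.isBundle.flip.pull f he)).symm
      rw [V.isBundle.toPreRep_pull he, V.isBundle.flip.toPreRep_pull he]
    · have k : (T.rep.toPreRep.pull f).Iso ((T'.rep.toPreRep.sum ε.toPreRep).pull f) :=
        hi.pull T.rep.isRep.adm (T'.rep.isRep.sum ε.isRep).adm f he
      rwa [PreRep.pull_sum] at k

variable [hβ : Fact (IsNormalizedCocycle β)]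

theorem EFT.IsPullback.cls_eq (he : ∀ g x, f (X.act g x) = Y.act g (f x)) {T : EFT β Y}
    {T' : EFT β X} (h : T.IsPullback f T') : (T.pull hβ.out he).cls = T'.cls :=
  EFT.cls_eq_of_rep_iso hβ.out (h.1 ▸ PreRep.Iso.refl (T.rep.isRep.pull hβ.out f he).adm)
    (h.η_eq he)

/-- Pullback of classes of field theories. -/
def EFTClasses.pull (he : ∀ g x, f (X.act g x) = Y.act g (f x)) : EFTClasses β Y →+ EFTClasses β X :=
  AddMonoidHom.mk' (Quot.lift (fun T => (T.pull hβ.out he).cls) fun _ _ => EFT.cls_pull hβ.out he)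
    fun a b => by
      obtain ⟨T, rfl⟩ := a.exists_cls
      obtain ⟨T', rfl⟩ := b.exists_cls
      rw [EFT.cls_add]
      refine Eq.trans ?_ (EFT.cls_add (T.pull hβ.out he) (T'.pull hβ.out he)).symm
      refine EFT.cls_eq_of_rep_iso hβ.out ?_ (pullClass_add f he _ _)
      show (PreRep.pull f (T.rep.toPreRep.sum T'.rep.toPreRep)).Iso _
      rw [PreRep.pull_sum]
      exact PreRep.Iso.refl ((T.pull hβ.out he).rep.isRep.sum (T'.pull hβ.out he).rep.isRep).adm

theorem KGen.exists_isPullback (he : ∀ g x, f (X.act g x) = Y.act g (f x)) (x : KGen β Y) :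
    ∃ y : KGen β X, x.IsPullback f y := by
  obtain ⟨w, hw, hη⟩ := exists_oc ((invEquiv hβ.out Y).symm x.η)
  have hw' := hw.pull f he
  refine ⟨⟨⟨x.V.pull f, x.V.isBundle.pull f he⟩, toInv β X (oc β fun g => pull f (w g))⟩, rfl,
    fun c => ⟨w _, (hw.1 _).1, (hw.1 _).2, (hw'.1 _).1, (hw'.1 _).2, ?_, toInv_oc hw' c⟩⟩
  rw [← toInv_oc hw c, hη, toInv_symm]

theorem KGen.IsPullback.theory (he : ∀ g x, f (X.act g x) = Y.act g (f x)) {x : KGen β Y}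
    {y : KGen β X} (h : x.IsPullback f y) :
    ((x.theory hβ.out).pull hβ.out he).cls = (y.theory hβ.out).cls := by
  obtain ⟨hV, hc⟩ := h
  have hr : y.V.toPreBundle.toPreRep = x.V.toPreBundle.toPreRep.pull f := by
    rw [hV, x.V.isBundle.toPreRep_pull he]
  refine EFT.cls_eq_of_rep_iso hβ.out
    (show PreRep.Iso _ y.V.toPreBundle.toPreRep from
      hr.symm ▸ PreRep.Iso.refl ((x.theory hβ.out).pull hβ.out he).rep.isRep.adm)
    (toInv_injective hβ.out (Eq.trans ?_ (toInv_symm _ _).symm))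
  obtain ⟨w, hw, hη⟩ := exists_oc ((invEquiv hβ.out Y).symm x.η)
  show toInv β X (pullClass f ((invEquiv hβ.out Y).symm x.η)) = _
  rw [← hη, pullClass_oc f he hw]
  refine Subtype.ext (funext fun c => ?_)
  obtain ⟨α, hs, hp, hs', hp', hx, hy⟩ := hc c
  rw [toInv_oc (hw.pull f he), hy, oddFixClass_eq_iff]
  rw [← toInv_symm hβ.out x.η, ← hη, toInv_oc hw, oddFixClass_eq_iff] at hx
  obtain ⟨γ, hγ, hγp, h⟩ := hx
  refine ⟨pull f γ, hγ.pull f, hasParity_pull hγp f, ?_⟩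
  rw [extD_pull f hγ, ← map_add, ← map_add]
  exact res_pull_congr f (he _) (h.trans (map_add _ _ _).symm)

end Naturality

section Curvature

variable {G : Type v} [Group G] [Finite G] {X : GMfd.{u} G} {β : G → G → Circle}

theorem fixD_out_oc {w : G → Form X} (hw : IsSection β true w) (g : G) :
    fixD ((Quotient.out (oc β w)).1 g) = res g (extD (w g)) := by
  have hq : (QuotientAddGroup.mk (Quotient.out (oc β w)) : OddClass β X) = oc β w := Quotient.out_eq _
  generalize Quotient.out (oc β w) = z at hq
  obtain ⟨z, w', hw', rfl⟩ := z
  rw [oc_eq hw] at hq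
  obtain ⟨v, hv, h⟩ := (oddClass_eq_iff hw' hw).1 hq
  rw [fixD_res (hw'.1 g).1, res_extD_congr (hw'.1 g).1 ((hw.1 g).1.add (hv.1 g).1.extD)
    ((h g).trans (map_add _ _ _).symm), extD_add (hw.1 g).1 (hv.1 g).1.extD,
    extD_extD (hv.1 g).1, add_zero]

theorem fixD_out_oddFixClass {g : G} {α : Form X} (hs : IsSmooth α) (hp : HasParity true α) :
    fixD (Quotient.out (oddFixClass g α hs hp)).1 = res g (extD α) := by
  have hq : (QuotientAddGroup.mk (Quotient.out (oddFixClass g α hs hp)) : OddFix X g) =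
    oddFixClass g α hs hp := Quotient.out_eq _
  generalize Quotient.out (oddFixClass g α hs hp) = z at hq
  obtain ⟨z, α', hs', hp', rfl⟩ := z
  obtain ⟨γ, hγ, -, h⟩ := (oddFixClass_eq_iff hs' hp' hs hp).1 hq
  rw [fixD_res hs', res_extD_congr hs' (hs.add hγ.extD) (h.trans (map_add _ _ _).symm),
    extD_add hs hγ.extD, extD_extD hγ, add_zero]

namespace EFT

variable {T T' : EFT β X}

theorem partitionFunction_eq {w : G → Form X} (hw : IsSection β true w) (h : T.η = oc β w) (g : G) :
    T.partitionFunction g = res g (T.rep.character g) + res g (extD (w g)) := by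
  rw [partitionFunction, h, fixD_out_oc hw]

theorem partitionFunction_sum (T T' : EFT β X) :
    (T.sum T').partitionFunction = T.partitionFunction + T'.partitionFunction := by
  obtain ⟨w, hw, hη⟩ := exists_oc T.η
  obtain ⟨w', hw', hη'⟩ := exists_oc T'.η
  have hs : (T.sum T').η = oc β (w + w') := by rw [oc_add hw hw', hη, hη']; rfl
  funext g
  rw [Pi.add_apply, partitionFunction_eq hw hη.symm, partitionFunction_eq hw' hη'.symm,
    partitionFunction_eq (hw.add hw') hs, Pi.add_apply, extD_add (hw.1 g).1 (hw'.1 g).1, map_add,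
    show (T.sum T').rep.character g = T.rep.character g + T'.rep.character g from
      PreRep.character_sum _ _ g, map_add,
    add_add_add_comm]

theorem partitionFunction_of_iso (hβ : IsNormalizedCocycle β) (h : T.Iso T') :
    T.partitionFunction = T'.partitionFunction := by
  obtain ⟨C, h0, h1, hs, hη⟩ := h
  obtain ⟨w, hw, hw'⟩ := exists_oc T'.η
  funext g
  have hc := C.isRep.character_smooth g
  have h2 := congrArg (res g) (fiberInt_stokes hc)
  rw [map_add, map_sub, res_fiberInt_eq_zero hc.extD (C.isRep.res_extD_character hβ g), zero_add,
    ← PreRep.character_pull, ← PreRep.character_pull,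
    (C.isRep.pull hβ _ (incl_act 0)).res_character_iso T.rep.isRep h0,
    (C.isRep.pull hβ _ (incl_act 1)).res_character_iso T'.rep.isRep h1] at h2
  rw [partitionFunction_eq hw hw'.symm, partitionFunction_eq (hw.add hs)
    (by rw [oc_add hw hs, hw', oc_eq hs, hη]), Pi.add_apply, extD_add (hw.1 g).1 hc.fiberInt,
    map_add, h2]
  abel

theorem partitionFunction_of_stableIso (hβ : IsNormalizedCocycle β) (h : T.StableIso T') :
    T.partitionFunction = T'.partitionFunction := by
  obtain ⟨hη, V, ε, -, hε, hi⟩ := h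
  funext g
  rw [partitionFunction, partitionFunction, hη,
    T.rep.isRep.res_character_iso (T'.rep.sum ε).isRep hi]
  congr 1
  have h1 : V.flip.toPreRep.character g = -V.toPreRep.character g := by
    simp only [PreRep.character, strace, ← Finset.sum_neg_distrib]
    refine Finset.sum_congr rfl fun i _ => ?_
    show (if (!V.par i) = true then _ else _) = -(if V.par i = true then _ else _)
    cases V.par i
    · rfl
    · exact (neg_neg _).symm
  have h2 : ε.character g = 0 := by
    rw [hε, show (V.sum V.flip).toPreRep = V.toPreRep.sum V.flip.toPreRep from
      IsBundle.toPreRep_sum hβ V.isBundle V.isBundle.flip, PreRep.character_sum, h1, add_neg_cancel]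
  rw [show (T'.rep.sum ε).character g = T'.rep.character g + ε.character g from
    PreRep.character_sum _ _ g, h2, add_zero]

end EFT

/-- The partition function of a class of field theories. -/
def EFTClasses.partitionFunction (hβ : IsNormalizedCocycle β) :
    EFTClasses β X → ∀ g, FixForm X g :=
  Quot.lift EFT.partitionFunction fun _ _ h =>
    h.elim (EFT.partitionFunction_of_iso hβ) (EFT.partitionFunction_of_stableIso hβ)

theorem KGen.partitionFunction_theory (hβ : IsNormalizedCocycle β) (x : KGen β X)
    (c : ConjClasses G) :
    (x.theory hβ).partitionFunction (conjRep c) = x.curvatureForm c := by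
  obtain ⟨w, hw, hη⟩ := exists_oc ((invEquiv hβ X).symm x.η)
  have hx : x.η.1 c = oddFixClass _ _ _ _ :=
    (by rw [hη, toInv_symm] : x.η.1 c = (toInv β X (oc β w)).1 c).trans (toInv_oc hw c)
  rw [EFT.partitionFunction_eq (T := x.theory hβ) hw hη.symm, KGen.curvatureForm, hx,
    fixD_out_oddFixClass, ← x.V.isBundle.character_eq, ← x.V.isBundle.toPreRep_eq]
  rfl

end Curvature

end

end TwistedK

end

theorem theorem1 {G : Type v} [Group G] [Finite G] (β : G → G → Circle)
    (hβ : TwistedK.IsNormalizedCocycle β) :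
    ∃ Φ : ∀ X : TwistedK.GMfd.{u} G, CompactSpace X.carrier →
        TwistedK.KHat β X ≃ TwistedK.EFTClasses β X,
      -- `Φ` carries the sum to the direct sum of field theories
      (∀ (X : TwistedK.GMfd.{u} G) (hX : CompactSpace X.carrier) (a b : TwistedK.KHat β X)
        (T T' : TwistedK.EFT β X),
        Φ X hX a = T.cls → Φ X hX b = T'.cls → Φ X hX (a + b) = (T.sum T').cls) ∧
      -- `Φ` sends `(V, ∇, η)` to the field theory with representation determined by `(V, ∇)`
      -- and with the section determined by `η`
      (∀ (X : TwistedK.GMfd.{u} G) (hX : CompactSpace X.carrier) (x : TwistedK.KGen β X),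
        (∃ T : TwistedK.EFT β X, TwistedK.EFT.IsAssociated x T) ∧
        ∀ T : TwistedK.EFT β X, TwistedK.EFT.IsAssociated x T → Φ X hX x.cls = T.cls) ∧
      -- `Φ` is natural for smooth equivariant maps
      (∀ (X Y : TwistedK.GMfd.{u} G) (hX : CompactSpace X.carrier) (hY : CompactSpace Y.carrier)
        (f : X.carrier → Y.carrier), TwistedK.IsEquivariantMap X Y f →
        ∃ (fK : TwistedK.KHat β Y →+ TwistedK.KHat β X)
          (fE : TwistedK.EFTClasses β Y → TwistedK.EFTClasses β X),
          (∀ x : TwistedK.KGen β Y, ∃ y : TwistedK.KGen β X, x.IsPullback f y) ∧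
          (∀ (x : TwistedK.KGen β Y) (y : TwistedK.KGen β X), x.IsPullback f y →
            fK x.cls = y.cls) ∧
          (∀ T : TwistedK.EFT β Y, ∃ T' : TwistedK.EFT β X, T.IsPullback f T') ∧
          (∀ (T : TwistedK.EFT β Y) (T' : TwistedK.EFT β X), T.IsPullback f T' →
            fE T.cls = T'.cls) ∧
          ∀ a, Φ X hX (fK a) = fE (Φ Y hY a)) ∧
      -- `Φ` carries the curvature map to the partition function
      (∀ (X : TwistedK.GMfd.{u} G) (hX : CompactSpace X.carrier),
        ∃ (curv : TwistedK.KHat β X →+ ∀ c, TwistedK.FixForm X (TwistedK.conjRep c))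
          (Z : TwistedK.EFTClasses β X → ∀ g, TwistedK.FixForm X g),
          (∀ x : TwistedK.KGen β X, curv x.cls = x.curvatureForm) ∧
          (∀ T : TwistedK.EFT β X, Z T.cls = T.partitionFunction) ∧
          ∀ a c, curv a c = Z (Φ X hX a) (TwistedK.conjRep c)) := by
  open TwistedK in
  have : Fact (IsNormalizedCocycle β) := ⟨hβ⟩
  refine ⟨fun X _ => (kEquiv β X).toEquiv, ?_, ?_, ?_, ?_⟩
  · intro X hX a b T T' ha hb
    refine ((kEquiv β X).map_add a b).trans ?_
    rw [← EFT.cls_add, ← ha, ← hb]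
    rfl
  · exact fun X hX x => ⟨⟨_, x.isAssociated_theory⟩, fun T hT => hT.cls_eq⟩
  · intro X Y hX hY f hf
    have : SmoothMap X Y f := ⟨hf.smooth⟩
    have he := hf.equivariant
    refine ⟨(kEquiv β X).symm.toAddMonoidHom.comp
      ((EFTClasses.pull he).comp (kToEFT β Y)), EFTClasses.pull he,
      KGen.exists_isPullback he, fun x y h => ?_,
      fun T => ⟨_, T.isPullback_pull hβ he⟩, fun T T' h => h.cls_eq he, fun a => ?_⟩
    · refine (kEquiv β X).symm_apply_eq.2 ?_
      exact (congrArg (EFTClasses.pull he) (kToEFT_cls x)).trans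
        ((h.theory he).trans (kToEFT_cls y).symm)
    · exact (kEquiv β X).apply_symm_apply _
  · intro X hX
    refine ⟨AddMonoidHom.mk' (fun a c => EFTClasses.partitionFunction hβ
      (kToEFT β X a) (conjRep c)) fun a b => ?_,
      EFTClasses.partitionFunction hβ, fun x => ?_, fun T => rfl, fun a c => rfl⟩
    · funext c
      rw [map_add]
      obtain ⟨T, hT⟩ := (kToEFT β X a).exists_cls
      obtain ⟨T', hT'⟩ := (kToEFT β X b).exists_cls
      rw [← hT, ← hT', EFT.cls_add]
      exact congrFun (EFT.partitionFunction_sum T T') _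
    · funext c
      show EFTClasses.partitionFunction hβ (kToEFT β X x.cls) _ = _
      rw [kToEFT_cls]
      exact x.partitionFunction_theory hβ c
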